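/- Let $p$ be a prime, let $A_p=\mathbb{Z}[1/p,e^{2\pi i/p}]\subset\mathbb{C}$, and let $Q$ be a regular local ring of Krull dimension $d$ that is an $A_p$-algebra. Let $\mathfrak{m}$ be its maximal ideal, and let $\mathrm{mf}^{\mathfrak m}(Q,0)$ be the category of $\mathbb{Z}/2$-graded complexes $P=(\alpha:P^1\to P^0,\ \beta:P^0\to P^1)$, $\alpha\beta=0=\beta\alpha$, with $P^0,P^1$ free $Q$-modules of finite rank and with homology modules $H^0(P),H^1(P)$ of finite length. Let $K_0(\mathrm{mf}^{\mathfrak m}(Q,0))$ be the abelian group generated by the objects $[P]$, modulo $[P]=[P']+[P'']$ for each short exact sequence $0\to P'\to P\to P''\to 0$ and $[P]=[P']$ whenever $P$ and $P'$ are homotopy equivalent. Let $\chi:K_0(\mathrm{mf}^{\mathfrak m}(Q,0))\to\mathbb{Z}$ be the Euler characteristic, i.e. the homomorphism with $\chi([P])=\operatorname{len}H^0(P)-\operatorname{len}H^1(P)$. For an object $P$, let $T^p(P)=P\otimes_Q\cdots\otimes_Q P$ ($p$ factors), with total degree modulo $2$ and differential $$\partial(x_1\otimes\cdots\otimes x_p)=\sum_i(-1)^{|x_1|+\cdots+|x_{i-1}|}x_1\otimes\cdots\otimes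 d(x_i)\otimes\cdots\otimes x_p,$$ and let the $p$-cycle $\sigma$ act on it by $$\sigma(x_1\otimes\cdots\otimes x_p)=(-1)^{|x_p|(|x_1|+\cdots+|x_{p-1}|)}x_p\otimes x_1\otimes\cdots\otimes x_{p-1}.$$ For a $p$-th root of unity $\zeta\in\mathbb{Z}[e^{2\pi i/p}]$ let $t^p_\zeta(P)$ be the complex obtained from the subcomplex $T^p(P)^{(\zeta)}=\ker(\sigma-\zeta)$ of $T^p(P)$, where $\zeta$ acts through its image in $Q$, by multiplying the component of the differential from degree $0$ to degree $1$ by $1/p$. Then $t^p_\zeta(P)$ is again an object of $\mathrm{mf}^{\mathfrak m}(Q,0)$; there is a unique group endomorphism $\psi^p_{\mathrm{cyc}}$ of $K_0(\mathrm{mf}^{\mathfrak m}(Q,0))$, the cyclic Adams operation, such that for every object $P$ $$\psi^p_{\mathrm{cyc}}([P])\otimes 1=\sum_{\zeta^p=1}[t^p_\zeta(P)]\otimes\zeta\quad\text{in } K_0(\mathrm{mf}^{\mathfrak m}(Q,0))\otimes_{\mathbb Z}\mathbb{Z}[e^{2\pi i/p}];$$ and $$\chi\circ\psi^p_{\mathrm{cyc}}=p^d\,\chi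 .$$ -/

import Mathlib

open CategoryTheory TensorProduct

universe u

namespace CyclicAdams

noncomputable section

/-! ### `ℤ/2`-graded complexes and the category `mf^𝔪(Q, 0)` -/

/-- `ℤ/2`-graded complexes of `Q`-modules: modules `X⁰`, `X¹` and maps `X⁰ → X¹`, `X¹ → X⁰` whose
composites are both zero. -/
abbrev Cx (Q : Type u) [CommRing Q] : Type (u + 1) :=
  HomologicalComplex (ModuleCat.{u} Q) (ComplexShape.up (ZMod 2))

/-- The objects of `mf^𝔪(Q, 0)`: the components are finitely generated and projective (that is, free
of finite rank, when `Q` is local) and both homology modules have finite length. -/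
structure IsMFfl {Q : Type u} [CommRing Q] (X : Cx Q) : Prop where
  finite : ∀ i, Module.Finite Q (X.X i)
  projective : ∀ i, Module.Projective Q (X.X i)
  finiteLength : ∀ i, IsFiniteLength Q (X.homology i)

/-- The type of objects of `mf^𝔪(Q, 0)`. -/
abbrev MFfl (Q : Type u) [CommRing Q] : Type (u + 1) := {X : Cx Q // IsMFfl X}

/-! ### The Grothendieck group -/

/-- The relations of the Grothendieck group: `[P] = [P'] + [P'']` for every (degreewise) short exact
sequence `0 → P' → P → P'' → 0`, and `[P] = [P']` if `P` and `P'` are homotopy equivalent. (As usual,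
isomorphic objects are homotopy equivalent, and direct sums are split short exact sequences.) -/
inductive K0Rel (Q : Type u) [CommRing Q] : FreeAbelianGroup (MFfl Q) → Prop
  | shortExact (P' P P'' : MFfl Q) (f : P'.1 ⟶ P.1) (g : P.1 ⟶ P''.1) (w : f ≫ g = 0)
      (h : (ShortComplex.mk f g w).ShortExact) :
      K0Rel Q (FreeAbelianGroup.of P - (FreeAbelianGroup.of P' + FreeAbelianGroup.of P''))
  | homotopyEquiv (P P' : MFfl Q) (e : HomotopyEquiv P.1 P'.1) :
      K0Rel Q (FreeAbelianGroup.of P - FreeAbelianGroup.of P')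

/-- The Grothendieck group `K₀(mf^𝔪(Q, 0))`. -/
abbrev K0 (Q : Type u) [CommRing Q] : Type (u + 1) :=
  FreeAbelianGroup (MFfl Q) ⧸ AddSubgroup.closure {r | K0Rel Q r}

/-- The class `[P]` of an object. -/
def K0.mk {Q : Type u} [CommRing Q] (P : MFfl Q) : K0 Q :=
  QuotientAddGroup.mk (FreeAbelianGroup.of P)

/-! ### The Euler characteristic -/

/-- The Euler characteristic `len H⁰(P) - len H¹(P)` of an object of `mf^𝔪(Q, 0)`. -/
def eulerChar {Q : Type u} [CommRing Q] (P : MFfl Q) : ℤ :=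
  ((Module.length Q (P.1.homology 0)).toNat : ℤ) - ((Module.length Q (P.1.homology 1)).toNat : ℤ)

lemma eulerChar_homotopyEquiv {Q : Type u} [CommRing Q] (P P' : MFfl Q)
    (e : HomotopyEquiv P.1 P'.1) : eulerChar P = eulerChar P' := by
  have h (i : ZMod 2) :
      Module.length Q (P.1.homology i) = Module.length Q (P'.1.homology i) :=
    (e.toHomologyIso i).toLinearEquiv.length_eq
  simp only [eulerChar, h]

/-- In an exact sequence `A → B → C` the length of `B` is the sum of the lengths of the images. -/
lemma length_of_exact {Q : Type u} [CommRing Q] {S : ShortComplex (ModuleCat.{u} Q)}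
    (hS : S.Exact) : Module.length Q S.X₂ =
      Module.length Q (LinearMap.range S.f.hom) + Module.length Q (LinearMap.range S.g.hom) := by
  have h1 : LinearMap.range S.f.hom = LinearMap.ker S.g.hom :=
    (ShortComplex.moduleCat_exact_iff_range_eq_ker S).1 hS
  rw [h1]
  refine Module.length_eq_add_of_exact (LinearMap.ker S.g.hom).subtype S.g.hom.rangeRestrict
    (Submodule.subtype_injective _) (LinearMap.surjective_rangeRestrict _) ?_
  intro x
  simp [Subtype.ext_iff]

lemma euler_arith {x' x x'' y' y y'' a b c a' b' c' : ℕ∞} (h1 : x' = c' + a) (h2 : x = a + b)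
    (h3 : x'' = b + c) (h4 : y' = c + a') (h5 : y = a' + b') (h6 : y'' = b' + c')
    (n1 : x ≠ ⊤) (n2 : y ≠ ⊤) (n3 : x'' ≠ ⊤) (n4 : y'' ≠ ⊤) :
    ((x.toNat : ℤ) - y.toNat) = ((x'.toNat : ℤ) - y'.toNat) + ((x''.toNat : ℤ) - y''.toNat) := by
  subst h1 h2 h3 h4 h5 h6
  simp only [ne_eq, ENat.add_eq_top, not_or] at n1 n2 n3 n4
  obtain ⟨⟨ha, hb⟩, ⟨ha', hb'⟩, ⟨-, hc⟩, ⟨-, hc'⟩⟩ := And.intro n1 (And.intro n2 (And.intro n3 n4))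
  lift a to ℕ using ha
  lift b to ℕ using hb
  lift c to ℕ using hc
  lift a' to ℕ using ha'
  lift b' to ℕ using hb'
  lift c' to ℕ using hc'
  simp only [← Nat.cast_add, ENat.toNat_natCast]
  push_cast
  ring

lemma eulerChar_shortExact {Q : Type u} [CommRing Q] (P' P P'' : MFfl Q)
    (f : P'.1 ⟶ P.1) (g : P.1 ⟶ P''.1) (w : f ≫ g = 0)
    (h : (ShortComplex.mk f g w).ShortExact) :
    eulerChar P = eulerChar P' + eulerChar P'' := by
  have r0 : (ComplexShape.up (ZMod 2)).Rel 0 1 := ComplexShape.up_mk _ _ (by decide)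
  have r1 : (ComplexShape.up (ZMod 2)).Rel 1 0 := ComplexShape.up_mk _ _ (by decide)
  have nt (R : MFfl Q) (i : ZMod 2) : Module.length Q (R.1.homology i) ≠ ⊤ :=
    Module.length_ne_top_iff.2 (R.2.finiteLength i)
  exact euler_arith (length_of_exact (h.homology_exact₁ 1 0 r1))
    (length_of_exact (h.homology_exact₂ 0)) (length_of_exact (h.homology_exact₃ 0 1 r0))
    (length_of_exact (h.homology_exact₁ 0 1 r0)) (length_of_exact (h.homology_exact₂ 1))
    (length_of_exact (h.homology_exact₃ 1 0 r1)) (nt P 0) (nt P 1) (nt P'' 0) (nt P'' 1)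

/-- The Euler characteristic as a homomorphism `K₀(mf^𝔪(Q, 0)) → ℤ`. -/
def chi (Q : Type u) [CommRing Q] : K0 Q →+ ℤ :=
  QuotientAddGroup.lift _ (FreeAbelianGroup.lift (eulerChar (Q := Q))) <| by
    rw [AddSubgroup.closure_le]
    rintro _ (⟨P', P, P'', f, g, w, h⟩ | ⟨P, P', e⟩)
    · simp [AddMonoidHom.mem_ker, eulerChar_shortExact P' P P'' f g w h]
    · simp [AddMonoidHom.mem_ker, eulerChar_homotopyEquiv P P' e]

lemma chi_mk {Q : Type u} [CommRing Q] (P : MFfl Q) : chi Q (K0.mk P) = eulerChar P := by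
  simp [chi, K0.mk]

/-! ### The tensor power `T^p(P)` with its cyclic action -/

section TensorPower

variable {Q : Type u} [CommRing Q]

/-- The total module `X⁰ × X¹` of a `ℤ/2`-graded complex. -/
abbrev Tot (X : Cx Q) : Type u := ∀ i : ZMod 2, X.X i

/-- The projection of the total module onto its component of degree `i`. -/
def proj (X : Cx Q) (i : ZMod 2) : Module.End Q (Tot X) :=
  LinearMap.single Q (fun i => X.X i) i ∘ₗ LinearMap.proj i

/-- The differential of `X`, as an (odd) endomorphism of the total module. -/
def diff (X : Cx Q) : Module.End Q (Tot X) :=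
  LinearMap.pi fun i => (X.d (i - 1) i).hom ∘ₗ LinearMap.proj (i - 1)

/-- The parity operator `x ↦ (-1)^{|x|} x`. -/
def parity (X : Cx Q) : Module.End Q (Tot X) := proj X 0 - proj X 1

/-- The underlying module of `T^p(X) = X ⊗ ⋯ ⊗ X` (`p` factors). -/
abbrev TPow (p : ℕ) (X : Cx Q) : Type u := ⨂[Q] _ : Fin p, Tot X

/-- The `i`-th summand of the differential of the tensor power:
`x₁ ⊗ ⋯ ⊗ x_p ↦ (-1)^{|x₁| + ⋯ + |x_{i-1}|} x₁ ⊗ ⋯ ⊗ d xᵢ ⊗ ⋯ ⊗ x_p`. -/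
def tDiffAt (p : ℕ) (X : Cx Q) (i : Fin p) : Module.End Q (TPow p X) :=
  PiTensorProduct.map fun j => if j < i then parity X else if j = i then diff X else 1

/-- The differential of the tensor power. -/
def tDiff (p : ℕ) (X : Cx Q) : Module.End Q (TPow p X) := ∑ i, tDiffAt p X i

/-- The component of degree `k` of the tensor power: it is spanned by the `x₁ ⊗ ⋯ ⊗ x_p` with
`xᵢ` homogeneous of degree `εᵢ` and `ε₁ + ⋯ + ε_p = k`. -/
def tDeg (p : ℕ) (X : Cx Q) (k : ZMod 2) : Submodule Q (TPow p X) :=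
  Submodule.span Q {t | ∃ (ε : Fin p → ZMod 2) (x : ∀ i, X.X (ε i)), ∑ i, ε i = k ∧
    (⨂ₜ[Q] i, (Pi.single (ε i) (x i) : Tot X)) = t}

/-- The action of the `p`-cycle `σ = (1 2 ⋯ p)` on the tensor power, which moves the last factor to
the front: `σ (x₁ ⊗ ⋯ ⊗ x_p) = (-1)^{|x_p| (|x₁| + ⋯ + |x_{p-1}|)} x_p ⊗ x₁ ⊗ ⋯ ⊗ x_{p-1}`. -/
def rot (p : ℕ) (X : Cx Q) : Module.End Q (TPow p X) :=
  (PiTensorProduct.reindex Q (fun _ => Tot X) (finRotate p)).toLinearMap ∘ₗ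
    (PiTensorProduct.map (fun j : Fin p => if (j : ℕ) + 1 = p then proj X 0 else 1) +
      PiTensorProduct.map (fun j : Fin p => if (j : ℕ) + 1 = p then proj X 1 else parity X))

lemma proj_single_self (X : Cx Q) (i : ZMod 2) (x : X.X i) :
    proj X i (Pi.single i x) = Pi.single i x := by
  simp [proj]

lemma proj_single_ne (X : Cx Q) {i j : ZMod 2} (h : i ≠ j) (x : X.X i) :
    proj X j (Pi.single i x) = 0 := by
  simp [proj, Pi.single_eq_of_ne h.symm]

lemma parity_single (X : Cx Q) (i : ZMod 2) (x : X.X i) :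
    parity X (Pi.single i x) = (-1 : Q) ^ i.val • Pi.single i x := by
  rcases (by decide : ∀ i : ZMod 2, i = 0 ∨ i = 1) i with rfl | rfl
  · simp [parity, proj_single_self, proj_single_ne]
  · simp [parity, proj_single_self, proj_single_ne, ZMod.val_one]

lemma diff_single (X : Cx Q) (i : ZMod 2) (x : X.X i) :
    diff X (Pi.single i x) = Pi.single (i + 1) ((X.d i (i + 1)).hom x) := by
  funext j
  by_cases hj : j = i + 1
  · subst hj
    have e : i + 1 - 1 = i := by ring
    rw [Pi.single_eq_same]
    change (X.d (i + 1 - 1) (i + 1)).hom ((Pi.single i x : Tot X) (i + 1 - 1)) = _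
    rw [e, Pi.single_eq_same]
  · rw [Pi.single_eq_of_ne hj]
    change (X.d (j - 1) j).hom ((Pi.single i x : Tot X) (j - 1)) = _
    rw [Pi.single_eq_of_ne (fun e => hj (by rw [← e]; ring)), map_zero]

lemma end_ext {X : Cx Q} {f g : Module.End Q (Tot X)}
    (h : ∀ i (x : X.X i), f (Pi.single i x) = g (Pi.single i x)) : f = g :=
  LinearMap.pi_ext h

lemma diff_mul_diff (X : Cx Q) : diff X * diff X = 0 := by
  refine end_ext fun i x => ?_
  have : (X.d (i + 1) (i + 1 + 1)).hom ((X.d i (i + 1)).hom x) = 0 := by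
    rw [← LinearMap.comp_apply, ← ModuleCat.hom_comp, X.d_comp_d]; rfl
  rw [Module.End.mul_apply, diff_single, diff_single, this]
  simp

lemma diff_mul_parity (X : Cx Q) : diff X * parity X = -(parity X * diff X) := by
  refine end_ext fun i x => ?_
  rw [LinearMap.neg_apply, Module.End.mul_apply, Module.End.mul_apply, parity_single, map_smul,
    diff_single, parity_single]
  rcases (by decide : ∀ i : ZMod 2, i = 0 ∨ i = 1) i with rfl | rfl
  · simp [ZMod.val_one]
  · simp [ZMod.val_one, (by decide : (1 + 1 : ZMod 2) = 0)]

lemma diff_mul_proj (X : Cx Q) (i : ZMod 2) : diff X * proj X i = proj X (i + 1) * diff X := by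
  refine end_ext fun j x => ?_
  rw [Module.End.mul_apply, Module.End.mul_apply, diff_single]
  by_cases h : j = i
  · subst h; rw [proj_single_self, proj_single_self, diff_single]
  · rw [proj_single_ne X h, proj_single_ne X (fun e => h (add_right_cancel e)), map_zero]

lemma parity_mul_parity (X : Cx Q) : parity X * parity X = 1 := by
  refine end_ext fun i x => ?_
  rw [Module.End.mul_apply, parity_single, map_smul, parity_single, smul_smul, ← mul_pow]
  simp

lemma parity_mul_proj (X : Cx Q) (i : ZMod 2) :
    parity X * proj X i = (-1 : Q) ^ i.val • proj X i := by
  refine end_ext fun j x => ?_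
  rw [Module.End.mul_apply, LinearMap.smul_apply]
  by_cases h : j = i
  · subst h; rw [proj_single_self, parity_single]
  · rw [proj_single_ne X h, map_zero, smul_zero]

/-- The differential of the tensor power raises the degree by one. -/
lemma tDiff_mem (p : ℕ) (X : Cx Q) {k l : ZMod 2} (hkl : k + 1 = l) {t : TPow p X}
    (ht : t ∈ tDeg p X k) : tDiff p X t ∈ tDeg p X l := by
  have key : tDeg p X k ≤ (tDeg p X l).comap (tDiff p X) := by
    refine Submodule.span_le.2 ?_
    rintro _ ⟨ε, x, hε, rfl⟩
    change tDiff p X _ ∈ tDeg p X l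
    rw [tDiff, LinearMap.sum_apply]
    refine Submodule.sum_mem _ fun i _ => ?_
    rw [tDiffAt, PiTensorProduct.map_tprod]
    have : ∀ j, ∃ y : X.X (Function.update ε i (ε i + 1) j),
        (if j < i then parity X else if j = i then diff X else 1)
          (Pi.single (ε j) (x j) : Tot X) = Pi.single (Function.update ε i (ε i + 1) j) y := by
      intro j
      by_cases hj : j = i
      · subst hj
        rw [Function.update_self, if_neg (lt_irrefl _), if_pos rfl]
        exact ⟨_, diff_single X _ _⟩
      · rw [Function.update_of_ne hj]
        by_cases hlt : j < i
        · rw [if_pos hlt, parity_single]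
          exact ⟨(-1 : Q) ^ (ε j).val • x j, by rw [← Pi.single_smul]⟩
        · rw [if_neg hlt, if_neg hj]
          exact ⟨x j, rfl⟩
    choose y hy using this
    simp only [hy]
    refine Submodule.subset_span ⟨_, y, ?_, rfl⟩
    rw [Finset.sum_update_of_mem (Finset.mem_univ i), ← hkl, ← hε,
      ← Finset.add_sum_erase _ _ (Finset.mem_univ i), Finset.sdiff_singleton_eq_erase]
    ring
  exact key ht

lemma map_eq_zero_at {p : ℕ} {X : Cx Q} (f : Fin p → Module.End Q (Tot X)) (i : Fin p)
    (hi : f i = 0) : PiTensorProduct.map f = 0 := by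
  have e : f = Function.update f i ((0 : Q) • f i) := by
    rw [zero_smul, ← hi, Function.update_eq_self]
  rw [e, PiTensorProduct.map_update_smul, zero_smul]

lemma map_add_map_at {p : ℕ} {X : Cx Q} (f g : Fin p → Module.End Q (Tot X)) (i : Fin p)
    (hi : f i + g i = 0) (h : ∀ j, j ≠ i → f j = g j) :
    PiTensorProduct.map f + PiTensorProduct.map g = 0 := by
  have e : f = Function.update g i (f i) := by
    funext j
    by_cases hj : j = i
    · subst hj; rw [Function.update_self]
    · rw [Function.update_of_ne hj, h j hj]
  have e' : PiTensorProduct.map g = PiTensorProduct.map (Function.update g i (g i)) := by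
    rw [Function.update_eq_self]
  rw [e, e', ← PiTensorProduct.map_update_add, hi]
  exact map_eq_zero_at _ i (Function.update_self _ _ _)

lemma map_congr_smul_two {p : ℕ} {X : Cx Q} (f g : Fin p → Module.End Q (Tot X)) {i k : Fin p}
    (hik : i ≠ k) (hi : f i = (-1 : Q) • g i) (hk : f k = (-1 : Q) • g k)
    (h : ∀ j, j ≠ i → j ≠ k → f j = g j) :
    PiTensorProduct.map f = PiTensorProduct.map g := by
  have e : f = Function.update (Function.update g k ((-1 : Q) • g k)) i ((-1 : Q) • g i) := by
    funext j
    by_cases hj : j = i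
    · subst hj; rw [Function.update_self, hi]
    · rw [Function.update_of_ne hj]
      by_cases hj' : j = k
      · subst hj'; rw [Function.update_self, hk]
      · rw [Function.update_of_ne hj', h j hj hj']
  have e' : Function.update (Function.update g k ((-1 : Q) • g k)) i (g i) =
      Function.update g k ((-1 : Q) • g k) := by
    rw [Function.update_eq_iff]
    exact ⟨(Function.update_of_ne hik _ _).symm, fun _ _ => rfl⟩
  rw [e, PiTensorProduct.map_update_smul, e', PiTensorProduct.map_update_smul,
    Function.update_eq_self, smul_smul, neg_mul_neg, one_mul, one_smul]

lemma tDiffAt_anticomm (p : ℕ) (X : Cx Q) {i j : Fin p} (hij : i < j) :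
    tDiffAt p X i * tDiffAt p X j + tDiffAt p X j * tDiffAt p X i = 0 := by
  rw [tDiffAt, tDiffAt, ← PiTensorProduct.map_mul, ← PiTensorProduct.map_mul]
  refine map_add_map_at _ _ i ?_ ?_
  · simp [hij, diff_mul_parity]
  · intro k hk
    rcases lt_trichotomy k i with h | h | h
    · simp [h, h.trans hij]
    · exact absurd h hk
    · simp [h.not_gt, hk]

lemma tDiffAt_sq (p : ℕ) (X : Cx Q) (i : Fin p) : tDiffAt p X i * tDiffAt p X i = 0 := by
  rw [tDiffAt, ← PiTensorProduct.map_mul]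
  exact map_eq_zero_at _ i (by simp [diff_mul_diff])

lemma tDiff_sq (p : ℕ) (X : Cx Q) : tDiff p X * tDiff p X = 0 := by
  rw [tDiff, Finset.sum_mul_sum, ← Finset.sum_product']
  refine Finset.sum_involution (fun a _ => (a.2, a.1)) ?_ ?_ (by simp) (by simp)
  · rintro ⟨i, j⟩ _
    rcases lt_trichotomy i j with h | h | h
    · exact tDiffAt_anticomm p X h
    · subst h; simp [tDiffAt_sq]
    · exact (add_comm _ _).trans (tDiffAt_anticomm p X h)
  · rintro ⟨i, j⟩ _ h e
    simp only [Prod.mk.injEq] at e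
    obtain ⟨rfl, -⟩ := e
    exact h (tDiffAt_sq p X _)

lemma succ_eq_iff_last {n : ℕ} (j : Fin (n + 1)) : (j : ℕ) + 1 = n + 1 ↔ j = Fin.last n := by
  rw [Fin.ext_iff, Fin.val_last]; omega

/-- The sign rule for the action of the `p`-cycle. -/
lemma rot_tprod (n : ℕ) (X : Cx Q) (ε : Fin (n + 1) → ZMod 2) (x : ∀ i, X.X (ε i)) :
    rot (n + 1) X (⨂ₜ[Q] i, (Pi.single (ε i) (x i) : Tot X)) =
      (-1 : Q) ^ ((ε (Fin.last n)).val * ∑ i : Fin n, (ε i.castSucc).val) •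
        ⨂ₜ[Q] i, (Pi.single (ε ((finRotate (n + 1)).symm i))
          (x ((finRotate (n + 1)).symm i)) : Tot X) := by
  have key : (PiTensorProduct.map
        (fun j : Fin (n + 1) => if (j : ℕ) + 1 = n + 1 then proj X 0 else 1) +
      PiTensorProduct.map
        (fun j : Fin (n + 1) => if (j : ℕ) + 1 = n + 1 then proj X 1 else parity X))
        (⨂ₜ[Q] i, (Pi.single (ε i) (x i) : Tot X)) =
      (-1 : Q) ^ ((ε (Fin.last n)).val * ∑ i : Fin n, (ε i.castSucc).val) •
        ⨂ₜ[Q] i, (Pi.single (ε i) (x i) : Tot X) := by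
    rw [LinearMap.add_apply, PiTensorProduct.map_tprod, PiTensorProduct.map_tprod]
    simp only [succ_eq_iff_last]
    rcases (by decide : ∀ i : ZMod 2, i = 0 ∨ i = 1) (ε (Fin.last n)) with h | h
    · rw [(PiTensorProduct.tprod Q).map_coord_zero (m := fun i => (if i = Fin.last n then proj X 1
        else parity X) (Pi.single (ε i) (x i) : Tot X)) (Fin.last n)
        (by rw [if_pos rfl]; exact proj_single_ne X (by rw [h]; decide) _), add_zero, h]
      simp only [ZMod.val_zero, zero_mul, pow_zero, one_smul]
      congr 1
      funext i
      by_cases hi : i = Fin.last n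
      · subst hi
        rw [if_pos rfl]
        conv_lhs => rw [← h]
        exact proj_single_self X _ _
      · rw [if_neg hi]; rfl
    · rw [(PiTensorProduct.tprod Q).map_coord_zero (m := fun i => (if i = Fin.last n then proj X 0
        else 1) (Pi.single (ε i) (x i) : Tot X)) (Fin.last n)
        (by rw [if_pos rfl]; exact proj_single_ne X (by rw [h]; decide) _), zero_add, h]
      have e : (fun i => (if i = Fin.last n then proj X 1 else parity X)
            (Pi.single (ε i) (x i) : Tot X)) =
          fun i => (if i = Fin.last n then (1 : Q) else (-1) ^ (ε i).val) •
            (Pi.single (ε i) (x i) : Tot X) := by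
        funext i
        by_cases hi : i = Fin.last n
        · subst hi
          rw [if_pos rfl, if_pos rfl, one_smul]
          conv_lhs => rw [← h]
          exact proj_single_self X _ _
        · rw [if_neg hi, if_neg hi, parity_single]
      rw [e, MultilinearMap.map_smul_univ, Fin.prod_univ_castSucc]
      simp [ZMod.val_one, Finset.prod_pow_eq_pow_sum, (Fin.castSucc_lt_last _).ne]
  rw [rot, LinearMap.comp_apply, key, map_smul]
  congr 1
  exact PiTensorProduct.reindex_tprod _ _

lemma map_rotate (p : ℕ) (X : Cx Q) (f : Fin p → Module.End Q (Tot X)) :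
    (PiTensorProduct.map f : Module.End Q (TPow p X)) ∘ₗ
        (PiTensorProduct.reindex Q (fun _ => Tot X) (finRotate p)).toLinearMap =
      (PiTensorProduct.reindex Q (fun _ => Tot X) (finRotate p)).toLinearMap ∘ₗ
        PiTensorProduct.map fun j => f (finRotate p j) := by
  refine PiTensorProduct.ext (MultilinearMap.ext fun x => ?_)
  simp [PiTensorProduct.reindex_tprod, -finRotate_apply, -finRotate_symm_apply]

lemma rot_tDiffAt_castSucc (n : ℕ) (X : Cx Q) (i : Fin n) :
    rot (n + 1) X * tDiffAt (n + 1) X i.castSucc = tDiffAt (n + 1) X i.succ * rot (n + 1) X := by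
  simp only [rot, tDiffAt, Module.End.mul_eq_comp]
  rw [← LinearMap.comp_assoc _ _ (PiTensorProduct.map _), map_rotate, LinearMap.comp_assoc,
    LinearMap.comp_assoc]
  congr 1
  simp only [← Module.End.mul_eq_comp, add_mul, mul_add, ← PiTensorProduct.map_mul,
    succ_eq_iff_last, finRotate_apply]
  congr 1
  · congr 1
    funext j
    refine Fin.lastCases ?_ (fun k => ?_) j
    · simp [parity_mul_proj, Fin.last_add_one, (Fin.castSucc_lt_last i).not_gt,
        (Fin.castSucc_lt_last i).ne', Fin.succ_pos]
    · simp [(Fin.castSucc_lt_last k).ne, Fin.coeSucc_eq_succ]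
  · refine map_congr_smul_two _ _ (Fin.castSucc_lt_last i).ne ?_ ?_ ?_
    · simp [(Fin.castSucc_lt_last i).ne, Fin.coeSucc_eq_succ, diff_mul_parity]
    · simp [parity_mul_proj, Fin.last_add_one, (Fin.castSucc_lt_last i).not_gt,
        (Fin.castSucc_lt_last i).ne', Fin.succ_pos, ZMod.val_one, smul_smul]
    · intro j h1 h2
      obtain ⟨k, rfl⟩ := Fin.exists_castSucc_eq.2 h2
      have h3 : k ≠ i := fun e => h1 (by rw [e])
      simp only [(Fin.castSucc_lt_last k).ne, Fin.coeSucc_eq_succ, Fin.succ_lt_succ_iff,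
        Fin.castSucc_lt_castSucc_iff, Fin.succ_inj, Fin.castSucc_inj, h3, if_false]
      split_ifs <;> simp

lemma rot_tDiffAt_last (n : ℕ) (X : Cx Q) :
    rot (n + 1) X * tDiffAt (n + 1) X (Fin.last n) = tDiffAt (n + 1) X 0 * rot (n + 1) X := by
  simp only [rot, tDiffAt, Module.End.mul_eq_comp]
  rw [← LinearMap.comp_assoc _ _ (PiTensorProduct.map _), map_rotate, LinearMap.comp_assoc,
    LinearMap.comp_assoc]
  congr 1
  simp only [← Module.End.mul_eq_comp, add_mul, mul_add, ← PiTensorProduct.map_mul,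
    succ_eq_iff_last, finRotate_apply]
  refine (add_comm _ _).trans ?_
  congr 1
  · congr 1
    funext j
    refine Fin.lastCases ?_ (fun k => ?_) j
    · simp [Fin.last_add_one, diff_mul_proj]
    · simp [(Fin.castSucc_lt_last k).ne, Fin.castSucc_lt_last, Fin.coeSucc_eq_succ,
        parity_mul_parity]
  · congr 1
    funext j
    refine Fin.lastCases ?_ (fun k => ?_) j
    · simp [Fin.last_add_one, diff_mul_proj, (by decide : (1 + 1 : ZMod 2) = 0)]
    · simp [(Fin.castSucc_lt_last k).ne, Fin.castSucc_lt_last, Fin.coeSucc_eq_succ]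

lemma rot_tDiff (p : ℕ) (X : Cx Q) : rot p X * tDiff p X = tDiff p X * rot p X := by
  obtain _ | n := p
  · simp [tDiff]
  · rw [tDiff, Finset.mul_sum, Finset.sum_mul, Fin.sum_univ_castSucc, Fin.sum_univ_succ,
      rot_tDiffAt_last]
    simp only [rot_tDiffAt_castSucc]
    exact add_comm _ _

/-- The component of degree `k` of the eigenspace `T^p(X)^{(ζ)} = ker (σ - ζ)`. -/
def eigenDeg (p : ℕ) (X : Cx Q) (ζ : Q) (k : ZMod 2) : Submodule Q (TPow p X) :=
  tDeg p X k ⊓ Module.End.eigenspace (rot p X) ζ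

lemma tDiff_mem_eigenDeg (p : ℕ) (X : Cx Q) (ζ : Q) {k l : ZMod 2} (hkl : k + 1 = l) :
    ∀ t ∈ eigenDeg p X ζ k, tDiff p X t ∈ eigenDeg p X ζ l := by
  rintro t ⟨h1, h2⟩
  refine ⟨tDiff_mem p X hkl h1, ?_⟩
  have h3 : rot p X (tDiff p X t) = tDiff p X (rot p X t) :=
    LinearMap.congr_fun (rot_tDiff p X) t
  have h4 : rot p X t = ζ • t := Module.End.mem_eigenspace_iff.1 h2
  refine Module.End.mem_eigenspace_iff.2 ?_
  rw [h3, h4, map_smul]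

/-- The `ℤ/2`-graded complex `T^p(X)^{(ζ)}`, the `ζ`-eigenspace of the `p`-cycle on `T^p(X)`. -/
def eigen (p : ℕ) (X : Cx Q) (ζ : Q) : Cx Q where
  X k := ModuleCat.of Q (eigenDeg p X ζ k)
  d i j := if h : i + 1 = j then
    ModuleCat.ofHom ((tDiff p X).restrict (tDiff_mem_eigenDeg p X ζ h)) else 0
  shape i j h := dif_neg h
  d_comp_d' i j k hij hjk := by
    have hij' : i + 1 = j := hij
    have hjk' : j + 1 = k := hjk
    rw [dif_pos hij', dif_pos hjk']
    refine ModuleCat.hom_ext (LinearMap.ext fun t => Subtype.ext ?_)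
    exact LinearMap.congr_fun (tDiff_sq p X) t.1

/-- The functor `mult_u`, which sends `(α : X¹ → X⁰, β : X⁰ → X¹)` to `(α, u β)`, on objects. -/
def mult (u : Q) (X : Cx Q) : Cx Q where
  X := X.X
  d i j := (if i = 0 then u else 1) • X.d i j
  shape i j h := by rw [X.shape i j h, smul_zero]
  d_comp_d' i j k _ _ := by
    rw [Linear.smul_comp, Linear.comp_smul, X.d_comp_d, smul_zero, smul_zero]

end TensorPower

/-! ### The ring `A_p` and the cyclic Adams operation -/

/-- The complex number `e^{2πi/p}`. -/
def zetaC (p : ℕ) : ℂ := Complex.exp (2 * Real.pi * Complex.I / p)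

/-- The subring `A_p = ℤ[1/p, e^{2πi/p}]` of `ℂ`. -/
abbrev Ap (p : ℕ) : Subalgebra ℤ ℂ := Algebra.adjoin ℤ {(p : ℂ)⁻¹, zetaC p}

/-- The subring `ℤ[e^{2πi/p}]` of `ℂ`. -/
abbrev Zzeta (p : ℕ) : Subalgebra ℤ ℂ := Algebra.adjoin ℤ {zetaC p}

/-- `e^{2πi/p}` as an element of `A_p`. -/
def Ap.zeta (p : ℕ) : Ap p := ⟨zetaC p, Algebra.subset_adjoin (by simp)⟩

/-- `1/p` as an element of `A_p`. -/
def Ap.inv (p : ℕ) : Ap p := ⟨(p : ℂ)⁻¹, Algebra.subset_adjoin (by simp)⟩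

/-- `e^{2πi/p}` as an element of `ℤ[e^{2πi/p}]`. -/
def Zzeta.zeta (p : ℕ) : Zzeta p := ⟨zetaC p, Algebra.subset_adjoin (by simp)⟩

/-- `t^p_ζ(X) = mult_{1/p} (T^p(X)^{(ζ)})`, where `ζ` is the image in `Q` of `e^{2πij/p}`; as `j` runs
through `0, …, p - 1` this covers each `p`-th root of unity once. -/
def tPow (p : ℕ) {Q : Type u} [CommRing Q] [Algebra (Ap p) Q] (X : Cx Q) (j : Fin p) : Cx Q :=
  mult (algebraMap (Ap p) Q (Ap.inv p)) (eigen p X (algebraMap (Ap p) Q (Ap.zeta p ^ (j : ℕ))))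

/-- Let `h` say that the functors `t^p_ζ` preserve `mf^𝔪(Q, 0)`. The endomorphism `ψ` of
`K₀(mf^𝔪(Q, 0))` is the cyclic Adams operation if `ψ [P] = ∑_ζ ζ [t^p_ζ(P)]` for every object `P`,
where the sum is over all `p`-th roots of unity and the equation holds in
`K₀(mf^𝔪(Q, 0)) ⊗ ℤ[e^{2πi/p}]`. -/
def IsCyclicAdams (p : ℕ) (Q : Type u) [CommRing Q] [Algebra (Ap p) Q]
    (h : ∀ (P : MFfl Q) (j : Fin p), IsMFfl (tPow p P.1 j)) (ψ : K0 Q →+ K0 Q) : Prop :=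
  ∀ P : MFfl Q, (ψ (K0.mk P) ⊗ₜ[ℤ] (1 : Zzeta p) : K0 Q ⊗[ℤ] Zzeta p) =
    ∑ j : Fin p, K0.mk ⟨tPow p P.1 j, h P j⟩ ⊗ₜ[ℤ] (Zzeta.zeta p ^ (j : ℕ))

end

end CyclicAdams

/-! Write P^(ζ) for the ζ-eigenspace of the p-cycle σ on T^p(P). As p is invertible, averaging over
σ projects onto each P^(ζ), so these are complexes of projectives. Multiplication by a unit of ℤ/p
permutes the tensor factors and normalises the group generated by σ; hence the eigenspaces of the
powers ζ^j with j prime to p are all isomorphic (`eigen_iso_pow`). Since the p-th roots of unity sum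
to 0, the defining formula forces ψ[P] = [t_1(P)] - [t_ζ(P)] for one fixed ζ = e^{2πi/p}. Uniqueness
holds because ℤ is a direct summand of ℤ[e^{2πi/p}] (`tmul_one_injective`).

Finite length is controlled by homotopies. A regular local ring has finite global dimension, so some
power of every element of the maximal ideal is null homotopic on every object
(`locallyNull_of_isRegularLocalRing`). This passes to eigenspaces (`Null.eigen`) and gives back
finite length of their homology.

Additivity of [t_1] - [t_ζ] (`cls_eigen_shortExact`): a short exact sequence splits degreewise, and
the tensor power is filtered by the number k of factors taken from the quotient. The pieces with k =
0 and k = p are the eigenspaces of the two outer terms. For 0 < k < p, scaling the i-th factor by a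
suitable η^i identifies the pieces of different eigenvalues, so they cancel in the difference.

For the Euler characteristic put δ(P) = χ(P^(1)) - χ(P^(ζ)). One shows that δ = c χ for some
constant c (`exists_eigenDiff_eq_mul`). The function δ is additive and vanishes on acyclic objects,
so it extends along syzygies to complexes of finite projective dimension (`IsAdditive.exists_succ`).
A complex V deforms over Q[X] from V at X = 1 to a complex at X = 0 that is an extension of its
homology, with zero differential, by an acyclic complex (`rees`, `redReesOne`, `redReesZero`). The
extended δ does not see the deformation: after passing to a syzygy E of projective Q[X]-modules, δ
of the fibre at a is computed by the index of X - a on the homology of the eigenspaces of E. These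
are finitely generated modules supported on the closed fibre, where that index is independent of a
(`ClosedFibre.hasIndex`). On homology of finite length, dévissage to the residue field gives a
multiple of χ.

The constant c is read off from the Koszul complex of a regular system of parameters, for which χ =
1. The p-th power of the cone of x is connected to that of the cone of 1, which is contractible, by
p interpolation steps. Each step contributes δ of the Koszul complex over Q/x (`eul_eigen_cone`).
Hence δ is multiplied by p with every parameter, and c = p^d (`eul_kos`). -/

namespace CyclicAdams
noncomputable section

/-! ### Complexes graded by ℤ/2, Euler characteristics and null homotopic scalars. -/

section Basics

variable {R : Type u} [CommRing R]

/-- A family of maps `X ⟶ Y` given degreewise by linear maps. -/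
def mkHom {X Y : Cx R} (f : ∀ i, X.X i →ₗ[R] Y.X i)
    (h : ∀ i x, f (i + 1) ((X.d i (i + 1)).hom x) = (Y.d i (i + 1)).hom (f i x)) : X ⟶ Y where
  f i := ModuleCat.ofHom (f i)
  comm' i j hij := by
    obtain rfl : i + 1 = j := hij
    ext x
    exact (h i x).symm

lemma hom_comm_apply {X Y : Cx R} (f : X ⟶ Y) (i j : ZMod 2) (x : X.X i) :
    (f.f j).hom ((X.d i j).hom x) = (Y.d i j).hom ((f.f i).hom x) := by
  exact (congrArg (fun g => g.hom x) (f.comm i j)).symm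

lemma d_d_apply (X : Cx R) (i j k : ZMod 2) (x : X.X i) :
    (X.d j k).hom ((X.d i j).hom x) = 0 := by
  exact congrArg (fun g => g.hom x) (X.d_comp_d i j k)

/-- A `ℤ/2`-graded complex from a family of modules and maps. -/
def mkCx (V : ZMod 2 → Type u) [∀ i, AddCommGroup (V i)] [∀ i, Module R (V i)]
    (d : ∀ i j, V i →ₗ[R] V j) (hs : ∀ i j, i + 1 ≠ j → d i j = 0)
    (hd : ∀ i j k x, d j k (d i j x) = 0) : Cx R where
  X i := ModuleCat.of R (V i)
  d i j := ModuleCat.ofHom (d i j)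
  shape i j h := by rw [hs i j h]; rfl
  d_comp_d' i j k _ _ := by
    ext x
    exact hd i j k x

/-- The complex with components `S k ⊆ T` and differential induced by an endomorphism of `T`. -/
def gradedCx {T : Type u} [AddCommGroup T] [Module R T] (D : Module.End R T)
    (S : ZMod 2 → Submodule R T) (hS : ∀ k, ∀ t ∈ S k, D t ∈ S (k + 1))
    (hD : ∀ k, ∀ t ∈ S k, D (D t) = 0) : Cx R where
  X k := ModuleCat.of R (S k)
  d i j := if h : i + 1 = j then
    ModuleCat.ofHom (D.restrict (p := S i) (q := S j) (by subst h; exact hS i)) else 0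
  shape i j h := dif_neg h
  d_comp_d' i j k hij hjk := by
    have hij' : i + 1 = j := hij
    have hjk' : j + 1 = k := hjk
    rw [dif_pos hij', dif_pos hjk']
    refine ModuleCat.hom_ext (LinearMap.ext fun t => Subtype.ext ?_)
    exact hD i t.1 t.2

section graded

variable {T T' T'' : Type u} [AddCommGroup T] [Module R T] [AddCommGroup T'] [Module R T']
  [AddCommGroup T''] [Module R T'']
  {D : Module.End R T} {S : ZMod 2 → Submodule R T} {hS : ∀ k, ∀ t ∈ S k, D t ∈ S (k + 1)}
  {hD : ∀ k, ∀ t ∈ S k, D (D t) = 0}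
  {D' : Module.End R T'} {S' : ZMod 2 → Submodule R T'} {hS' : ∀ k, ∀ t ∈ S' k, D' t ∈ S' (k + 1)}
  {hD' : ∀ k, ∀ t ∈ S' k, D' (D' t) = 0}
  {D'' : Module.End R T''} {S'' : ZMod 2 → Submodule R T''}
  {hS'' : ∀ k, ∀ t ∈ S'' k, D'' t ∈ S'' (k + 1)} {hD'' : ∀ k, ∀ t ∈ S'' k, D'' (D'' t) = 0}

lemma gradedCx_d_apply (i : ZMod 2) (x : S i) :
    (((gradedCx D S hS hD).d i (i + 1)).hom x : S (i + 1)) = ⟨D x.1, hS i _ x.2⟩ := by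
  simp only [gradedCx, dif_pos]
  rfl

/-- A chain map between complexes of the form `gradedCx`. -/
def gradedHom (φ : T →ₗ[R] T') (h : ∀ k, ∀ t ∈ S k, φ t ∈ S' k)
    (hc : ∀ k, ∀ t ∈ S k, φ (D t) = D' (φ t)) : gradedCx D S hS hD ⟶ gradedCx D' S' hS' hD' :=
  mkHom (fun k => φ.restrict (h k)) fun i x => by
    erw [gradedCx_d_apply, gradedCx_d_apply]
    exact Subtype.ext (hc i _ x.2)

/-- Mutually inverse chain maps. -/
def gradedIso (φ : T →ₗ[R] T') (ψ : T' →ₗ[R] T) (h : ∀ k, ∀ t ∈ S k, φ t ∈ S' k)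
    (h' : ∀ k, ∀ t ∈ S' k, ψ t ∈ S k) (hc : ∀ k, ∀ t ∈ S k, φ (D t) = D' (φ t))
    (h1 : ∀ k, ∀ t ∈ S k, ψ (φ t) = t) (h2 : ∀ k, ∀ t ∈ S' k, φ (ψ t) = t) :
    gradedCx D S hS hD ≅ gradedCx D' S' hS' hD' where
  hom := gradedHom φ h hc
  inv := gradedHom ψ h' fun k t ht => by
    have := hc k (ψ t) (h' k t ht)
    rw [h2 k t ht] at this
    rw [← this, h1 (k + 1) _ (hS k _ (h' k t ht))]
  hom_inv_id := by
    ext k x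
    exact Subtype.ext (h1 k _ x.2)
  inv_hom_id := by
    ext k x
    exact Subtype.ext (h2 k _ x.2)

lemma add_one_add_one (i : ZMod 2) : i + 1 + 1 = i := by
  rw [add_assoc, (by decide : (1 + 1 : ZMod 2) = 0), add_zero]

/-- A homotopy between chain maps, from a family of maps of odd degree. -/
def mkHomotopy {X Y : Cx R} {f g : X ⟶ Y} (h : ∀ i j, X.X i →ₗ[R] Y.X j)
    (hh : ∀ i x, (f.f i).hom x = h (i + 1) i ((X.d i (i + 1)).hom x) +
      (Y.d (i + 1) i).hom (h i (i + 1) x) + (g.f i).hom x) : Homotopy f g where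
  -- In ℤ/2 the degree `i + 1` is both the successor and the predecessor of `i`, so only the
  -- components `h (i + 1) i` and `h i (i + 1)` of the family ever matter.
  hom i j := if j + 1 = i then ModuleCat.ofHom (h i j) else 0
  zero i j hij := if_neg hij
  comm i := by
    have r1 : (ComplexShape.up (ZMod 2)).Rel i (i + 1) := rfl
    have e := add_one_add_one i
    have r2 : (ComplexShape.up (ZMod 2)).Rel (i + 1) i := e
    rw [dNext_eq _ r1, prevD_eq _ r2, if_pos rfl, if_pos e]
    ext x
    exact hh i x

lemma Homotopy.exists_family {X Y : Cx R} {f g : X ⟶ Y} (h : Homotopy f g) :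
    ∃ s : ∀ i j, X.X i →ₗ[R] Y.X j, ∀ i x, (f.f i).hom x =
      s (i + 1) i ((X.d i (i + 1)).hom x) + (Y.d (i + 1) i).hom (s i (i + 1) x) +
        (g.f i).hom x := by
  refine ⟨fun i j => (h.hom i j).hom, fun i x => ?_⟩
  have r1 : (ComplexShape.up (ZMod 2)).Rel i (i + 1) := rfl
  have r2 : (ComplexShape.up (ZMod 2)).Rel (i + 1) i := add_one_add_one i
  have := h.comm i
  rw [dNext_eq _ r1, prevD_eq _ r2] at this
  exact congrArg (fun g => g.hom x) this

lemma coe_gradedCx_d {i j : ZMod 2} (h : i + 1 = j) (x : S i) :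
    Subtype.val (p := (· ∈ S j)) (((gradedCx D S hS hD).d i j).hom x) = D x.1 := by
  subst h
  exact congrArg Subtype.val (gradedCx_d_apply i x)

/-- The restrictions of a map of odd degree to the components. -/
def oddRes (H : T →ₗ[R] T') (hH : ∀ k, ∀ t ∈ S k, H t ∈ S' (k + 1)) (i j : ZMod 2) :
    S i →ₗ[R] S' j :=
  if h : i + 1 = j then H.restrict (p := S i) (q := S' j) (by subst h; exact hH i) else 0

lemma coe_oddRes (H : T →ₗ[R] T') (hH : ∀ k, ∀ t ∈ S k, H t ∈ S' (k + 1)) {i j : ZMod 2}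
    (h : i + 1 = j) (x : S i) : (oddRes H hH i j x : T') = H x.1 := by
  rw [oddRes, dif_pos h]
  rfl

/-- Odd maps `T → T'` induce homotopies. -/
def gradedHomotopy {φ ψ : T →ₗ[R] T'} {h1 : ∀ k, ∀ t ∈ S k, φ t ∈ S' k}
    {h2 : ∀ k, ∀ t ∈ S k, ψ t ∈ S' k} {hc1 : ∀ k, ∀ t ∈ S k, φ (D t) = D' (φ t)}
    {hc2 : ∀ k, ∀ t ∈ S k, ψ (D t) = D' (ψ t)}
    (H : T →ₗ[R] T') (hH : ∀ k, ∀ t ∈ S k, H t ∈ S' (k + 1))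
    (hh : ∀ k, ∀ t ∈ S k, φ t = H (D t) + D' (H t) + ψ t) :
    Homotopy (gradedHom (hS := hS) (hD := hD) (hS' := hS') (hD' := hD') φ h1 hc1)
      (gradedHom ψ h2 hc2) :=
  mkHomotopy (fun i j => oddRes H hH i j) fun i (x : S i) => Subtype.ext (by
    change φ x.1 = (oddRes H hH (i + 1) i (((gradedCx D S hS hD).d i (i + 1)).hom x) : S' i).1 +
      Subtype.val (p := (· ∈ S' i))
        (((gradedCx D' S' hS' hD').d (i + 1) i).hom (oddRes H hH i (i + 1) x)) + ψ x.1
    have a := (coe_oddRes H hH (add_one_add_one i)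
      (((gradedCx D S hS hD).d i (i + 1)).hom x)).trans (congrArg H (coe_gradedCx_d rfl x))
    have b := (coe_gradedCx_d (hS := hS') (hD := hD') (add_one_add_one i)
      (oddRes H hH i (i + 1) x)).trans (congrArg D' (coe_oddRes H hH rfl x))
    exact (hh i _ x.2).trans (congrArg₂ (· + ·) (congrArg₂ (· + ·) a.symm b.symm) rfl))

end graded

lemma shortExact_of {X Y Z : Cx R} (f : X ⟶ Y) (g : Y ⟶ Z)
    (hf : ∀ i, Function.Injective (f.f i).hom) (hg : ∀ i, Function.Surjective (g.f i).hom)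
    (w : ∀ i x, (g.f i).hom ((f.f i).hom x) = 0)
    (ex : ∀ i y, (g.f i).hom y = 0 → ∃ x, (f.f i).hom x = y) :
    ∃ w : f ≫ g = 0, (ShortComplex.mk f g w).ShortExact := by
  have w' : f ≫ g = 0 := by
    ext i x
    exact w i x
  refine ⟨w', HomologicalComplex.shortExact_of_degreewise_shortExact _ fun i => ?_⟩
  have hm : Mono (f.f i) := (ModuleCat.mono_iff_injective _).2 (hf i)
  have he : Epi (g.f i) := (ModuleCat.epi_iff_surjective _).2 (hg i)
  refine { exact := ?_, mono_f := hm, epi_g := he }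
  rw [ShortComplex.moduleCat_exact_iff]
  exact fun y hy => ex i y hy

/-- Additive invariants only see the three terms, so the maps are hidden in an existential and the
terms are pinned down by equalities. -/
lemma gradedCx_shortExact {T T' T'' : Type u} [AddCommGroup T] [Module R T] [AddCommGroup T']
    [Module R T'] [AddCommGroup T''] [Module R T'']
    {D : Module.End R T} {S : ZMod 2 → Submodule R T} {hS : ∀ k, ∀ t ∈ S k, D t ∈ S (k + 1)}
    {hD : ∀ k, ∀ t ∈ S k, D (D t) = 0} {D' : Module.End R T'} {S' : ZMod 2 → Submodule R T'}
    {hS' : ∀ k, ∀ t ∈ S' k, D' t ∈ S' (k + 1)} {hD' : ∀ k, ∀ t ∈ S' k, D' (D' t) = 0}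
    {D'' : Module.End R T''} {S'' : ZMod 2 → Submodule R T''}
    {hS'' : ∀ k, ∀ t ∈ S'' k, D'' t ∈ S'' (k + 1)} {hD'' : ∀ k, ∀ t ∈ S'' k, D'' (D'' t) = 0}
    (φ : T →ₗ[R] T') (ψ : T' →ₗ[R] T'') (h1 : ∀ k, ∀ t ∈ S k, φ t ∈ S' k)
    (h2 : ∀ k, ∀ t ∈ S' k, ψ t ∈ S'' k) (hc1 : ∀ k, ∀ t ∈ S k, φ (D t) = D' (φ t))
    (hc2 : ∀ k, ∀ t ∈ S' k, ψ (D' t) = D'' (ψ t)) (hφ : ∀ k, ∀ t ∈ S k, φ t = 0 → t = 0)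
    (hψ : ∀ k, ∀ t ∈ S'' k, ∃ s ∈ S' k, ψ s = t) (h0 : ∀ k, ∀ t ∈ S k, ψ (φ t) = 0)
    (hex : ∀ k, ∀ t ∈ S' k, ψ t = 0 → ∃ s ∈ S k, φ s = t) :
    ∃ s : ShortComplex (Cx R), s.ShortExact ∧ s.X₁ = gradedCx D S hS hD ∧
      s.X₂ = gradedCx D' S' hS' hD' ∧ s.X₃ = gradedCx D'' S'' hS'' hD'' := by
  obtain ⟨w, hw⟩ := shortExact_of
    (gradedHom (hS := hS) (hD := hD) (hS' := hS') (hD' := hD') φ h1 hc1)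
    (gradedHom (hS := hS') (hD := hD') (hS' := hS'') (hD' := hD'') ψ h2 hc2)
    (fun i => (injective_iff_map_eq_zero _).2 fun x hx => Subtype.ext
      (hφ i _ x.2 (congrArg (Subtype.val (p := (· ∈ S' i))) hx)))
    (fun i x => by
      obtain ⟨s, hs, hst⟩ := hψ i _ x.2
      exact ⟨⟨s, hs⟩, Subtype.ext hst⟩)
    (fun i x => Subtype.ext (h0 i _ x.2))
    (fun i y hy => by
      obtain ⟨s, hs, hst⟩ := hex i _ y.2 (congrArg (Subtype.val (p := (· ∈ S'' i))) hy)
      exact ⟨⟨s, hs⟩, Subtype.ext hst⟩)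
  exact ⟨_, hw, rfl, rfl, rfl⟩

lemma ShortExact.injective {S : ShortComplex (Cx R)} (h : S.ShortExact) (i : ZMod 2) :
    Function.Injective (S.f.f i).hom := by
  have := (h.map_of_exact (HomologicalComplex.eval (ModuleCat R) (ComplexShape.up (ZMod 2)) i))
  exact (ModuleCat.mono_iff_injective _).1 this.mono_f

lemma ShortExact.surjective {S : ShortComplex (Cx R)} (h : S.ShortExact) (i : ZMod 2) :
    Function.Surjective (S.g.f i).hom := by
  have := (h.map_of_exact (HomologicalComplex.eval (ModuleCat R) (ComplexShape.up (ZMod 2)) i))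
  exact (ModuleCat.epi_iff_surjective _).1 this.epi_g

lemma ShortExact.zero {S : ShortComplex (Cx R)} (i : ZMod 2) (x : S.X₁.X i) :
    (S.g.f i).hom ((S.f.f i).hom x) = 0 := by
  exact congrArg (fun h => (h.f i).hom x) S.zero

lemma ShortExact.exact {S : ShortComplex (Cx R)} (h : S.ShortExact) (i : ZMod 2) (y : S.X₂.X i)
    (hy : (S.g.f i).hom y = 0) : ∃ x, (S.f.f i).hom x = y := by
  have := (h.map_of_exact (HomologicalComplex.eval (ModuleCat R) (ComplexShape.up (ZMod 2)) i))
  exact (ShortComplex.moduleCat_exact_iff _).1 this.exact y hy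

/-! ### Finite length homology and Euler characteristics -/

/-- Complexes with homology of finite length. -/
def FinLen (X : Cx R) : Prop := ∀ i, IsFiniteLength R (X.homology i)

/-- The Euler characteristic of a complex. -/
def eul (X : Cx R) : ℤ :=
  ((Module.length R (X.homology 0)).toNat : ℤ) - ((Module.length R (X.homology 1)).toNat : ℤ)

lemma finLen_iff {X : Cx R} : FinLen X ↔ ∀ i, Module.length R (X.homology i) ≠ ⊤ :=
  forall_congr' fun _ => Module.length_ne_top_iff.symm

lemma rel01 : (ComplexShape.up (ZMod 2)).Rel 0 1 := ComplexShape.up_mk _ _ (by decide)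
lemma rel10 : (ComplexShape.up (ZMod 2)).Rel 1 0 := ComplexShape.up_mk _ _ (by decide)

/-- The long exact homology sequence closes up to a hexagon because the degrees are taken modulo 2.
Finiteness of two of the three homologies already bounds all six ranks of its maps, so nothing is
asked of the first term. -/
lemma eul_shortExact {S : ShortComplex (Cx R)} (h : S.ShortExact) (h2 : FinLen S.X₂)
    (h3 : FinLen S.X₃) : eul S.X₂ = eul S.X₁ + eul S.X₃ := by
  rw [finLen_iff] at h2 h3
  exact euler_arith (length_of_exact (h.homology_exact₁ 1 0 rel10))
    (length_of_exact (h.homology_exact₂ 0)) (length_of_exact (h.homology_exact₃ 0 1 rel01))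
    (length_of_exact (h.homology_exact₁ 0 1 rel01)) (length_of_exact (h.homology_exact₂ 1))
    (length_of_exact (h.homology_exact₃ 1 0 rel10)) (h2 0) (h2 1) (h3 0) (h3 1)

lemma length_ne_top_of_exact {S : ShortComplex (ModuleCat.{u} R)} (hS : S.Exact)
    (h1 : Module.length R S.X₁ ≠ ⊤) (h3 : Module.length R S.X₃ ≠ ⊤) :
    Module.length R S.X₂ ≠ ⊤ := by
  rw [length_of_exact hS, ne_eq, ENat.add_eq_top, not_or]
  constructor
  · exact ne_top_of_le_ne_top h1 (Module.length_le_of_surjective _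
      (LinearMap.surjective_rangeRestrict S.f.hom))
  · exact ne_top_of_le_ne_top h3 (Module.length_le_of_injective _
      (LinearMap.range S.g.hom).injective_subtype)

lemma exists_rel (i : ZMod 2) : ∃ j, (ComplexShape.up (ZMod 2)).Rel i j ∧
    (ComplexShape.up (ZMod 2)).Rel j i := ⟨i + 1, rfl, add_one_add_one i⟩

lemma FinLen.of_shortExact₂ {S : ShortComplex (Cx R)} (h : S.ShortExact) (h1 : FinLen S.X₁)
    (h3 : FinLen S.X₃) : FinLen S.X₂ := by
  rw [finLen_iff] at *
  exact fun i => length_ne_top_of_exact (h.homology_exact₂ i) (h1 i) (h3 i)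

lemma FinLen.of_shortExact₁ {S : ShortComplex (Cx R)} (h : S.ShortExact) (h2 : FinLen S.X₂)
    (h3 : FinLen S.X₃) : FinLen S.X₁ := by
  rw [finLen_iff] at *
  intro i
  obtain ⟨j, hj, hj'⟩ := exists_rel i
  exact length_ne_top_of_exact (h.homology_exact₁ j i hj') (h3 j) (h2 i)

lemma eul_eq_of_iso {X Y : Cx R} (e : X ≅ Y) : eul X = eul Y := by
  have h (i : ZMod 2) : Module.length R (X.homology i) = Module.length R (Y.homology i) :=
    ((HomologicalComplex.homologyFunctor _ _ i).mapIso e).toLinearEquiv.length_eq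
  simp only [eul, h]

lemma FinLen.of_iso {X Y : Cx R} (e : X ≅ Y) (h : FinLen X) : FinLen Y := by
  rw [finLen_iff] at *
  intro i
  exact ((HomologicalComplex.homologyFunctor _ _ i).mapIso e).toLinearEquiv.length_eq ▸ h i

/-- Acyclic complexes. -/
def Acyclic (X : Cx R) : Prop := ∀ i, Subsingleton (X.homology i)

lemma Acyclic.finLen {X : Cx R} (h : Acyclic X) : FinLen X := fun i =>
  haveI := h i; IsFiniteLength.of_subsingleton

lemma Acyclic.eul {X : Cx R} (h : Acyclic X) : eul X = 0 := by
  have := h 0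
  have := h 1
  simp [CyclicAdams.eul]

lemma subsingleton_iff_length {M : Type*} [AddCommGroup M] [Module R M] :
    Subsingleton M ↔ Module.length R M = 0 := Module.length_eq_zero_iff.symm

lemma length_eq_zero_of_exact {S : ShortComplex (ModuleCat.{u} R)} (hS : S.Exact)
    (h1 : Module.length R S.X₁ = 0) (h3 : Module.length R S.X₃ = 0) :
    Module.length R S.X₂ = 0 := by
  have a := Module.length_le_of_surjective (R := R) _
      (LinearMap.surjective_rangeRestrict S.f.hom)
  have b := Module.length_le_of_injective (R := R) _
      (LinearMap.range S.g.hom).injective_subtype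
  rw [h1, nonpos_iff_eq_zero] at a
  rw [h3, nonpos_iff_eq_zero] at b
  rw [length_of_exact hS, a, b, add_zero]

lemma acyclic_iff {X : Cx R} : Acyclic X ↔ ∀ i, Module.length R (X.homology i) = 0 :=
  forall_congr' fun _ => subsingleton_iff_length

lemma Acyclic.of_shortExact₁ {S : ShortComplex (Cx R)} (h : S.ShortExact) (h2 : Acyclic S.X₂)
    (h3 : Acyclic S.X₃) : Acyclic S.X₁ := by
  rw [acyclic_iff] at *
  intro i
  obtain ⟨j, hj, hj'⟩ := exists_rel i
  exact length_eq_zero_of_exact (h.homology_exact₁ j i hj') (h3 j) (h2 i)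

lemma exactAt_iff (X : Cx R) (i : ZMod 2) : X.ExactAt i ↔
    ∀ x, (X.d i (i + 1)).hom x = 0 → ∃ y, (X.d (i + 1) i).hom y = x := by
  rw [X.exactAt_iff' (i + 1) i (i + 1) ((ComplexShape.up (ZMod 2)).prev_eq' (add_one_add_one i))
    ((ComplexShape.up (ZMod 2)).next_eq' rfl), ShortComplex.moduleCat_exact_iff]
  rfl

lemma acyclic_iff_exact (X : Cx R) : Acyclic X ↔
    ∀ i x, (X.d i (i + 1)).hom x = 0 → ∃ y, (X.d (i + 1) i).hom y = x := by
  refine forall_congr' fun i => ?_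
  rw [← exactAt_iff, HomologicalComplex.exactAt_iff_isZero_homology,
    ModuleCat.isZero_iff_subsingleton]

/-! ### Null homotopic scalars -/

/-- Multiplication by `r` on `X` is null homotopic. -/
def Null (r : R) (X : Cx R) : Prop :=
  ∃ h : ∀ i j, X.X i →ₗ[R] X.X j, ∀ i x,
    h (i + 1) i ((X.d i (i + 1)).hom x) + (X.d (i + 1) i).hom (h i (i + 1) x) = r • x

lemma Null.homotopy {r : R} {X : Cx R} (h : Null r X) : Nonempty (Homotopy (r • 𝟙 X) 0) := by
  obtain ⟨h, hh⟩ := h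
  refine ⟨mkHomotopy h fun i x => ?_⟩
  rw [hh]
  exact (add_zero _).symm

/-- The ideal of null homotopic scalars. -/
def nullIdeal (X : Cx R) : Ideal R where
  carrier := {r | Null r X}
  zero_mem' := ⟨fun _ _ => 0, fun i x => by simp⟩
  add_mem' := by
    rintro a b ⟨h, hh⟩ ⟨h', hh'⟩
    refine ⟨fun i j => h i j + h' i j, fun i x => ?_⟩
    rw [add_smul, ← hh, ← hh']
    simp only [LinearMap.add_apply, map_add]
    abel
  smul_mem' := by
    rintro c b ⟨h, hh⟩
    refine ⟨fun i j => c • h i j, fun i x => ?_⟩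
    rw [smul_assoc, ← hh, smul_add]
    simp only [LinearMap.smul_apply, map_smul]

lemma Null.smul_homology {r : R} {X : Cx R} (h : Null r X) (i : ZMod 2) (x : X.homology i) :
    r • x = 0 := by
  obtain ⟨h⟩ := h.homotopy
  have := h.homologyMap_eq i
  rw [HomologicalComplex.homologyMap_zero] at this
  have e : HomologicalComplex.homologyMap (r • 𝟙 X) i = r • 𝟙 (X.homology i) := by
    rw [← HomologicalComplex.homologyMap_id]
    exact ShortComplex.homologyMap_smul
      ((HomologicalComplex.shortComplexFunctor (ModuleCat R) (ComplexShape.up (ZMod 2)) i).map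
        (𝟙 X)) r
  rw [e] at this
  exact congrArg (fun g => g.hom x) this

lemma Null.acyclic {X : Cx R} (h : Null 1 X) : Acyclic X := fun i =>
  ⟨fun x y => by rw [← one_smul R x, ← one_smul R y, h.smul_homology, h.smul_homology]⟩

lemma Null.of_graded {T : Type u} [AddCommGroup T] [Module R T] {D : Module.End R T}
    {S : ZMod 2 → Submodule R T} {hS : ∀ k, ∀ t ∈ S k, D t ∈ S (k + 1)}
    {hD : ∀ k, ∀ t ∈ S k, D (D t) = 0} {r : R} (H : Module.End R T)
    (hH : ∀ k, ∀ t ∈ S k, H t ∈ S (k + 1)) (hh : ∀ k, ∀ t ∈ S k, H (D t) + D (H t) = r • t) :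
    Null r (gradedCx D S hS hD) :=
  ⟨fun i j => oddRes H hH i j, fun i (x : S i) => Subtype.ext (by
    change (oddRes H hH (i + 1) i (((gradedCx D S hS hD).d i (i + 1)).hom x) : S i).1 +
      Subtype.val (p := (· ∈ S i))
        (((gradedCx D S hS hD).d (i + 1) i).hom (oddRes H hH i (i + 1) x)) = r • x.1
    have a := (coe_oddRes H hH (add_one_add_one i)
      (((gradedCx D S hS hD).d i (i + 1)).hom x)).trans (congrArg H (coe_gradedCx_d rfl x))
    have b := (coe_gradedCx_d (hS := hS) (hD := hD) (add_one_add_one i)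
      (oddRes H hH i (i + 1) x)).trans (congrArg D (coe_oddRes H hH rfl x))
    exact (congrArg₂ (· + ·) a b).trans (hh i _ x.2))⟩

lemma homology_finite [IsNoetherianRing R] {X : Cx R} (h : ∀ i, Module.Finite R (X.X i))
    (i : ZMod 2) : Module.Finite R (X.homology i) := by
  have := h i
  have m : Function.Injective (X.iCycles i).hom := (ModuleCat.mono_iff_injective _).1 inferInstance
  have e : Function.Surjective (X.homologyπ i).hom :=
    (ModuleCat.epi_iff_surjective _).1 inferInstance
  have : Module.Finite R (X.cycles i) := Module.Finite.of_injective _ m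
  exact Module.Finite.of_surjective _ e

end Basics
end
end CyclicAdams

namespace CyclicAdams
noncomputable section

/-! ### Koszul signs and the signed action of permutations on tensor powers. -/

section Tensor

variable {R : Type u} [CommRing R]

lemma zmod2_cases (i : ZMod 2) : i = 0 ∨ i = 1 := by revert i; decide

/-- The sign `(-1)^a` of `a : ℤ/2`. -/
def sg (R : Type u) [CommRing R] (a : ZMod 2) : R := (-1) ^ a.val

@[simp] lemma sg_zero : sg R 0 = 1 := by simp [sg]

@[simp] lemma sg_one : sg R 1 = -1 := by simp [sg, ZMod.val_one]

lemma sg_add (a b : ZMod 2) : sg R (a + b) = sg R a * sg R b := by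
  rcases zmod2_cases a with rfl | rfl <;> rcases zmod2_cases b with rfl | rfl <;>
    simp [(by decide : (1 + 1 : ZMod 2) = 0)]

lemma sg_mul_self (a : ZMod 2) : sg R a * sg R a = 1 := by
  rw [← sg_add, (by revert a; decide : a + a = 0), sg_zero]

lemma sg_sum {ι : Type*} (s : Finset ι) (f : ι → ZMod 2) :
    sg R (∑ i ∈ s, f i) = ∏ i ∈ s, sg R (f i) := by
  classical
  induction s using Finset.induction_on with
  | empty => simp
  | insert a s ha ih => rw [Finset.sum_insert ha, Finset.prod_insert ha, sg_add, ih]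

lemma sg_natCast (n : ℕ) : sg R (n : ZMod 2) = (-1) ^ n := by
  induction n with
  | zero => simp
  | succ n ih => rw [Nat.cast_succ, sg_add, ih, sg_one, pow_succ]

variable {X Y Z : Cx R}

lemma proj_apply (X : Cx R) (a : ZMod 2) (v : Tot X) : proj X a v = Pi.single a (v a) := rfl

lemma proj_mul_proj (X : Cx R) (a b : ZMod 2) :
    proj X a * proj X b = if a = b then proj X b else 0 := by
  refine end_ext fun i x => ?_
  rw [Module.End.mul_apply]
  by_cases h : i = b
  · subst h
    rw [proj_single_self]
    split_ifs with h'
    · subst h'; rw [proj_single_self]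
    · rw [proj_single_ne X (Ne.symm h')]; rfl
  · rw [proj_single_ne X h, map_zero]
    split_ifs
    · rw [proj_single_ne X h]
    · rfl

lemma proj_proj (X : Cx R) (a : ZMod 2) (v : Tot X) : proj X a (proj X a v) = proj X a v := by
  have := LinearMap.congr_fun (proj_mul_proj X a a) v
  simpa using this

lemma proj_proj_ne (X : Cx R) {a b : ZMod 2} (h : a ≠ b) (v : Tot X) :
    proj X a (proj X b v) = 0 := by
  have := LinearMap.congr_fun (proj_mul_proj X a b) v
  simpa [h] using this

lemma sum_proj (X : Cx R) (v : Tot X) : ∑ a, proj X a v = v := by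
  simp only [proj_apply]
  exact Finset.univ_sum_single v

/-- `f` is homogeneous of degree `b`. -/
def HasDeg (b : ZMod 2) (f : Tot X →ₗ[R] Tot Y) : Prop :=
  ∀ a v, f (proj X a v) = proj Y (a + b) (f v)

lemma HasDeg.proj_eq {b a c : ZMod 2} {f : Tot X →ₗ[R] Tot Y} (h : HasDeg b f) {v : Tot X}
    (hv : proj X a v = v) (hc : a + b = c) : proj Y c (f v) = f v := by
  rw [← hc, ← h a v, hv]

lemma hasDeg_one : HasDeg 0 (1 : Module.End R (Tot X)) := fun a v => by simp

lemma HasDeg.mul {b c : ZMod 2} {f : Tot Y →ₗ[R] Tot Z} {g : Tot X →ₗ[R] Tot Y}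
    (hf : HasDeg b f) (hg : HasDeg c g) : HasDeg (b + c) (f ∘ₗ g) := fun a v => by
  rw [LinearMap.comp_apply, hg, hf, LinearMap.comp_apply, add_assoc, add_comm c]

lemma HasDeg.add {b : ZMod 2} {f g : Tot X →ₗ[R] Tot Y} (hf : HasDeg b f) (hg : HasDeg b g) :
    HasDeg b (f + g) := fun a v => by simp [hf a v, hg a v]

lemma HasDeg.smul {b : ZMod 2} {f : Tot X →ₗ[R] Tot Y} (hf : HasDeg b f) (r : R) :
    HasDeg b (r • f) := fun a v => by simp [hf a v]

lemma HasDeg.sub {b : ZMod 2} {f g : Tot X →ₗ[R] Tot Y} (hf : HasDeg b f) (hg : HasDeg b g) :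
    HasDeg b (f - g) := fun a v => by simp [hf a v, hg a v]

lemma hasDeg_diff (X : Cx R) : HasDeg 1 (diff X) := fun a v =>
  LinearMap.congr_fun (diff_mul_proj X a) v

lemma hasDeg_proj (X : Cx R) (b : ZMod 2) : HasDeg 0 (proj X b) := fun a v => by
  rw [add_zero]
  by_cases h : a = b
  · subst h; rfl
  · rw [proj_proj_ne X h, proj_proj_ne X (Ne.symm h)]

lemma hasDeg_parity (X : Cx R) : HasDeg 0 (parity X) := by
  have := (hasDeg_proj X 0).sub (hasDeg_proj X 1)
  exact this

lemma parity_of_proj {a : ZMod 2} {v : Tot X} (hv : proj X a v = v) :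
    parity X v = sg R a • v := by
  rw [← hv, ← Module.End.mul_apply, parity_mul_proj]
  rfl

lemma HasDeg.parity_apply {b : ZMod 2} {f : Tot X →ₗ[R] Tot Y} (hf : HasDeg b f) (v : Tot X) :
    f (parity X v) = sg R b • parity Y (f v) := by
  have e (X : Cx R) (v : Tot X) : parity X v = proj X 0 v - proj X 1 v := rfl
  rw [e, e, map_sub, hf, hf]
  rcases zmod2_cases b with rfl | rfl
  · simp
  · simp [(by decide : (1 + 1 : ZMod 2) = 0)]

/-- A family of homogeneous vectors of degrees `ε i`. -/
def Homog {p : ℕ} (ε : Fin p → ZMod 2) (y : Fin p → Tot X) : Prop :=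
  ∀ i, proj X (ε i) (y i) = y i

lemma tprod_eq_sum {p : ℕ} (y : Fin p → Tot X) :
    PiTensorProduct.tprod R y =
      ∑ ε : Fin p → ZMod 2, PiTensorProduct.tprod R fun i => proj X (ε i) (y i) := by
  conv_lhs => rw [show y = fun i => ∑ a, proj X a (y i) from funext fun i => (sum_proj X _).symm]
  rw [MultilinearMap.map_sum]

/-- Every vector is the sum of its homogeneous components, so pure tensors of homogeneous vectors
span. On these the parity operators are scalars, and all sign identities reduce to identities of
exponents in ℤ/2. -/
lemma tensor_ext {p : ℕ} {N : Type*} [AddCommGroup N] [Module R N] {f g : TPow p X →ₗ[R] N}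
    (h : ∀ (ε : Fin p → ZMod 2) (y : Fin p → Tot X), Homog ε y →
      f (PiTensorProduct.tprod R y) = g (PiTensorProduct.tprod R y)) : f = g := by
  refine PiTensorProduct.ext (MultilinearMap.ext fun y => ?_)
  change f (PiTensorProduct.tprod R y) = g (PiTensorProduct.tprod R y)
  rw [tprod_eq_sum, map_sum, map_sum]
  exact Finset.sum_congr rfl fun ε _ => h ε _ fun i => proj_proj X _ _

lemma Homog.mem_tDeg {p : ℕ} {ε : Fin p → ZMod 2} {y : Fin p → Tot X} (h : Homog ε y)
    {k : ZMod 2} (hk : ∑ i, ε i = k) : PiTensorProduct.tprod R y ∈ tDeg p X k :=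
  Submodule.subset_span ⟨ε, fun i => y i (ε i), hk, congrArg _ (funext fun i => h i)⟩

lemma tDeg_le {p : ℕ} {k : ZMod 2} {S : Submodule R (TPow p X)}
    (h : ∀ (ε : Fin p → ZMod 2) (y : Fin p → Tot X), Homog ε y → ∑ i, ε i = k →
      PiTensorProduct.tprod R y ∈ S) : tDeg p X k ≤ S := by
  refine Submodule.span_le.2 ?_
  rintro _ ⟨ε, x, hε, rfl⟩
  exact h ε _ (fun i => proj_single_self X _ _) hε

lemma map_mem_tDeg {p : ℕ} (f : Fin p → (Tot X →ₗ[R] Tot Y)) (b : Fin p → ZMod 2)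
    (hf : ∀ i, HasDeg (b i) (f i)) {k l : ZMod 2} (hl : k + ∑ i, b i = l) :
    ∀ t ∈ tDeg p X k, PiTensorProduct.map f t ∈ tDeg p Y l := by
  have : tDeg p X k ≤ (tDeg p Y l).comap (PiTensorProduct.map f) := tDeg_le fun ε y hy hk => by
    change PiTensorProduct.map f (PiTensorProduct.tprod R y) ∈ tDeg p Y l
    rw [PiTensorProduct.map_tprod]
    refine Homog.mem_tDeg (ε := fun i => ε i + b i) (fun i => (hf i).proj_eq (hy i) rfl) ?_
    rw [Finset.sum_add_distrib, hk, hl]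
  exact this

lemma Homog.map_proj {p : ℕ} {ε : Fin p → ZMod 2} {y : Fin p → Tot X} (h : Homog ε y)
    (δ : Fin p → ZMod 2) : PiTensorProduct.map (fun i => proj X (δ i)) (PiTensorProduct.tprod R y) =
      if δ = ε then PiTensorProduct.tprod R y else 0 := by
  rw [PiTensorProduct.map_tprod]
  split_ifs with hδ
  · subst hδ
    exact congrArg _ (funext h)
  · obtain ⟨i, hi⟩ := Function.ne_iff.1 hδ
    refine MultilinearMap.map_coord_zero _ i ?_
    rw [← h i, proj_proj_ne X hi]

/-- The projection of the tensor power onto its component of degree `k`. -/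
def tproj (p : ℕ) (X : Cx R) (k : ZMod 2) : Module.End R (TPow p X) :=
  ∑ ε : Fin p → ZMod 2, if ∑ i, ε i = k then PiTensorProduct.map (fun i => proj X (ε i)) else 0

lemma Homog.tproj {p : ℕ} {ε : Fin p → ZMod 2} {y : Fin p → Tot X} (h : Homog ε y) (k : ZMod 2) :
    tproj p X k (PiTensorProduct.tprod R y) =
      if ∑ i, ε i = k then PiTensorProduct.tprod R y else 0 := by
  rw [CyclicAdams.tproj, LinearMap.sum_apply, Finset.sum_eq_single ε]
  · split_ifs
    · rw [h.map_proj, if_pos rfl]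
    · rfl
  · intro δ _ hδ
    split_ifs
    · rw [h.map_proj, if_neg hδ]
    · rfl
  · simp

lemma tproj_mem (p : ℕ) (X : Cx R) (k : ZMod 2) (t : TPow p X) : tproj p X k t ∈ tDeg p X k := by
  have : (tDeg p X k).mkQ ∘ₗ tproj p X k = 0 := tensor_ext fun ε y hy => by
    rw [LinearMap.comp_apply, hy.tproj]
    split_ifs with hk
    · simpa using hy.mem_tDeg hk
    · simp
  simpa using LinearMap.congr_fun this t

lemma tproj_of_mem {p : ℕ} {k : ZMod 2} {t : TPow p X} (ht : t ∈ tDeg p X k) :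
    tproj p X k t = t := by
  have : tDeg p X k ≤ LinearMap.eqLocus (tproj p X k) LinearMap.id := tDeg_le fun ε y hy hk => by
    rw [LinearMap.mem_eqLocus, hy.tproj, if_pos hk, LinearMap.id_apply]
  exact this ht

/-! ### Signed permutations -/

/-- The exponent of the Koszul sign of the permutation `π` on tensors of multidegree `ε`. -/
def qf {p : ℕ} (π : Equiv.Perm (Fin p)) (ε : Fin p → ZMod 2) : ZMod 2 :=
  ∑ i, ∑ j, if i < j ∧ π j < π i then ε i * ε j else 0

/-- The terms at `(a, b)` and `(b, a)` cancel in pairs; this is how sums over ordered pairs of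
positions are compared modulo 2. -/
lemma sum_antisymm {p : ℕ} (m : Fin p → Fin p → ZMod 2) (ε : Fin p → ZMod 2)
    (hd : ∀ a, m a a = 0) (h : ∀ a b, a ≠ b → m a b + m b a = 0) :
    ∑ a, ∑ b, m a b * (ε a * ε b) = 0 := by
  rw [← Finset.sum_product']
  refine Finset.sum_involution (fun a _ => (a.2, a.1)) ?_ ?_ (by simp) (by simp)
  · rintro ⟨a, b⟩ _
    by_cases hab : a = b
    · subst hab; simp [hd]
    · change m a b * (ε a * ε b) + m b a * (ε b * ε a) = 0
      rw [mul_comm (ε b), ← add_mul, h a b hab, zero_mul]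
  · rintro ⟨a, b⟩ _ hne e
    simp only [Prod.mk.injEq] at e
    obtain ⟨rfl, -⟩ := e
    exact hne (by simp [hd])

/-- A pair of positions is inverted by `π * ρ` exactly when one but not both of the following
happens: `ρ` inverts it, or `π` inverts its image. Modulo 2 the three inversion counts therefore add
up to zero on each unordered pair. This cocycle rule makes the signed action multiplicative. -/
lemma qf_mul {p : ℕ} (π ρ : Equiv.Perm (Fin p)) (ε : Fin p → ZMod 2) :
    qf (π * ρ) ε = qf ρ ε + qf π (fun i => ε (ρ.symm i)) := by
  -- Reindexing by `ρ` lets all three sums run over the same pairs; the price is the order condition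
  -- `ρ a < ρ b` instead of `a < b`.
  have e : qf π (fun i => ε (ρ.symm i)) =
      ∑ a, ∑ b, if ρ a < ρ b ∧ π (ρ b) < π (ρ a) then ε a * ε b else 0 := by
    rw [qf, ← Equiv.sum_comp ρ]
    refine Finset.sum_congr rfl fun a _ => ?_
    rw [← Equiv.sum_comp ρ]
    simp
  have two : ∀ x : ZMod 2, x + x = 0 := by decide
  have key : qf (π * ρ) ε + (qf ρ ε + qf π (fun i => ε (ρ.symm i))) = 0 := by
    rw [e, qf, qf, ← Finset.sum_add_distrib, ← Finset.sum_add_distrib]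
    simp only [← Finset.sum_add_distrib]
    refine Eq.trans ?_ (sum_antisymm (fun a b =>
      (if a < b ∧ π (ρ b) < π (ρ a) then 1 else 0) + ((if a < b ∧ ρ b < ρ a then 1 else 0) +
        if ρ a < ρ b ∧ π (ρ b) < π (ρ a) then 1 else 0)) ε (by simp) ?_)
    · refine Finset.sum_congr rfl fun a _ => Finset.sum_congr rfl fun b _ => ?_
      simp only [add_mul, ite_mul, one_mul, zero_mul, Equiv.Perm.mul_apply]
      rfl
    · intro a b hab
      have h1 : (b < a) ↔ ¬ (a < b) := by
        rw [not_lt, le_iff_lt_or_eq, or_iff_left (Ne.symm hab)]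
      have hr : ρ a ≠ ρ b := fun h => hab (ρ.injective h)
      have h2 : (ρ b < ρ a) ↔ ¬ (ρ a < ρ b) := by
        rw [not_lt, le_iff_lt_or_eq, or_iff_left (Ne.symm hr)]
      have hp : π (ρ a) ≠ π (ρ b) := fun h => hr (π.injective h)
      have h3 : (π (ρ b) < π (ρ a)) ↔ ¬ (π (ρ a) < π (ρ b)) := by
        rw [not_lt, le_iff_lt_or_eq, or_iff_left (Ne.symm hp)]
      simp only [h1, h2, h3]
      by_cases c1 : a < b <;> by_cases c2 : ρ a < ρ b <;> by_cases c3 : π (ρ a) < π (ρ b) <;>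
        simp [c1, c2, c3, (by decide : (1 + 1 : ZMod 2) = 0)]
  exact add_right_cancel (key.trans (two _).symm)

/-- The action of a permutation on the tensor power, with the Koszul signs. -/
def permOp (p : ℕ) (X : Cx R) (π : Equiv.Perm (Fin p)) : Module.End R (TPow p X) :=
  (PiTensorProduct.reindex R (fun _ => Tot X) π).toLinearMap ∘ₗ
    ∑ ε : Fin p → ZMod 2, sg R (qf π ε) • PiTensorProduct.map (fun i => proj X (ε i))

lemma Homog.permOp {p : ℕ} {ε : Fin p → ZMod 2} {y : Fin p → Tot X} (h : Homog ε y)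
    (π : Equiv.Perm (Fin p)) : permOp p X π (PiTensorProduct.tprod R y) =
      sg R (qf π ε) • PiTensorProduct.tprod R fun i => y (π.symm i) := by
  rw [CyclicAdams.permOp, LinearMap.comp_apply, LinearMap.sum_apply, Finset.sum_eq_single ε]
  · rw [LinearMap.smul_apply, h.map_proj, if_pos rfl, map_smul]
    congr 1
    exact PiTensorProduct.reindex_tprod _ _
  · intro δ _ hδ
    rw [LinearMap.smul_apply, h.map_proj, if_neg hδ, smul_zero]
  · simp

lemma Homog.comp {p : ℕ} {ε : Fin p → ZMod 2} {y : Fin p → Tot X} (h : Homog ε y)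
    (π : Equiv.Perm (Fin p)) : Homog (fun i => ε (π i)) fun i => y (π i) := fun i => h (π i)

lemma permOp_mul (p : ℕ) (X : Cx R) (π ρ : Equiv.Perm (Fin p)) :
    permOp p X (π * ρ) = permOp p X π * permOp p X ρ := by
  refine tensor_ext fun ε y hy => ?_
  rw [Module.End.mul_apply, hy.permOp, hy.permOp, map_smul, (hy.comp ρ.symm).permOp, smul_smul,
    qf_mul, sg_add]
  rfl

lemma permOp_one (p : ℕ) (X : Cx R) : permOp p X 1 = 1 := by
  refine tensor_ext fun ε y hy => ?_
  rw [hy.permOp]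
  have : qf (1 : Equiv.Perm (Fin p)) ε = 0 := by
    refine Finset.sum_eq_zero fun i _ => Finset.sum_eq_zero fun j _ => ?_
    rw [if_neg]
    rintro ⟨h1, h2⟩
    exact lt_asymm h1 h2
  rw [this, sg_zero, one_smul]
  rfl

lemma permOp_pow (p : ℕ) (X : Cx R) (π : Equiv.Perm (Fin p)) (n : ℕ) :
    permOp p X (π ^ n) = permOp p X π ^ n := by
  induction n with
  | zero => rw [pow_zero, pow_zero, permOp_one]
  | succ n ih => rw [pow_succ, pow_succ, permOp_mul, ih]

lemma permOp_mem (p : ℕ) (X : Cx R) (π : Equiv.Perm (Fin p)) (k : ZMod 2) :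
    ∀ t ∈ tDeg p X k, permOp p X π t ∈ tDeg p X k := by
  have : tDeg p X k ≤ (tDeg p X k).comap (permOp p X π) := tDeg_le fun ε y hy hk => by
    rw [Submodule.mem_comap, hy.permOp]
    refine Submodule.smul_mem _ _ ((hy.comp π.symm).mem_tDeg ?_)
    rw [← hk]
    exact Equiv.sum_comp π.symm ε
  exact this

/-- The `i`-th summand of the derivation of the tensor power given by an odd endomorphism `h`. -/
def tOddAt (p : ℕ) (h : Module.End R (Tot X)) (i : Fin p) : Module.End R (TPow p X) :=
  PiTensorProduct.map fun j => if j < i then parity X else if j = i then h else 1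

/-- The derivation of the tensor power given by an odd endomorphism `h`. -/
def tOdd (p : ℕ) (h : Module.End R (Tot X)) : Module.End R (TPow p X) := ∑ i, tOddAt p h i

/-- The derivation is set up for an arbitrary odd operator because the differential will later be
cut into two odd pieces, each of which has to be extended to the tensor power by itself. -/
lemma tDiff_eq_tOdd (p : ℕ) (X : Cx R) : tDiff p X = tOdd p (diff X) := rfl

lemma Homog.tOddAt {p : ℕ} {ε : Fin p → ZMod 2} {y : Fin p → Tot X} (h : Homog ε y)
    (d : Module.End R (Tot X)) (i : Fin p) : tOddAt p d i (PiTensorProduct.tprod R y) =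
      sg R (∑ j, if j < i then ε j else 0) •
        PiTensorProduct.tprod R (Function.update y i (d (y i))) := by
  rw [CyclicAdams.tOddAt, PiTensorProduct.map_tprod, sg_sum, ← MultilinearMap.map_smul_univ]
  congr 1
  funext j
  rcases lt_trichotomy j i with hj | rfl | hj
  · rw [if_pos hj, if_pos hj, Function.update_of_ne hj.ne, parity_of_proj (h j)]
  · simp
  · rw [if_neg hj.not_gt, if_neg hj.ne', if_neg hj.not_gt, Function.update_of_ne hj.ne', sg_zero,
      one_smul]
    rfl

lemma Homog.update {p : ℕ} {ε : Fin p → ZMod 2} {y : Fin p → Tot X} (h : Homog ε y) (i : Fin p)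
    {a : ZMod 2} {v : Tot X} (hv : proj X a v = v) :
    Homog (Function.update ε i a) (Function.update y i v) := by
  intro j
  by_cases hj : j = i
  · subst hj; simpa using hv
  · simpa [hj] using h j

/-- Raising the degree in slot `i` changes the exponent by the total degree of the slots that form
an inversion with `i`. A slot `j` does so exactly when one of `j < i` and `π j < π i` holds but not
both, which gives the sum of the two prefix sums. -/
lemma qf_update {p : ℕ} (π : Equiv.Perm (Fin p)) (ε : Fin p → ZMod 2) (i : Fin p) :
    qf π (Function.update ε i (ε i + 1)) =
      qf π ε + ((∑ j, if j < i then ε j else 0) + ∑ j, if π j < π i then ε j else 0) := by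
  have hu : ∀ j, Function.update ε i (ε i + 1) j = ε j + if j = i then 1 else 0 := by
    intro j
    by_cases hj : j = i
    · subst hj; simp
    · simp [hj]
  have e : ∀ a b : Fin p, (if a < b ∧ π b < π a then
        Function.update ε i (ε i + 1) a * Function.update ε i (ε i + 1) b else 0) =
      (if a < b ∧ π b < π a then ε a * ε b else 0) +
        ((if a = i then (if i < b ∧ π b < π i then ε b else 0) else 0) +
          (if b = i then (if a < i ∧ π i < π a then ε a else 0) else 0)) := by
    intro a b
    rw [hu, hu]
    by_cases ha : a = i
    · by_cases hb : b = i
      · simp [ha, hb]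
      · subst ha
        simp only [hb, if_true, if_false, add_zero]
        split_ifs <;> ring
    · by_cases hb : b = i
      · subst hb
        simp only [ha, if_true, if_false, zero_add, add_zero]
        split_ifs <;> ring
      · simp [ha, hb]
  rw [qf, qf]
  simp only [e, Finset.sum_add_distrib]
  congr 1
  have e1 : (∑ a, ∑ b, if a = i then (if i < b ∧ π b < π i then ε b else 0) else 0) =
      ∑ b, if i < b ∧ π b < π i then ε b else 0 := by
    rw [Finset.sum_eq_single i (fun a _ ha => by simp [ha]) (by simp)]
    simp
  have e2 : (∑ a, ∑ b, if b = i then (if a < i ∧ π i < π a then ε a else 0) else 0) =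
      ∑ a, if a < i ∧ π i < π a then ε a else 0 := by
    refine Finset.sum_congr rfl fun a _ => ?_
    rw [Finset.sum_eq_single i (fun b _ hb => by simp [hb]) (by simp)]
    simp
  rw [e1, e2, ← Finset.sum_add_distrib, ← Finset.sum_add_distrib]
  refine Finset.sum_congr rfl fun j _ => ?_
  by_cases hj : j = i
  · subst hj; simp
  · have h1 : (i < j) ↔ ¬ (j < i) := by
      rw [not_lt, le_iff_lt_or_eq, or_iff_left (Ne.symm hj)]
    have hp : π j ≠ π i := fun h => hj (π.injective h)
    have h3 : (π i < π j) ↔ ¬ (π j < π i) := by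
      rw [not_lt, le_iff_lt_or_eq, or_iff_left (Ne.symm hp)]
    have two : ∀ x : ZMod 2, x + x = 0 := by decide
    simp only [h1, h3]
    by_cases c1 : j < i <;> by_cases c2 : π j < π i <;> simp [c1, c2, two]

/-- By `qf_update`, the change of the permutation sign equals the quotient of the Koszul signs of
`d` in slot `i` before the permutation and in slot `π i` after it. -/
lemma permOp_tOddAt {p : ℕ} {d : Module.End R (Tot X)} (hd : HasDeg 1 d) (π : Equiv.Perm (Fin p))
    (i : Fin p) : permOp p X π * tOddAt p d i = tOddAt p d (π i) * permOp p X π := by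
  refine tensor_ext fun ε y hy => ?_
  rw [Module.End.mul_apply, Module.End.mul_apply, hy.tOddAt, hy.permOp, map_smul, map_smul,
    (hy.comp π.symm).tOddAt,
    (hy.update i (hd.proj_eq (hy i) rfl)).permOp, smul_smul, smul_smul, qf_update]
  have e1 : (∑ j, if j < π i then ε (π.symm j) else 0) = ∑ j, if π j < π i then ε j else 0 := by
    rw [← Equiv.sum_comp π]
    simp
  have e2 : (fun j => Function.update y i (d (y i)) (π.symm j)) =
      Function.update (fun j => y (π.symm j)) (π i) (d (y (π.symm (π i)))) := by
    funext j
    by_cases hj : j = π i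
    · subst hj; simp
    · rw [Function.update_of_ne hj, Function.update_of_ne]
      rintro rfl
      exact hj (by simp)
  rw [e1, e2]
  congr 1
  rw [sg_add, sg_add]
  linear_combination (sg R (qf π ε) * sg R (∑ j, if π j < π i then ε j else 0)) *
    sg_mul_self (R := R) (∑ j, if j < i then ε j else 0)

lemma permOp_tOdd {p : ℕ} {d : Module.End R (Tot X)} (hd : HasDeg 1 d) (π : Equiv.Perm (Fin p)) :
    permOp p X π * tOdd p d = tOdd p d * permOp p X π := by
  rw [tOdd, Finset.mul_sum, Finset.sum_mul]
  simp only [permOp_tOddAt hd]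
  exact Equiv.sum_comp π fun i => tOddAt p d i * permOp p X π

lemma permOp_tDiff (p : ℕ) (X : Cx R) (π : Equiv.Perm (Fin p)) :
    permOp p X π * tDiff p X = tDiff p X * permOp p X π :=
  permOp_tOdd (hasDeg_diff X) π

/-- The inversions of the cycle are exactly the pairs containing the last position, which yields the
sign in `rot`. This embeds the cyclic action in the signed action of the symmetric group, where its
normaliser is available. -/
lemma rot_eq_permOp (n : ℕ) (X : Cx R) : rot (n + 1) X = permOp (n + 1) X (finRotate (n + 1)) := by
  refine tensor_ext fun ε y hy => ?_
  have e : y = fun i => (Pi.single (ε i) (y i (ε i)) : Tot X) := funext fun i => (hy i).symm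
  rw [hy.permOp]
  conv_lhs => rw [e]
  rw [rot_tprod]
  congr 1
  · have : qf (finRotate (n + 1)) ε =
        ((ε (Fin.last n)).val * ∑ i : Fin n, (ε i.castSucc).val : ℕ) := by
      have h0 : ∀ a : Fin (n + 1), ∀ b : Fin n,
          ¬ (a < b.castSucc ∧ finRotate (n + 1) b.castSucc < finRotate (n + 1) a) := by
        rintro a b ⟨h1, h2⟩
        obtain ⟨a, rfl⟩ := Fin.exists_castSucc_eq.2 (h1.trans (Fin.castSucc_lt_last b)).ne
        rw [finRotate_apply, finRotate_apply, Fin.coeSucc_eq_succ, Fin.coeSucc_eq_succ,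
          Fin.succ_lt_succ_iff] at h2
        exact lt_asymm (Fin.castSucc_lt_castSucc_iff.1 h1) h2
      have h1 : ∀ a : Fin n, (a.castSucc < Fin.last n ∧
          finRotate (n + 1) (Fin.last n) < finRotate (n + 1) a.castSucc) := by
        intro a
        refine ⟨Fin.castSucc_lt_last a, ?_⟩
        rw [finRotate_apply, finRotate_apply, Fin.coeSucc_eq_succ, Fin.last_add_one]
        exact Fin.succ_pos a
      rw [qf]
      simp only [Fin.sum_univ_castSucc (n := n) (f := fun b => ite (_ < b ∧ _) _ _), h0, if_false,
        Finset.sum_const_zero, zero_add]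
      rw [Fin.sum_univ_castSucc]
      simp only [h1, and_self, if_true, lt_irrefl, if_false, add_zero]
      push_cast
      rw [Finset.mul_sum]
      refine Finset.sum_congr rfl fun i _ => ?_
      rw [ZMod.natCast_zmod_val, ZMod.natCast_zmod_val, mul_comm]
    rw [this, sg_natCast]
  · exact congrArg _ (funext fun i => hy _)

end Tensor
end
end CyclicAdams

namespace CyclicAdams
open scoped Fin.NatCast Fin.CommRing
noncomputable section

/-! ### Eigenspaces of the cyclic action: projectors, comparison, functoriality and homotopies. -/

section Rotation

variable {R : Type u} [CommRing R] {X Y Z : Cx R}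

lemma finRotate_pow_apply (n k : ℕ) (i : Fin (n + 1)) :
    (finRotate (n + 1) ^ k) i = i + (k : Fin (n + 1)) := by
  induction k with
  | zero => simp
  | succ k ih =>
    rw [pow_succ', Equiv.Perm.mul_apply, ih, finRotate_apply, Nat.cast_succ, add_assoc]

lemma rot_pow_self {p : ℕ} (hp : p ≠ 0) (X : Cx R) : rot p X ^ p = 1 := by
  obtain ⟨n, rfl⟩ := Nat.exists_eq_succ_of_ne_zero hp
  rw [Nat.succ_eq_add_one, rot_eq_permOp, ← permOp_pow, ← permOp_one]
  congr 1
  ext i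
  rw [finRotate_pow_apply]
  simp

lemma rot_mem_tDeg {p : ℕ} (hp : p ≠ 0) (X : Cx R) (k : ZMod 2) :
    ∀ t ∈ tDeg p X k, rot p X t ∈ tDeg p X k := by
  obtain ⟨n, rfl⟩ := Nat.exists_eq_succ_of_ne_zero hp
  rw [Nat.succ_eq_add_one, rot_eq_permOp]
  exact permOp_mem _ _ _ _

lemma rot_tOdd {p : ℕ} (hp : p ≠ 0) {d : Module.End R (Tot X)} (hd : HasDeg 1 d) (t : TPow p X) :
    rot p X (tOdd p d t) = tOdd p d (rot p X t) := by
  obtain ⟨n, rfl⟩ : ∃ n, p = n + 1 := Nat.exists_eq_succ_of_ne_zero hp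
  rw [rot_eq_permOp]
  exact LinearMap.congr_fun (permOp_tOdd hd _) t

lemma mem_eigenDeg {p : ℕ} {l : R} {k : ZMod 2} {t : TPow p X} :
    t ∈ eigenDeg p X l k ↔ t ∈ tDeg p X k ∧ rot p X t = l • t := by
  rw [eigenDeg, Submodule.mem_inf, Module.End.mem_eigenspace_iff]

/-- The projection onto an eigenspace of the cyclic action. -/
def eproj (p : ℕ) (X : Cx R) (u l : R) : Module.End R (TPow p X) :=
  u • ∑ i ∈ Finset.range p, (l ^ (p - 1)) ^ i • rot p X ^ i

variable {p : ℕ} {u l : R}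

/-- When `l ^ p = 1`, the power `l ^ (p - 1)` is the inverse of `l`, so `eproj` is a multiple of ∑
l⁻ⁱ σⁱ. Applying σ shifts the index by one, which costs a factor `l`, and the sum closes up because
the terms for `0` and `p` agree. -/
lemma rot_eproj (hp : p ≠ 0) (hl : l ^ p = 1) (t : TPow p X) :
    rot p X (eproj p X u l t) = l • eproj p X u l t := by
  have hlm : l * l ^ (p - 1) = 1 := by rw [mul_pow_sub_one hp, hl]
  have key : rot p X * ∑ i ∈ Finset.range p, (l ^ (p - 1)) ^ i • rot p X ^ i =
      l • ∑ i ∈ Finset.range p, (l ^ (p - 1)) ^ i • rot p X ^ i := by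
    have h1 : rot p X * ∑ i ∈ Finset.range p, (l ^ (p - 1)) ^ i • rot p X ^ i =
        l • ∑ i ∈ Finset.range p, (l ^ (p - 1)) ^ (i + 1) • rot p X ^ (i + 1) := by
      rw [Finset.mul_sum, Finset.smul_sum]
      refine Finset.sum_congr rfl fun i _ => ?_
      rw [mul_smul_comm, ← pow_succ', smul_smul]
      congr 1
      rw [pow_succ', ← mul_assoc, hlm, one_mul]
    rw [h1]
    congr 1
    have h2 := Finset.sum_range_succ' (fun i => (l ^ (p - 1)) ^ i • rot p X ^ i) p
    rw [Finset.sum_range_succ] at h2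
    rw [rot_pow_self hp, ← pow_mul, mul_comm (p - 1), pow_mul, hl, one_pow, pow_zero, pow_zero] at h2
    refine LinearMap.ext fun t => ?_
    have h3 := LinearMap.congr_fun h2 t
    rw [LinearMap.add_apply, LinearMap.add_apply] at h3
    exact (add_right_cancel h3).symm
  rw [eproj, LinearMap.smul_apply, map_smul, ← Module.End.mul_apply, key, LinearMap.smul_apply,
    smul_comm]

lemma eproj_of_eigen (hp : p ≠ 0) (hu : u * p = 1) (hl : l ^ p = 1) {t : TPow p X}
    (ht : rot p X t = l • t) : eproj p X u l t = t := by
  have hlm : l ^ (p - 1) * l = 1 := by rw [mul_comm, mul_pow_sub_one hp, hl]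
  have h : ∀ i : ℕ, (rot p X ^ i) t = l ^ i • t := by
    intro i
    induction i with
    | zero => simp
    | succ i ih => rw [pow_succ', Module.End.mul_apply, ih, map_smul, ht, smul_smul, ← pow_succ]
  rw [eproj, LinearMap.smul_apply, LinearMap.sum_apply]
  simp only [LinearMap.smul_apply, h, smul_smul, ← mul_pow, hlm, one_pow, one_smul,
    Finset.sum_const, Finset.card_range, ← Nat.cast_smul_eq_nsmul R, hu]

lemma eproj_comm {φ : TPow p X →ₗ[R] TPow p Y} (h : ∀ t, φ (rot p X t) = rot p Y (φ t))
    (t : TPow p X) : φ (eproj p X u l t) = eproj p Y u l (φ t) := by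
  have h' : ∀ (i : ℕ) t, φ ((rot p X ^ i) t) = (rot p Y ^ i) (φ t) := by
    intro i
    induction i with
    | zero => simp
    | succ i ih => intro t; rw [pow_succ', pow_succ', Module.End.mul_apply, h, ih]; rfl
  simp only [eproj, LinearMap.smul_apply, LinearMap.sum_apply, map_smul, map_sum, h']

lemma eproj_mem_tDeg (hp : p ≠ 0) {k : ZMod 2} {t : TPow p X} (ht : t ∈ tDeg p X k) :
    eproj p X u l t ∈ tDeg p X k := by
  have h' : ∀ i : ℕ, (rot p X ^ i) t ∈ tDeg p X k := by
    intro i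
    induction i with
    | zero => simpa
    | succ i ih => rw [pow_succ']; exact rot_mem_tDeg hp X k _ ih
  rw [eproj, LinearMap.smul_apply, LinearMap.sum_apply]
  exact Submodule.smul_mem _ _ (Submodule.sum_mem _ fun i _ => Submodule.smul_mem _ _ (h' i))

lemma eproj_mem (hp : p ≠ 0) (hl : l ^ p = 1) {k : ZMod 2} {t : TPow p X} (ht : t ∈ tDeg p X k) :
    eproj p X u l t ∈ eigenDeg p X l k :=
  mem_eigenDeg.2 ⟨eproj_mem_tDeg hp ht, rot_eproj hp hl t⟩

/-! ### The eigenspaces of the nontrivial roots of unity are isomorphic -/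

/-- Multiplication by a unit of `ℤ/(n+1)`, as a permutation. -/
def mulPerm (n : ℕ) (a : (ZMod (n + 1))ˣ) : Equiv.Perm (Fin (n + 1)) where
  -- `Fin (n + 1)` and `ZMod (n + 1)` are the same type by definition, so positions of factors are
  -- read as residues.
  toFun i := (a * (show ZMod (n + 1) from i) : ZMod (n + 1))
  invFun i := ((a⁻¹ : (ZMod (n + 1))ˣ) * (show ZMod (n + 1) from i) : ZMod (n + 1))
  left_inv i := by
    change (a⁻¹ : (ZMod (n + 1))ˣ) * (a * (show ZMod (n + 1) from i)) = i
    exact Units.inv_mul_cancel_left _ _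
  right_inv i := by
    change a * ((a⁻¹ : (ZMod (n + 1))ˣ) * (show ZMod (n + 1) from i)) = i
    exact Units.mul_inv_cancel_left _ _

/-- This is a(i + 1) = ai + a: multiplication by a unit normalises the group of rotations, and
therefore permutes the eigenspaces of the rotation. -/
lemma mulPerm_mul_finRotate (n : ℕ) (a : (ZMod (n + 1))ˣ) : mulPerm n a * finRotate (n + 1) =
    finRotate (n + 1) ^ (a : ZMod (n + 1)).val * mulPerm n a := by
  refine Equiv.ext fun i => ?_
  rw [Equiv.Perm.mul_apply, Equiv.Perm.mul_apply, finRotate_pow_apply, finRotate_apply]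
  have h : (((a : ZMod (n + 1)).val : ℕ) : Fin (n + 1)) = (a : ZMod (n + 1)) :=
    ZMod.natCast_zmod_val (n := n + 1) (a : ZMod (n + 1))
  rw [h]
  change (a : ZMod (n + 1)) * ((show ZMod (n + 1) from i) + 1) =
    a * (show ZMod (n + 1) from i) + a
  ring

/-- Conjugation turns σ into σ^A, so the permuted vector is an eigenvector of σ^A with eigenvalue
`l`. Raising σ^A to the power `B`, with AB ≡ 1 modulo the order of σ, recovers σ and turns the
eigenvalue into `l ^ B`. -/
lemma permOp_mulPerm_mem {n : ℕ} {l : R} (a : (ZMod (n + 1))ˣ) (k : ZMod 2) :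
    ∀ t ∈ eigenDeg (n + 1) X l k, permOp (n + 1) X (mulPerm n a) t ∈
      eigenDeg (n + 1) X (l ^ ((a⁻¹ : (ZMod (n + 1))ˣ) : ZMod (n + 1)).val) k := by
  intro t ht
  rw [mem_eigenDeg] at ht ⊢
  refine ⟨permOp_mem _ _ _ _ _ ht.1, ?_⟩
  set A := (a : ZMod (n + 1)).val
  set B := ((a⁻¹ : (ZMod (n + 1))ˣ) : ZMod (n + 1)).val
  set v := permOp (n + 1) X (mulPerm n a) t with hv
  have h1 : (rot (n + 1) X ^ A) v = l • v := by
    rw [hv, ← map_smul, ← ht.2, rot_eq_permOp, ← permOp_pow, ← Module.End.mul_apply,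
      ← Module.End.mul_apply, ← permOp_mul, ← permOp_mul, mulPerm_mul_finRotate]
  have h2 : ∀ m : ℕ, ((rot (n + 1) X ^ A) ^ m) v = l ^ m • v := by
    intro m
    induction m with
    | zero => simp
    | succ m ih => rw [pow_succ', Module.End.mul_apply, ih, map_smul, h1, smul_smul, ← pow_succ]
  have h3 : A * B ≡ 1 [MOD (n + 1)] := by
    rw [← ZMod.natCast_eq_natCast_iff]
    push_cast
    rw [ZMod.natCast_zmod_val, ZMod.natCast_zmod_val, Units.mul_inv]
  have h4 : (rot (n + 1) X ^ A) ^ B = rot (n + 1) X := by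
    rw [← pow_mul, pow_eq_pow_mod _ (rot_pow_self n.succ_ne_zero X), h3,
      ← pow_eq_pow_mod _ (rot_pow_self n.succ_ne_zero X), pow_one]
  rw [← h2, h4]

/-- The eigenspaces for `l` and `l ^ b`, with `b` prime to `p`, are isomorphic. -/
lemma eigen_iso_pow {n : ℕ} {l : R} (hl : l ^ (n + 1) = 1) (b : (ZMod (n + 1))ˣ) :
    Nonempty (eigen (n + 1) X l ≅ eigen (n + 1) X (l ^ (b : ZMod (n + 1)).val)) := by
  have hinv : ∀ (a b : (ZMod (n + 1))ˣ) (t : TPow (n + 1) X), a * b = 1 →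
      permOp (n + 1) X (mulPerm n a) (permOp (n + 1) X (mulPerm n b) t) = t := by
    intro a b t hab
    rw [← Module.End.mul_apply, ← permOp_mul]
    have : mulPerm n a * mulPerm n b = 1 := by
      refine Equiv.ext fun i => ?_
      change (a : ZMod (n + 1)) * (b * (show ZMod (n + 1) from i)) = i
      rw [← mul_assoc, ← Units.val_mul, hab, Units.val_one, one_mul]
    rw [this, permOp_one]
    rfl
  have e : (l ^ (b : ZMod (n + 1)).val) ^ ((b⁻¹ : (ZMod (n + 1))ˣ) : ZMod (n + 1)).val = l := by
    have h3 : (b : ZMod (n + 1)).val * ((b⁻¹ : (ZMod (n + 1))ˣ) : ZMod (n + 1)).val ≡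
        1 [MOD (n + 1)] := by
      rw [← ZMod.natCast_eq_natCast_iff]
      push_cast
      rw [ZMod.natCast_zmod_val, ZMod.natCast_zmod_val, Units.mul_inv]
    rw [← pow_mul, pow_eq_pow_mod _ hl, h3, ← pow_eq_pow_mod _ hl, pow_one]
  refine ⟨gradedIso (hS := fun _ => tDiff_mem_eigenDeg (n + 1) X l rfl)
    (hD := fun _ t _ => LinearMap.congr_fun (tDiff_sq (n + 1) X) t)
    (hS' := fun _ => tDiff_mem_eigenDeg (n + 1) X (l ^ (b : ZMod (n + 1)).val) rfl)
    (hD' := fun _ t _ => LinearMap.congr_fun (tDiff_sq (n + 1) X) t)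
    (permOp (n + 1) X (mulPerm n b⁻¹)) (permOp (n + 1) X (mulPerm n b))
    ?_ ?_ ?_ ?_ ?_⟩
  -- The permutation given by a unit raises the eigenvalue to the inverse of that unit, hence the
  -- map towards `l ^ b` uses `b⁻¹`.
  · intro k t ht
    have := permOp_mulPerm_mem (l := l) b⁻¹ k t ht
    rwa [inv_inv] at this
  · intro k t ht
    have := permOp_mulPerm_mem (l := l ^ (b : ZMod (n + 1)).val) b k t ht
    rwa [e] at this
  · exact fun k t _ => LinearMap.congr_fun (permOp_tDiff (n + 1) X _) t
  · exact fun k t _ => hinv _ _ t (mul_inv_cancel b)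
  · exact fun k t _ => hinv _ _ t (inv_mul_cancel b)

/-! ### Functoriality -/

lemma map_rot (hp : p ≠ 0) {f : Tot X →ₗ[R] Tot Y} (hf : HasDeg 0 f) (t : TPow p X) :
    PiTensorProduct.map (fun _ => f) (rot p X t) = rot p Y (PiTensorProduct.map (fun _ => f) t) := by
  obtain ⟨n, rfl⟩ : ∃ n, p = n + 1 := Nat.exists_eq_succ_of_ne_zero hp
  rw [rot_eq_permOp, rot_eq_permOp]
  refine LinearMap.congr_fun (f := PiTensorProduct.map (fun _ => f) ∘ₗ permOp (n + 1) X _)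
    (g := permOp (n + 1) Y _ ∘ₗ PiTensorProduct.map (fun _ => f)) (tensor_ext fun ε y hy => ?_) t
  rw [LinearMap.comp_apply, LinearMap.comp_apply, hy.permOp, map_smul, PiTensorProduct.map_tprod,
    PiTensorProduct.map_tprod]
  have : Homog ε fun i => f (y i) := fun i => hf.proj_eq (hy i) (add_zero _)
  rw [this.permOp]

lemma map_tOdd {f : Tot X →ₗ[R] Tot Y} (hf : HasDeg 0 f) {d : Module.End R (Tot X)}
    {d' : Module.End R (Tot Y)} (hd : ∀ v, f (d v) = d' (f v)) (t : TPow p X) :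
    PiTensorProduct.map (fun _ => f) (tOdd p d t) =
      tOdd p d' (PiTensorProduct.map (fun _ => f) t) := by
  refine LinearMap.congr_fun (f := PiTensorProduct.map (fun _ => f) ∘ₗ tOdd p d)
    (g := tOdd p d' ∘ₗ PiTensorProduct.map (fun _ => f)) (PiTensorProduct.ext ?_) t
  refine MultilinearMap.ext fun y => ?_
  simp only [LinearMap.compMultilinearMap_apply, LinearMap.comp_apply, tOdd, LinearMap.sum_apply,
    map_sum, tOddAt, PiTensorProduct.map_tprod]
  refine Finset.sum_congr rfl fun i _ => congrArg _ (funext fun j => ?_)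
  split_ifs
  · rw [hf.parity_apply, sg_zero, one_smul]
  · rw [hd]
  · rfl

lemma map_tDiff {f : Tot X →ₗ[R] Tot Y} (hf : HasDeg 0 f) (hd : ∀ v, f (diff X v) = diff Y (f v))
    (t : TPow p X) : PiTensorProduct.map (fun _ => f) (tDiff p X t) =
      tDiff p Y (PiTensorProduct.map (fun _ => f) t) := map_tOdd hf hd t

lemma map_mem_eigenDeg (hp : p ≠ 0) {f : Tot X →ₗ[R] Tot Y} (hf : HasDeg 0 f) (k : ZMod 2) :
    ∀ t ∈ eigenDeg p X l k, PiTensorProduct.map (fun _ => f) t ∈ eigenDeg p Y l k := by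
  intro t ht
  rw [mem_eigenDeg] at ht ⊢
  refine ⟨map_mem_tDeg _ (fun _ => 0) (fun _ => hf) (by simp) _ ht.1, ?_⟩
  rw [← map_rot hp hf, ht.2, map_smul]

/-- The map of total modules induced by a chain map. -/
def totMap (f : X ⟶ Y) : Tot X →ₗ[R] Tot Y :=
  LinearMap.pi fun i => (f.f i).hom ∘ₗ LinearMap.proj i

lemma totMap_single (f : X ⟶ Y) (i : ZMod 2) (x : X.X i) :
    totMap f (Pi.single i x) = Pi.single i ((f.f i).hom x) := by
  funext j
  change (f.f j).hom ((Pi.single i x : Tot X) j) = _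
  by_cases h : j = i
  · subst h; simp
  · rw [Pi.single_eq_of_ne h, Pi.single_eq_of_ne h, map_zero]

lemma tot_ext {N : Type*} [AddCommGroup N] [Module R N] {f g : Tot X →ₗ[R] N}
    (h : ∀ i (x : X.X i), f (Pi.single i x) = g (Pi.single i x)) : f = g :=
  LinearMap.pi_ext h

lemma hasDeg_iff {b : ZMod 2} {f : Tot X →ₗ[R] Tot Y} :
    HasDeg b f ↔ ∀ i (x : X.X i), proj Y (i + b) (f (Pi.single i x)) = f (Pi.single i x) := by
  constructor
  · intro h i x
    exact h.proj_eq (proj_single_self X i x) rfl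
  · intro h a
    refine LinearMap.congr_fun (f := f ∘ₗ proj X a) (g := proj Y (a + b) ∘ₗ f) (tot_ext fun i x => ?_)
    rw [LinearMap.comp_apply, LinearMap.comp_apply]
    by_cases hi : i = a
    · subst hi; rw [proj_single_self, h]
    · rw [proj_single_ne X hi, map_zero, ← h i x,
        proj_proj_ne Y (fun e => hi (add_right_cancel e).symm)]

lemma hasDeg_totMap (f : X ⟶ Y) : HasDeg 0 (totMap f) := hasDeg_iff.2 fun i x => by
  rw [totMap_single, add_zero, proj_single_self]

lemma totMap_diff (f : X ⟶ Y) (v : Tot X) : totMap f (diff X v) = diff Y (totMap f v) := by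
  refine LinearMap.congr_fun (f := totMap f ∘ₗ diff X) (g := diff Y ∘ₗ totMap f)
    (tot_ext fun i x => ?_) v
  rw [LinearMap.comp_apply, LinearMap.comp_apply, diff_single, totMap_single, totMap_single,
    diff_single, hom_comm_apply]

/-- The map of total modules of degree one induced by a family of maps. -/
def oddMap (h : ∀ i j, X.X i →ₗ[R] Y.X j) : Tot X →ₗ[R] Tot Y :=
  LinearMap.pi fun i => h (i - 1) i ∘ₗ LinearMap.proj (i - 1)

lemma oddMap_single (h : ∀ i j, X.X i →ₗ[R] Y.X j) (i : ZMod 2) (x : X.X i) :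
    oddMap h (Pi.single i x) = Pi.single (i + 1) (h i (i + 1) x) := by
  funext j
  by_cases hj : j = i + 1
  · subst hj
    have e : i + 1 - 1 = i := by ring
    rw [Pi.single_eq_same]
    change h (i + 1 - 1) (i + 1) ((Pi.single i x : Tot X) (i + 1 - 1)) = _
    rw [e, Pi.single_eq_same]
  · rw [Pi.single_eq_of_ne hj]
    change h (j - 1) j ((Pi.single i x : Tot X) (j - 1)) = _
    rw [Pi.single_eq_of_ne (fun e => hj (by rw [← e]; ring)), map_zero]

lemma hasDeg_oddMap (h : ∀ i j, X.X i →ₗ[R] Y.X j) : HasDeg 1 (oddMap h) :=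
  hasDeg_iff.2 fun i x => by rw [oddMap_single, proj_single_self]

lemma single_add_one_add_one (i : ZMod 2) (h : ∀ j, Y.X j) :
    (Pi.single (i + 1 + 1) (h (i + 1 + 1)) : Tot Y) = Pi.single i (h i) := by
  rw [add_one_add_one]

lemma oddMap_homotopy {f g : X ⟶ Y} {h : ∀ i j, X.X i →ₗ[R] Y.X j}
    (hh : ∀ i x, (f.f i).hom x = h (i + 1) i ((X.d i (i + 1)).hom x) +
      (Y.d (i + 1) i).hom (h i (i + 1) x) + (g.f i).hom x) (v : Tot X) :
    totMap f v = oddMap h (diff X v) + diff Y (oddMap h v) + totMap g v := by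
  refine LinearMap.congr_fun (f := totMap f)
    (g := oddMap h ∘ₗ diff X + diff Y ∘ₗ oddMap h + totMap g) (tot_ext fun i x => ?_) v
  simp only [LinearMap.add_apply, LinearMap.comp_apply, diff_single, oddMap_single, totMap_single]
  rw [single_add_one_add_one i fun j => h (i + 1) j ((X.d i (i + 1)).hom x),
    single_add_one_add_one i fun j => (Y.d (i + 1) j).hom (h i (i + 1) x), hh, Pi.single_add,
    Pi.single_add]

/-! ### Homotopies -/

/-- The `i`-th summand of the homotopy between `a ^ p` and the tensor power of `w`. -/
def tHtpyAt (p : ℕ) (w h : Module.End R (Tot X)) (a : R) (i : Fin p) : Module.End R (TPow p X) :=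
  PiTensorProduct.map fun j => if j < i then parity X * w else if j = i then h else a • 1

/-- A homotopy between `a ^ p` and the tensor power of `w`. -/
def tHtpy (p : ℕ) (w h : Module.End R (Tot X)) (a : R) : Module.End R (TPow p X) :=
  ∑ i, tHtpyAt p w h a i

lemma HasDeg.parity_comm {f : Module.End R (Tot X)} (hf : HasDeg 0 f) :
    f * parity X = parity X * f := LinearMap.ext fun v => by
  have := hf.parity_apply v
  rwa [sg_zero, one_smul] at this

lemma HasDeg.parity_anticomm {f : Module.End R (Tot X)} (hf : HasDeg 1 f) :
    f * parity X = - (parity X * f) := LinearMap.ext fun v => by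
  have := hf.parity_apply v
  simpa using this

variable {d w h : Module.End R (Tot X)} {a : R}

/-- In distinct slots the parity operators produce the sign -1, while in the remaining slots `d`
commutes with `w` and with scalars. So in the commutator of the differential with the homotopy only
the terms with equal slots survive. -/
lemma tHtpyAt_anticomm (hd : HasDeg 1 d) (hw : HasDeg 0 w) (hh : HasDeg 1 h) (hwd : d * w = w * d)
    {i k : Fin p} (hik : i ≠ k) :
    tOddAt p d k * tHtpyAt p w h a i + tHtpyAt p w h a i * tOddAt p d k = 0 := by
  rw [tOddAt, tHtpyAt, ← PiTensorProduct.map_mul, ← PiTensorProduct.map_mul]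
  have hpp := parity_mul_parity X
  rcases lt_or_gt_of_ne hik with hlt | hlt
  · refine map_add_map_at _ _ i ?_ fun j hj => ?_
    · simp [hlt, hh.parity_anticomm]
    · rcases lt_trichotomy j i with h1 | h1 | h1
      · simp only [h1, h1.trans hlt, if_true]
        rw [mul_assoc (parity X) w, hw.parity_comm]
      · exact absurd h1 hj
      · simp only [h1.not_gt, hj, if_false]
        split_ifs <;> simp
  · refine map_add_map_at _ _ k ?_ fun j hj => ?_
    · simp only [hlt, lt_irrefl, if_true, if_false]
      refine LinearMap.ext fun v => ?_
      have e1 := LinearMap.congr_fun hd.parity_anticomm (w v)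
      have e2 := LinearMap.congr_fun hwd v
      simp only [Module.End.mul_apply, LinearMap.neg_apply] at e1 e2
      simp [e1, e2]
    · rcases lt_trichotomy j k with h1 | h1 | h1
      · simp only [h1, h1.trans hlt, if_true]
        rw [mul_assoc (parity X) w, hw.parity_comm]
      · exact absurd h1 hj
      · simp only [h1.not_gt, hj, if_false]
        simp

/-- The parity operators to the left of slot `i` cancel, and in slot `i` one gets `d * h + h * d`,
which is `a - w`. The result is the difference of two mixed tensor products that have `w` in the
leading `i`, respectively `i + 1`, slots. -/
lemma tHtpyAt_comm (hw : HasDeg 0 w)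
    (hdh : d * h + h * d = a • 1 - w) (i : Fin p) :
    tOddAt p d i * tHtpyAt p w h a i + tHtpyAt p w h a i * tOddAt p d i +
      PiTensorProduct.map (fun j : Fin p => if (j : ℕ) < i + 1 then w else a • 1) =
        PiTensorProduct.map (fun j : Fin p => if (j : ℕ) < i then w else a • 1) := by
  have hpp := parity_mul_parity X
  set F : Fin p → Module.End R (Tot X) := fun j => if (j : ℕ) < i then w else a • 1 with hF
  have e1 : tOddAt p d i * tHtpyAt p w h a i =
      PiTensorProduct.map (Function.update F i (d * h)) := by
    rw [tOddAt, tHtpyAt, ← PiTensorProduct.map_mul]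
    congr 1
    funext j
    rcases lt_trichotomy j i with h1 | h1 | h1
    · simp only [h1, if_true, Function.update_of_ne h1.ne, hF, Fin.lt_def.1 h1]
      rw [← mul_assoc, hpp, one_mul]
    · subst h1; simp
    · simp [h1.not_gt, h1.ne', hF]
  have e2 : tHtpyAt p w h a i * tOddAt p d i =
      PiTensorProduct.map (Function.update F i (h * d)) := by
    rw [tOddAt, tHtpyAt, ← PiTensorProduct.map_mul]
    congr 1
    funext j
    rcases lt_trichotomy j i with h1 | h1 | h1
    · simp only [h1, if_true, Function.update_of_ne h1.ne, hF, Fin.lt_def.1 h1]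
      rw [mul_assoc, hw.parity_comm, ← mul_assoc, hpp, one_mul]
    · subst h1; simp
    · simp [h1.not_gt, h1.ne', hF]
  have e3 : PiTensorProduct.map F = PiTensorProduct.map (Function.update F i (a • 1)) := by
    congr 1
    rw [eq_comm, Function.update_eq_iff]
    exact ⟨by simp [hF], fun _ _ => rfl⟩
  have e4 : PiTensorProduct.map (fun j : Fin p => if (j : ℕ) < i + 1 then w else a • 1) =
      PiTensorProduct.map (Function.update F i w) := by
    congr 1
    funext j
    by_cases hj : j = i
    · subst hj; simp
    · have : (j : ℕ) ≠ i := fun e => hj (Fin.ext e)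
      rw [Function.update_of_ne hj, hF]
      simp only
      congr 1
      rw [eq_iff_iff]
      omega
  have e5 : a • 1 - w + w = a • 1 := LinearMap.ext fun v => by simp
  rw [e1, e2, ← PiTensorProduct.map_update_add, hdh, e3, e4, ← PiTensorProduct.map_update_add, e5]

/-- The diagonal terms telescope from `a` in all slots to `w` in all slots. The case `w = 0`
produces null homotopic scalars, and the case `a = 1` shows that maps homotopic to the identity stay
so after taking tensor powers. -/
lemma tOdd_tHtpy (hd : HasDeg 1 d) (hw : HasDeg 0 w) (hh : HasDeg 1 h) (hwd : d * w = w * d)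
    (hdh : d * h + h * d = a • 1 - w) :
    tOdd p d * tHtpy p w h a + tHtpy p w h a * tOdd p d =
      a ^ p • 1 - PiTensorProduct.map fun _ => w := by
  have e1 : tOdd p d * tHtpy p w h a + tHtpy p w h a * tOdd p d =
      ∑ i, (tOddAt p d i * tHtpyAt p w h a i + tHtpyAt p w h a i * tOddAt p d i) := by
    rw [tOdd, tHtpy, Finset.sum_mul_sum, Finset.sum_mul_sum, Finset.sum_comm (s := Finset.univ)
      (f := fun i j => tHtpyAt p w h a i * tOddAt p d j), ← Finset.sum_add_distrib]
    refine Finset.sum_congr rfl fun i _ => ?_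
    rw [← Finset.sum_add_distrib]
    exact Finset.sum_eq_single i (fun j _ hj => tHtpyAt_anticomm hd hw hh hwd hj) (by simp)
  have e2 : (PiTensorProduct.map fun _ : Fin p => (a • 1 : Module.End R (Tot X))) = a ^ p • 1 := by
    refine PiTensorProduct.ext (MultilinearMap.ext fun y => ?_)
    have := MultilinearMap.map_smul_univ (PiTensorProduct.tprod R) (fun _ : Fin p => a) y
    simpa using this
  rw [e1]
  refine LinearMap.ext fun t => ?_
  set G : ℕ → TPow p X := fun i =>
    PiTensorProduct.map (fun j : Fin p => if (j : ℕ) < i then w else a • 1) t with hG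
  have e3 : ∀ i : Fin p, (tOddAt p d i * tHtpyAt p w h a i + tHtpyAt p w h a i * tOddAt p d i) t =
      G i - G (i + 1) := fun i =>
    eq_sub_of_add_eq (LinearMap.congr_fun (tHtpyAt_comm hw hdh i) t)
  have e4 : G 0 = a ^ p • t := by
    have := LinearMap.congr_fun e2 t
    simpa [hG] using this
  have e5 : G p = PiTensorProduct.map (fun _ => w) t := by
    simp [hG]
  rw [LinearMap.sum_apply, Finset.sum_congr rfl fun i _ => e3 i,
    Fin.sum_univ_eq_sum_range (fun i => G i - G (i + 1)) p]
  exact (Finset.sum_range_sub' G p).trans (by rw [e4, e5]; rfl)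

lemma tHtpy_mem (hw : HasDeg 0 w) (hh : HasDeg 1 h) (k : ZMod 2) :
    ∀ t ∈ tDeg p X k, tHtpy p w h a t ∈ tDeg p X (k + 1) := by
  intro t ht
  rw [tHtpy, LinearMap.sum_apply]
  refine Submodule.sum_mem _ fun i _ => ?_
  refine map_mem_tDeg _ (fun j => if j = i then 1 else 0) (fun j => ?_) (by simp) t ht
  rcases lt_trichotomy j i with h1 | h1 | h1
  · simp only [h1, h1.ne, if_true, if_false]
    have := (hasDeg_parity X).mul hw
    exact this
  · simpa [h1] using hh
  · simp only [h1.not_gt, h1.ne', if_false]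
    exact hasDeg_one.smul a

/-- The homotopy on an eigenspace. -/
lemma exists_eigen_homotopy (hp : p ≠ 0) (hu : u * p = 1) (hl : l ^ p = 1) (hd : HasDeg 1 d) (hw : HasDeg 0 w)
    (hh : HasDeg 1 h) (hwd : d * w = w * d)
    (hdh : d * h + h * d = a • 1 - w) :
    ∃ H : Module.End R (TPow p X), (∀ k, ∀ t ∈ eigenDeg p X l k, H t ∈ eigenDeg p X l (k + 1)) ∧
      ∀ k, ∀ t ∈ eigenDeg p X l k, a ^ p • t =
        H (tOdd p d t) + tOdd p d (H t) + PiTensorProduct.map (fun _ => w) t := by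
  -- The telescoping homotopy depends on the order of the factors and need not commute with σ.
  -- Composing with the projector repairs this: the projector commutes with the differential and
  -- fixes both `a ^ p • t` and the image of `t` under the power of `w`.
  refine ⟨eproj p X u l * tHtpy p w h a, fun k t ht => ?_, fun k t ht => ?_⟩
  · exact eproj_mem hp hl (tHtpy_mem hw hh k t (mem_eigenDeg.1 ht).1)
  · have h1 := LinearMap.congr_fun (tOdd_tHtpy (p := p) hd hw hh hwd hdh) t
    have h2 := congrArg (eproj p X u l) h1
    simp only [LinearMap.add_apply, LinearMap.sub_apply, LinearMap.smul_apply, Module.End.one_apply,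
      Module.End.mul_apply, map_add, map_sub, map_smul] at h2
    rw [eproj_of_eigen hp hu hl (mem_eigenDeg.1 ht).2,
      eproj_of_eigen hp hu hl (mem_eigenDeg.1 (map_mem_eigenDeg hp hw k t ht)).2,
      ← eproj_comm (φ := tOdd p d)
        (fun t => (rot_tOdd hp hd t).symm)] at h2
    rw [Module.End.mul_apply, Module.End.mul_apply, add_comm (eproj p X u l _), h2, sub_add_cancel]

lemma Null.exists_oddMap {r : R} (h : Null r X) : ∃ s : Module.End R (Tot X), HasDeg 1 s ∧
    diff X * s + s * diff X = r • 1 := by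
  obtain ⟨s, hs⟩ := h
  refine ⟨oddMap s, hasDeg_oddMap s, LinearMap.ext fun v => ?_⟩
  have := oddMap_homotopy (f := r • 𝟙 X) (g := 0) (h := s)
    (fun i x => ((hs i x).symm.trans (add_zero _).symm)) v
  have e1 : totMap (r • 𝟙 X) v = r • v := rfl
  have e2 : totMap (0 : X ⟶ X) v = 0 := rfl
  rw [e1, e2, add_zero] at this
  rw [LinearMap.add_apply, add_comm]
  exact this.symm

/-- The telescoping homotopy for `w = 0` and `a = r`: a homotopy for `r` on one factor gives one for
`r ^ p` on the eigenspace. -/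
lemma Null.eigen (hp : p ≠ 0) (hu : u * p = 1) (hl : l ^ p = 1) {r : R} (hr : Null r X) :
    Null (r ^ p) (eigen p X l) := by
  obtain ⟨s, hs, hds⟩ := hr.exists_oddMap
  obtain ⟨H, hH, hc⟩ := exists_eigen_homotopy (w := 0) (l := l) hp hu hl (hasDeg_diff X) (fun a v => by simp) hs
    (by simp) (by rw [hds, sub_zero])
  simp only [← tDiff_eq_tOdd] at hc
  refine Null.of_graded (hS := fun _ => tDiff_mem_eigenDeg p X l rfl)
    (hD := fun _ t _ => LinearMap.congr_fun (tDiff_sq p X) t)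
    H hH fun k t ht => ?_
  have h0 : PiTensorProduct.map (fun _ : Fin p => (0 : Module.End R (Tot X))) = 0 :=
    map_eq_zero_at _ ⟨0, Nat.pos_of_ne_zero hp⟩ rfl
  rw [hc k t ht, h0, LinearMap.zero_apply, add_zero]

/-- Eigenspaces of tensor powers preserve chain maps. -/
def eigenMap (hp : p ≠ 0) (l : R) (f : X ⟶ Y) : eigen p X l ⟶ eigen p Y l :=
  gradedHom (hS := fun _ => tDiff_mem_eigenDeg p X l rfl)
    (hD := fun _ t _ => LinearMap.congr_fun (tDiff_sq p X) t)
    (hS' := fun _ => tDiff_mem_eigenDeg p Y l rfl)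
    (hD' := fun _ t _ => LinearMap.congr_fun (tDiff_sq p Y) t)
    (PiTensorProduct.map fun _ => totMap f) (map_mem_eigenDeg hp (hasDeg_totMap f))
    fun _ t _ => map_tDiff (hasDeg_totMap f) (totMap_diff f) t

lemma map_totMap_comp (f : X ⟶ Y) (g : Y ⟶ Z) :
    (PiTensorProduct.map fun _ : Fin p => totMap (f ≫ g)) =
      (PiTensorProduct.map fun _ => totMap g) ∘ₗ PiTensorProduct.map fun _ => totMap f :=
  PiTensorProduct.map_comp (fun _ : Fin p => totMap g) fun _ => totMap f

lemma eigenMap_comp (hp : p ≠ 0) (f : X ⟶ Y) (g : Y ⟶ Z) :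
    eigenMap hp l f ≫ eigenMap hp l g = eigenMap hp l (f ≫ g) := by
  ext k x
  exact Subtype.ext (LinearMap.congr_fun (map_totMap_comp f g) _).symm

/-- Since `eigenMap` respects composition, preserving homotopies to the identity is enough to
preserve homotopy equivalences. The formula is the telescoping one with `a = 1`; it only applies to
an endomorphism compared with a scalar, which explains the restriction to the identity. -/
lemma eigenMap_homotopy_id (hp : p ≠ 0) (hu : u * p = 1) (hl : l ^ p = 1) {f : X ⟶ X}
    (h : Homotopy f (𝟙 X)) : Nonempty (Homotopy (eigenMap hp l f) (𝟙 (eigen p X l))) := by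
  obtain ⟨s, hs⟩ := Homotopy.exists_family h
  have key := oddMap_homotopy hs
  obtain ⟨H, hH, hc⟩ := exists_eigen_homotopy (w := totMap f) (h := - oddMap s) (a := 1) (l := l)
    hp hu hl (hasDeg_diff X) (hasDeg_totMap f) (by
      have := (hasDeg_oddMap s).smul (-1)
      exact fun a v => by simpa using this a v)
    (LinearMap.ext fun v => (totMap_diff f v).symm) (LinearMap.ext fun v => by
      have e : totMap (𝟙 X) v = v := rfl
      have := key v
      rw [e] at this
      simp only [LinearMap.add_apply, LinearMap.sub_apply, LinearMap.neg_apply,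
        Module.End.one_apply, Module.End.mul_apply, map_neg, one_smul, this]
      abel)
  simp only [← tDiff_eq_tOdd] at hc
  have : eigenMap hp l (𝟙 X) = 𝟙 _ := by
    ext k x
    exact Subtype.ext (LinearMap.congr_fun (PiTensorProduct.map_id (R := R)) _)
  rw [← this]
  refine ⟨gradedHomotopy (hS := fun _ => tDiff_mem_eigenDeg p X l rfl)
    (hD := fun _ t _ => LinearMap.congr_fun (tDiff_sq p X) t)
    (hS' := fun _ => tDiff_mem_eigenDeg p X l rfl)
    (hD' := fun _ t _ => LinearMap.congr_fun (tDiff_sq p X) t)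
    (-H) (fun k t ht => Submodule.neg_mem _ (hH k t ht)) fun k t ht => ?_⟩
  have e : PiTensorProduct.map (fun _ => totMap (𝟙 X)) t = t :=
    LinearMap.congr_fun (PiTensorProduct.map_id (R := R)) t
  have := hc k t ht
  rw [one_pow, one_smul] at this
  rw [e]
  generalize PiTensorProduct.map (fun _ => totMap f) t = z at this ⊢
  simp only [LinearMap.neg_apply, map_neg]
  rw [← neg_add, neg_add_eq_sub, eq_sub_iff_add_eq, add_comm, ← this]

/-- Eigenspaces of tensor powers preserve homotopy equivalences. -/
def eigenHomotopyEquiv (hp : p ≠ 0) (hu : u * p = 1) (hl : l ^ p = 1) (e : HomotopyEquiv X Y) :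
    HomotopyEquiv (eigen p X l) (eigen p Y l) where
  hom := eigenMap hp l e.hom
  inv := eigenMap hp l e.inv
  homotopyHomInvId := by
    rw [eigenMap_comp]
    exact (eigenMap_homotopy_id hp hu hl e.homotopyHomInvId).some
  homotopyInvHomId := by
    rw [eigenMap_comp]
    exact (eigenMap_homotopy_id hp hu hl e.homotopyInvHomId).some

/-! ### Projectivity -/

/-- A retraction of a finite free module onto `V` induces one of its tensor power, which has a basis
of pure tensors. -/
lemma projective_piTensorProduct {ι V : Type*} [Finite ι] [AddCommGroup V] [Module R V]
    [Module.Finite R V] [Module.Projective R V] : Module.Projective R (⨂[R] _ : ι, V) := by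
  obtain ⟨n, f, g, -, -, hfg⟩ := Module.Finite.exists_comp_eq_id_of_projective R V
  have : Module.Free R (⨂[R] _ : ι, (Fin n → R)) :=
    Module.Free.of_basis (Basis.piTensorProduct fun _ => Pi.basisFun R (Fin n))
  refine Module.Projective.of_split (PiTensorProduct.map fun _ => g)
    (PiTensorProduct.map fun _ => f) ?_
  rw [← PiTensorProduct.map_comp]
  simp only [hfg]
  exact PiTensorProduct.map_id

lemma projective_tot (hX : ∀ i, Module.Projective R (X.X i)) : Module.Projective R (Tot X) :=
  Module.Projective.of_equiv (DFinsupp.linearEquivFunOnFintype (R := R) (M := fun i => X.X i))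

lemma finite_tPow (hX : ∀ i, Module.Finite R (X.X i)) : Module.Finite R (TPow p X) :=
  inferInstance

lemma projective_tPow (hX : ∀ i, Module.Finite R (X.X i)) (hX' : ∀ i, Module.Projective R (X.X i)) :
    Module.Projective R (TPow p X) :=
  haveI := projective_tot hX'
  projective_piTensorProduct

lemma finite_of_retract {M : Type*} [AddCommGroup M] [Module R M] [Module.Finite R M]
    {S : Submodule R M} (e : M →ₗ[R] M) (h : ∀ x, e x ∈ S)
    (h' : ∀ x ∈ S, e x = x) : Module.Finite R S :=
  Module.Finite.of_surjective (e.codRestrict S h) fun x => ⟨x.1, Subtype.ext (h' _ x.2)⟩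

lemma projective_of_retract {M : Type*} [AddCommGroup M] [Module R M]
    [Module.Projective R M] {S : Submodule R M} (e : M →ₗ[R] M) (h : ∀ x, e x ∈ S)
    (h' : ∀ x ∈ S, e x = x) : Module.Projective R S :=
  Module.Projective.of_split S.subtype (e.codRestrict S h)
    (LinearMap.ext fun x => Subtype.ext (h' _ x.2))

lemma eproj_tproj_mem (hp : p ≠ 0) (hl : l ^ p = 1) (k : ZMod 2) (t : TPow p X) :
    (eproj p X u l * tproj p X k) t ∈ eigenDeg p X l k :=
  eproj_mem hp hl (tproj_mem p X k t)

lemma eproj_tproj_of_mem (hp : p ≠ 0) (hu : u * p = 1) (hl : l ^ p = 1) {k : ZMod 2}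
    {t : TPow p X} (ht : t ∈ eigenDeg p X l k) : (eproj p X u l * tproj p X k) t = t := by
  rw [mem_eigenDeg] at ht
  rw [Module.End.mul_apply, tproj_of_mem ht.1, eproj_of_eigen hp hu hl ht.2]

end Rotation
end
end CyclicAdams

/-! ### The weight grading of a tensor power attached to a two-step decomposition. -/

namespace CyclicAdams
open scoped Fin.NatCast Fin.CommRing
noncomputable section

/-! ### Filtrations of tensor powers by weight -/

section Weights

variable {R : Type u} [CommRing R] {X Y : Cx R} {p : ℕ}

/-- A decomposition of the total module of `X` into two summands, an odd endomorphism `d0` that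
preserves them and an odd endomorphism `nu` that maps the second summand to the first one. -/
structure Weighted (X : Cx R) where
  e : Bool → Module.End R (Tot X)
  deg : ∀ b, HasDeg 0 (e b)
  idem : ∀ b v, e b (e b v) = e b v
  orth : ∀ b v, e b (e (!b) v) = 0
  sum : ∀ v, e false v + e true v = v
  d0 : Module.End R (Tot X)
  nu : Module.End R (Tot X)
  d0_deg : HasDeg 1 d0
  nu_deg : HasDeg 1 nu
  d0_comm : ∀ b v, d0 (e b v) = e b (d0 v)
  nu_true : ∀ v, e true (nu v) = 0
  nu_false : ∀ v, nu (e false v) = 0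
  d0_sq : ∀ v, d0 (d0 v) = 0
  d0_nu : ∀ v, d0 (nu v) + nu (d0 v) = 0

variable (E : Weighted X)

namespace Weighted

lemma false_nu (v : Tot X) : E.e false (E.nu v) = E.nu v := by
  have := E.sum (E.nu v)
  rwa [E.nu_true, add_zero] at this

lemma nu_nu (v : Tot X) : E.nu (E.nu v) = 0 := by
  rw [← E.false_nu v, E.nu_false]

/-- The vectors `y i` lie in the summands given by `δ i`. -/
def WHomog (δ : Fin p → Bool) (y : Fin p → Tot X) : Prop := ∀ i, E.e (δ i) (y i) = y i

/-- The operator on the tensor power that is multiplication by `m δ` on the summand given by `δ`. -/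
def scal (p : ℕ) (m : (Fin p → Bool) → R) : Module.End R (TPow p X) :=
  ∑ δ, m δ • PiTensorProduct.map fun i => E.e (δ i)

variable {E}

lemma WHomog.map {δ : Fin p → Bool} {y : Fin p → Tot X} (h : E.WHomog δ y) (δ' : Fin p → Bool) :
    PiTensorProduct.map (fun i => E.e (δ' i)) (PiTensorProduct.tprod R y) =
      if δ' = δ then PiTensorProduct.tprod R y else 0 := by
  rw [PiTensorProduct.map_tprod]
  split_ifs with hδ
  · subst hδ
    exact congrArg _ (funext h)
  · obtain ⟨i, hi⟩ := Function.ne_iff.1 hδ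
    refine MultilinearMap.map_coord_zero _ i ?_
    rw [← h i, ← E.orth (δ' i) (y i)]
    congr 2
    revert hi
    cases δ i <;> cases δ' i <;> simp

lemma WHomog.scal_apply {δ : Fin p → Bool} {y : Fin p → Tot X} (h : E.WHomog δ y)
    (m : (Fin p → Bool) → R) :
    E.scal p m (PiTensorProduct.tprod R y) = m δ • PiTensorProduct.tprod R y := by
  rw [scal, LinearMap.sum_apply, Finset.sum_eq_single δ]
  · rw [LinearMap.smul_apply, h.map, if_pos rfl]
  · intro δ' _ hδ
    rw [LinearMap.smul_apply, h.map, if_neg hδ, smul_zero]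
  · simp

variable (E)

lemma ext {N : Type*} [AddCommGroup N] [Module R N] {f g : TPow p X →ₗ[R] N}
    (h : ∀ (ε : Fin p → ZMod 2) (δ : Fin p → Bool) (y : Fin p → Tot X), Homog ε y → E.WHomog δ y →
      f (PiTensorProduct.tprod R y) = g (PiTensorProduct.tprod R y)) : f = g := by
  refine tensor_ext fun ε y hy => ?_
  have : PiTensorProduct.tprod R y =
      ∑ δ : Fin p → Bool, PiTensorProduct.tprod R fun i => E.e (δ i) (y i) := by
    conv_lhs => rw [show y = fun i => ∑ b, E.e b (y i) from funext fun i => by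
      rw [Fintype.sum_bool, add_comm, E.sum]]
    rw [MultilinearMap.map_sum]
  rw [this, map_sum, map_sum]
  exact Finset.sum_congr rfl fun δ _ => h ε δ _
    (fun i => (E.deg _).proj_eq (hy i) (add_zero _)) fun i => E.idem _ _

lemma scal_scal (m m' : (Fin p → Bool) → R) (t : TPow p X) :
    E.scal p m (E.scal p m' t) = E.scal p (fun δ => m δ * m' δ) t := by
  refine LinearMap.congr_fun (f := E.scal p m ∘ₗ E.scal p m') (E.ext fun ε δ y _ hy => ?_) t
  rw [LinearMap.comp_apply, hy.scal_apply, map_smul, hy.scal_apply, hy.scal_apply, smul_smul, mul_comm]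

lemma scal_one (t : TPow p X) : E.scal p (fun _ => 1) t = t := by
  refine LinearMap.congr_fun (g := LinearMap.id) (E.ext fun ε δ y _ hy => ?_) t
  rw [hy.scal_apply, one_smul, LinearMap.id_apply]

lemma scal_zero (t : TPow p X) : E.scal p (fun _ => 0) t = 0 := by
  refine LinearMap.congr_fun (g := 0) (E.ext fun ε δ y _ hy => ?_) t
  rw [hy.scal_apply, zero_smul, LinearMap.zero_apply]

lemma scal_add (m m' : (Fin p → Bool) → R) (t : TPow p X) :
    E.scal p (fun δ => m δ + m' δ) t = E.scal p m t + E.scal p m' t := by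
  simp only [scal, add_smul, Finset.sum_add_distrib, LinearMap.add_apply]

lemma scal_smul (c : R) (m : (Fin p → Bool) → R) (t : TPow p X) :
    E.scal p (fun δ => c * m δ) t = c • E.scal p m t := by
  simp only [scal, mul_smul, ← Finset.smul_sum, LinearMap.smul_apply]

lemma scal_permOp (m : (Fin p → Bool) → R) (π : Equiv.Perm (Fin p)) (t : TPow p X) :
    E.scal p m (permOp p X π t) = permOp p X π (E.scal p (fun δ => m (δ ∘ π.symm)) t) := by
  refine LinearMap.congr_fun (f := E.scal p m ∘ₗ permOp p X π) (g := permOp p X π ∘ₗ E.scal p _)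
    (E.ext fun ε δ y hy hy' => ?_) t
  have : E.WHomog (δ ∘ π.symm) fun i => y (π.symm i) := fun i => hy' _
  rw [LinearMap.comp_apply, LinearMap.comp_apply, hy.permOp, map_smul, this.scal_apply,
    hy'.scal_apply, map_smul, hy.permOp, smul_comm]

lemma scal_mem_tDeg (m : (Fin p → Bool) → R) (k : ZMod 2) :
    ∀ t ∈ tDeg p X k, E.scal p m t ∈ tDeg p X k := by
  intro t ht
  rw [scal, LinearMap.sum_apply]
  exact Submodule.sum_mem _ fun δ _ => Submodule.smul_mem _ _
    (map_mem_tDeg _ (fun _ => 0) (fun i => E.deg (δ i)) (by simp) t ht)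

lemma scal_tOdd {d : Module.End R (Tot X)} (hd : ∀ b v, d (E.e b v) = E.e b (d v))
    (m : (Fin p → Bool) → R) (t : TPow p X) :
    E.scal p m (tOdd p d t) = tOdd p d (E.scal p m t) := by
  refine LinearMap.congr_fun (f := E.scal p m ∘ₗ tOdd p d) (g := tOdd p d ∘ₗ E.scal p m)
    (E.ext fun ε δ y hy hy' => ?_) t
  rw [LinearMap.comp_apply, LinearMap.comp_apply, hy'.scal_apply, map_smul, tOdd,
    LinearMap.sum_apply, map_sum, Finset.smul_sum]
  refine Finset.sum_congr rfl fun i _ => ?_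
  have : E.WHomog δ (Function.update y i (d (y i))) := fun j => by
    by_cases hj : j = i
    · subst hj; rw [Function.update_self, ← hd, hy' j]
    · rw [Function.update_of_ne hj, hy' j]
  rw [hy.tOddAt, map_smul, this.scal_apply, smul_comm]

/-- The number of factors in the second summand. -/
def wt (δ : Fin p → Bool) : ℕ := ∑ i, (δ i).toNat

/-- The operator that is multiplication by `c k` on the part of weight `k`. -/
def W (p : ℕ) (c : ℕ → R) : Module.End R (TPow p X) := E.scal p fun δ => c (wt δ)

lemma wt_le (δ : Fin p → Bool) : wt δ ≤ p := by
  refine (Finset.sum_le_card_nsmul _ _ 1 fun i _ => Bool.toNat_le _).trans ?_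
  simp

lemma wt_update {δ : Fin p → Bool} {i : Fin p} (h : δ i = true) :
    wt (Function.update δ i false) = wt δ - 1 := by
  have h1 : wt δ = (δ i).toNat + ∑ j ∈ Finset.univ.erase i, (δ j).toNat :=
    (Finset.add_sum_erase _ _ (Finset.mem_univ i)).symm
  have h2 : wt (Function.update δ i false) = ∑ j ∈ Finset.univ.erase i, (δ j).toNat := by
    refine ((Finset.add_sum_erase _ _ (Finset.mem_univ i)).symm).trans ?_
    rw [Function.update_self, Bool.toNat_false, zero_add]
    refine Finset.sum_congr rfl fun j hj => ?_
    rw [Function.update_of_ne (Finset.ne_of_mem_erase hj)]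
  rw [h1, h2, h, Bool.toNat_true, Nat.add_sub_cancel_left]

lemma W_W (c c' : ℕ → R) (t : TPow p X) : E.W p c (E.W p c' t) = E.W p (fun k => c k * c' k) t :=
  E.scal_scal _ _ t

lemma W_congr {c c' : ℕ → R} (h : ∀ k ≤ p, c k = c' k) (t : TPow p X) : E.W p c t = E.W p c' t := by
  rw [W, W]
  congr 2
  exact funext fun δ => h _ (wt_le δ)

lemma W_eq_self {c : ℕ → R} (h : ∀ k ≤ p, c k = 1) (t : TPow p X) : E.W p c t = t :=
  (E.W_congr h t).trans (E.scal_one t)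

lemma W_eq_zero {c : ℕ → R} (h : ∀ k ≤ p, c k = 0) (t : TPow p X) : E.W p c t = 0 :=
  (E.W_congr h t).trans (E.scal_zero t)

lemma W_add (c c' : ℕ → R) (t : TPow p X) :
    E.W p (fun k => c k + c' k) t = E.W p c t + E.W p c' t := E.scal_add _ _ t

lemma W_smul (a : R) (c : ℕ → R) (t : TPow p X) : E.W p (fun k => a * c k) t = a • E.W p c t :=
  E.scal_smul _ _ t

lemma W_rot (hp : p ≠ 0) (c : ℕ → R) (t : TPow p X) :
    E.W p c (rot p X t) = rot p X (E.W p c t) := by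
  obtain ⟨n, rfl⟩ : ∃ n, p = n + 1 := Nat.exists_eq_succ_of_ne_zero hp
  rw [rot_eq_permOp, W, scal_permOp]
  congr 3
  funext δ
  congr 1
  exact Equiv.sum_comp (finRotate (n + 1)).symm fun i => (δ i).toNat

lemma W_mem (hp : p ≠ 0) (c : ℕ → R) {l : R} (k : ZMod 2) :
    ∀ t ∈ eigenDeg p X l k, E.W p c t ∈ eigenDeg p X l k := by
  intro t ht
  rw [mem_eigenDeg] at ht ⊢
  exact ⟨E.scal_mem_tDeg _ _ _ ht.1, by rw [← E.W_rot hp, ht.2, map_smul]⟩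

lemma W_d0 (c : ℕ → R) (t : TPow p X) : E.W p c (tOdd p E.d0 t) = tOdd p E.d0 (E.W p c t) :=
  E.scal_tOdd E.d0_comm _ t

/-- Each summand of the derivation by `nu` moves one factor from the second summand to the first, so
it lowers the weight by one. The truncated subtraction at weight `0` is harmless because `nu`
vanishes there. -/
lemma W_nu (c : ℕ → R) (t : TPow p X) :
    E.W p c (tOdd p E.nu t) = tOdd p E.nu (E.W p (fun k => c (k - 1)) t) := by
  refine LinearMap.congr_fun (f := E.W p c ∘ₗ tOdd p E.nu)
    (g := tOdd p E.nu ∘ₗ E.W p fun k => c (k - 1)) (E.ext fun ε δ y hy hy' => ?_) t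
  rw [LinearMap.comp_apply, LinearMap.comp_apply, W, W, hy'.scal_apply, map_smul, tOdd,
    LinearMap.sum_apply, map_sum, Finset.smul_sum]
  refine Finset.sum_congr rfl fun i _ => ?_
  rw [hy.tOddAt, map_smul]
  cases hi : δ i with
  | false =>
    have h0 : E.nu (y i) = 0 := by
      have := hy' i
      rw [hi] at this
      rw [← this, E.nu_false]
    rw [h0, MultilinearMap.map_update_zero]
    simp
  | true =>
    have : E.WHomog (Function.update δ i false) (Function.update y i (E.nu (y i))) := fun j => by
      by_cases hj : j = i
      · subst hj; rw [Function.update_self, Function.update_self, E.false_nu]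
      · rw [Function.update_of_ne hj, Function.update_of_ne hj, hy' j]
    rw [this.scal_apply, smul_comm, wt_update hi]

/-- A factor not killed by `nu` lies in the second summand, so a tensor of weight `0` is
annihilated. Consequently coefficients of `nu` matter only at positive weights. -/
lemma nu_W_eq_zero {c : ℕ → R} (h : ∀ k, 0 < k → c k = 0) (t : TPow p X) :
    tOdd p E.nu (E.W p c t) = 0 := by
  refine LinearMap.congr_fun (f := tOdd p E.nu ∘ₗ E.W p c) (g := 0)
    (E.ext fun ε δ y hy hy' => ?_) t
  rw [LinearMap.comp_apply, W, hy'.scal_apply, map_smul, tOdd, LinearMap.sum_apply,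
    Finset.smul_sum]
  refine Finset.sum_eq_zero fun i _ => ?_
  cases hi : δ i with
  | false =>
    have h0 : E.nu (y i) = 0 := by
      have := hy' i
      rw [hi] at this
      rw [← this, E.nu_false]
    rw [hy.tOddAt, h0, MultilinearMap.map_update_zero, smul_zero, smul_zero]
  | true =>
    have : 0 < wt δ := by
      have : (δ i).toNat ≤ wt δ := Finset.single_le_sum (f := fun i => (δ i).toNat)
        (fun _ _ => Nat.zero_le _) (Finset.mem_univ i)
      rw [hi, Bool.toNat_true] at this
      exact this
    rw [h _ this, zero_smul]

end Weighted

lemma tOddAt_anticomm {d h : Module.End R (Tot X)} (hd : HasDeg 1 d)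
    {i j : Fin p} (hij : i < j) :
    tOddAt p d i * tOddAt p h j + tOddAt p h j * tOddAt p d i = 0 := by
  rw [tOddAt, tOddAt, ← PiTensorProduct.map_mul, ← PiTensorProduct.map_mul]
  refine map_add_map_at _ _ i ?_ ?_
  · simp only [hij, lt_irrefl, if_true, if_false]
    rw [hd.parity_anticomm]
    exact LinearMap.ext fun v => neg_add_cancel _
  · intro k hk
    rcases lt_trichotomy k i with h | h | h
    · simp [h, h.trans hij]
    · exact absurd h hk
    · simp [h.not_gt, hk]

lemma tOdd_sq {d : Module.End R (Tot X)} (hd : HasDeg 1 d) (h : ∀ v, d (d v) = 0) (t : TPow p X) :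
    tOdd p d (tOdd p d t) = 0 := by
  have hs : ∀ i, tOddAt p d i * tOddAt p d i = 0 := fun i => by
    rw [tOddAt, ← PiTensorProduct.map_mul]
    refine map_eq_zero_at _ i ?_
    simp only [lt_irrefl, if_true, if_false]
    exact LinearMap.ext h
  have key : tOdd p d * tOdd p d = 0 := by
    rw [tOdd, Finset.sum_mul_sum, ← Finset.sum_product']
    refine Finset.sum_involution (fun a _ => (a.2, a.1)) ?_ ?_ (by simp) (by simp)
    · rintro ⟨i, j⟩ _
      rcases lt_trichotomy i j with h | h | h
      · exact tOddAt_anticomm hd h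
      · subst h; simp [hs]
      · exact (add_comm _ _).trans (tOddAt_anticomm hd h)
    · rintro ⟨i, j⟩ _ h e
      simp only [Prod.mk.injEq] at e
      obtain ⟨rfl, -⟩ := e
      exact h (hs _)
  exact LinearMap.congr_fun key t

lemma tOdd_anticomm {d h : Module.End R (Tot X)} (hd : HasDeg 1 d) (hh : HasDeg 1 h)
    (hdh : ∀ v, d (h v) + h (d v) = 0) (t : TPow p X) :
    tOdd p d (tOdd p h t) + tOdd p h (tOdd p d t) = 0 := by
  have hs : ∀ i, tOddAt p d i * tOddAt p h i + tOddAt p h i * tOddAt p d i = 0 := fun i => by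
    rw [tOddAt, tOddAt, ← PiTensorProduct.map_mul, ← PiTensorProduct.map_mul]
    refine map_add_map_at _ _ i ?_ fun j hj => ?_
    · simp only [lt_irrefl, if_true, if_false]
      exact LinearMap.ext hdh
    · simp only [hj, if_false]
  have key : tOdd p d * tOdd p h + tOdd p h * tOdd p d = 0 := by
    rw [tOdd, tOdd, Finset.sum_mul_sum, Finset.sum_mul_sum, Finset.sum_comm (s := Finset.univ)
      (f := fun i j => tOddAt p h i * tOddAt p d j), ← Finset.sum_add_distrib]
    refine Finset.sum_eq_zero fun i _ => ?_
    rw [← Finset.sum_add_distrib]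
    refine Finset.sum_eq_zero fun j _ => ?_
    rcases lt_trichotomy i j with h | h | h
    · exact tOddAt_anticomm hd h
    · subst h; exact hs _
    · exact (add_comm _ _).trans (tOddAt_anticomm hh h)
  exact LinearMap.congr_fun key t

lemma tOdd_mem_eigenDeg (hp : p ≠ 0) {d : Module.End R (Tot X)} (hd : HasDeg 1 d) {l : R}
    (k : ZMod 2) : ∀ t ∈ eigenDeg p X l k, tOdd p d t ∈ eigenDeg p X l (k + 1) := by
  intro t ht
  rw [mem_eigenDeg] at ht ⊢
  refine ⟨?_, by rw [rot_tOdd hp hd, ht.2, map_smul]⟩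
  rw [tOdd, LinearMap.sum_apply]
  refine Submodule.sum_mem _ fun i _ => ?_
  refine map_mem_tDeg _ (fun j => if j = i then 1 else 0) (fun j => ?_) (by simp) t ht.1
  rcases lt_trichotomy j i with h1 | h1 | h1
  · simp only [h1, h1.ne, if_true, if_false]
    exact hasDeg_parity X
  · simpa [h1] using hd
  · simp only [h1.not_gt, h1.ne', if_false]
    exact hasDeg_one

lemma tOdd_add (d h : Module.End R (Tot X)) (t : TPow p X) :
    tOdd p (d + h) t = tOdd p d t + tOdd p h t := by
  have : tOdd p (d + h) = tOdd p d + tOdd p h := by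
    rw [tOdd, tOdd, tOdd, ← Finset.sum_add_distrib]
    refine Finset.sum_congr rfl fun i _ => ?_
    have key : ∀ d : Module.End R (Tot X), tOddAt p d i = PiTensorProduct.map
        (Function.update (fun j => if j < i then parity X else 1) i d) := fun d => by
      rw [tOddAt]
      congr 1
      funext j
      by_cases hj : j = i
      · subst hj; simp
      · simp [hj]
    rw [key, key, key, PiTensorProduct.map_update_add]
  exact LinearMap.congr_fun this t

namespace Weighted

/-- The differential `d0 + c nu`, where `c` depends on the weight. -/
def D (p : ℕ) (c : ℕ → R) : Module.End R (TPow p X) := tOdd p E.d0 + tOdd p E.nu ∘ₗ E.W p c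

lemma D_apply (c : ℕ → R) (t : TPow p X) :
    E.D p c t = tOdd p E.d0 t + tOdd p E.nu (E.W p c t) := rfl

/-- The derivations by `d0` and `nu` have square zero and anticommute; the former preserves the
weight and the latter lowers it by exactly one. Hence rescaling `nu` by an arbitrary function of the
weight still gives a differential. The choices `0` and `1` and a step function between `1` and `x`
are the ones used below. -/
lemma D_sq (c : ℕ → R) (t : TPow p X) : E.D p c (E.D p c t) = 0 := by
  rw [D_apply, D_apply, map_add, map_add, map_add, tOdd_sq E.d0_deg E.d0_sq, zero_add, W_nu,
    tOdd_sq E.nu_deg E.nu_nu, add_zero, W_d0]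
  exact tOdd_anticomm E.d0_deg E.nu_deg E.d0_nu _

lemma W_D (f c : ℕ → R) (t : TPow p X) : E.W p f (E.D p c t) =
    tOdd p E.d0 (E.W p f t) + tOdd p E.nu (E.W p (fun k => f (k - 1) * c k) t) := by
  rw [D_apply, map_add, W_d0, W_nu, W_W]

lemma D_mem (hp : p ≠ 0) (c : ℕ → R) {l : R} (k : ZMod 2) :
    ∀ t ∈ eigenDeg p X l k, E.D p c t ∈ eigenDeg p X l (k + 1) := fun t ht =>
  Submodule.add_mem _ (tOdd_mem_eigenDeg hp E.d0_deg k t ht)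
    (tOdd_mem_eigenDeg hp E.nu_deg k _ (E.W_mem hp c k t ht))

end Weighted

end Weights
end
end CyclicAdams

namespace CyclicAdams
open scoped Fin.NatCast Fin.CommRing
noncomputable section

/-! ### The weight filtration of an eigenspace and the twist between eigenvalues. -/

section Filtration

variable {R : Type u} [CommRing R] {X Y : Cx R} {p : ℕ} {u l : R}

namespace Weighted

variable (E : Weighted X)

/-- The elements `t` of the eigenspace with `W f t = t`. -/
def deg_sub (p : ℕ) (f : ℕ → R) (l : R) (k : ZMod 2) : Submodule R (TPow p X) :=
  eigenDeg p X l k ⊓ LinearMap.eqLocus (E.W p f) LinearMap.id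

lemma mem_deg_sub {f : ℕ → R} {l : R} {k : ZMod 2} {t : TPow p X} :
    t ∈ E.deg_sub p f l k ↔ t ∈ eigenDeg p X l k ∧ E.W p f t = t := Iff.rfl

lemma W_absorb {f g : ℕ → R} (h : ∀ k, f k * g k = g k) {t : TPow p X} (ht : E.W p g t = t) :
    E.W p f t = t := by
  conv_lhs => rw [← ht]
  rw [W_W]
  simp only [h]
  exact ht

lemma W_kill {f g : ℕ → R} (h : ∀ k, f k * g k = 0) {t : TPow p X} (ht : E.W p g t = t) :
    E.W p f t = 0 := by
  rw [← ht, W_W]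
  exact E.W_eq_zero (fun k _ => h k) t

/-- The condition says that if weight `k` is present and the coefficient `c k` is felt, then weight
`k - 1`, where `nu` lands, is present too. -/
lemma D_mem_deg_sub (hp : p ≠ 0) {c f : ℕ → R} (h : ∀ k, f (k - 1) * (c k * f k) = c k * f k)
    (l : R) (k : ZMod 2) : ∀ t ∈ E.deg_sub p f l k, E.D p c t ∈ E.deg_sub p f l (k + 1) := by
  intro t ht
  rw [mem_deg_sub] at ht ⊢
  refine ⟨E.D_mem hp c k t ht.1, ?_⟩
  rw [W_D, ht.2, D_apply]
  conv_lhs => rw [← ht.2]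
  conv_rhs => rw [← ht.2]
  rw [W_W, W_W, ht.2]
  simp only [mul_assoc, h]

/-- The subcomplex of an eigenspace defined by `f`, with differential `d0 + c nu`. -/
def cx (hp : p ≠ 0) (c f : ℕ → R) (h : ∀ k, f (k - 1) * (c k * f k) = c k * f k) (l : R) : Cx R :=
  gradedCx (E.D p c) (E.deg_sub p f l) (E.D_mem_deg_sub hp h l) fun _ t _ => E.D_sq c t

section

variable (hp : p ≠ 0) {c f c' f' : ℕ → R} {h : ∀ k, f (k - 1) * (c k * f k) = c k * f k}
  {h' : ∀ k, f' (k - 1) * (c' k * f' k) = c' k * f' k}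

/-- The projection onto the components of `cx`. -/
def retr (p : ℕ) (u : R) (f : ℕ → R) (l : R) (k : ZMod 2) : Module.End R (TPow p X) :=
  E.W p f * (eproj p X u l * tproj p X k)

include hp

lemma retr_mem (hl : l ^ p = 1) (hf : ∀ k, f k * f k = f k) (k : ZMod 2) (t : TPow p X) :
    E.retr p u f l k t ∈ E.deg_sub p f l k := by
  refine E.mem_deg_sub.2 ⟨E.W_mem hp f k _ (eproj_tproj_mem hp hl k t), ?_⟩
  rw [retr, Module.End.mul_apply, W_W]
  simp only [hf]

lemma retr_of_mem (hu : u * p = 1) (hl : l ^ p = 1) {k : ZMod 2} {t : TPow p X}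
    (ht : t ∈ E.deg_sub p f l k) : E.retr p u f l k t = t := by
  rw [retr, Module.End.mul_apply, eproj_tproj_of_mem hp hu hl ht.1, (E.mem_deg_sub.1 ht).2]

lemma finite_cx (hu : u * p = 1) (hl : l ^ p = 1) (hf : ∀ k, f k * f k = f k)
    (hX : ∀ i, Module.Finite R (X.X i)) (i : ZMod 2) : Module.Finite R ((E.cx hp c f h l).X i) :=
  haveI : Module.Finite R (TPow p X) := finite_tPow hX
  finite_of_retract (M := TPow p X) (S := E.deg_sub p f l i) (E.retr p u f l i) (E.retr_mem hp hl hf i)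
    fun _ ht => E.retr_of_mem hp hu hl ht

lemma projective_cx (hu : u * p = 1) (hl : l ^ p = 1) (hf : ∀ k, f k * f k = f k)
    (hX : ∀ i, Module.Finite R (X.X i)) (hX' : ∀ i, Module.Projective R (X.X i)) (i : ZMod 2) :
    Module.Projective R ((E.cx hp c f h l).X i) :=
  haveI : Module.Projective R (TPow p X) := projective_tPow hX hX'
  projective_of_retract (M := TPow p X) (S := E.deg_sub p f l i) (E.retr p u f l i) (E.retr_mem hp hl hf i)
    fun _ ht => E.retr_of_mem hp hu hl ht

/-- With zero coefficients the differential is the derivation by `d0` alone, to which the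
telescoping homotopy with `w = 0` applies. Cutting the homotopy down by `W f` is allowed because
`d0` preserves weights. -/
lemma null_cx (hu : u * p = 1) (hl : l ^ p = 1) (hf : ∀ k, f k * f k = f k) (hc : ∀ k, c k = 0)
    {s : Module.End R (Tot X)} (hs : HasDeg 1 s) {r : R} (hds : E.d0 * s + s * E.d0 = r • 1) :
    Null (r ^ p) (E.cx hp c f h l) := by
  obtain ⟨H, hH, hc'⟩ := exists_eigen_homotopy (w := 0) (l := l) hp hu hl E.d0_deg
    (fun a v => by simp) hs (by simp) (by rw [hds, sub_zero])
  have hD : ∀ t : TPow p X, E.D p c t = tOdd p E.d0 t := fun t => by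
    rw [D_apply, E.W_eq_zero fun k _ => hc k, map_zero, add_zero]
  have h0 : PiTensorProduct.map (fun _ : Fin p => (0 : Module.End R (Tot X))) = 0 :=
    map_eq_zero_at _ ⟨0, Nat.pos_of_ne_zero hp⟩ rfl
  refine Null.of_graded (E.W p f * H) 
    (fun k t ht => E.mem_deg_sub.2 ⟨E.W_mem hp f _ _ (hH k t ht.1), ?_⟩) fun k t ht => ?_
  · rw [Module.End.mul_apply, W_W]
    simp only [hf]
  · rw [hD, hD, Module.End.mul_apply, Module.End.mul_apply, ← W_d0, ← map_add]
    have := hc' k t ht.1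
    rw [h0, LinearMap.zero_apply, add_zero] at this
    rw [← this, map_smul, ht.2, LinearMap.id_apply]

/-- The short exact sequence of a filtration step. -/
lemma exists_shortExact {f g e : ℕ → R} {z o : ℕ → R}
    {hf : ∀ k, f (k - 1) * (o k * f k) = o k * f k} {hg : ∀ k, g (k - 1) * (o k * g k) = o k * g k}
    {he : ∀ k, e (k - 1) * (z k * e k) = z k * e k} (hz : ∀ k, z k = 0)
    (ho : ∀ k, 0 < k → e (k - 1) * (o k * g k) = 0)
    (h1 : ∀ k, g k * f k = f k) (h3 : ∀ k, e k * f k = 0)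
    (h4 : ∀ k, f k + e k = g k) (h5 : ∀ k, e k * e k = e k) (h6 : ∀ k, g k * e k = e k) :
    ∃ S : ShortComplex (Cx R), S.ShortExact ∧ S.X₁ = E.cx hp o f hf l ∧
      S.X₂ = E.cx hp o g hg l ∧ S.X₃ = E.cx hp z e he l := by
  have m1 : ∀ k, ∀ t ∈ E.deg_sub p f l k, t ∈ E.deg_sub p g l k := fun k t ht =>
    E.mem_deg_sub.2 ⟨ht.1, E.W_absorb h1 ht.2⟩
  have m2 : ∀ k, ∀ t ∈ E.deg_sub p g l k, E.W p e t ∈ E.deg_sub p e l k := fun k t ht =>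
    E.mem_deg_sub.2 ⟨E.W_mem hp e k t ht.1, by rw [W_W]; simp only [h5]⟩
  have m3 : ∀ k, ∀ t ∈ E.deg_sub p e l k, t ∈ E.deg_sub p g l k := fun k t ht =>
    E.mem_deg_sub.2 ⟨ht.1, E.W_absorb h6 ht.2⟩
  have m4 : ∀ k, ∀ t ∈ E.deg_sub p g l k, E.W p e t = 0 → t ∈ E.deg_sub p f l k := by
    intro k t ht h0
    refine E.mem_deg_sub.2 ⟨ht.1, ?_⟩
    have e3 := E.W_add f e t
    simp only [h4] at e3
    rw [(E.mem_deg_sub.1 ht).2, h0, add_zero] at e3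
    exact e3.symm
  exact gradedCx_shortExact LinearMap.id (E.W p e) m1 m2 (fun _ _ _ => rfl)
    -- The projection to the weights of `e` is a chain map because `nu` moves no weight `k > 0` of
    -- `g` into a weight of `e`, and weight `0` is killed by `nu` anyway.
    (fun k t ht => by
      rw [W_D, D_apply, E.W_eq_zero fun k _ => hz k, map_zero, add_zero]
      have : tOdd p E.nu (E.W p (fun k => e (k - 1) * o k) t) = 0 := by
        have e1 : t = E.W p g t := ht.2.symm
        rw [e1, W_W]
        exact E.nu_W_eq_zero (fun k hk => by rw [mul_assoc, ho k hk]) t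
      rw [this, add_zero])
    (fun k t _ ht => ht) (fun k t ht => ⟨t, m3 k t ht, ht.2⟩)
    (fun k t ht => E.W_kill h3 ht.2) fun k t ht h0 => ⟨t, m4 k t ht h0, rfl⟩

end

/-! ### Twisting -/

/-- The factor by which the twist acts on the summand given by `δ`. -/
def twistFactor (p : ℕ) (η : R) (δ : Fin p → Bool) : R := ∏ i, if δ i then η ^ (i : ℕ) else 1

lemma prod_ite_wt (η : R) (δ : Fin p → Bool) : (∏ i, if δ i then η else 1) = η ^ wt δ := by
  rw [wt, ← Finset.prod_pow_eq_pow_sum]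
  refine Finset.prod_congr rfl fun i _ => ?_
  cases δ i <;> simp

lemma twistFactor_mul (η η' : R) (δ : Fin p → Bool) :
    twistFactor p η δ * twistFactor p η' δ = twistFactor p (η * η') δ := by
  rw [twistFactor, twistFactor, twistFactor, ← Finset.prod_mul_distrib]
  refine Finset.prod_congr rfl fun i _ => ?_
  split_ifs
  · rw [mul_pow]
  · rw [mul_one]

lemma twistFactor_one (δ : Fin p → Bool) : twistFactor p (1 : R) δ = 1 := by
  simp [twistFactor]

/-- The rotation moves slot `i` to slot `i + 1`, so every factor from the second summand picks up
one more `η`. The last slot returns to position `0`, which is consistent because η^{n+1} = 1. -/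
lemma twistFactor_rotate {n : ℕ} {η : R} (hη : η ^ (n + 1) = 1) (δ : Fin (n + 1) → Bool) :
    twistFactor (n + 1) η (δ ∘ (finRotate (n + 1)).symm) =
      η ^ wt δ * twistFactor (n + 1) η δ := by
  rw [← prod_ite_wt, twistFactor, twistFactor, ← Finset.prod_mul_distrib,
    ← Equiv.prod_comp (finRotate (n + 1))]
  refine Finset.prod_congr rfl fun i _ => ?_
  simp only [Function.comp_apply, Equiv.symm_apply_apply]
  split_ifs
  · rw [← pow_succ']
    refine Fin.lastCases ?_ (fun i => ?_) i
    · rw [finRotate_apply, Fin.last_add_one, Fin.val_last, hη, Fin.val_zero, pow_zero]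
    · rw [finRotate_apply, Fin.coeSucc_eq_succ, Fin.val_succ, Fin.val_castSucc]
  · rw [mul_one]

/-- The operator which multiplies a tensor by `η ^ i` for each factor number `i` in the second
summand. -/
def twist (p : ℕ) (η : R) : Module.End R (TPow p X) := E.scal p (twistFactor p η)

lemma twist_twist {η η' : R} (h : η * η' = 1) (t : TPow p X) :
    E.twist p η (E.twist p η' t) = t := by
  rw [twist, twist, scal_scal]
  simp only [twistFactor_mul, h, twistFactor_one]
  exact E.scal_one t

/-- The function that is `1` at `k` and `0` elsewhere. -/
def at_ (k : ℕ) (j : ℕ) : R := if j = k then 1 else 0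

lemma W_twist (f : ℕ → R) (η : R) (t : TPow p X) :
    E.W p f (E.twist p η t) = E.twist p η (E.W p f t) := by
  rw [W, twist, scal_scal, scal_scal]
  simp only [mul_comm]

/-- On tensors of weight `k` the twist commutes with the rotation up to the factor `η ^ k`, so it
divides the eigenvalue by `η ^ k`. -/
lemma twist_mem (hp : p ≠ 0) {η l μ : R} (hη : η ^ p = 1) {k : ℕ} (h : μ * η ^ k = l) (i : ZMod 2) :
    ∀ t ∈ E.deg_sub p (at_ k) l i, E.twist p η t ∈ E.deg_sub p (at_ k) μ i := by
  intro t ht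
  rw [mem_deg_sub, mem_eigenDeg] at ht ⊢
  refine ⟨⟨E.scal_mem_tDeg _ _ _ ht.1.1, ?_⟩, by rw [W_twist, ht.2]⟩
  have key : E.twist p η (rot p X t) = η ^ k • rot p X (E.twist p η t) := by
    obtain ⟨n, rfl⟩ : ∃ n, p = n + 1 := Nat.exists_eq_succ_of_ne_zero hp
    rw [rot_eq_permOp, twist, scal_permOp]
    simp only [twistFactor_rotate hη]
    rw [← map_smul, ← scal_smul]
    congr 1
    conv_lhs => rw [← ht.2]
    conv_rhs => rw [← ht.2]
    rw [W, scal_scal, scal_scal]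
    congr 2
    funext δ
    by_cases hδ : wt δ = k
    · rw [hδ]
    · simp [at_, hδ]
  rw [ht.1.2, map_smul, ← h] at key
  -- The power `η ^ (k * (p - 1))` plays the role of the inverse of `η ^ k`.
  have h2 : η ^ (k * (p - 1)) * η ^ k = 1 := by
    rw [← pow_add, ← Nat.mul_succ, Nat.succ_eq_add_one, Nat.sub_add_cancel (Nat.pos_of_ne_zero hp),
      mul_comm, pow_mul, hη, one_pow]
  have := congrArg (η ^ (k * (p - 1)) • ·) key
  simp only [smul_smul] at this
  rw [h2, one_smul, mul_left_comm, h2, mul_one] at this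
  exact this.symm

lemma tOdd_twist (η : R) (t : TPow p X) :
    E.twist p η (tOdd p E.d0 t) = tOdd p E.d0 (E.twist p η t) := E.scal_tOdd E.d0_comm _ t

/-- The pieces of weight `k` of different eigenspaces are isomorphic. -/
lemma cx_iso (hp : p ≠ 0) {c : ℕ → R} (hc : ∀ k, c k = 0) {η η' l μ : R} {k : ℕ}
    {h : ∀ j, at_ k (j - 1) * (c j * at_ k j) = c j * at_ k j} (hη : η ^ p = 1) (hη' : η * η' = 1)
    (hl : μ * η ^ k = l) : Nonempty (E.cx hp c (at_ k) h l ≅ E.cx hp c (at_ k) h μ) := by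
  have hη'' : η' ^ p = 1 := by
    have := congrArg (· ^ p) hη'
    simpa [mul_pow, hη] using this
  have hl' : l * η' ^ k = μ := by rw [← hl, mul_assoc, ← mul_pow, hη', one_pow, mul_one]
  have hD : ∀ t : TPow p X, E.D p c t = tOdd p E.d0 t := fun t => by
    rw [D_apply, E.W_eq_zero fun k _ => hc k, map_zero, add_zero]
  exact ⟨gradedIso (E.twist p η) (E.twist p η') (E.twist_mem hp hη hl) (E.twist_mem hp hη'' hl')
    (fun _ t _ => by rw [hD, hD, tOdd_twist])
    (fun _ t _ => E.twist_twist (by rw [mul_comm, hη']) t) fun _ t _ => E.twist_twist hη' t⟩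

end Weighted

end Filtration
end
end CyclicAdams

namespace CyclicAdams
open scoped Fin.NatCast Fin.CommRing
noncomputable section

/-! ### Degreewise split exact sequences and the two extreme weights. -/

section Split

variable {R : Type u} [CommRing R] {A X B Y : Cx R} {p : ℕ} {u l : R}

/-- The map of total modules given by a family of linear maps. -/
def famMap (f : ∀ i, X.X i →ₗ[R] Y.X i) : Tot X →ₗ[R] Tot Y :=
  LinearMap.pi fun i => f i ∘ₗ LinearMap.proj i

lemma famMap_apply (f : ∀ i, X.X i →ₗ[R] Y.X i) (v : Tot X) (i : ZMod 2) :
    famMap f v i = f i (v i) := rfl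

lemma hasDeg_famMap (f : ∀ i, X.X i →ₗ[R] Y.X i) : HasDeg 0 (famMap f) := fun a v => by
  funext j
  rw [famMap_apply, proj_apply, proj_apply, add_zero]
  by_cases h : j = a
  · subst h; rw [Pi.single_eq_same, Pi.single_eq_same, famMap_apply]
  · rw [Pi.single_eq_of_ne h, Pi.single_eq_of_ne h, map_zero]

/-- A splitting of the total module of `X` into those of `A` and `B`, with an odd anti-chain map from
`B` to `A`. -/
structure Split (A X B : Cx R) where
  i : Tot A →ₗ[R] Tot X
  r : Tot X →ₗ[R] Tot A
  j : Tot B →ₗ[R] Tot X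
  q : Tot X →ₗ[R] Tot B
  i_deg : HasDeg 0 i
  r_deg : HasDeg 0 r
  j_deg : HasDeg 0 j
  q_deg : HasDeg 0 q
  r_i : ∀ v, r (i v) = v
  q_j : ∀ v, q (j v) = v
  r_j : ∀ v, r (j v) = 0
  q_i : ∀ v, q (i v) = 0
  sum : ∀ v, i (r v) + j (q v) = v
  nu : Tot B →ₗ[R] Tot A
  nu_deg : HasDeg 1 nu
  nu_comm : ∀ v, diff A (nu v) + nu (diff B v) = 0

namespace Split

/-- The weighted structure given by a splitting. -/
def toWeighted (S : Split A X B) : Weighted X where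
  e b := bif b then S.j ∘ₗ S.q else S.i ∘ₗ S.r
  deg b := by
    cases b
    · exact S.i_deg.mul S.r_deg
    · exact S.j_deg.mul S.q_deg
  idem b v := by
    cases b
    · simp [S.r_i]
    · simp [S.q_j]
  orth b v := by
    cases b
    · simp [S.r_j]
    · simp [S.q_i]
  sum v := S.sum v
  d0 := S.i ∘ₗ diff A ∘ₗ S.r + S.j ∘ₗ diff B ∘ₗ S.q
  nu := S.i ∘ₗ S.nu ∘ₗ S.q
  d0_deg := (S.i_deg.mul ((hasDeg_diff A).mul S.r_deg)).add (S.j_deg.mul ((hasDeg_diff B).mul S.q_deg))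
  nu_deg := S.i_deg.mul (S.nu_deg.mul S.q_deg)
  d0_comm b v := by
    cases b
    · simp [S.r_i, S.q_i, S.r_j]
    · simp [S.q_j, S.r_j, S.q_i]
  nu_true v := by simp [S.q_i]
  nu_false v := by simp [S.q_i]
  d0_sq v := by
    have h (Z : Cx R) (v : Tot Z) : diff Z (diff Z v) = 0 := LinearMap.congr_fun (diff_mul_diff Z) v
    simp [S.r_i, S.q_i, S.r_j, S.q_j, h]
  d0_nu v := by
    have := congrArg S.i (S.nu_comm (S.q v))
    rw [map_add, map_zero] at this
    simpa [S.r_i, S.q_i, S.r_j, S.q_j] using this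

variable (S : Split A X B)

/-- The operator `d0` is block diagonal with blocks the differentials of `A` and `B`, so homotopies
for the same scalar on the two blocks can be added. -/
lemma exists_homotopy {r : R} (hA : Null r A) (hB : Null r B) : ∃ s : Module.End R (Tot X),
    HasDeg 1 s ∧ S.toWeighted.d0 * s + s * S.toWeighted.d0 = r • 1 := by
  obtain ⟨s, hs, h⟩ := hA.exists_oddMap
  obtain ⟨s', hs', h'⟩ := hB.exists_oddMap
  refine ⟨S.i ∘ₗ s ∘ₗ S.r + S.j ∘ₗ s' ∘ₗ S.q,
    (S.i_deg.mul (hs.mul S.r_deg)).add (S.j_deg.mul (hs'.mul S.q_deg)), LinearMap.ext fun v => ?_⟩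
  have e1 := congrArg S.i (LinearMap.congr_fun h (S.r v))
  have e2 := congrArg S.j (LinearMap.congr_fun h' (S.q v))
  simp only [LinearMap.add_apply, Module.End.mul_apply, LinearMap.smul_apply, Module.End.one_apply,
    map_add, map_smul] at e1 e2
  simp only [toWeighted, LinearMap.add_apply, Module.End.mul_apply, LinearMap.comp_apply, map_add,
    S.r_i, S.q_i, S.r_j, S.q_j, map_zero, add_zero, zero_add, LinearMap.smul_apply,
    Module.End.one_apply]
  conv_rhs => rw [← S.sum v, smul_add, ← e1, ← e2]
  abel

end Split

namespace Weighted

variable (E : Weighted X)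

lemma wt_const (b : Bool) : wt (fun _ : Fin p => b) = b.toNat * p := by
  simp [wt, mul_comm]

lemma eq_const_of_wt {b : Bool} {δ : Fin p → Bool} (h : wt δ = b.toNat * p) : δ = fun _ => b := by
  funext i
  cases b with
  | false =>
    rw [Bool.toNat_false, zero_mul, wt, Finset.sum_eq_zero_iff] at h
    have := h i (Finset.mem_univ i)
    revert this
    cases δ i <;> simp
  | true =>
    rw [Bool.toNat_true, one_mul] at h
    by_contra hi
    have hi' : δ i = false := by simpa using hi
    have h1 : wt (Function.update δ i true) = wt δ + 1 := by
      have := wt_update (δ := Function.update δ i true) (i := i) (Function.update_self _ _ _)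
      have h2 : Function.update (Function.update δ i true) i false = δ := by
        rw [Function.update_idem, ← hi', Function.update_eq_self]
      rw [h2] at this
      have h3 : 0 < wt (Function.update δ i true) :=
        lt_of_lt_of_le (by simp) (Finset.single_le_sum
          (f := fun j => (Function.update δ i true j).toNat) (fun _ _ => Nat.zero_le _)
          (Finset.mem_univ i))
      omega
    have := wt_le (Function.update δ i true)
    omega

/-- Weights `0` and `p` are each attained by a single pattern of summands, the constant one, so the
corresponding projector is a pure power of `e b`. -/
lemma W_at (b : Bool) (t : TPow p X) :
    E.W p (at_ (b.toNat * p)) t = PiTensorProduct.map (fun _ => E.e b) t := by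
  refine LinearMap.congr_fun (E.ext fun ε δ y _ hy => ?_) t
  rw [W, hy.scal_apply, hy.map, at_]
  by_cases h : wt δ = b.toNat * p
  · rw [if_pos h, if_pos (eq_const_of_wt h).symm, one_smul]
  · rw [if_neg h, if_neg, zero_smul]
    rintro rfl
    exact h (wt_const b)

/-- The extreme pieces of the weight filtration are eigenspaces of the tensor powers of the two
summands. -/
lemma cx_iso_eigen (hp : p ≠ 0) {c : ℕ → R} (hc : ∀ k, c k = 0) (b : Bool)
    {h : ∀ j, at_ (b.toNat * p) (j - 1) * (c j * at_ (b.toNat * p) j) = c j * at_ (b.toNat * p) j}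
    {i : Tot A →ₗ[R] Tot X} {r : Tot X →ₗ[R] Tot A} (hi : HasDeg 0 i) (hr : HasDeg 0 r)
    (hri : ∀ v, r (i v) = v) (hir : ∀ v, i (r v) = E.e b v)
    (hd : ∀ v, E.d0 (i v) = i (diff A v)) :
    Nonempty (E.cx hp c (at_ (b.toNat * p)) h l ≅ eigen p A l) := by
  have hD : ∀ t : TPow p X, E.D p c t = tOdd p E.d0 t := fun t => by
    rw [D_apply, E.W_eq_zero fun k _ => hc k, map_zero, add_zero]
  have hmap : ∀ t : TPow p A, PiTensorProduct.map (fun _ => r)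
      (PiTensorProduct.map (fun _ => i) t) = t := fun t => by
    rw [← LinearMap.comp_apply, ← PiTensorProduct.map_comp,
      (funext fun _ => LinearMap.ext hri : (fun _ : Fin p => r ∘ₗ i) = fun _ => LinearMap.id),
      PiTensorProduct.map_id]
    rfl
  have hmap' : ∀ t : TPow p X, PiTensorProduct.map (fun _ => i)
      (PiTensorProduct.map (fun _ => r) t) = E.W p (at_ (b.toNat * p)) t := fun t => by
    rw [← LinearMap.comp_apply, ← PiTensorProduct.map_comp,
      (funext fun _ => LinearMap.ext hir : (fun _ : Fin p => i ∘ₗ r) = fun _ => E.e b), W_at]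
  have hd' : ∀ v, r (E.d0 v) = diff A (r v) := fun v => by
    have h1 : r (E.e b (E.d0 v)) = diff A (r v) := by rw [← E.d0_comm, ← hir, hd, hri]
    rw [← h1, ← hir, hri]
  refine ⟨gradedIso (hS := E.D_mem_deg_sub hp h l) (hD := fun _ t _ => E.D_sq c t)
    (hS' := fun _ => tDiff_mem_eigenDeg p A l rfl)
    (hD' := fun _ t _ => LinearMap.congr_fun (tDiff_sq p A) t)
    (PiTensorProduct.map fun _ => r) (PiTensorProduct.map fun _ => i)
    (fun k t ht => map_mem_eigenDeg hp hr k t ht.1) (fun k t ht => ?_)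
    (fun k t ht => ?_) (fun k t ht => (hmap' t).trans ht.2) (fun k t _ => hmap t)⟩
  · refine E.mem_deg_sub.2 ⟨map_mem_eigenDeg hp hi k t ht, ?_⟩
    rw [← hmap', hmap]
  · rw [hD]
    exact map_tOdd hr hd' t

/-- The whole eigenspace. -/
lemma cx_eq_eigen (hp : p ≠ 0) {c f : ℕ → R} (hc : ∀ k ≤ p, c k = 1) (hf : ∀ k ≤ p, f k = 1)
    {h : ∀ j, f (j - 1) * (c j * f j) = c j * f j} (hd : ∀ v, diff X v = E.d0 v + E.nu v) :
    Nonempty (E.cx hp c f h l ≅ eigen p X l) := by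
  have hD : ∀ t : TPow p X, E.D p c t = tDiff p X t := fun t => by
    rw [D_apply, E.W_eq_self hc, tDiff_eq_tOdd, ← tOdd_add]
    congr 2
    exact (LinearMap.ext hd).symm
  exact ⟨gradedIso (hS := E.D_mem_deg_sub hp h l) (hD := fun _ t _ => E.D_sq c t)
    (hS' := fun _ => tDiff_mem_eigenDeg p X l rfl)
    (hD' := fun _ t _ => LinearMap.congr_fun (tDiff_sq p X) t) LinearMap.id LinearMap.id
    (fun k t ht => ht.1) (fun k t ht => E.mem_deg_sub.2 ⟨ht, E.W_eq_self hf t⟩)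
    (fun k t _ => hD t) (fun _ _ _ => rfl) fun _ _ _ => rfl⟩

end Weighted

/-- Short exact sequences of complexes with projective third term are split degreewise. -/
lemma exists_split {S : ShortComplex (Cx R)} (hS : S.ShortExact)
    (h3 : ∀ i, Module.Projective R (S.X₃.X i)) : ∃ s : Split S.X₁ S.X₂ S.X₃,
      ∀ v, diff S.X₂ v = s.toWeighted.d0 v + s.toWeighted.nu v := by
  have hj : ∀ i, ∃ j : S.X₃.X i →ₗ[R] S.X₂.X i, (S.g.f i).hom ∘ₗ j = LinearMap.id := fun i =>
    Module.projective_lifting_property _ _ (ShortExact.surjective hS i)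
  choose j hj using hj
  have hj' : ∀ i x, (S.g.f i).hom (j i x) = x := fun i x => LinearMap.congr_fun (hj i) x
  have hr : ∀ i, ∃ r : S.X₂.X i →ₗ[R] S.X₁.X i,
      ∀ x, (S.f.f i).hom (r x) = x - j i ((S.g.f i).hom x) := by
    intro i
    let m : S.X₂.X i →ₗ[R] S.X₂.X i := LinearMap.id - j i ∘ₗ (S.g.f i).hom
    have hm : ∀ x, m x ∈ LinearMap.range (S.f.f i).hom := fun x => ShortExact.exact hS i _ (by
      change (S.g.f i).hom (x - j i ((S.g.f i).hom x)) = 0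
      rw [map_sub, hj', sub_self])
    refine ⟨(LinearEquiv.ofInjective _ (ShortExact.injective hS i)).symm.toLinearMap ∘ₗ
      LinearMap.codRestrict _ m hm, fun x => ?_⟩
    exact congrArg Subtype.val ((LinearEquiv.ofInjective _
      (ShortExact.injective hS i)).apply_symm_apply (LinearMap.codRestrict _ m hm x))
  choose r hr using hr
  have inj : Function.Injective (totMap S.f) := fun v w h =>
    funext fun i => ShortExact.injective hS i (congrFun h i)
  have hfr : ∀ v, totMap S.f (famMap r v) = v - famMap j (totMap S.g v) := fun v =>
    funext fun i => hr i (v i)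
  have hgj : ∀ v, totMap S.g (famMap j v) = v := fun v => funext fun i => hj' i (v i)
  have hgf : ∀ v, totMap S.g (totMap S.f v) = 0 := fun v => funext fun i => ShortExact.zero i (v i)
  have dd (Z : Cx R) (v : Tot Z) : diff Z (diff Z v) = 0 := LinearMap.congr_fun (diff_mul_diff Z) v
  have hdj : ∀ v, totMap S.f (famMap r (diff S.X₂ (famMap j v))) =
      diff S.X₂ (famMap j v) - famMap j (diff S.X₃ v) := fun v => by
    rw [hfr, totMap_diff, hgj]
  refine ⟨{ i := totMap S.f, r := famMap r, j := famMap j, q := totMap S.g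
            i_deg := hasDeg_totMap _, r_deg := hasDeg_famMap _, j_deg := hasDeg_famMap _
            q_deg := hasDeg_totMap _
            r_i := fun v => inj (by rw [hfr, hgf, map_zero, sub_zero])
            q_j := hgj
            r_j := fun v => inj (by rw [hfr, hgj, sub_self, map_zero])
            q_i := hgf
            sum := fun v => by rw [hfr, sub_add_cancel]
            -- In the chosen splitting the differential of the middle term is upper triangular: the
            -- diagonal blocks are the outer differentials and `nu` is the corner. That the middle
            -- differential squares to zero is what makes the corner anticommute with the outer
            -- differentials.
            nu := famMap r ∘ₗ diff S.X₂ ∘ₗ famMap j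
            nu_deg := (hasDeg_famMap r).mul ((hasDeg_diff _).mul (hasDeg_famMap j))
            nu_comm := fun v => inj ?_ }, fun v => ?_⟩
  · simp only [LinearMap.comp_apply]
    rw [map_add, totMap_diff, hdj, hdj, map_sub, dd, dd, map_zero, map_zero, sub_zero, zero_sub,
      neg_add_cancel]
  · change diff S.X₂ v = totMap S.f (diff S.X₁ (famMap r v)) +
      famMap j (diff S.X₃ (totMap S.g v)) + totMap S.f (famMap r (diff S.X₂ (famMap j (totMap S.g v))))
    rw [hdj, totMap_diff, hfr, map_sub]
    abel

end Split
end
end CyclicAdams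

/-! ### Finite length from homotopies, the functor `mult`, and classes in the Grothendieck group. -/

namespace CyclicAdams
open scoped Fin.NatCast Fin.CommRing
noncomputable section

/-! ### Finite length from null homotopies -/

section NullHomotopic

variable {R : Type u} [CommRing R] {X Y : Cx R} {p : ℕ} {u v l : R}

/-- Dévissage to quotients by primes: if powers of all elements of the maximal ideal kill the
quotient by `P`, then these elements lie in `P`, so `P` is the maximal ideal and the quotient is
simple. -/
lemma isFiniteLength_of_radical [IsNoetherianRing R] [IsLocalRing R] {M : Type*} [AddCommGroup M]
    [Module R M] [Module.Finite R M]
    (h : ∀ r ∈ IsLocalRing.maximalIdeal R, ∃ n : ℕ, ∀ x : M, r ^ n • x = 0) :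
    IsFiniteLength R M := by
  suffices H : (∀ r ∈ IsLocalRing.maximalIdeal R, ∃ n : ℕ, ∀ x : M, r ^ n • x = 0) →
    Module.length R M ≠ ⊤ from Module.length_ne_top_iff.1 (H h)
  clear h
  induction ‹Module.Finite R M› using
    IsNoetherianRing.induction_on_isQuotientEquivQuotientPrime R with
  | subsingleton N => simp
  | quotient N P e =>
    intro h
    have : P.1 = IsLocalRing.maximalIdeal R := by
      refine le_antisymm (IsLocalRing.le_maximalIdeal P.2.ne_top) fun r hr => ?_
      obtain ⟨n, hn⟩ := h r hr
      have := congrArg e (hn (e.symm (Ideal.Quotient.mk _ 1)))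
      rw [map_smul, e.apply_symm_apply, map_zero] at this
      have h2 : Ideal.Quotient.mk P.1 (r ^ n) = 0 := by
        rw [← this, Algebra.smul_def, map_one, mul_one]
        rfl
      exact P.2.mem_of_pow_mem n (Ideal.Quotient.eq_zero_iff_mem.1 h2)
    rw [e.length_eq, this]
    have hs : IsSimpleModule R (R ⧸ IsLocalRing.maximalIdeal R) :=
      (isSimpleModule_iff_isCoatom).2 (IsLocalRing.maximalIdeal.isMaximal R).out
    rw [Module.length_eq_one]
    exact ENat.one_ne_top
  | exact N₁ N₂ N₃ f g hf hg hfg h₁ h₃ =>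
    intro h
    rw [Module.length_eq_add_of_exact f g hf hg hfg, ne_eq, ENat.add_eq_top, not_or]
    refine ⟨h₁ fun r hr => ?_, h₃ fun r hr => ?_⟩
    · obtain ⟨n, hn⟩ := h r hr
      exact ⟨n, fun x => hf (by rw [map_smul, hn, map_zero])⟩
    · obtain ⟨n, hn⟩ := h r hr
      refine ⟨n, fun x => ?_⟩
      obtain ⟨y, rfl⟩ := hg x
      rw [← map_smul, hn, map_zero]

/-- Every element of the maximal ideal has a null homotopic power. -/
def LocallyNull [IsLocalRing R] (X : Cx R) : Prop :=
  ∀ r ∈ IsLocalRing.maximalIdeal R, ∃ n : ℕ, Null (r ^ n) X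

/-- This is how finite length is transported. Homology of an eigenspace is hard to bound directly,
but null homotopic powers pass to eigenspaces, and over a Noetherian local ring they force finite
length. -/
lemma LocallyNull.finLen [IsNoetherianRing R] [IsLocalRing R] (hX : LocallyNull X)
    (hf : ∀ i, Module.Finite R (X.X i)) : FinLen X := fun i =>
  haveI := homology_finite hf i
  isFiniteLength_of_radical fun r hr => by
    obtain ⟨n, hn⟩ := hX r hr
    exact ⟨n, fun x => hn.smul_homology i x⟩

lemma LocallyNull.eigen [IsLocalRing R] (hp : p ≠ 0) (hu : u * p = 1) (hl : l ^ p = 1)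
    (hX : LocallyNull X) : LocallyNull (eigen p X l) := fun r hr => by
  obtain ⟨n, hn⟩ := hX r hr
  exact ⟨n * p, by rw [pow_mul]; exact hn.eigen hp hu hl⟩

lemma finite_eigen (hp : p ≠ 0) (hu : u * p = 1) (hl : l ^ p = 1)
    (hX : ∀ i, Module.Finite R (X.X i)) (i : ZMod 2) : Module.Finite R ((eigen p X l).X i) :=
  haveI : Module.Finite R (TPow p X) := finite_tPow hX
  finite_of_retract (M := TPow p X) (S := eigenDeg p X l i) (eproj p X u l * tproj p X i)
    (eproj_tproj_mem hp hl i) fun _ ht => eproj_tproj_of_mem hp hu hl ht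

lemma projective_eigen (hp : p ≠ 0) (hu : u * p = 1) (hl : l ^ p = 1)
    (hX : ∀ i, Module.Finite R (X.X i)) (hX' : ∀ i, Module.Projective R (X.X i)) (i : ZMod 2) :
    Module.Projective R ((eigen p X l).X i) :=
  haveI : Module.Projective R (TPow p X) := projective_tPow hX hX'
  projective_of_retract (M := TPow p X) (S := eigenDeg p X l i) (eproj p X u l * tproj p X i)
    (eproj_tproj_mem hp hl i) fun _ ht => eproj_tproj_of_mem hp hu hl ht

/-! ### The functor `mult` -/

/-- The functor `mult` on morphisms. -/
def multHom (u : R) (f : X ⟶ Y) : mult u X ⟶ mult u Y :=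
  mkHom (fun i => (f.f i).hom) fun i (x : X.X i) => by
    change (f.f (i + 1)).hom ((if i = 0 then u else 1) • (X.d i (i + 1)).hom x) =
      (if i = 0 then u else 1) • (Y.d i (i + 1)).hom ((f.f i).hom x)
    rw [map_smul, hom_comm_apply]

/-- The functor `mult` on isomorphisms. -/
def multIso (u : R) (e : X ≅ Y) : mult u X ≅ mult u Y where
  hom := multHom u e.hom
  inv := multHom u e.inv
  hom_inv_id := by
    ext i x
    exact congrArg (fun g => (g.f i).hom x) e.hom_inv_id
  inv_hom_id := by
    ext i x
    exact congrArg (fun g => (g.f i).hom x) e.inv_hom_id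

lemma mult_shortExact (u : R) {S : ShortComplex (Cx R)} (hS : S.ShortExact) :
    ∃ S' : ShortComplex (Cx R), S'.ShortExact ∧ S'.X₁ = mult u S.X₁ ∧ S'.X₂ = mult u S.X₂ ∧
      S'.X₃ = mult u S.X₃ := by
  obtain ⟨w, hw⟩ := shortExact_of (multHom u S.f) (multHom u S.g) (ShortExact.injective hS)
    (ShortExact.surjective hS) (fun i x => ShortExact.zero i x) (ShortExact.exact hS)
  exact ⟨_, hw, rfl, rfl, rfl⟩

/-- The family of maps underlying a null homotopy on `mult u X`. -/
def multFam (v : R) (h : ∀ i j, X.X i →ₗ[R] Y.X j) (i j : ZMod 2) : X.X i →ₗ[R] Y.X j :=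
  (if i = 0 then 1 else v) • h i j

/-- Only the differential leaving degree `0` is scaled by `u`, and only the homotopy component
leaving degree `1` is scaled by `v`. Each of the two composites contains both of them or neither, so
the scalings cancel. -/
lemma multFam_d (huv : u * v = 1) (h : ∀ i j, X.X i →ₗ[R] Y.X j) (i : ZMod 2) (x : X.X i) :
    multFam v h (i + 1) i ((if i = 0 then u else 1) • (X.d i (i + 1)).hom x) +
      (if i + 1 = 0 then u else 1) • (Y.d (i + 1) i).hom (multFam v h i (i + 1) x) =
    h (i + 1) i ((X.d i (i + 1)).hom x) + (Y.d (i + 1) i).hom (h i (i + 1) x) := by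
  simp only [multFam, LinearMap.smul_apply, map_smul, smul_smul]
  rcases zmod2_cases i with rfl | rfl
  · simp only [if_true, zero_add, one_ne_zero, if_false, mul_one, one_smul]
    rw [huv, one_smul]
  · simp only [(by decide : (1 + 1 : ZMod 2) = 0), if_true, one_ne_zero, if_false, mul_one,
      one_smul]
    rw [huv, one_smul]

lemma Null.mult (huv : u * v = 1) {r : R} (h : Null r X) : Null r (mult u X) := by
  obtain ⟨h, hh⟩ := h
  exact ⟨multFam v h, fun i x => (multFam_d huv h i x).trans (hh i x)⟩

lemma LocallyNull.mult [IsLocalRing R] (huv : u * v = 1) (hX : LocallyNull X) :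
    LocallyNull (mult u X) := fun r hr => by
  obtain ⟨n, hn⟩ := hX r hr
  exact ⟨n, hn.mult huv⟩

/-- The functor `mult` preserves homotopies. -/
lemma multHomotopy (huv : u * v = 1) {f g : X ⟶ Y} (h : Homotopy f g) :
    Nonempty (Homotopy (multHom u f) (multHom u g)) := by
  obtain ⟨s, hs⟩ := Homotopy.exists_family h
  refine ⟨mkHomotopy (multFam v s) fun i x => ?_⟩
  exact (hs i x).trans (congrArg (· + (g.f i).hom x) (multFam_d huv s i x).symm)

/-- The functor `mult` preserves homotopy equivalences. -/
def multHomotopyEquiv (huv : u * v = 1) (e : HomotopyEquiv X Y) :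
    HomotopyEquiv (mult u X) (mult u Y) where
  hom := multHom u e.hom
  inv := multHom u e.inv
  homotopyHomInvId := (multHomotopy huv e.homotopyHomInvId).some
  homotopyInvHomId := (multHomotopy huv e.homotopyInvHomId).some

/-- Around one degree at a time, rescaling the two outer modules by units identifies the three-term
complexes. No compatibility between different degrees is needed for comparing lengths. -/
lemma length_homology_mult (huv : u * v = 1) (X : Cx R) (i : ZMod 2) :
    Module.length R ((mult u X).homology i) = Module.length R (X.homology i) := by
  let U : Rˣ := ⟨u, v, huv, by rw [mul_comm, huv]⟩
  let c : ZMod 2 → Rˣ := fun i => if i = 0 then U else 1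
  have hc : ∀ i, ((c i : Rˣ) : R) = if i = 0 then u else 1 := fun i => by
    simp only [c]
    split_ifs <;> rfl
  let e : (mult u X).sc i ≅ X.sc i := ShortComplex.isoMk
    (LinearEquiv.smulOfUnit (c ((ComplexShape.up (ZMod 2)).prev i))).toModuleIso
    (Iso.refl _)
    (LinearEquiv.smulOfUnit (c i)⁻¹).toModuleIso
    (by
      refine ModuleCat.hom_ext (LinearMap.ext fun (x : X.X _) => ?_)
      change (X.d _ i).hom ((c _ : R) • x) = (if _ = 0 then u else 1) • (X.d _ i).hom x
      rw [hc, map_smul])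
    (by
      refine ModuleCat.hom_ext (LinearMap.ext fun (x : X.X i) => ?_)
      change (X.d i _).hom x = (((c i)⁻¹ : Rˣ) : R) • ((if i = 0 then u else 1) • (X.d i _).hom x)
      rw [← hc, smul_smul, Units.inv_mul, one_smul])
  exact (ShortComplex.homologyMapIso e).toLinearEquiv.length_eq

lemma eul_mult (huv : u * v = 1) (X : Cx R) : eul (mult u X) = eul X := by
  simp only [eul, length_homology_mult huv]

/-! ### The Grothendieck group -/

lemma IsMFfl.of_iso (e : X ≅ Y) (h : IsMFfl X) : IsMFfl Y := by
  have e' (i : ZMod 2) : X.X i ≃ₗ[R] Y.X i :=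
    ((HomologicalComplex.eval (ModuleCat R) (ComplexShape.up (ZMod 2)) i).mapIso e).toLinearEquiv
  exact ⟨fun i => haveI := h.finite i; Module.Finite.equiv (e' i),
    fun i => haveI := h.projective i; Module.Projective.of_equiv (e' i),
    FinLen.of_iso e h.finiteLength⟩

open scoped Classical in
/-- The class of a complex in the Grothendieck group, or `0` if it is not in `mf`. -/
def cls (X : Cx R) : K0 R := if h : IsMFfl X then K0.mk ⟨X, h⟩ else 0

lemma cls_of (h : IsMFfl X) : cls X = K0.mk ⟨X, h⟩ := dif_pos h

lemma K0.mk_eq_of_rel {P P' : MFfl R} (h : K0Rel R (FreeAbelianGroup.of P - FreeAbelianGroup.of P')) :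
    K0.mk P = K0.mk P' := by
  have : FreeAbelianGroup.of P - FreeAbelianGroup.of P' ∈ AddSubgroup.closure {r | K0Rel R r} :=
    AddSubgroup.subset_closure h
  rw [K0.mk, K0.mk, eq_comm, QuotientAddGroup.eq]
  rwa [neg_add_eq_sub]

lemma cls_homotopyEquiv (hX : IsMFfl X) (hY : IsMFfl Y) (e : HomotopyEquiv X Y) :
    cls X = cls Y := by
  rw [cls_of hX, cls_of hY]
  exact K0.mk_eq_of_rel (K0Rel.homotopyEquiv ⟨X, hX⟩ ⟨Y, hY⟩ e)

lemma cls_iso (e : X ≅ Y) : cls X = cls Y := by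
  by_cases h : IsMFfl X
  · exact cls_homotopyEquiv h (h.of_iso e) (HomotopyEquiv.ofIso e)
  · have h' : ¬ IsMFfl Y := fun h' => h (h'.of_iso e.symm)
    rw [cls, cls, dif_neg h, dif_neg h']

lemma cls_shortExact {S : ShortComplex (Cx R)} (hS : S.ShortExact) (h1 : IsMFfl S.X₁)
    (h2 : IsMFfl S.X₂) (h3 : IsMFfl S.X₃) : cls S.X₂ = cls S.X₁ + cls S.X₃ := by
  rw [cls_of h1, cls_of h2, cls_of h3]
  have : FreeAbelianGroup.of (⟨S.X₂, h2⟩ : MFfl R) - (FreeAbelianGroup.of ⟨S.X₁, h1⟩ +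
      FreeAbelianGroup.of ⟨S.X₃, h3⟩) ∈ AddSubgroup.closure {r | K0Rel R r} :=
    AddSubgroup.subset_closure (K0Rel.shortExact ⟨S.X₁, h1⟩ ⟨S.X₂, h2⟩ ⟨S.X₃, h3⟩ S.f S.g S.zero hS)
  rw [K0.mk, K0.mk, K0.mk, ← QuotientAddGroup.mk_add, eq_comm, QuotientAddGroup.eq]
  rwa [neg_add_eq_sub]

lemma cls_eq_zero (h : ∀ i, Subsingleton (X.X i)) : cls X = 0 := by
  by_cases hX : IsMFfl X
  -- The zero complex is an extension of itself by itself, so its class equals twice its class.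
  · obtain ⟨w, hw⟩ := shortExact_of (𝟙 X) (𝟙 X) (fun i x y _ => (h i).elim x y)
      (fun i x => ⟨x, rfl⟩) (fun i x => (h i).elim _ _) fun i y _ => ⟨y, rfl⟩
    have := cls_shortExact hw hX hX hX
    exact left_eq_add.1 this
  · exact dif_neg hX

end NullHomotopic
end
end CyclicAdams

namespace CyclicAdams
open scoped Fin.NatCast Fin.CommRing
noncomputable section

/-! ### Additivity of the difference of the classes of two eigenspaces. -/

section Additivity

variable {R : Type u} [CommRing R] {A X B Y : Cx R} {p : ℕ}
  {u v w l z : R}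

/-- The indicator function of `k < m`. -/
def below (m k : ℕ) : R := if k < m then 1 else 0

lemma below_cond (m k : ℕ) : (below m (k - 1) : R) * (1 * below m k) = 1 * below m k := by
  simp only [below]
  split_ifs with h1 h2
  · simp
  · simp
  · omega
  · simp

lemma at_cond (m k : ℕ) : (Weighted.at_ m (k - 1) : R) * (0 * Weighted.at_ m k) =
    0 * Weighted.at_ m k := by simp

lemma at_sq (m k : ℕ) : (Weighted.at_ m k : R) * Weighted.at_ m k = Weighted.at_ m k := by
  simp only [Weighted.at_]
  split_ifs <;> simp

lemma below_sq (m k : ℕ) : (below m k : R) * below m k = below m k := by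
  simp only [below]
  split_ifs <;> simp

/-- The piece of weight `k` of an eigenspace. -/
abbrev Weighted.gr (E : Weighted X) (hp : p ≠ 0) (k : ℕ) (l : R) : Cx R :=
  E.cx hp (fun _ => 0) (Weighted.at_ k) (at_cond k) l

/-- The piece of weight less than `k` of an eigenspace. -/
abbrev Weighted.fil (E : Weighted X) (hp : p ≠ 0) (k : ℕ) (l : R) : Cx R :=
  E.cx hp (fun _ => 1) (below k) (below_cond k) l

/-- As `nu` lowers weights, the part of weight less than `m + 1` contains the part of weight less
than `m` as a subcomplex, and on the quotient only `d0` is left. -/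
lemma Weighted.fil_shortExact (E : Weighted X) (hp : p ≠ 0) (m : ℕ) (l : R) :
    ∃ S : ShortComplex (Cx R), S.ShortExact ∧ S.X₁ = E.fil hp m l ∧ S.X₂ = E.fil hp (m + 1) l ∧
      S.X₃ = E.gr hp m l := by
  refine E.exists_shortExact hp (fun _ => rfl) ?_ ?_ ?_ ?_ (at_sq m) ?_
  · intro k hk
    simp only [Weighted.at_, below]
    split_ifs <;> first | omega | simp
  all_goals
    intro k
    simp only [Weighted.at_, below]
    split_ifs <;> first | omega | simp

/-- The two outer complexes may require different powers of `r`; the exponent `n + m` serves both,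
since null homotopic scalars form an ideal. -/
lemma LocallyNull.gr [IsLocalRing R] {S : Split A X B} (hA : LocallyNull A) (hB : LocallyNull B) (hp : p ≠ 0)
    (hu : u * p = 1) (hl : l ^ p = 1) (k : ℕ) : LocallyNull (S.toWeighted.gr hp k l) := by
  intro r hr
  obtain ⟨n, hn⟩ := hA r hr
  obtain ⟨m, hm⟩ := hB r hr
  have h1 : Null (r ^ (n + m)) A := by
    rw [pow_add, mul_comm]; exact (nullIdeal A).mul_mem_left _ hn
  have h2 : Null (r ^ (n + m)) B := by
    rw [pow_add]; exact (nullIdeal B).mul_mem_left _ hm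
  obtain ⟨s, hs, hds⟩ := S.exists_homotopy h1 h2
  refine ⟨(n + m) * p, ?_⟩
  rw [pow_mul]
  exact S.toWeighted.null_cx hp hu hl (at_sq k) (fun _ => rfl) hs hds

variable [IsNoetherianRing R] [IsLocalRing R] (hv : v * w = 1)

lemma LocallyNull.isMFfl (hN : LocallyNull X) (hX : ∀ i, Module.Finite R (X.X i))
    (hX' : ∀ i, Module.Projective R (X.X i)) : IsMFfl X := ⟨hX, hX', hN.finLen hX⟩

include hv in
lemma isMFfl_eigen (hX : ∀ i, Module.Finite R (X.X i)) (hX' : ∀ i, Module.Projective R (X.X i))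
    (hN : LocallyNull X) (hp : p ≠ 0) (hu : u * p = 1) (hl : l ^ p = 1) :
    IsMFfl (mult v (eigen p X l)) :=
  ((hN.eigen hp hu hl).mult hv).isMFfl (finite_eigen hp hu hl hX)
    (projective_eigen hp hu hl hX hX')

section

variable (S : Split A X B) (hX : ∀ i, Module.Finite R (X.X i))
  (hX' : ∀ i, Module.Projective R (X.X i)) (hA : LocallyNull A) (hB : LocallyNull B) (hp : p ≠ 0)
  (hu : u * p = 1) (hl : l ^ p = 1)

include hv hX hX' hA hB hu hl

lemma isMFfl_gr (k : ℕ) : IsMFfl (mult v (S.toWeighted.gr hp k l)) :=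
  ((hA.gr hB hp hu hl k).mult hv).isMFfl (S.toWeighted.finite_cx hp (c := fun _ => 0) (h := at_cond k) hu hl (at_sq k) hX)
    (S.toWeighted.projective_cx hp (c := fun _ => 0) (h := at_cond k) hu hl (at_sq k) hX hX')

/-- Membership in the category and the formula for the class are proved in one induction, because
the relation in the Grothendieck group presupposes that all three terms of each filtration step are
objects. -/
lemma fil_aux (m : ℕ) : IsMFfl (mult v (S.toWeighted.fil hp m l)) ∧
    cls (mult v (S.toWeighted.fil hp m l)) =
      ∑ k ∈ Finset.range m, cls (mult v (S.toWeighted.gr hp k l)) := by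
  have fp : ∀ m, FinLen (mult v (S.toWeighted.fil hp m l)) →
      IsMFfl (mult v (S.toWeighted.fil hp m l)) := fun m h =>
    ⟨S.toWeighted.finite_cx hp (c := fun _ => 1) (h := below_cond m) hu hl (below_sq m) hX,
      S.toWeighted.projective_cx hp (c := fun _ => 1) (h := below_cond m) hu hl (below_sq m) hX hX', h⟩
  induction m with
  | zero =>
    have h0 : ∀ i, Subsingleton ((mult v (S.toWeighted.fil hp 0 l)).X i) := fun i =>
      ⟨fun x y => by
        have : ∀ x : S.toWeighted.deg_sub p (below 0) l i, x = 0 := fun x => Subtype.ext <|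
          x.2.2.symm.trans (S.toWeighted.W_eq_zero (fun k _ => by simp [below]) _)
        exact (this x).trans (this y).symm⟩
    refine ⟨fp 0 (Acyclic.finLen ((acyclic_iff_exact _).2 fun i x _ =>
      ⟨0, (h0 i).elim _ _⟩)), ?_⟩
    rw [Finset.sum_range_zero]
    exact cls_eq_zero h0
  | succ m ih =>
    obtain ⟨s, hs, e1, e2, e3⟩ := S.toWeighted.fil_shortExact hp m l
    obtain ⟨s', hs', e1', e2', e3'⟩ := mult_shortExact v hs
    rw [e1] at e1'
    rw [e2] at e2'
    rw [e3] at e3'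
    have g := isMFfl_gr hv S hX hX' hA hB hp hu hl m
    have h2 := FinLen.of_shortExact₂ hs' (by rw [e1']; exact ih.1.finiteLength)
      (by rw [e3']; exact g.finiteLength)
    rw [e2'] at h2
    refine ⟨fp _ h2, ?_⟩
    have := cls_shortExact hs' (by rw [e1']; exact ih.1) (by rw [e2']; exact fp _ h2)
      (by rw [e3']; exact g)
    rw [e1', e2', e3', ih.2] at this
    rw [this, Finset.sum_range_succ]

lemma cls_eigen_eq_sum (hd : ∀ v, diff X v = S.toWeighted.d0 v + S.toWeighted.nu v) :
    cls (mult v (eigen p X l)) =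
      ∑ k ∈ Finset.range (p + 1), cls (mult v (S.toWeighted.gr hp k l)) := by
  rw [← (fil_aux hv S hX hX' hA hB hp hu hl (p + 1)).2]
  obtain ⟨e⟩ := S.toWeighted.cx_eq_eigen (l := l) hp (fun _ _ => rfl)
    (fun k hk => by simp [below, Nat.lt_succ_of_le hk]) (h := below_cond (p + 1)) hd
  exact (cls_iso (multIso v e)).symm

end

section

variable {R : Type u} [CommRing R] {A X B : Cx R} {l z : R} (S : Split A X B)

/-- The piece of weight zero. -/
lemma Split.gr_zero_iso (hp : p ≠ 0) (l : R) :
    Nonempty (S.toWeighted.gr hp 0 l ≅ eigen p A l) := by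
  have := S.toWeighted.cx_iso_eigen (l := l) hp (c := fun _ => 0) (fun _ => rfl) false
    (h := fun j => by simp) S.i_deg S.r_deg S.r_i (fun v => rfl)
    (fun v => by simp [Split.toWeighted, S.r_i, S.q_i])
  simpa only [Bool.toNat_false, zero_mul] using this

/-- The piece of top weight. -/
lemma Split.gr_last_iso (hp : p ≠ 0) (l : R) :
    Nonempty (S.toWeighted.gr hp p l ≅ eigen p B l) := by
  have := S.toWeighted.cx_iso_eigen (l := l) hp (c := fun _ => 0) (fun _ => rfl) true
    (h := fun j => by simp) S.j_deg S.q_deg S.q_j (fun v => rfl)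
    (fun v => by simp [Split.toWeighted, S.q_j, S.r_j])
  simpa only [Bool.toNat_true, one_mul] using this

/-- The other pieces are the same for all eigenvalues. -/
lemma Weighted.gr_iso (E : Weighted X) (hp : p.Prime) (hz : z ^ p = 1) {k : ℕ} (hk : 0 < k)
    (hk' : k < p) : Nonempty (E.gr hp.ne_zero k 1 ≅ E.gr hp.ne_zero k z) := by
  have := Fact.mk hp
  have hkz : (k : ZMod p) ≠ 0 := fun h =>
    absurd (Nat.le_of_dvd hk ((ZMod.natCast_eq_zero_iff _ _).1 h)) (by omega)
  -- The twist by η = z^a must satisfy z · η^k = 1, that is 1 + ak ≡ 0 modulo p. This is solvable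
  -- because 0 < k < p and p is prime.
  set a : ℕ := (-(k : ZMod p)⁻¹).val with ha
  have hak : ((1 + a * k : ℕ) : ZMod p) = 0 := by
    push_cast
    rw [ha, ZMod.natCast_zmod_val, neg_mul, inv_mul_cancel₀ hkz, add_neg_cancel]
  obtain ⟨b, hb⟩ := (ZMod.natCast_eq_zero_iff _ _).1 hak
  exact E.cx_iso (l := 1) (μ := z) hp.ne_zero (c := fun _ => 0) (fun _ => rfl)
    (h := at_cond k) (η := z ^ a) (η' := z ^ (a * (p - 1)))
    (by rw [← pow_mul, mul_comm, pow_mul, hz, one_pow])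
    (by rw [← pow_add, ← mul_one_add a, Nat.add_sub_cancel' hp.one_le, mul_comm, pow_mul, hz,
      one_pow])
    (by rw [← pow_mul, ← pow_succ', Nat.add_comm, hb, pow_mul, hz, one_pow])

end

include hv in
/-- The difference of the classes of the eigenspaces for `1` and `z` is additive. -/
theorem cls_eigen_shortExact {S : ShortComplex (Cx R)} (hS : S.ShortExact)
    (h2 : ∀ i, Module.Finite R (S.X₂.X i)) (h2' : ∀ i, Module.Projective R (S.X₂.X i))
    (h3 : ∀ i, Module.Projective R (S.X₃.X i))
    (hA : LocallyNull S.X₁) (hB : LocallyNull S.X₃) (hp : p.Prime) (hu : u * p = 1)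
    (hz : z ^ p = 1) :
    cls (mult v (eigen p S.X₂ 1)) - cls (mult v (eigen p S.X₂ z)) =
      (cls (mult v (eigen p S.X₁ 1)) - cls (mult v (eigen p S.X₁ z))) +
      (cls (mult v (eigen p S.X₃ 1)) - cls (mult v (eigen p S.X₃ z))) := by
  obtain ⟨s, hd⟩ := exists_split hS h3
  have h0 := hp.ne_zero
  have ga (l : R) : cls (mult v (s.toWeighted.gr h0 0 l)) = cls (mult v (eigen p S.X₁ l)) :=
    (s.gr_zero_iso h0 l).elim fun e => cls_iso (multIso v e)
  have gb (l : R) : cls (mult v (s.toWeighted.gr h0 p l)) = cls (mult v (eigen p S.X₃ l)) :=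
    (s.gr_last_iso h0 l).elim fun e => cls_iso (multIso v e)
  have gk (k : ℕ) (hk : 0 < k) (hk' : k < p) : cls (mult v (s.toWeighted.gr h0 k 1)) =
      cls (mult v (s.toWeighted.gr h0 k z)) :=
    (s.toWeighted.gr_iso hp hz hk hk').elim fun e => cls_iso (multIso v e)
  -- Only the weights `0` and `p` feel the eigenvalue, and their pieces are the eigenspaces of the
  -- outer terms; all intermediate weights cancel in the difference.
  rw [cls_eigen_eq_sum hv s h2 h2' hA hB h0 hu (one_pow p) hd,
    cls_eigen_eq_sum hv s h2 h2' hA hB h0 hu hz hd, Finset.sum_range_succ, Finset.sum_range_succ,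
    gb, gb]
  obtain ⟨n, rfl⟩ : ∃ n, p = n + 1 := Nat.exists_eq_succ_of_ne_zero h0
  rw [Finset.sum_range_succ', Finset.sum_range_succ', ga, ga,
    Finset.sum_congr rfl fun k hk => gk (k + 1) (Nat.succ_pos k)
      (Nat.succ_lt_succ (Finset.mem_range.1 hk))]
  abel

end Additivity
end
end CyclicAdams

namespace CyclicAdams
open scoped Fin.NatCast Fin.CommRing
noncomputable section

/-! ### The cyclic Adams operation on the Grothendieck group. -/

section AdamsOperation

/-! ### Existence and uniqueness of the operation -/

lemma isPrimitiveRoot_zetaC {p : ℕ} (hp : p ≠ 0) : IsPrimitiveRoot (zetaC p) p :=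
  Complex.isPrimitiveRoot_exp p hp

lemma zetaC_pow {p : ℕ} (hp : p ≠ 0) : zetaC p ^ p = 1 := (isPrimitiveRoot_zetaC hp).pow_eq_one

lemma sum_zetaC {p : ℕ} (hp : p.Prime) : ∑ i ∈ Finset.range p, zetaC p ^ i = 0 :=
  (isPrimitiveRoot_zetaC hp.ne_zero).geom_sum_eq_zero hp.one_lt

/-- A functional on `ℤ[e^{2πi/p}]` which maps `1` to `1`. -/
lemma exists_functional {p : ℕ} (hp : p ≠ 0) : ∃ f : Zzeta p →ₗ[ℤ] ℤ, f 1 = 1 := by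
  have hint : IsIntegral ℤ (zetaC p) := (isPrimitiveRoot_zetaC hp).isIntegral (Nat.pos_of_ne_zero hp)
  let B := Algebra.adjoin.powerBasis' hint
  have hpos : 0 < B.dim := B.dim_pos
  -- The element `1` is the zeroth member of the power basis, so the zeroth coordinate is a
  -- retraction onto ℤ.
  refine ⟨B.basis.coord ⟨0, hpos⟩, ?_⟩
  have h1 : B.basis ⟨0, hpos⟩ = 1 := by rw [B.coe_basis]; simp
  conv_lhs => rw [← h1]
  rw [Module.Basis.coord_apply, Module.Basis.repr_self, Finsupp.single_eq_same]

/-- As ℤ is a direct summand of ℤ[e^{2πi/p}], nothing is lost under `x ↦ x ⊗ 1`, even if the group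
has torsion. This gives uniqueness of the operation. -/
lemma tmul_one_injective {p : ℕ} (hp : p ≠ 0) {M : Type*} [AddCommGroup M] {x y : M}
    (h : (x ⊗ₜ[ℤ] (1 : Zzeta p) : M ⊗[ℤ] Zzeta p) = y ⊗ₜ[ℤ] 1) : x = y := by
  obtain ⟨f, hf⟩ := exists_functional hp
  have := congrArg ((TensorProduct.rid ℤ M).toLinearMap ∘ₗ f.lTensor M) h
  simpa [hf] using this

variable {R : Type u} [CommRing R] {p : ℕ}

/-- A homomorphism from the Grothendieck group. -/
def K0.lift {G : Type*} [AddCommGroup G] (f : MFfl R → G)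
    (h1 : ∀ (P' P P'' : MFfl R) (a : P'.1 ⟶ P.1) (b : P.1 ⟶ P''.1) (w : a ≫ b = 0),
      (ShortComplex.mk a b w).ShortExact → f P = f P' + f P'')
    (h2 : ∀ (P P' : MFfl R), HomotopyEquiv P.1 P'.1 → f P = f P') : K0 R →+ G :=
  QuotientAddGroup.lift _ (FreeAbelianGroup.lift f) <| by
    rw [AddSubgroup.closure_le]
    rintro _ (⟨P', P, P'', a, b, w, h⟩ | ⟨P, P', e⟩)
    · simp [AddMonoidHom.mem_ker, h1 P' P P'' a b w h]
    · simp [AddMonoidHom.mem_ker, h2 P P' e]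

lemma K0.lift_mk {G : Type*} [AddCommGroup G] (f : MFfl R → G) (h1) (h2) (P : MFfl R) :
    K0.lift f h1 h2 (K0.mk P) = f P := by
  simp [K0.lift, K0.mk]

lemma K0.hom_ext {G : Type*} [AddCommGroup G] {f g : K0 R →+ G}
    (h : ∀ P, f (K0.mk P) = g (K0.mk P)) : f = g := by
  refine QuotientAddGroup.addMonoidHom_ext _ (FreeAbelianGroup.lift_ext _ _ fun P => h P)

variable [Algebra (Ap p) R]

lemma algebraMap_inv_mul (hp : p ≠ 0) : algebraMap (Ap p) R (Ap.inv p) * p = 1 := by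
  have : Ap.inv p * (p : Ap p) = 1 := Subtype.ext (by
    change ((p : ℂ)⁻¹) * ((p : Ap p) : ℂ) = 1
    push_cast
    exact inv_mul_cancel₀ (Nat.cast_ne_zero.2 hp))
  rw [← map_natCast (algebraMap (Ap p) R), ← map_mul, this, map_one]

lemma algebraMap_zeta_pow (hp : p ≠ 0) : algebraMap (Ap p) R (Ap.zeta p) ^ p = 1 := by
  have : Ap.zeta p ^ p = 1 := Subtype.ext (zetaC_pow hp)
  rw [← map_pow, this, map_one]

lemma sum_algebraMap_zeta (hp : p.Prime) :
    ∑ i ∈ Finset.range p, algebraMap (Ap p) R (Ap.zeta p) ^ i = 0 := by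
  have : ∑ i ∈ Finset.range p, Ap.zeta p ^ i = 0 := Subtype.ext (by
    rw [AddSubmonoidClass.coe_finsetSum]
    exact sum_zetaC hp)
  simpa using congrArg (algebraMap (Ap p) R) this

/-- The image of `1/p`. -/
abbrev pinv (p : ℕ) (R : Type u) [CommRing R] [Algebra (Ap p) R] : R := algebraMap (Ap p) R (Ap.inv p)

/-- The image of `e^{2πi/p}`. -/
abbrev zet (p : ℕ) (R : Type u) [CommRing R] [Algebra (Ap p) R] : R := algebraMap (Ap p) R (Ap.zeta p)

/-- A nonzero residue modulo a prime is a unit, so multiplication of the positions by it carries the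
eigenspace of ζ to that of ζ^j. Up to isomorphism only two eigenspaces occur. -/
lemma cls_tPow (hp : p.Prime) (X : Cx R) (j : Fin p) :
    cls (tPow p X j) = cls (mult (pinv p R) (eigen p X (if (j : ℕ) = 0 then 1 else zet p R))) := by
  rw [tPow, map_pow]
  split_ifs with h
  · rw [h, pow_zero]
  · have := Fact.mk hp
    have hj : (j : ZMod p) ≠ 0 := fun h' => h (Nat.eq_zero_of_dvd_of_lt
      ((ZMod.natCast_eq_zero_iff _ _).1 h') j.2)
    have hval : ((j : ℕ) : ZMod p).val = j := ZMod.val_cast_of_lt j.2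
    obtain ⟨n, rfl⟩ : ∃ n, p = n + 1 := Nat.exists_eq_succ_of_ne_zero hp.ne_zero
    obtain ⟨e⟩ := eigen_iso_pow (X := X) (l := zet (n + 1) R) (algebraMap_zeta_pow hp.ne_zero)
      (Units.mk0 ((j : ℕ) : ZMod (n + 1)) hj)
    rw [Units.val_mk0, hval] at e
    exact (cls_iso (multIso _ e)).symm

variable [IsNoetherianRing R] [IsLocalRing R] (hp : p.Prime) (hN : ∀ P : MFfl R, LocallyNull P.1)

include hp hN in
lemma isMFfl_tPow (P : MFfl R) (j : Fin p) : IsMFfl (tPow p P.1 j) := by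
  refine isMFfl_eigen (algebraMap_inv_mul hp.ne_zero) P.2.finite P.2.projective (hN P) hp.ne_zero
    (algebraMap_inv_mul hp.ne_zero) ?_
  rw [map_pow, ← pow_mul, mul_comm, pow_mul, algebraMap_zeta_pow hp.ne_zero, one_pow]

/-- The cyclic Adams operation. -/
def adams : K0 R →+ K0 R :=
  K0.lift (fun P => cls (mult (pinv p R) (eigen p P.1 1)) -
      cls (mult (pinv p R) (eigen p P.1 (zet p R))))
    (fun P' P P'' a b w h => cls_eigen_shortExact (algebraMap_inv_mul hp.ne_zero) h P.2.finite
      P.2.projective P''.2.projective (hN P') (hN P'') hp (algebraMap_inv_mul hp.ne_zero)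
      (algebraMap_zeta_pow hp.ne_zero))
    (fun P P' e => by
      have hu := algebraMap_inv_mul (R := R) hp.ne_zero
      have h (l : R) (hl : l ^ p = 1) : cls (mult (pinv p R) (eigen p P.1 l)) =
          cls (mult (pinv p R) (eigen p P'.1 l)) :=
        cls_homotopyEquiv (isMFfl_eigen hu P.2.finite P.2.projective (hN P) hp.ne_zero hu hl)
          (isMFfl_eigen hu P'.2.finite P'.2.projective (hN P') hp.ne_zero hu hl)
          (multHomotopyEquiv hu (eigenHomotopyEquiv hp.ne_zero hu hl e))
      rw [h 1 (one_pow p), h _ (algebraMap_zeta_pow hp.ne_zero)])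

lemma adams_mk (P : MFfl R) : adams hp hN (K0.mk P) = cls (mult (pinv p R) (eigen p P.1 1)) -
    cls (mult (pinv p R) (eigen p P.1 (zet p R))) := K0.lift_mk _ _ _ _

/-- All summands share the class of the ζ-eigenspace, except that the one for eigenvalue 1 differs
from it by the value of the operation. The common part is tensored with the sum of all roots of
unity, which is zero. -/
lemma isCyclicAdams_adams : IsCyclicAdams p R (isMFfl_tPow hp hN) (adams hp hN) := by
  intro P
  have h0 : ∑ j : Fin p, (Zzeta.zeta p ^ (j : ℕ)) = 0 := by
    rw [Fin.sum_univ_eq_sum_range (fun i => Zzeta.zeta p ^ i) p]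
    exact Subtype.ext (by
      rw [AddSubmonoidClass.coe_finsetSum]
      exact sum_zetaC hp)
  have h1 (j : Fin p) : K0.mk ⟨tPow p P.1 j, isMFfl_tPow hp hN P j⟩ =
      cls (mult (pinv p R) (eigen p P.1 (zet p R))) +
        if (j : ℕ) = 0 then adams hp hN (K0.mk P) else 0 := by
    rw [← cls_of, cls_tPow hp, adams_mk]
    split_ifs
    · abel
    · rw [add_zero]
  simp only [h1, add_tmul, Finset.sum_add_distrib, ← tmul_sum, h0, tmul_zero, zero_add]
  rw [Finset.sum_eq_single (⟨0, hp.pos⟩ : Fin p)]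
  · rw [if_pos rfl, pow_zero]
  · intro j _ hj
    rw [if_neg fun h => hj (Fin.ext h), zero_tmul]
  · simp

lemma existsUnique_adams : ∃! ψ : K0 R →+ K0 R, IsCyclicAdams p R (isMFfl_tPow hp hN) ψ := by
  refine ⟨adams hp hN, isCyclicAdams_adams hp hN, fun ψ hψ => K0.hom_ext fun P => ?_⟩
  exact tmul_one_injective hp.ne_zero ((hψ P).trans (isCyclicAdams_adams hp hN P).symm)

lemma chi_adams_mk (P : MFfl R) : chi R (adams hp hN (K0.mk P)) =
    eul (eigen p P.1 1) - eul (eigen p P.1 (zet p R)) := by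
  have hu := algebraMap_inv_mul (R := R) hp.ne_zero
  have h (l : R) (hl : l ^ p = 1) : chi R (cls (mult (pinv p R) (eigen p P.1 l))) =
      eul (eigen p P.1 l) := by
    rw [cls_of (isMFfl_eigen hu P.2.finite P.2.projective (hN P) hp.ne_zero hu hl), chi_mk]
    exact eul_mult hu _
  rw [adams_mk, map_sub, h 1 (one_pow p), h _ (algebraMap_zeta_pow hp.ne_zero)]

/-- If all objects of `mf` are locally null homotopic and the Euler characteristics of the
eigenspaces satisfy the expected formula, then so does the cyclic Adams operation. -/
lemma chi_adams {d : ℕ} (h : ∀ P : MFfl R, eul (eigen p P.1 1) - eul (eigen p P.1 (zet p R)) =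
    (p : ℤ) ^ d * eul P.1) (x : K0 R) : chi R (adams hp hN x) = (p : ℤ) ^ d * chi R x := by
  have : (chi R).comp (adams hp hN) = (AddMonoidHom.mulLeft ((p : ℤ) ^ d)).comp (chi R) :=
    K0.hom_ext fun P => by
      rw [AddMonoidHom.comp_apply, AddMonoidHom.comp_apply, chi_adams_mk, h, chi_mk]
      rfl
  exact DFunLike.congr_fun this x

end AdamsOperation
end
end CyclicAdams

namespace CyclicAdams
open scoped Fin.NatCast Fin.CommRing
noncomputable section

/-! ### Regular local rings: a regular sequence of parameters and finite global dimension. -/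

section RegularLocal

open IsLocalRing RingTheory.Sequence

/-! ### Regular local rings have finite global dimension -/

/-- Exchange: if all coefficients of `x` in terms of the generators were nonunits, `x` would lie in
the square of the maximal ideal. A generator with unit coefficient can therefore be replaced by `x`.
-/
lemma exists_span_insert_succAbove_eq {R : Type u} [CommRing R] [IsLocalRing R] {n : ℕ}
    {f : Fin (n + 1) → R} (hf : Ideal.span (Set.range f) = maximalIdeal R) {x : R}
    (hx : x ∈ maximalIdeal R) (hx2 : x ∉ maximalIdeal R * maximalIdeal R) :
    ∃ i : Fin (n + 1), Ideal.span {x} ⊔ Ideal.span (Set.range fun j => f (i.succAbove j)) =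
      maximalIdeal R := by
  have hfm (i) : f i ∈ maximalIdeal R := hf ▸ Ideal.subset_span ⟨i, rfl⟩
  have hx' := hx
  rw [← hf] at hx'
  obtain ⟨a, ha⟩ := (Ideal.mem_span_range_iff_exists_fun).1 hx'
  have : ∃ i, IsUnit (a i) := by
    by_contra! h
    refine hx2 (ha ▸ Ideal.sum_mem _ fun i _ => Ideal.mul_mem_mul ?_ (hfm i))
    exact (mem_maximalIdeal _).2 (h i)
  obtain ⟨i, b, hb⟩ := this
  refine ⟨i, le_antisymm ?_ ?_⟩
  · refine sup_le ((Ideal.span_singleton_le_iff_mem _).2 hx) (Ideal.span_le.2 ?_)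
    rintro _ ⟨j, rfl⟩
    exact hfm _
  · rw [← hf, Ideal.span_le]
    have hj (j) : f (i.succAbove j) ∈
        Ideal.span {x} ⊔ Ideal.span (Set.range fun j => f (i.succAbove j)) :=
      Ideal.mem_sup_right (Ideal.subset_span ⟨j, rfl⟩)
    rintro _ ⟨j, rfl⟩
    obtain rfl | ⟨k, rfl⟩ := Fin.eq_self_or_eq_succAbove i j
    · rw [Fin.sum_univ_succAbove _ j, ← hb] at ha
      have e : f j = ↑b⁻¹ * (x - ∑ k, a (j.succAbove k) * f (j.succAbove k)) := by
        rw [← ha, add_sub_cancel_right, ← mul_assoc, Units.inv_mul, one_mul]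
      change f j ∈ _
      rw [e]
      refine Ideal.mul_mem_left _ _ (Ideal.sub_mem _ ?_ ?_)
      · exact Ideal.mem_sup_left (Ideal.mem_span_singleton_self x)
      · exact Ideal.sum_mem _ fun k _ => Ideal.mul_mem_left _ _ (hj k)
    · exact hj k

/-- Prime avoidance, in which the square of the maximal ideal is admitted as a nonprime member. If
the maximal ideal were contained in its square it would vanish by Nakayama, and if it were contained
in a minimal prime it would have height zero; both contradict positive dimension. -/
lemma exists_mem_notMem_sq {R : Type u} [CommRing R] [IsLocalRing R] [IsNoetherianRing R]
    (h : 1 ≤ ringKrullDim R) : ∃ x ∈ maximalIdeal R, x ∉ maximalIdeal R * maximalIdeal R ∧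
      ∀ q ∈ minimalPrimes R, x ∉ q := by
  by_contra! hc
  have hdim : ¬ ringKrullDim R ≤ 0 := fun h' => absurd (h.trans h') (by norm_num)
  have hfin := Ideal.finite_minimalPrimes_of_isNoetherianRing R ⊥
  have hsub : (maximalIdeal R : Set R) ⊆
      ⋃ i ∈ insert (maximalIdeal R * maximalIdeal R) (minimalPrimes R), (id i : Ideal R) := by
    intro x hx
    by_cases hx2 : x ∈ maximalIdeal R * maximalIdeal R
    · exact Set.mem_biUnion (Set.mem_insert _ _) hx2
    · obtain ⟨q, hq, hxq⟩ := hc x hx hx2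
      exact Set.mem_biUnion (Set.mem_insert_of_mem _ hq) hxq
  rw [Ideal.subset_union_prime_finite (hfin.insert _) (maximalIdeal R * maximalIdeal R)
    (maximalIdeal R * maximalIdeal R) (fun i hi hne _ => by
      obtain rfl | hi := hi
      · exact absurd rfl hne
      · exact Ideal.IsMinimalPrime.isPrime hi)] at hsub
  obtain ⟨q, rfl | hq, hle⟩ := hsub
  · have h0 : maximalIdeal R = ⊥ :=
      Submodule.eq_bot_of_le_smul_of_le_jacobson_bot (maximalIdeal R) (maximalIdeal R)
        (IsNoetherian.noetherian _) hle (jacobson_eq_maximalIdeal ⊥ bot_ne_top).ge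
    apply hdim
    rw [← maximalIdeal_height_eq_ringKrullDim, h0]
    have : (⊥ : Ideal R).IsPrime := h0 ▸ (inferInstance : (maximalIdeal R).IsPrime)
    have : (⊥ : Ideal R).height = 0 := by
      rw [Ideal.height_eq_zero_iff]
      exact ⟨⟨inferInstance, le_rfl⟩, fun _ _ _ => bot_le⟩
    rw [this]; rfl
  · have hqp := Ideal.IsMinimalPrime.isPrime hq
    have e : maximalIdeal R = q := le_antisymm hle (le_maximalIdeal hqp.ne_top)
    apply hdim
    rw [← maximalIdeal_height_eq_ringKrullDim, Ideal.height_eq_zero_iff.2 (e ▸ hq)]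
    rfl

/-- A minimal prime `q` inside the prime `(x)` satisfies q = xq, since `x` is not in `q`. Nakayama
gives q = 0. -/
lemma isDomain_of_isPrime_span_singleton {R : Type u} [CommRing R] [IsLocalRing R]
    [IsNoetherianRing R] {x : R} (hx : x ∈ maximalIdeal R) (hq : ∀ q ∈ minimalPrimes R, x ∉ q)
    (hp : (Ideal.span {x}).IsPrime) : IsDomain R := by
  obtain ⟨q, hqm, hqx⟩ := Ideal.exists_minimalPrimes_le (bot_le : ⊥ ≤ Ideal.span {x})
  have hqp := Ideal.IsMinimalPrime.isPrime hqm
  have h0 : q = ⊥ := by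
    refine Submodule.eq_bot_of_le_smul_of_le_jacobson_bot (maximalIdeal R) q
        (IsNoetherian.noetherian _) ?_ (jacobson_eq_maximalIdeal ⊥ bot_ne_top).ge
    intro y hy
    obtain ⟨a, rfl⟩ := Ideal.mem_span_singleton'.1 (hqx hy)
    have ha : a ∈ q := (hqp.mem_or_mem hy).resolve_right (hq q hqm)
    rw [mul_comm]
    exact Ideal.mul_mem_mul hx ha
  subst h0
  exact IsDomain.of_bot_isPrime R

/-- The inductive hypothesis asks only for `n` generators and dimension at least `n`, a condition
that survives division by a parameter. That the ring is a domain is proved along the way because it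
makes the chosen parameter a nonzerodivisor. -/
theorem exists_isWeaklyRegular_aux (n : ℕ) : ∀ (R : Type u) [CommRing R] [IsLocalRing R]
    [IsNoetherianRing R], (n : WithBot ℕ∞) ≤ ringKrullDim R → ∀ f : Fin n → R,
      Ideal.span (Set.range f) = maximalIdeal R → IsDomain R ∧
      ∃ l : List R, l.length = n ∧ IsWeaklyRegular R l ∧ Ideal.ofList l = maximalIdeal R := by
  induction n with
  | zero =>
    intro R _ _ _ _ f hf
    have h0 : maximalIdeal R = ⊥ := by rw [← hf, Set.range_eq_empty, Ideal.span_empty]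
    refine ⟨?_, [], rfl, IsWeaklyRegular.nil R R, by rw [Ideal.ofList_nil, h0]⟩
    have : (⊥ : Ideal R).IsPrime := h0 ▸ (inferInstance : (maximalIdeal R).IsPrime)
    exact IsDomain.of_bot_isPrime R
  | succ n ih =>
    intro R _ _ _ hdim f hf
    have h1 : 1 ≤ ringKrullDim R := le_trans (by exact_mod_cast Nat.le_add_left 1 n) hdim
    obtain ⟨x, hx, hx2, hxq⟩ := exists_mem_notMem_sq h1
    obtain ⟨i, hi⟩ := exists_span_insert_succAbove_eq hf hx hx2
    set mk := Ideal.Quotient.mk (Ideal.span {x})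
    have hsurj : Function.Surjective mk := Ideal.Quotient.mk_surjective
    have hne : Ideal.span {x} ≠ ⊤ := fun e => by
      rw [Ideal.span_singleton_eq_top] at e
      exact (mem_maximalIdeal x).1 hx e
    have : Nontrivial (R ⧸ Ideal.span {x}) := Ideal.Quotient.nontrivial_iff.2 hne
    have : IsLocalRing (R ⧸ Ideal.span {x}) := IsLocalRing.of_surjective' mk hsurj
    have hmap : (maximalIdeal R).map mk = maximalIdeal (R ⧸ Ideal.span {x}) := by
      have := (IsLocalHom.of_surjective mk hsurj)
      exact IsLocalRing.map_maximalIdeal_of_surjective mk hsurj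
    have hker : RingHom.ker mk = Ideal.span {x} := Ideal.mk_ker
    have hcomap (I : Ideal R) (hI : Ideal.span {x} ≤ I) : (I.map mk).comap mk = I := by
      rw [Ideal.comap_map_of_surjective mk hsurj, ← RingHom.ker_eq_comap_bot, hker,
        sup_eq_left.2 hI]
    -- Dividing by one element of the maximal ideal lowers the dimension by at most one.
    have hdim' : (n : WithBot ℕ∞) ≤ ringKrullDim (R ⧸ Ideal.span {x}) := by
      have h2 := Ideal.height_le_ringKrullDim_quotient_add_one hx
      rw [maximalIdeal_height_eq_ringKrullDim] at h2
      have h3 := hdim.trans h2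
      rw [Nat.cast_succ] at h3
      exact ENat.WithBot.add_le_add_one_right_iff.1 h3
    obtain ⟨hdom, l, hl, hreg, hgen⟩ := ih (R ⧸ Ideal.span {x}) hdim'
      (fun j => mk (f (i.succAbove j))) (by
        rw [← hmap, ← hi, Ideal.map_sup, Ideal.map_span, Ideal.map_span, Set.image_singleton,
          Ideal.Quotient.eq_zero_iff_mem.2 (Ideal.mem_span_singleton_self x),
          Ideal.span_singleton_eq_bot.2 rfl, bot_sup_eq, ← Set.range_comp]
        rfl)
    have hRd : IsDomain R := isDomain_of_isPrime_span_singleton hx hxq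
      ((Ideal.Quotient.isDomain_iff_prime _).1 hdom)
    have hx0 : x ≠ 0 := fun e => hx2 (e ▸ zero_mem _)
    refine ⟨hRd, x :: l.map (Function.surjInv hsurj), by simp [hl], ?_, ?_⟩
    · rw [isWeaklyRegular_cons_iff]
      refine ⟨fun a b h => mul_left_cancel₀ hx0 h, ?_⟩
      let e : QuotSMulTop x R ≃ₗ[R] R ⧸ Ideal.span {x} :=
        Submodule.quotEquivOfEq _ _ (by
          rw [← Submodule.ideal_span_singleton_smul, smul_eq_mul, Ideal.mul_top])
      rw [e.isWeaklyRegular_congr, ← isWeaklyRegular_map_algebraMap_iff (R ⧸ Ideal.span {x})]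
      convert! hreg
      rw [List.map_map]
      conv_rhs => rw [← List.map_id l]
      exact List.map_congr_left fun a _ => Function.surjInv_eq hsurj a
    · have h3 : (Ideal.ofList (x :: l.map (Function.surjInv hsurj))).map mk =
          maximalIdeal (R ⧸ Ideal.span {x}) := by
        rw [← hgen, Ideal.map_ofList, List.map_cons, List.map_map, Ideal.ofList_cons,
          Ideal.Quotient.eq_zero_iff_mem.2 (Ideal.mem_span_singleton_self x),
          Ideal.span_singleton_eq_bot.2 rfl, bot_sup_eq]
        congr 1
        conv_rhs => rw [← List.map_id l]
        exact List.map_congr_left fun a _ => Function.surjInv_eq hsurj a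
      rw [← hcomap (Ideal.ofList (x :: l.map (Function.surjInv hsurj)))
        (by rw [Ideal.ofList_cons]; exact le_sup_left), h3, ← hmap,
        hcomap _ ((Ideal.span_singleton_le_iff_mem _).2 hx)]

lemma exists_isWeaklyRegular (R : Type u) [CommRing R] [IsRegularLocalRing R] {d : ℕ}
    (hd : ringKrullDim R = d) : ∃ l : List R, l.length = d ∧ IsWeaklyRegular R l ∧
      Ideal.ofList l = maximalIdeal R := by
  have hs := IsRegularLocalRing.spanFinrank_maximalIdeal (R := R)
  rw [hd] at hs
  have hs : (maximalIdeal R).spanFinrank = d := by exact_mod_cast hs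
  obtain ⟨s, hs1, hs2⟩ := Submodule.FG.exists_span_set_encard_eq_spanFinrank
    (IsNoetherian.noetherian (maximalIdeal R))
  rw [hs] at hs1
  have hfin : s.Finite := Set.finite_of_encard_eq_coe hs1
  have := hfin.to_subtype
  have hc : Nat.card s = d := by
    have := hfin.cast_ncard_eq
    rw [hs1] at this
    exact_mod_cast this
  let e : Fin d ≃ s := (finCongr hc.symm).trans (Finite.equivFin s).symm
  refine (exists_isWeaklyRegular_aux d R hd.ge (fun i => (e i : R)) ?_).2
  rw [← hs2]
  congr 1
  have : (fun i => (e i : R)) = Subtype.val ∘ e := rfl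
  rw [this, Set.range_comp, e.surjective.range_eq, Set.image_univ, Subtype.range_val]

open Abelian in
/-- `Ext^i(N, L) = 0` for all finitely generated `L` and all `i > d`. -/
def ExtVanish (R : Type u) [CommRing R] (d : ℕ) (N : Type u) [AddCommGroup N] [Module R N] : Prop :=
  ∀ (L : ModuleCat.{u} R) [Module.Finite R L] (i : ℕ), d < i →
    Subsingleton (Ext (ModuleCat.of R N) L i)

lemma shortExact_of_exact {R : Type u} [CommRing R] {A B C : Type u} [AddCommGroup A] [Module R A]
    [AddCommGroup B] [Module R B] [AddCommGroup C] [Module R C] {f : A →ₗ[R] B} {g : B →ₗ[R] C}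
    (hf : Function.Injective f) (hg : Function.Surjective g) (hfg : Function.Exact f g) :
    (ShortComplex.mk (ModuleCat.ofHom f) (ModuleCat.ofHom g)
      (ModuleCat.hom_ext hfg.linearMap_comp_eq_zero)).ShortExact where
  exact := (ShortComplex.moduleCat_exact_iff _).2 fun x hx => (hfg x).1 hx
  mono_f := (ModuleCat.mono_iff_injective _).2 hf
  epi_g := (ModuleCat.epi_iff_surjective _).2 hg

open Abelian

lemma ExtVanish.of_equiv {R : Type u} [CommRing R] {d : ℕ} {N N' : Type u} [AddCommGroup N]
    [Module R N] [AddCommGroup N'] [Module R N'] (e : N ≃ₗ[R] N') (h : ExtVanish R d N) :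
    ExtVanish R d N' := fun L _ i hi => by
  have := h L i hi
  refine ⟨fun a b => ?_⟩
  have key (a : Ext (ModuleCat.of R N') L i) : a = (Ext.mk₀ e.toModuleIso.inv).comp
      ((Ext.mk₀ e.toModuleIso.hom).comp a (zero_add i)) (zero_add i) := by
    rw [Ext.mk₀_comp_mk₀_assoc, Iso.inv_hom_id, Ext.mk₀_id_comp]
  rw [key a, key b, Subsingleton.elim ((Ext.mk₀ e.toModuleIso.hom).comp a (zero_add i))]

lemma ExtVanish.of_exact {R : Type u} [CommRing R] {d : ℕ} {A B C : Type u} [AddCommGroup A]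
    [Module R A] [AddCommGroup B] [Module R B] [AddCommGroup C] [Module R C] {f : A →ₗ[R] B}
    {g : B →ₗ[R] C} (hf : Function.Injective f) (hg : Function.Surjective g)
    (hfg : Function.Exact f g) (hA : ExtVanish R d A) (hC : ExtVanish R d C) :
    ExtVanish R d B := fun L _ i hi => by
  have h1 := hA L i hi
  have h3 := hC L i hi
  refine subsingleton_of_forall_eq 0 fun b => ?_
  obtain ⟨c, hc⟩ := Ext.contravariant_sequence_exact₂ (shortExact_of_exact hf hg hfg) L b
    (Subsingleton.elim (α := Ext (ModuleCat.of R A) L i) _ _)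
  rw [← hc, Subsingleton.elim (α := Ext (ModuleCat.of R C) L i) c 0, Ext.comp_zero]

/-- In the long exact sequence of multiplication by `x`, vanishing of the next Ext of the quotient
makes `x` surjective on Ext^i(N, L). This module is finitely generated, so Nakayama kills it. -/
lemma ExtVanish.of_isSMulRegular {R : Type u} [CommRing R] [IsLocalRing R] [IsNoetherianRing R]
    {d : ℕ} {N : Type u} [AddCommGroup N] [Module R N] [Module.Finite R N] {x : R}
    (hx : x ∈ maximalIdeal R) (hreg : IsSMulRegular N x)
    (h : ExtVanish R d (N ⧸ LinearMap.range (LinearMap.lsmul R N x))) :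
    ExtVanish R d N := fun L _ i hi => by
  have h3 := h L (1 + i) (by omega)
  have hS := shortExact_of_exact (R := R) (f := LinearMap.lsmul R N x) (g := Submodule.mkQ _) hreg
    (Submodule.mkQ_surjective _) (LinearMap.exact_map_mkQ_range _)
  have : Module.Finite R (ModuleCat.of R N) := ‹_›
  have htop : (⊤ : Submodule R (Ext (ModuleCat.of R N) L i)) = ⊥ := by
    refine Submodule.eq_bot_of_le_smul_of_le_jacobson_bot (maximalIdeal R) _
      (IsNoetherian.noetherian _) ?_ (jacobson_eq_maximalIdeal ⊥ bot_ne_top).ge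
    intro a _
    obtain ⟨b, hb⟩ := Ext.contravariant_sequence_exact₁ hS L a rfl (Subsingleton.elim
      (α := Ext (ModuleCat.of R (N ⧸ LinearMap.range (LinearMap.lsmul R N x))) L (1 + i)) _ _)
    have e : ModuleCat.ofHom (LinearMap.lsmul R N x) = x • 𝟙 (ModuleCat.of R N) := rfl
    have hb' : (Ext.mk₀ (ModuleCat.ofHom (LinearMap.lsmul R N x))).comp b (zero_add i) = a := hb
    rw [e, Ext.mk₀_smul, Ext.smul_comp, Ext.mk₀_id_comp] at hb'
    rw [← hb']
    exact Submodule.smul_mem_smul hx Submodule.mem_top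
  exact (Submodule.subsingleton_iff R).1 (subsingleton_of_bot_eq_top htop.symm)

/-- Noetherian induction on an ideal contained in the annihilator, combined with prime filtrations.
For a nonmaximal prime `q`, an element of the maximal ideal outside `q` is regular on the quotient
by `q`, and dividing by it enlarges the annihilator. What remains is the residue field. -/
theorem extVanish_of_finite {R : Type u} [CommRing R] [IsLocalRing R] [IsNoetherianRing R]
    {d : ℕ} (hk : ExtVanish R d (R ⧸ maximalIdeal R)) (I : Ideal R) :
    ∀ (N : Type u) [AddCommGroup N] [Module R N] [Module.Finite R N],
      I ≤ Module.annihilator R N → ExtVanish R d N := by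
  induction I using IsNoetherian.induction with
  | hgt I ih =>
  intro N _ _ hfin
  refine IsNoetherianRing.induction_on_isQuotientEquivQuotientPrime R hfin
    (motive := fun N _ _ _ => I ≤ Module.annihilator R N → ExtVanish R d N) ?_ ?_ ?_
  · intro N _ _ _ _ _ L _ i hi
    refine subsingleton_of_forall_eq 0 fun a => ?_
    rw [← Ext.mk₀_id_comp a, (ModuleCat.isZero_of_subsingleton (ModuleCat.of R N)).eq_of_src
      (𝟙 _) 0, Ext.mk₀_zero, Ext.zero_comp]
  · intro N _ _ _ q e hI
    have hq := q.2
    refine ExtVanish.of_equiv e.symm ?_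
    rw [e.annihilator_eq, Ideal.annihilator_quotient] at hI
    obtain hlt | rfl := hI.lt_or_eq
    · exact ih _ hlt _ (Ideal.annihilator_quotient).ge
    obtain hlt | heq := (le_maximalIdeal hq.ne_top).lt_or_eq
    · obtain ⟨x, hx, hxq⟩ := SetLike.exists_of_lt hlt
      refine ExtVanish.of_isSMulRegular hx ?_ (ih (q.1 ⊔ Ideal.span {x}) ?_ _ ?_)
      · refine isSMulRegular_iff_right_eq_zero_of_smul.2 fun a ha => ?_
        obtain ⟨a, rfl⟩ := Ideal.Quotient.mk_surjective a
        change Ideal.Quotient.mk q.1 (x * a) = 0 at ha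
        rw [Ideal.Quotient.eq_zero_iff_mem] at ha ⊢
        exact (hq.mem_or_mem ha).resolve_left hxq
      · refine lt_of_le_of_ne le_sup_left fun e => hxq ?_
        rw [e]
        exact Ideal.mem_sup_right (Ideal.mem_span_singleton_self x)
      · refine sup_le ?_ ((Ideal.span_singleton_le_iff_mem _).2 ?_)
        · intro y hy
          refine Module.mem_annihilator.2 fun m => ?_
          obtain ⟨m, rfl⟩ := Submodule.mkQ_surjective _ m
          obtain ⟨a, rfl⟩ := Ideal.Quotient.mk_surjective m
          rw [← map_smul]
          have : y • (Ideal.Quotient.mk q.1 a) = 0 :=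
            Ideal.Quotient.eq_zero_iff_mem.2 (Ideal.mul_mem_right _ _ hy)
          rw [this, map_zero]
        · refine Module.mem_annihilator.2 fun m => ?_
          obtain ⟨m, rfl⟩ := Submodule.mkQ_surjective _ m
          rw [← map_smul]
          exact (Submodule.Quotient.mk_eq_zero _).2 ⟨m, rfl⟩
    · rw [heq]; exact hk
  · intro A _ _ _ B _ _ _ C _ _ _ f g hf hg hfg hA hC hB
    exact ExtVanish.of_exact hf hg hfg
      (hA (hB.trans (f.annihilator_le_of_injective hf)))
      (hC (hB.trans (g.annihilator_le_of_surjective hg)))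

/-- The residue field is the quotient by a regular sequence of length `d`, so it has projective
dimension `d`; dévissage carries the bound to every finitely generated module. -/
theorem hasProjectiveDimensionLT_of_isRegularLocalRing (R : Type u) [CommRing R]
    [IsRegularLocalRing R] {d : ℕ} (hd : ringKrullDim R = d) (M : ModuleCat.{u} R)
    [Module.Finite R M] : HasProjectiveDimensionLT M (d + 1) := by
  obtain ⟨l, hl, hreg, hgen⟩ := exists_isWeaklyRegular R hd
  have hpd := ModuleCat.projectiveDimension_quotient_eq_add_length_of_isWeaklyRegular
    (ModuleCat.of R R) l hreg (fun r hr => hgen ▸ Ideal.subset_span hr)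
  have hle : HasProjectiveDimensionLE (ModuleCat.of R (R ⧸ Ideal.ofList l • (⊤ : Submodule R R)))
      d := by
    rw [← projectiveDimension_le_iff]
    refine hpd.le.trans ?_
    rw [ModuleCat.projectiveDimension_eq_zero_of_projective, hl, zero_add]
  have hk : ExtVanish R d (R ⧸ Ideal.ofList l • (⊤ : Submodule R R)) := fun L _ i hi =>
    HasProjectiveDimensionLT.subsingleton _ (d + 1) i hi L
  have hk' : ExtVanish R d (R ⧸ maximalIdeal R) :=
    hk.of_equiv (Submodule.quotEquivOfEq _ _ (by rw [hgen, smul_eq_mul, Ideal.mul_top]))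
  exact ModuleCat.hasProjectiveDimensionLT_of_forall_finite M (d + 1) fun L _ =>
    extVanish_of_finite hk' ⊥ M bot_le L (d + 1) (Nat.lt_succ_self d)

end RegularLocal
end
end CyclicAdams

namespace CyclicAdams
open scoped Fin.NatCast Fin.CommRing
noncomputable section

/-! ### Null homotopic powers of scalars that kill the homology. -/

section LocalNullity

open Abelian

variable {R : Type u} [CommRing R]

/-! ### Homology as a quotient module -/

/-- The cycles of degree `i`. -/
abbrev cyc (X : Cx R) (i : ZMod 2) : Submodule R (X.X i) := LinearMap.ker (X.d i (i + 1)).hom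

/-- The boundaries of degree `i`. -/
abbrev bdry (X : Cx R) (i : ZMod 2) : Submodule R (X.X i) := LinearMap.range (X.d (i + 1) i).hom

lemma bdry_le_cyc (X : Cx R) (i : ZMod 2) : bdry X i ≤ cyc X i := by
  rintro _ ⟨y, rfl⟩
  exact congrArg (fun f => f.hom y) (X.d_comp_d (i + 1) i (i + 1))

/-- The homology module of degree `i` is the quotient of the cycles by the boundaries. -/
def homologyEquiv (X : Cx R) (i : ZMod 2) :
    X.homology i ≃ₗ[R] cyc X i ⧸ (bdry X i).submoduleOf (cyc X i) :=
  ((X.homologyIsoSc' (i + 1) i (i + 1) ((ComplexShape.up (ZMod 2)).prev_eq' (add_one_add_one i))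
    ((ComplexShape.up (ZMod 2)).next_eq' rfl)).toLinearEquiv.trans
    (ShortComplex.moduleCatHomologyIso _).toLinearEquiv).trans
    (Submodule.quotEquivOfEq _ _ (by
      ext z
      change _ ↔ z.1 ∈ bdry X i
      constructor
      · rintro ⟨y, rfl⟩
        exact ⟨y, rfl⟩
      · rintro ⟨y, hy⟩
        exact ⟨y, Subtype.ext hy⟩))

lemma smul_mem_bdry {X : Cx R} {i : ZMod 2} {r : R} (h : ∀ x : X.homology i, r • x = 0)
    {z : X.X i} (hz : z ∈ cyc X i) : r • z ∈ bdry X i := by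
  have e := congrArg (homologyEquiv X i) (h ((homologyEquiv X i).symm (Submodule.mkQ _ ⟨z, hz⟩)))
  rw [map_smul, LinearEquiv.apply_symm_apply, map_zero, ← map_smul] at e
  exact (Submodule.Quotient.mk_eq_zero ((bdry X i).submoduleOf (cyc X i))).1 e

lemma IsFiniteLength.exists_pow_smul_eq_zero [IsLocalRing R] {M : Type*} [AddCommGroup M]
    [Module R M] (h : IsFiniteLength R M) {r : R} (hr : r ∈ IsLocalRing.maximalIdeal R) :
    ∃ n : ℕ, ∀ x : M, r ^ n • x = 0 := by
  induction h with
  | of_subsingleton => exact ⟨0, fun x => Subsingleton.elim _ _⟩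
  | @of_simple_quotient M _ _ N hs _ ih =>
    obtain ⟨n, hn⟩ := ih
    refine ⟨n + 1, fun x => ?_⟩
    have h1 : r • x ∈ N := by
      rw [← Submodule.Quotient.mk_eq_zero, Submodule.Quotient.mk_smul]
      have : Module.annihilator R (M ⧸ N) = IsLocalRing.maximalIdeal R :=
        IsLocalRing.eq_maximalIdeal IsSimpleModule.annihilator_isMaximal
      exact Module.mem_annihilator.1 (this ▸ hr) _
    rw [pow_succ, mul_smul]
    exact congrArg Subtype.val (hn ⟨r • x, h1⟩)

/-! ### Scalars killing `Ext` -/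

/-- The scalar `r` kills `Ext^j(A, Y)` for all `Y`. -/
def KillsExt (r : R) (j : ℕ) (A : ModuleCat.{u} R) : Prop :=
  ∀ (Y : ModuleCat.{u} R) (e : Ext A Y j), r • e = 0

lemma KillsExt.X₁ {S : ShortComplex (ModuleCat.{u} R)} (hS : S.ShortExact) {r : R} {j : ℕ}
    (hj : 1 ≤ j) (hp : Projective S.X₂) (h : KillsExt r (1 + j) S.X₃) : KillsExt r j S.X₁ := by
  intro Y e
  obtain ⟨k, rfl⟩ := Nat.exists_eq_add_of_le' hj
  obtain ⟨x, hx⟩ := Ext.contravariant_sequence_exact₁ hS Y (r • e) rfl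
    (by rw [Ext.comp_smul]; exact h Y _)
  rw [← hx, (Ext.subsingleton_of_projective S.X₂ Y k).elim x 0, Ext.comp_zero]

/-- For a class on the submodule, its multiple by `s` has zero image in the next Ext of the
quotient, since `s` kills the quotient. Hence it extends to the middle term, where `r` kills it. -/
lemma KillsExt.of_smul {S : ShortComplex (ModuleCat.{u} R)} (hS : S.ShortExact) {r s : R} {j : ℕ}
    (hs : ∀ x : S.X₃, s • x = 0) (h : KillsExt r j S.X₂) : KillsExt (r * s) j S.X₁ := by
  intro Y e
  have h3 (f : Ext S.X₃ Y (1 + j)) : s • f = 0 := by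
    have : s • 𝟙 S.X₃ = 0 := ModuleCat.hom_ext (LinearMap.ext hs)
    rw [← Ext.mk₀_id_comp f, ← Ext.smul_comp, ← Ext.mk₀_smul, this, Ext.mk₀_zero, Ext.zero_comp]
  obtain ⟨x, hx⟩ := Ext.contravariant_sequence_exact₁ hS Y (s • e) rfl
    (by rw [Ext.comp_smul]; exact h3 _)
  rw [mul_smul, ← hx, ← Ext.comp_smul, h Y x, Ext.comp_zero]

/-- The obstruction to lifting `r` times the identity through the epimorphism is `r` times the
extension class. -/
lemma KillsExt.exists_section {S : ShortComplex (ModuleCat.{u} R)} (hS : S.ShortExact) {r : R}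
    (h : KillsExt r 1 S.X₃) : ∃ s : S.X₃ ⟶ S.X₂, s ≫ S.g = r • 𝟙 S.X₃ := by
  obtain ⟨x, hx⟩ := Ext.covariant_sequence_exact₃ S.X₃ hS (Ext.mk₀ (r • 𝟙 S.X₃)) (zero_add 1)
    (by rw [Ext.mk₀_smul, Ext.smul_comp, Ext.mk₀_id_comp]; exact h _ _)
  obtain ⟨s, rfl⟩ := (Ext.mk₀_bijective _ _).2 x
  rw [Ext.mk₀_comp_mk₀] at hx
  exact ⟨s, (Ext.mk₀_bijective _ _).1 hx⟩

/-- Two steps: the sequence of cycles, chains and boundaries shifts dimension because the chains are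
projective, and the sequence of boundaries, cycles and homology costs one factor `s`. Together they
trade one degree of Ext for one factor `s`. -/
lemma KillsExt.bdry {X : Cx R} {r s : R} {j : ℕ} (hj : 1 ≤ j)
    (hp : ∀ i, Module.Projective R (X.X i)) (hs : ∀ i (x : X.homology i), s • x = 0)
    {i k : ZMod 2} (hik : i + 1 = k) (hki : k + 1 = i)
    (h : KillsExt r (1 + j) (ModuleCat.of R (LinearMap.range (X.d i k).hom))) :
    KillsExt (r * s) j (ModuleCat.of R (LinearMap.range (X.d k i).hom)) := by
  subst hik
  have hZ : KillsExt r j (ModuleCat.of R (cyc X i)) := by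
    have hS := shortExact_of_exact (f := (cyc X i).subtype)
      (g := (X.d i (i + 1)).hom.rangeRestrict) (Submodule.subtype_injective _)
      (LinearMap.surjective_rangeRestrict _) (by
        intro x
        simp [Subtype.ext_iff])
    have := hp i
    exact KillsExt.X₁ hS hj (inferInstanceAs (Projective (X.X i))) h
  have hS := shortExact_of_exact (f := Submodule.inclusion (bdry_le_cyc X i))
      (g := Submodule.mkQ ((CyclicAdams.bdry X i).submoduleOf (cyc X i)))
      (Submodule.inclusion_injective _) (Submodule.mkQ_surjective _) (by
        intro x
        rw [Submodule.mkQ_apply, Submodule.Quotient.mk_eq_zero]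
        change x.1 ∈ CyclicAdams.bdry X i ↔ _
        exact ⟨fun hx => ⟨⟨x.1, hx⟩, rfl⟩, fun ⟨y, hy⟩ => hy ▸ y.2⟩)
  refine KillsExt.of_smul hS (fun x => ?_) hZ
  have e := congrArg (homologyEquiv X i) (hs i ((homologyEquiv X i).symm x))
  rwa [map_smul, LinearEquiv.apply_symm_apply, map_zero] at e

/-- Descent from Ext^{n+1}, which vanishes by the bound on projective dimension, down to Ext^1; each
step contributes one factor `s` and swaps the two parities. -/
lemma KillsExt.bdry_pow {X : Cx R} {s : R}
    (hp : ∀ i, Module.Projective R (X.X i)) (hs : ∀ i (x : X.homology i), s • x = 0) {n : ℕ}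
    (hn : ∀ i k, HasProjectiveDimensionLT (ModuleCat.of R (LinearMap.range (X.d i k).hom)) (n + 1))
    (m : ℕ) : ∀ j, 1 ≤ j → j + m = n + 1 → ∀ i k : ZMod 2, i + 1 = k → k + 1 = i →
      KillsExt (s ^ m) j (ModuleCat.of R (LinearMap.range (X.d i k).hom)) := by
  induction m with
  | zero =>
    intro j _ hj i k _ _ Y e
    have := hn i k
    have := HasProjectiveDimensionLT.subsingleton
      (ModuleCat.of R (LinearMap.range (X.d i k).hom)) (n + 1) j (by omega) Y
    exact Subsingleton.elim _ _
  | succ m ih =>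
    intro j h1 hj i k hik hki
    rw [pow_succ]
    exact KillsExt.bdry h1 hp hs hki hik (ih (1 + j) (by omega) (by omega) k i hki hik)

lemma exists_section_of_pow_smul {X : Cx R} {s : R}
    (hp : ∀ i, Module.Projective R (X.X i)) (hs : ∀ i (x : X.homology i), s • x = 0) {n : ℕ}
    (hn : ∀ i k, HasProjectiveDimensionLT (ModuleCat.of R (LinearMap.range (X.d i k).hom)) (n + 1))
    {i k : ZMod 2} (hik : i + 1 = k) (hki : k + 1 = i) :
    ∃ σ : LinearMap.range (X.d i k).hom →ₗ[R] X.X i, ∀ y, (X.d i k).hom (σ y) = s ^ n • y.1 := by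
  have hS := shortExact_of_exact (f := (LinearMap.ker (X.d i k).hom).subtype)
      (g := (X.d i k).hom.rangeRestrict) (Submodule.subtype_injective _)
      (LinearMap.surjective_rangeRestrict _) (by
        intro x
        simp [Subtype.ext_iff])
  obtain ⟨σ, hσ⟩ := KillsExt.exists_section hS
    (KillsExt.bdry_pow hp hs hn n 1 le_rfl (by omega) i k hik hki)
  exact ⟨σ.hom, fun y => congrArg (fun f => (f.hom y : LinearMap.range (X.d i k).hom).1) hσ⟩

/-- A scalar killing the homology of a complex of projectives, the boundaries of which have finite
projective dimension, has a null homotopic power. -/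
theorem exists_null_pow {X : Cx R} {s : R}
    (hp : ∀ i, Module.Projective R (X.X i)) (hs : ∀ i (x : X.homology i), s • x = 0) {n : ℕ}
    (hn : ∀ i k, HasProjectiveDimensionLT (ModuleCat.of R (LinearMap.range (X.d i k).hom))
      (n + 1)) : Null (s ^ (2 * n + 1)) X := by
  have hσ (i k : ZMod 2) : ∃ σ : LinearMap.range (X.d i k).hom →ₗ[R] X.X i,
      i + 1 = k → ∀ y, (X.d i k).hom (σ y) = s ^ n • y.1 := by
    by_cases hik : i + 1 = k
    · obtain ⟨σ, h⟩ := exists_section_of_pow_smul hp hs hn hik (hik ▸ add_one_add_one i)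
      exact ⟨σ, fun _ => h⟩
    · exact ⟨0, fun h => absurd h hik⟩
  choose σ hσ using hσ
  have key (i k : ZMod 2) : ∃ h : X.X k →ₗ[R] X.X i, ∀ (hik : i + 1 = k) (hki : k + 1 = i) (y),
      ∃ hy : s • (s ^ n • y - σ k i ⟨(X.d k i).hom y, y, rfl⟩) ∈ LinearMap.range (X.d i k).hom,
        h y = σ i k ⟨_, hy⟩ := by
    by_cases hik : i + 1 = k
    · subst hik
      -- As σ splits the differential up to `s ^ n`, the element s^n y - σ(dy) is a cycle;
      -- multiplied by `s` it becomes a boundary, to which the other section can be applied.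
      let g : X.X (i + 1) →ₗ[R] X.X (i + 1) :=
        s • (s ^ n • LinearMap.id - σ (i + 1) i ∘ₗ (X.d (i + 1) i).hom.rangeRestrict)
      have hg (y) : g y ∈ LinearMap.range (X.d i (i + 1)).hom := by
        have hz : s ^ n • y - σ (i + 1) i ⟨(X.d (i + 1) i).hom y, y, rfl⟩ ∈ cyc X (i + 1) := by
          have e := hσ (i + 1) i (add_one_add_one i) ⟨(X.d (i + 1) i).hom y, y, rfl⟩
          have e1 : i + 1 + 1 = i := add_one_add_one i
          rw [cyc, e1, LinearMap.mem_ker, map_sub, map_smul]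
          exact sub_eq_zero.2 e.symm
        have := smul_mem_bdry (hs (i + 1)) hz
        rw [bdry, add_one_add_one i] at this
        exact this
      exact ⟨σ i (i + 1) ∘ₗ g.codRestrict _ hg, fun _ _ y => ⟨hg y, rfl⟩⟩
    · exact ⟨0, fun h => absurd h hik⟩
  choose h hh using key
  refine ⟨fun k i => h i k, fun i x => ?_⟩
  have hji := add_one_add_one i
  obtain ⟨m1, e1⟩ := hh i (i + 1) rfl hji ((X.d i (i + 1)).hom x)
  obtain ⟨m2, e2⟩ := hh (i + 1) i hji rfl x
  -- On a boundary dx the correction term vanishes, so the homotopy of dx is s^{n+1} σ(dx). The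
  -- differential of the homotopy of x is s^{n+1} (s^n x - σ(dx)). The terms with σ cancel and
  -- s^{2n+1} x remains.
  rw [e1, e2, hσ _ _ hji]
  have h0 : (X.d (i + 1) i).hom ((X.d i (i + 1)).hom x) = 0 :=
    congrArg (fun f => f.hom x) (X.d_comp_d i (i + 1) i)
  have e3 : (⟨_, m1⟩ : LinearMap.range (X.d i (i + 1)).hom) =
      s ^ (n + 1) • ⟨(X.d i (i + 1)).hom x, x, rfl⟩ := by
    refine Subtype.ext ?_
    change s • (s ^ n • (X.d i (i + 1)).hom x - σ (i + 1) i ⟨_, _⟩) = _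
    have : (⟨(X.d (i + 1) i).hom ((X.d i (i + 1)).hom x), (X.d i (i + 1)).hom x, rfl⟩ :
        LinearMap.range (X.d (i + 1) i).hom) = 0 := Subtype.ext h0
    rw [this, map_zero, sub_zero, smul_smul, ← pow_succ']
    rfl
  rw [e3, map_smul]
  change s ^ (n + 1) • _ + s ^ n • s • (s ^ n • x - _) = _
  rw [smul_smul (s ^ n) s, ← pow_succ, ← smul_add, add_sub_cancel, smul_smul, ← pow_add]
  congr 2
  omega

theorem locallyNull_of_isRegularLocalRing [IsRegularLocalRing R] {d : ℕ}
    (hd : ringKrullDim R = d) {X : Cx R} (hX : IsMFfl X) : LocallyNull X := fun r hr => by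
  obtain ⟨a, ha⟩ := IsFiniteLength.exists_pow_smul_eq_zero (hX.finiteLength 0) hr
  obtain ⟨b, hb⟩ := IsFiniteLength.exists_pow_smul_eq_zero (hX.finiteLength 1) hr
  refine ⟨(a + b) * (2 * d + 1), ?_⟩
  rw [pow_mul]
  refine exists_null_pow hX.projective (fun i x => ?_) fun i k => ?_
  · obtain rfl | rfl := zmod2_cases i
    · rw [add_comm, pow_add, mul_smul, ha, smul_zero]
    · rw [pow_add, mul_smul, hb, smul_zero]
  · have := hX.finite k
    exact hasProjectiveDimensionLT_of_isRegularLocalRing R hd _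

lemma Acyclic.null [IsRegularLocalRing R] {X : Cx R} (hX : IsMFfl X) (h : Acyclic X) :
    Null 1 X := by
  obtain ⟨d, hd⟩ : ∃ d : ℕ, ringKrullDim R = d :=
    ⟨_, (IsRegularLocalRing.spanFinrank_maximalIdeal (R := R)).symm⟩
  -- On an acyclic complex the scalar `1` kills the homology, so the general statement applies with
  -- `s = 1`.
  rw [← one_pow (2 * d + 1)]
  refine exists_null_pow hX.projective (fun i x => (h i).elim _ _) fun i k => ?_
  have := hX.finite k
  exact hasProjectiveDimensionLT_of_isRegularLocalRing R hd _

end LocalNullity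
end
end CyclicAdams

namespace CyclicAdams
open scoped Fin.NatCast Fin.CommRing
noncomputable section

/-! ### Reduction modulo an element: semilinear maps, tensor powers and eigenspaces. -/

section ChangeOfRings

/-! ### Semilinear maps of complexes -/

variable {R S : Type u} [CommRing R] [CommRing S] {φ : R →+* S}

lemma length_eq_of_semilinear {M N : Type*} [AddCommGroup M] [Module R M] [AddCommGroup N]
    [Module S N] (hφ : Function.Surjective φ) (f : M →ₛₗ[φ] N) (hf : Function.Bijective f) :
    Module.length R M = Module.length S N := by
  let := φ.toAlgebra
  let := Module.compHom N φ
  have : IsScalarTower R S N := ⟨fun r s n => by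
    change (φ r * s) • n = φ r • s • n
    rw [mul_smul]⟩
  let g : M →ₗ[R] N := { toFun := f, map_add' := f.map_add, map_smul' := f.map_smulₛₗ }
  have e : M ≃ₗ[R] N := LinearEquiv.ofBijective g hf
  rw [e.length_eq, Module.length_eq_of_surjective (R := S) hφ]

/-- The map on homology induced by a semilinear map of complexes. -/
def semiHomology {X : Cx R} {Y : Cx S} (ρ : ∀ i, X.X i →ₛₗ[φ] Y.X i)
    (hc : ∀ i j x, ρ j ((X.d i j).hom x) = (Y.d i j).hom (ρ i x)) (i : ZMod 2) :
    (cyc X i ⧸ (bdry X i).submoduleOf (cyc X i)) →ₛₗ[φ]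
      (cyc Y i ⧸ (bdry Y i).submoduleOf (cyc Y i)) :=
  Submodule.mapQ _ _ (((ρ i).domRestrict (cyc X i)).codRestrict (cyc Y i) fun x => by
    have := hc i (i + 1) x.1
    rw [x.2, map_zero] at this
    exact this.symm) fun x ⟨y, hy⟩ => ⟨ρ (i + 1) y, (hc (i + 1) i y).symm.trans (congrArg _ hy)⟩

lemma length_homology_semilinear (hφ : Function.Surjective φ) {X : Cx R} {Y : Cx S}
    (ρ : ∀ i, X.X i →ₛₗ[φ] Y.X i)
    (hc : ∀ i j x, ρ j ((X.d i j).hom x) = (Y.d i j).hom (ρ i x))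
    (hb : ∀ i, Function.Bijective (ρ i)) (i : ZMod 2) :
    Module.length R (X.homology i) = Module.length S (Y.homology i) := by
  rw [(homologyEquiv X i).length_eq, (homologyEquiv Y i).length_eq]
  refine length_eq_of_semilinear hφ (semiHomology ρ hc i) ⟨?_, fun y => ?_⟩
  · rw [injective_iff_map_eq_zero]
    intro x hx
    obtain ⟨z, rfl⟩ := Submodule.mkQ_surjective _ x
    obtain ⟨y, hy⟩ := (Submodule.Quotient.mk_eq_zero ((bdry Y i).submoduleOf (cyc Y i))).1 hx
    obtain ⟨w, rfl⟩ := (hb (i + 1)).2 y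
    exact (Submodule.Quotient.mk_eq_zero ((bdry X i).submoduleOf (cyc X i))).2
      ⟨w, (hb i).1 ((hc (i + 1) i w).trans hy)⟩
  · obtain ⟨⟨z, hz⟩, rfl⟩ := Submodule.mkQ_surjective _ y
    obtain ⟨w, rfl⟩ := (hb i).2 z
    refine ⟨Submodule.mkQ _ ⟨w, (hb (i + 1)).1 ?_⟩, rfl⟩
    rw [map_zero]
    exact (hc i (i + 1) w).trans hz

/-- Restriction of scalars of complexes. -/
def resCx (φ : R →+* S) (Y : Cx S) : Cx R :=
  let := fun i => Module.compHom (Y.X i) φ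
  mkCx (fun i => Y.X i)
    (fun i j => { toFun := (Y.d i j).hom, map_add' := (Y.d i j).hom.map_add,
                  map_smul' := fun r x => (Y.d i j).hom.map_smul (φ r) x })
    (fun i j h => LinearMap.ext fun x => congrArg (fun f => f.hom x) (Y.shape i j h))
    fun i j k x => d_d_apply Y i j k x

lemma length_homology_resCx (hφ : Function.Surjective φ) (Y : Cx S) (i : ZMod 2) :
    Module.length R ((resCx φ Y).homology i) = Module.length S (Y.homology i) :=
  length_homology_semilinear (φ := φ) (X := resCx φ Y) (Y := Y) hφ
    (fun _ => { toFun := fun y => y, map_add' := fun _ _ => rfl, map_smul' := fun _ _ => rfl })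
    (fun _ _ _ => rfl) (fun _ => Function.bijective_id) i

lemma eul_resCx (hφ : Function.Surjective φ) (Y : Cx S) : eul (resCx φ Y) = eul Y := by
  simp only [eul, length_homology_resCx hφ]

lemma finLen_resCx (hφ : Function.Surjective φ) {Y : Cx S} (h : FinLen Y) :
    FinLen (resCx φ Y) := by
  rw [finLen_iff] at *
  intro i
  rw [length_homology_resCx hφ]
  exact h i

lemma exists_shortExact_resCx {X' X : Cx R} {Y : Cx S} (f : X' ⟶ X)
    (g : ∀ i, X.X i →ₛₗ[φ] Y.X i)
    (hc : ∀ i j x, g j ((X.d i j).hom x) = (Y.d i j).hom (g i x))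
    (hf : ∀ i, Function.Injective (f.f i).hom) (hg : ∀ i, Function.Surjective (g i))
    (w : ∀ i x, g i ((f.f i).hom x) = 0)
    (ex : ∀ i y, g i y = 0 → ∃ x, (f.f i).hom x = y) :
    ∃ (g' : X ⟶ resCx φ Y) (w : f ≫ g' = 0), (ShortComplex.mk f g' w).ShortExact :=
  ⟨_, shortExact_of f (Z := resCx φ Y)
    (mkHom (Y := resCx φ Y) (fun i =>
      { toFun := g i, map_add' := (g i).map_add, map_smul' := (g i).map_smulₛₗ })
      fun i x => hc i (i + 1) x) hf hg w ex⟩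

lemma gradedCx_shortExact_resCx {T T' T'' : Type u} [AddCommGroup T] [Module R T] [AddCommGroup T']
    [Module R T'] [AddCommGroup T''] [Module S T'']
    {D : Module.End R T} {U : ZMod 2 → Submodule R T} {hS : ∀ k, ∀ t ∈ U k, D t ∈ U (k + 1)}
    {hD : ∀ k, ∀ t ∈ U k, D (D t) = 0} {D' : Module.End R T'} {U' : ZMod 2 → Submodule R T'}
    {hS' : ∀ k, ∀ t ∈ U' k, D' t ∈ U' (k + 1)} {hD' : ∀ k, ∀ t ∈ U' k, D' (D' t) = 0}
    {D'' : Module.End S T''} {U'' : ZMod 2 → Submodule S T''}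
    {hS'' : ∀ k, ∀ t ∈ U'' k, D'' t ∈ U'' (k + 1)} {hD'' : ∀ k, ∀ t ∈ U'' k, D'' (D'' t) = 0}
    (f : T →ₗ[R] T') (g : T' →ₛₗ[φ] T'') (h1 : ∀ k, ∀ t ∈ U k, f t ∈ U' k)
    (h2 : ∀ k, ∀ t ∈ U' k, g t ∈ U'' k) (hc1 : ∀ k, ∀ t ∈ U k, f (D t) = D' (f t))
    (hc2 : ∀ k, ∀ t ∈ U' k, g (D' t) = D'' (g t)) (hf : ∀ k, ∀ t ∈ U k, f t = 0 → t = 0)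
    (hg : ∀ k, ∀ t ∈ U'' k, ∃ s ∈ U' k, g s = t) (h0 : ∀ k, ∀ t ∈ U k, g (f t) = 0)
    (hex : ∀ k, ∀ t ∈ U' k, g t = 0 → ∃ s ∈ U k, f s = t) :
    ∃ s : ShortComplex (Cx R), s.ShortExact ∧ s.X₁ = gradedCx D U hS hD ∧
      s.X₂ = gradedCx D' U' hS' hD' ∧ s.X₃ = resCx φ (gradedCx D'' U'' hS'' hD'') := by
  suffices h : ∃ (g' : gradedCx D' U' hS' hD' ⟶ resCx φ (gradedCx D'' U'' hS'' hD''))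
      (w : gradedHom (hS := hS) (hD := hD) (hS' := hS') (hD' := hD') f h1 hc1 ≫ g' = 0),
      (ShortComplex.mk _ g' w).ShortExact by
    obtain ⟨g', w, h⟩ := h
    exact ⟨_, h, rfl, rfl, rfl⟩
  refine exists_shortExact_resCx
    (gradedHom (hS := hS) (hD := hD) (hS' := hS') (hD' := hD') f h1 hc1)
    (fun i => (g.domRestrict (U' i)).codRestrict (U'' i) fun x => h2 i _ x.2)
    (fun i j (x : U' i) => ?_)
    (fun i => (injective_iff_map_eq_zero _).2 fun x hx => Subtype.ext
      (hf i _ x.2 (congrArg (Subtype.val (p := (· ∈ U' i))) hx)))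
    (fun i x => by
      obtain ⟨s, hs, hst⟩ := hg i _ x.2
      exact ⟨⟨s, hs⟩, Subtype.ext hst⟩)
    (fun i x => Subtype.ext (h0 i _ x.2))
    (fun i y hy => by
      obtain ⟨s, hs, hst⟩ := hex i _ y.2 (congrArg (Subtype.val (p := (· ∈ U'' i))) hy)
      exact ⟨⟨s, hs⟩, Subtype.ext hst⟩)
  by_cases hij : i + 1 = j
  · refine Subtype.ext ?_
    have e1 := coe_gradedCx_d (hS := hS') (hD := hD') hij x
    have e2 := coe_gradedCx_d (hS := hS'') (hD := hD'') hij
      (((g.domRestrict (U' i)).codRestrict (U'' i) fun x => h2 i _ x.2) x)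
    exact (congrArg g e1).trans ((hc2 i _ x.2).trans e2.symm)
  · have e1 : (gradedCx D' U' hS' hD').d i j = 0 := (gradedCx D' U' hS' hD').shape i j hij
    have e2 : (gradedCx D'' U'' hS'' hD'').d i j = 0 :=
      (gradedCx D'' U'' hS'' hD'').shape i j hij
    rw [e1, e2]
    exact map_zero _

/-! ### Tensor powers of semilinear maps -/

section TensorMap

variable {p : ℕ} {V : Type u} {V' : Type u} [AddCommGroup V] [Module R V] [AddCommGroup V']
  [Module S V']

/-- The tensor power of a semilinear map. -/
def tmap (p : ℕ) (ρ : V →ₛₗ[φ] V') : (⨂[R] _ : Fin p, V) →ₛₗ[φ] (⨂[S] _ : Fin p, V') :=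
  let := φ.toAlgebra
  let f : (⨂[R] _ : Fin p, V) →ₗ[R] (⨂[S] _ : Fin p, V') := PiTensorProduct.lift
    { toFun := fun x => PiTensorProduct.tprod S fun i => ρ (x i)
      map_update_add' := fun x i a b => by
        have (c : V) : (fun j => ρ (Function.update x i c j)) =
            Function.update (fun j => ρ (x j)) i (ρ c) := Function.comp_update ρ x i c
        rw [this, this, this, map_add, MultilinearMap.map_update_add]
      map_update_smul' := fun x i r a => by
        have (c : V) : (fun j => ρ (Function.update x i c j)) =
            Function.update (fun j => ρ (x j)) i (ρ c) := Function.comp_update ρ x i c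
        rw [this, this, ρ.map_smulₛₗ, MultilinearMap.map_update_smul]
        exact algebraMap_smul S r (PiTensorProduct.tprod S _) }
  { toFun := f, map_add' := f.map_add,
    map_smul' := fun r x => (f.map_smul r x).trans (algebraMap_smul S r (f x)).symm }

lemma tmap_tprod (ρ : V →ₛₗ[φ] V') (x : Fin p → V) :
    tmap p ρ (PiTensorProduct.tprod R x) = PiTensorProduct.tprod S fun i => ρ (x i) := by
  let := φ.toAlgebra
  exact PiTensorProduct.lift.tprod (R := R) (E := ⨂[S] _ : Fin p, V') x

lemma tmap_surjective (ρ : V →ₛₗ[φ] V') (hφ : Function.Surjective φ)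
    (hρ : Function.Surjective ρ) : Function.Surjective (tmap p ρ) := by
  intro y
  induction y using PiTensorProduct.induction_on with
  | smul_tprod r y =>
    choose σ hσ using fun i => hρ (y i)
    obtain ⟨r, rfl⟩ := hφ r
    exact ⟨r • PiTensorProduct.tprod R σ, by rw [map_smulₛₗ, tmap_tprod]; simp only [hσ]⟩
  | add a b ha hb =>
    obtain ⟨a, rfl⟩ := ha
    obtain ⟨b, rfl⟩ := hb
    exact ⟨a + b, map_add _ _ _⟩

lemma tmap_ext {N : Type*} [AddCommGroup N] (f g : (⨂[R] _ : Fin p, V) →+ N)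
    (h : ∀ (r : R) (x : Fin p → V), f (r • PiTensorProduct.tprod R x) = g (r • PiTensorProduct.tprod R x)) : f = g := by
  refine AddMonoidHom.ext fun t => ?_
  induction t using PiTensorProduct.induction_on with
  | smul_tprod r y => exact h r y
  | add a b ha hb => rw [map_add, map_add, ha, hb]

lemma tmap_comm (ρ : V →ₛₗ[φ] V') (F : Module.End R (⨂[R] _ : Fin p, V))
    (G : Module.End S (⨂[S] _ : Fin p, V'))
    (h : ∀ x : Fin p → V, tmap p ρ (F (PiTensorProduct.tprod R x)) =
      G (PiTensorProduct.tprod S fun i => ρ (x i))) (t) : tmap p ρ (F t) = G (tmap p ρ t) := by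
  induction t using PiTensorProduct.induction_on with
  | smul_tprod r y => rw [map_smul, map_smulₛₗ, map_smulₛₗ, map_smul, h, tmap_tprod]
  | add a b ha hb => simp only [map_add, ha, hb]

lemma tmap_map (ρ : V →ₛₗ[φ] V') {f : Fin p → Module.End R V} {g : Fin p → Module.End S V'}
    (h : ∀ i v, ρ (f i v) = g i (ρ v)) (t) :
    tmap p ρ (PiTensorProduct.map f t) = PiTensorProduct.map g (tmap p ρ t) := by
  refine tmap_comm ρ (PiTensorProduct.map f) (PiTensorProduct.map g) (fun x => ?_) t
  rw [PiTensorProduct.map_tprod, PiTensorProduct.map_tprod, tmap_tprod]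
  simp only [h]

/-- The kernel of a tensor power: if the kernel of `ρ` is contained in `x V`, then that of its
tensor power is contained in `x (V ⊗ ⋯ ⊗ V)`. -/
lemma exists_of_tmap_eq_zero (hp : p ≠ 0) (ρ : V →ₛₗ[φ] V') (hφ : Function.Surjective φ)
    (hρ : Function.Surjective ρ) {x : R} (hx : ∀ v, ρ v = 0 → ∃ w, v = x • w)
    {t : ⨂[R] _ : Fin p, V} (ht : tmap p ρ t = 0) : ∃ s, t = x • s := by
  set q := (LinearMap.range (LinearMap.lsmul R (⨂[R] _ : Fin p, V) x)).mkQ with hq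
  have hqx (s) : q (x • s) = 0 := (Submodule.Quotient.mk_eq_zero _).2 ⟨s, rfl⟩
  let i0 : Fin p := ⟨0, Nat.pos_of_ne_zero hp⟩
  -- Modulo `x` a pure tensor depends only on the images of its entries under `ρ`: changing one
  -- entry within its fibre changes the tensor by a multiple of `x`.
  have step (y : Fin p → V) (i : Fin p) (b : V) (h : ρ (y i) = ρ b) :
      q (PiTensorProduct.tprod R y) = q (PiTensorProduct.tprod R (Function.update y i b)) := by
    obtain ⟨w, hw⟩ := hx (y i - b) (by rw [map_sub, h, sub_self])
    have : y = Function.update y i (b + x • w) := by rw [← hw, add_sub_cancel, Function.update_eq_self]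
    conv_lhs => rw [this]
    rw [MultilinearMap.map_update_add, MultilinearMap.map_update_smul, map_add, hqx, add_zero]
  have key (y z : Fin p → V) (h : ∀ i, ρ (y i) = ρ (z i)) :
      q (PiTensorProduct.tprod R y) = q (PiTensorProduct.tprod R z) := by
    have (s : Finset (Fin p)) : q (PiTensorProduct.tprod R y) =
        q (PiTensorProduct.tprod R (s.piecewise z y)) := by
      induction s using Finset.induction_on with
      | empty => rw [Finset.piecewise_empty]
      | insert i s hi ih =>
        rw [Finset.piecewise_insert, ih]
        exact step _ i (z i) (by rw [Finset.piecewise_eq_of_notMem _ _ _ hi, h])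
    rw [this Finset.univ, Finset.piecewise_univ]
  have key' (r r' : R) (y z : Fin p → V) (hr : φ r = φ r') (h : ∀ i, ρ (y i) = ρ (z i)) :
      q (r • PiTensorProduct.tprod R y) = q (r' • PiTensorProduct.tprod R z) := by
    -- The scalar is absorbed into the slot `i0`, which exists because `p ≠ 0`, so that fibres of
    -- `φ` are treated like fibres of `ρ`.
    rw [← Function.update_eq_self i0 y, ← Function.update_eq_self i0 z,
      ← MultilinearMap.map_update_smul, ← MultilinearMap.map_update_smul]
    refine key _ _ fun i => ?_
    by_cases hi : i = i0
    · subst hi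
      rw [Function.update_self, Function.update_self, map_smulₛₗ, map_smulₛₗ, hr, h]
    · rw [Function.update_of_ne hi, Function.update_of_ne hi, h]
  choose σ hσ using hρ
  choose τ hτ using hφ
  have upd (z : Fin p → V') (i : Fin p) (m : V') (b : V) (hb : ρ b = m) (j) :
      ρ (σ (Function.update z i m j)) = ρ (Function.update (fun j => σ (z j)) i b j) := by
    rw [hσ]
    by_cases hj : j = i
    · subst hj; rw [Function.update_self, Function.update_self, hb]
    · rw [Function.update_of_ne hj, Function.update_of_ne hj, hσ]
  -- A left inverse modulo `x`, built from arbitrary set-theoretic sections of `ρ` and `φ`. The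
  -- sections respect no structure, but by `key'` the class does not depend on the choice of lifts,
  -- so all relations of the tensor power hold.
  let β : (⨂[S] _ : Fin p, V') →+ _ := PiTensorProduct.liftAddHom
    (fun a : S × (Fin p → V') => q (τ a.1 • PiTensorProduct.tprod R fun i => σ (a.2 i)))
    (fun r z i hi => by
      rw [key' (τ r) (τ r) _ (Function.update (fun j => σ (z j)) i 0) rfl fun j => ?_]
      · rw [MultilinearMap.map_update_zero, smul_zero, map_zero]
      · conv_lhs => rw [← Function.update_eq_self i z]
        exact upd z i (z i) 0 (by rw [map_zero, hi]) j)
    (fun z => by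
      rw [key' (τ 0) 0 _ (fun j => σ (z j)) (by rw [hτ, map_zero]) fun _ => rfl, zero_smul,
        map_zero])
    (fun r z i m₁ m₂ => by
      rename_i inst
      obtain rfl := Subsingleton.elim inst (instDecidableEqFin p)
      have e1 := key' (τ r) (τ r) _ _ rfl (upd z i m₁ (σ m₁) (hσ _))
      have e2 := key' (τ r) (τ r) _ _ rfl (upd z i m₂ (σ m₂) (hσ _))
      have e3 := key' (τ r) (τ r) _ _ rfl (upd z i (m₁ + m₂) (σ m₁ + σ m₂)
        (by rw [map_add, hσ, hσ]))
      rw [MultilinearMap.map_update_add, smul_add, map_add] at e3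
      exact (congrArg₂ (· + ·) e1 e2).trans e3.symm)
    (fun r r' z => by
      rw [← map_add, ← add_smul]
      exact key' _ _ _ _ (by rw [map_add, hτ, hτ, hτ]) fun _ => rfl)
    (fun r z i r' => by
      rename_i inst
      obtain rfl := Subsingleton.elim inst (instDecidableEqFin p)
      have e1 := key' (τ r) (τ r) _ _ rfl (upd z i (r' • z i) (τ r' • σ (z i))
        (by rw [map_smulₛₗ, hσ, hτ]))
      rw [MultilinearMap.map_update_smul, smul_smul, Function.update_eq_self] at e1
      exact e1.trans (key' _ _ _ _ (by rw [map_mul, hτ, hτ, hτ, mul_comm]) fun _ => rfl))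
  have hβ : β.comp (tmap p ρ).toAddMonoidHom = q.toAddMonoidHom := by
    refine tmap_ext _ _ fun r y => ?_
    change β (tmap p ρ (r • PiTensorProduct.tprod R y)) = q (r • PiTensorProduct.tprod R y)
    rw [map_smulₛₗ, tmap_tprod]
    have e : φ r • PiTensorProduct.tprod S (fun i => ρ (y i)) =
        PiTensorProduct.tprodCoeff S (φ r) fun i => ρ (y i) :=
      (PiTensorProduct.tprodCoeff_eq_smul_tprod _ _).symm
    rw [e]
    refine Eq.trans (b := q (τ (φ r) • PiTensorProduct.tprod R fun i => σ (ρ (y i)))) rfl ?_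
    exact key' _ _ _ _ (hτ _) fun i => hσ _
  have h0 : q t = 0 := by
    have := DFunLike.congr_fun hβ t
    change β (tmap p ρ t) = q t at this
    rw [← this, ht, map_zero]
  obtain ⟨s, hs⟩ := (Submodule.Quotient.mk_eq_zero _).1 h0
  exact ⟨s, hs.symm⟩

lemma tmap_reindex (ρ : V →ₛₗ[φ] V') (e : Equiv.Perm (Fin p)) (t) :
    tmap p ρ (PiTensorProduct.reindex R (fun _ => V) e t) =
      PiTensorProduct.reindex S (fun _ => V') e (tmap p ρ t) := by
  refine tmap_comm ρ (PiTensorProduct.reindex R (fun _ => V) e).toLinearMap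
    (PiTensorProduct.reindex S (fun _ => V') e).toLinearMap (fun x => ?_) t
  rw [LinearEquiv.coe_coe, LinearEquiv.coe_coe, PiTensorProduct.reindex_tprod,
    PiTensorProduct.reindex_tprod, tmap_tprod]

end TensorMap

/-! ### Reduction of eigenspaces -/

section Reduction

variable {X : Cx R} {Y : Cx S} {p : ℕ} {u l : R}

/-- The map of total modules given by a family of semilinear maps. -/
def semiTot (ρ : ∀ i, X.X i →ₛₗ[φ] Y.X i) : Tot X →ₛₗ[φ] Tot Y where
  toFun v i := ρ i (v i)
  map_add' _ _ := funext fun i => (ρ i).map_add _ _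
  map_smul' _ _ := funext fun i => (ρ i).map_smulₛₗ _ _

/-- Semilinear maps of total modules that preserve the grading. -/
def SemiGraded (ρ : Tot X →ₛₗ[φ] Tot Y) : Prop := ∀ a v, ρ (proj X a v) = proj Y a (ρ v)

lemma semiGraded_semiTot (ρ : ∀ i, X.X i →ₛₗ[φ] Y.X i) : SemiGraded (semiTot ρ) := fun a v => by
  funext j
  rw [proj_apply, proj_apply]
  change ρ j _ = _
  by_cases h : j = a
  · subst h; rw [Pi.single_eq_same, Pi.single_eq_same]; rfl
  · rw [Pi.single_eq_of_ne h, Pi.single_eq_of_ne h, map_zero]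

lemma semiTot_diff (ρ : ∀ i, X.X i →ₛₗ[φ] Y.X i)
    (hc : ∀ i j x, ρ j ((X.d i j).hom x) = (Y.d i j).hom (ρ i x)) (v : Tot X) :
    semiTot ρ (diff X v) = diff Y (semiTot ρ v) :=
  funext fun _ => hc _ _ _

variable {ρ : Tot X →ₛₗ[φ] Tot Y} (hρ : SemiGraded ρ)

namespace SemiGraded

include hρ

lemma parity (v : Tot X) : ρ (CyclicAdams.parity X v) = CyclicAdams.parity Y (ρ v) := by
  rw [CyclicAdams.parity, CyclicAdams.parity, LinearMap.sub_apply, LinearMap.sub_apply, map_sub,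
    hρ, hρ]

lemma rot (t : TPow p X) : tmap p ρ (rot p X t) = CyclicAdams.rot p Y (tmap p ρ t) := by
  rw [CyclicAdams.rot, CyclicAdams.rot, LinearMap.comp_apply, LinearMap.comp_apply,
    LinearMap.add_apply, LinearMap.add_apply, LinearEquiv.coe_coe, LinearEquiv.coe_coe,
    tmap_reindex, map_add, tmap_map, tmap_map]
  · intro i v
    split_ifs
    · exact hρ _ _
    · exact hρ.parity _
  · intro i v
    split_ifs
    · exact hρ _ _
    · rfl

lemma tOdd {d : Module.End R (Tot X)} {d' : Module.End S (Tot Y)} (hd : ∀ v, ρ (d v) = d' (ρ v))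
    (t : TPow p X) : tmap p ρ (CyclicAdams.tOdd p d t) = CyclicAdams.tOdd p d' (tmap p ρ t) := by
  rw [CyclicAdams.tOdd, CyclicAdams.tOdd, LinearMap.sum_apply, LinearMap.sum_apply, map_sum]
  refine Finset.sum_congr rfl fun i _ => tmap_map ρ (fun j v => ?_) t
  split_ifs
  · exact hρ.parity _
  · exact hd _
  · rfl

lemma tproj (k : ZMod 2) (t : TPow p X) :
    tmap p ρ (CyclicAdams.tproj p X k t) = CyclicAdams.tproj p Y k (tmap p ρ t) := by
  rw [CyclicAdams.tproj, CyclicAdams.tproj, LinearMap.sum_apply, LinearMap.sum_apply, map_sum]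
  refine Finset.sum_congr rfl fun ε _ => ?_
  split_ifs
  · exact tmap_map ρ (fun j v => hρ _ _) t
  · exact map_zero _

lemma eproj (t : TPow p X) :
    tmap p ρ (CyclicAdams.eproj p X u l t) = CyclicAdams.eproj p Y (φ u) (φ l) (tmap p ρ t) := by
  have hr (n : ℕ) (t : TPow p X) :
      tmap p ρ ((CyclicAdams.rot p X ^ n) t) = (CyclicAdams.rot p Y ^ n) (tmap p ρ t) := by
    induction n generalizing t with
    | zero => rfl
    | succ n ih => rw [pow_succ, pow_succ, Module.End.mul_apply, Module.End.mul_apply, ih, hρ.rot]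
  simp only [CyclicAdams.eproj, LinearMap.smul_apply, LinearMap.sum_apply, map_smulₛₗ, map_sum, hr,
    map_pow]

lemma mem_eigenDeg {k : ZMod 2} {t : TPow p X} (ht : t ∈ eigenDeg p X l k) :
    tmap p ρ t ∈ eigenDeg p Y (φ l) k := by
  rw [CyclicAdams.mem_eigenDeg] at *
  constructor
  · rw [← tproj_of_mem ht.1, hρ.tproj]
    exact tproj_mem p Y k _
  · rw [← hρ.rot, ht.2, map_smulₛₗ]

/-- The projectors onto degrees and eigenspaces are given by universal formulas, so they commute
with reduction. An arbitrary lift may therefore be projected back into the eigenspace. -/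
lemma exists_mem_eigenDeg (hφ : Function.Surjective φ) (hs : Function.Surjective ρ) (hp : p ≠ 0)
    (hu : u * p = 1) (hl : l ^ p = 1) {k : ZMod 2} {y : TPow p Y} (hy : y ∈ eigenDeg p Y (φ l) k) :
    ∃ t ∈ eigenDeg p X l k, tmap p ρ t = y := by
  obtain ⟨t, rfl⟩ := tmap_surjective ρ hφ hs y
  refine ⟨_, eproj_tproj_mem (u := u) hp hl k t, ?_⟩
  rw [Module.End.mul_apply, hρ.eproj, hρ.tproj]
  exact eproj_tproj_of_mem hp (by rw [← map_natCast φ, ← map_mul, hu, map_one])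
    (by rw [← map_pow, hl, map_one]) hy

end SemiGraded

/-- Division by `x` is possible in the full tensor power; projecting the quotient puts it into the
eigenspace without changing its multiple by `x`. -/
lemma exists_smul_of_mem_eigenDeg (hφ : Function.Surjective φ) (hs : Function.Surjective ρ)
    {x : R} (hx : ∀ v, ρ v = 0 → ∃ w, v = x • w) (hp : p ≠ 0)
    (hu : u * p = 1) (hl : l ^ p = 1) {k : ZMod 2} {t : TPow p X} (ht : t ∈ eigenDeg p X l k)
    (h0 : tmap p ρ t = 0) : ∃ s ∈ eigenDeg p X l k, x • s = t := by
  obtain ⟨s, hs⟩ := exists_of_tmap_eq_zero hp ρ hφ hs hx h0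
  refine ⟨_, eproj_tproj_mem (u := u) hp hl k s, ?_⟩
  rw [← map_smul, ← hs, eproj_tproj_of_mem hp hu hl ht]

lemma semiTot_surjective {ρ : ∀ i, X.X i →ₛₗ[φ] Y.X i} (h : ∀ i, Function.Surjective (ρ i)) :
    Function.Surjective (semiTot ρ) := fun v => by
  choose w hw using fun i => h i (v i)
  exact ⟨w, funext hw⟩

lemma semiTot_ker {ρ : ∀ i, X.X i →ₛₗ[φ] Y.X i} {x : R}
    (h : ∀ i v, ρ i v = 0 → ∃ w, v = x • w) (v : Tot X) (hv : semiTot ρ v = 0) :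
    ∃ w, v = x • w := by
  choose w hw using fun i => h i (v i) (congrFun hv i)
  exact ⟨w, funext hw⟩

/-- If `Y` is the reduction of `X` modulo `x`, then the eigenspaces of `Y` are the reductions of
those of `X`. -/
theorem exists_shortExact_eigen_resCx (hφ : Function.Surjective φ) (ρ : ∀ i, X.X i →ₛₗ[φ] Y.X i)
    (hc : ∀ i j x, ρ j ((X.d i j).hom x) = (Y.d i j).hom (ρ i x))
    (hs : ∀ i, Function.Surjective (ρ i)) {x : R} (hx0 : φ x = 0)
    (hx : ∀ i v, ρ i v = 0 → ∃ w, v = x • w) (hp : p ≠ 0) (hu : u * p = 1) (hl : l ^ p = 1)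
    (hreg : ∀ t : TPow p X, x • t = 0 → t = 0) :
    ∃ (g : eigen p X l ⟶ resCx φ (eigen p Y (φ l))) (w : (x • 𝟙 (eigen p X l)) ≫ g = 0),
      (ShortComplex.mk _ g w).ShortExact := by
  have hg := semiGraded_semiTot ρ
  refine exists_shortExact_resCx (x • 𝟙 (eigen p X l))
    (fun i => ((tmap p (semiTot ρ)).domRestrict (eigenDeg p X l i)).codRestrict
      (eigenDeg p Y (φ l) i) fun t => hg.mem_eigenDeg t.2) (fun i j t => ?_) (fun i => ?_)
    (fun i y => ?_) (fun i t => ?_) fun i t ht => ?_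
  · by_cases hij : i + 1 = j
    · subst hij
      refine Subtype.ext ?_
      have e1 := coe_gradedCx_d (D := tDiff p X) (S := eigenDeg p X l)
        (hS := fun k => tDiff_mem_eigenDeg p X l (k := k) (l := k + 1) rfl)
        (hD := fun _ t _ => LinearMap.congr_fun (tDiff_sq p X) t) (j := i + 1) rfl t
      have e2 := coe_gradedCx_d (D := tDiff p Y) (S := eigenDeg p Y (φ l))
        (hS := fun k => tDiff_mem_eigenDeg p Y (φ l) (k := k) (l := k + 1) rfl)
        (hD := fun _ t _ => LinearMap.congr_fun (tDiff_sq p Y) t) (i := i) (j := i + 1) rfl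
        ⟨tmap p (semiTot ρ) t.1, hg.mem_eigenDeg t.2⟩
      exact (congrArg (tmap p (semiTot ρ)) e1).trans
        ((hg.tOdd (semiTot_diff ρ hc) t.1).trans e2.symm)
    · rw [(eigen p X l).shape i j hij, (eigen p Y (φ l)).shape i j hij]
      exact map_zero _
  · refine (injective_iff_map_eq_zero _).2 fun t ht => Subtype.ext (hreg _ ?_)
    exact congrArg (Subtype.val (p := (· ∈ eigenDeg p X l i))) ht
  · obtain ⟨t, ht, h⟩ := hg.exists_mem_eigenDeg hφ (semiTot_surjective hs) hp hu hl y.2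
    exact ⟨⟨t, ht⟩, Subtype.ext h⟩
  · refine Subtype.ext ?_
    change tmap p (semiTot ρ) (x • t.1) = 0
    rw [map_smulₛₗ, hx0, zero_smul]
  · obtain ⟨s, hs', h⟩ := exists_smul_of_mem_eigenDeg hφ (semiTot_surjective hs)
      (semiTot_ker hx) hp hu hl t.2 (congrArg Subtype.val ht)
    exact ⟨⟨s, hs'⟩, Subtype.ext h⟩

end Reduction

end ChangeOfRings
end
end CyclicAdams

namespace CyclicAdams
open scoped Fin.NatCast Fin.CommRing
noncomputable section

/-! ### Extension of additive functions along syzygies to complexes of finite projective dimension.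
-/

section Extension

open Limits

/-! ### Pullbacks of short exact sequences -/

lemma exists_shortExact_of_isPullback {C : Type*} [Category* C] [Abelian C] {S : ShortComplex C}
    (hS : S.ShortExact) {L A : C} {a : L ⟶ A} {b : L ⟶ S.X₂} {f : A ⟶ S.X₃}
    (h : IsPullback a b f S.g) :
    ∃ (i : S.X₁ ⟶ L) (w : i ≫ a = 0), (ShortComplex.mk i a w).ShortExact := by
  have := hS.epi_g
  have := hS.mono_f
  have hi : h.lift 0 S.f (by simp) ≫ a = 0 := h.lift_fst _ _ _
  have hb : h.lift 0 S.f (by simp) ≫ b = S.f := h.lift_snd _ _ _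
  have hm : Mono (h.lift 0 S.f (by simp)) := mono_of_mono_fac hb
  refine ⟨_, hi, ?_⟩
  refine { exact := ?_, mono_f := hm, epi_g := Abelian.epi_fst_of_isLimit f S.g h.isLimit }
  refine ShortComplex.exact_of_f_is_kernel _ (KernelFork.IsLimit.ofι _ _
    (fun x hx => hS.fIsKernel.lift (KernelFork.ofι (x ≫ b)
      (by rw [Category.assoc, ← h.w, ← Category.assoc, hx, zero_comp]))) (fun x hx => ?_)
    fun x hx m hm' => ?_)
  · refine h.hom_ext ?_ ?_
    · rw [Category.assoc, hi, comp_zero, hx]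
    · rw [Category.assoc, hb]
      exact hS.fIsKernel.fac (KernelFork.ofι (x ≫ b) _) WalkingParallelPair.zero
  · rw [← cancel_mono S.f]
    refine Eq.trans ?_ (hS.fIsKernel.fac (KernelFork.ofι (x ≫ b) _) WalkingParallelPair.zero).symm
    change m ≫ S.f = x ≫ b
    have e : (m ≫ h.lift 0 S.f (by simp)) ≫ b = x ≫ b := congrArg (· ≫ b) hm'
    rwa [Category.assoc, hb] at e

/-- The kernel of a composite epimorphism is the preimage of the kernel of the second map. It turns
a cover of the middle term into a cover of the third term with computable kernel. -/
lemma shortExact_comp_of_isPullback {C : Type*} [Category* C] [Abelian C] {S : ShortComplex C}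
    (hS : S.ShortExact) {L B : C} {a : L ⟶ S.X₁} {b : L ⟶ B} {f : B ⟶ S.X₂} [Epi f]
    (h : IsPullback a b S.f f) :
    ∃ w : b ≫ f ≫ S.g = 0, (ShortComplex.mk b (f ≫ S.g) w).ShortExact := by
  have := hS.epi_g
  have := hS.mono_f
  have w : b ≫ f ≫ S.g = 0 := by
    rw [← Category.assoc, ← h.w, Category.assoc, S.zero, comp_zero]
  have hm : Mono b := by
    refine ⟨fun x y hxy => h.hom_ext ?_ hxy⟩
    rw [← cancel_mono S.f, Category.assoc, Category.assoc, h.w, ← Category.assoc, hxy,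
      Category.assoc]
  refine ⟨w, ?_⟩
  refine { exact := ?_, mono_f := hm, epi_g := epi_comp f S.g }
  refine ShortComplex.exact_of_f_is_kernel _ (KernelFork.IsLimit.ofι _ _
    (fun x hx => h.lift (hS.fIsKernel.lift (KernelFork.ofι (x ≫ f)
      (by rw [Category.assoc]; exact hx))) x
      (hS.fIsKernel.fac (KernelFork.ofι (x ≫ f) _) WalkingParallelPair.zero)) (fun x hx => ?_)
    fun x hx m hm' => ?_)
  · exact h.lift_snd _ _ _
  · exact (cancel_mono b).1 (hm'.trans (h.lift_snd _ _ _).symm)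

/-- The fibre product of the two epimorphisms projects onto each source, with kernel that of the
other; this is the comparison in Schanuel's lemma. -/
lemma exists_pullback_shortExact {C : Type*} [Category* C] [Abelian C] {K A X K' B : C}
    {k : K ⟶ A} {f : A ⟶ X} {w : k ≫ f = 0} (h : (ShortComplex.mk k f w).ShortExact)
    {k' : K' ⟶ B} {g : B ⟶ X} {w' : k' ≫ g = 0} (h' : (ShortComplex.mk k' g w').ShortExact) :
    ∃ (L : C) (i : K' ⟶ L) (a : L ⟶ A) (w₁ : i ≫ a = 0) (j : K ⟶ L) (b : L ⟶ B)
      (w₂ : j ≫ b = 0), (ShortComplex.mk i a w₁).ShortExact ∧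
        (ShortComplex.mk j b w₂).ShortExact := by
  obtain ⟨i, w₁, h₁⟩ := exists_shortExact_of_isPullback h' (IsPullback.of_hasPullback f g)
  obtain ⟨j, w₂, h₂⟩ := exists_shortExact_of_isPullback h (IsPullback.of_hasPullback f g).flip
  exact ⟨_, i, _, w₁, j, _, w₂, h₁, h₂⟩

variable {R : Type u} [CommRing R] {X Y : Cx R}

/-! ### Kernels and covers -/

/-- The kernel of a chain map. -/
def kerCx (f : X ⟶ Y) : Cx R :=
  mkCx (fun i => LinearMap.ker (f.f i).hom)
    (fun i j => (X.d i j).hom.restrict fun x hx => by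
      rw [LinearMap.mem_ker] at *
      rw [hom_comm_apply, hx, map_zero])
    (fun i j h => by
      ext x
      exact congrArg (fun f => f.hom x.1) (X.shape i j h))
    fun i j k x => Subtype.ext (d_d_apply X i j k x.1)

/-- The inclusion of the kernel. -/
def kerCxι (f : X ⟶ Y) : kerCx f ⟶ X :=
  mkHom (fun i => (LinearMap.ker (f.f i).hom).subtype) fun _ _ => rfl

lemma kerCx_shortExact {f : X ⟶ Y} (hf : ∀ i, Function.Surjective (f.f i).hom) :
    ∃ w : kerCxι f ≫ f = 0, (ShortComplex.mk (kerCxι f) f w).ShortExact :=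
  shortExact_of _ _ (fun _ => Submodule.subtype_injective _) hf (fun _ x => x.2)
    fun _ y hy => ⟨⟨y, hy⟩, rfl⟩

/-- A contractible complex of free modules. -/
def disc (R : Type u) [CommRing R] (m : ℕ) : Cx R :=
  mkCx (fun _ => (Fin m → R) × (Fin m → R))
    (fun i j => if i + 1 = j then LinearMap.inr R _ _ ∘ₗ LinearMap.fst R _ _ else 0)
    (fun i j h => if_neg h) fun i j k x => by split_ifs <;> simp

lemma disc_d_apply (m : ℕ) (i : ZMod 2) (x : (Fin m → R) × (Fin m → R)) :
    ((disc R m).d i (i + 1)).hom x = (0, x.1) := by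
  change (if i + 1 = i + 1 then LinearMap.inr R _ _ ∘ₗ LinearMap.fst R _ _ else 0 :
    (Fin m → R) × (Fin m → R) →ₗ[R] (Fin m → R) × (Fin m → R)) x = _
  rw [if_pos rfl]
  rfl

lemma disc_d_apply' (m : ℕ) (i : ZMod 2) (x : (Fin m → R) × (Fin m → R)) :
    ((disc R m).d (i + 1) i).hom x = (0, x.1) := by
  have h := disc_d_apply m (i + 1) x
  rw [add_one_add_one] at h
  exact h

/-- The map from a contractible complex given by elements of the total module. -/
def discMap {m : ℕ} (e : Fin m → Tot X) : disc R m ⟶ X :=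
  mkHom (fun i => LinearMap.coprod (LinearMap.proj i ∘ₗ Fintype.linearCombination R e)
      ((X.d (i + 1) i).hom ∘ₗ LinearMap.proj (i + 1) ∘ₗ Fintype.linearCombination R e))
    fun i (x : (Fin m → R) × (Fin m → R)) => by
      set π := Fintype.linearCombination R e
      change (π _) (i + 1) + (X.d (i + 1 + 1) (i + 1)).hom (π _ (i + 1 + 1)) =
        (X.d i (i + 1)).hom (π x.1 i + (X.d (i + 1) i).hom (π x.2 (i + 1)))
      erw [disc_d_apply]
      change (π (0 : Fin m → R)) (i + 1) + (X.d (i + 1 + 1) (i + 1)).hom (π x.1 (i + 1 + 1)) = _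
      rw [map_add, d_d_apply, add_zero, map_zero, Pi.zero_apply, zero_add, add_one_add_one]

lemma discMap_apply {m : ℕ} (e : Fin m → Tot X) (i : ZMod 2) (x : (Fin m → R) × (Fin m → R)) :
    ((discMap e).f i).hom x = Fintype.linearCombination R e x.1 i +
      (X.d (i + 1) i).hom (Fintype.linearCombination R e x.2 (i + 1)) := rfl

lemma discMap_surjective {m : ℕ} {e : Fin m → Tot X} (he : Submodule.span R (Set.range e) = ⊤)
    (i : ZMod 2) : Function.Surjective ((discMap e).f i).hom := fun x => by
  have : (Pi.single i x : Tot X) ∈ LinearMap.range (Fintype.linearCombination R e) := by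
    rw [Fintype.range_linearCombination, he]; trivial
  obtain ⟨a, ha⟩ := this
  refine ⟨((a, 0) : (Fin m → R) × (Fin m → R)), (discMap_apply e i (a, 0)).trans ?_⟩
  rw [ha, Pi.single_eq_same, map_zero, Pi.zero_apply, map_zero, add_zero]

instance (m : ℕ) (i : ZMod 2) : Module.Finite R ((disc R m).X i) :=
  inferInstanceAs (Module.Finite R ((Fin m → R) × (Fin m → R)))

instance (m : ℕ) (i : ZMod 2) : Module.Projective R ((disc R m).X i) :=
  inferInstanceAs (Module.Projective R ((Fin m → R) × (Fin m → R)))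

lemma acyclic_disc (m : ℕ) : Acyclic (disc R m) := by
  rw [acyclic_iff_exact]
  intro i (x : (Fin m → R) × (Fin m → R)) hx
  refine ⟨((x.2, 0) : (Fin m → R) × (Fin m → R)), (disc_d_apply' m i _).trans ?_⟩
  have h1 : x.1 = 0 := congrArg Prod.snd ((disc_d_apply m i x).symm.trans hx)
  exact Prod.ext h1.symm rfl

lemma exists_span_tot (h : ∀ i, Module.Finite R (X.X i)) :
    ∃ (m : ℕ) (e : Fin m → Tot X), Submodule.span R (Set.range e) = ⊤ :=
  Module.Finite.exists_fin

/-! ### Complexes of bounded projective dimension -/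

/-- Complexes with homology of finite length of finitely generated modules of projective dimension
at most `n`. -/
structure PDim (n : ℕ) (X : Cx R) : Prop where
  finite : ∀ i, Module.Finite R (X.X i)
  finLen : FinLen X
  pd : ∀ i, HasProjectiveDimensionLT (X.X i) (n + 1)

lemma pdim_zero_iff : PDim 0 X ↔ IsMFfl X := by
  have h (i : ZMod 2) : HasProjectiveDimensionLT (X.X i) (0 + 1) ↔ Module.Projective R (X.X i) := by
    rw [zero_add, ← projective_iff_hasProjectiveDimensionLT_one, ← IsProjective.iff_projective]
  exact ⟨fun a => ⟨a.finite, fun i => (h i).1 (a.pd i), a.finLen⟩,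
    fun a => ⟨a.finite, a.finiteLength, fun i => (h i).2 (a.projective i)⟩⟩

lemma PDim.mono {n m : ℕ} (h : PDim n X) (hnm : n ≤ m) : PDim m X :=
  ⟨h.finite, h.finLen, fun i =>
    have := h.pd i
    hasProjectiveDimensionLT_of_ge _ (n + 1) (m + 1) (by omega)⟩

lemma pdim_disc (n m : ℕ) : PDim n (disc R m) :=
  (pdim_zero_iff.2 ⟨inferInstance, inferInstance, (acyclic_disc m).finLen⟩).mono (Nat.zero_le n)

lemma ShortExact.eval {S : ShortComplex (Cx R)} (h : S.ShortExact) (i : ZMod 2) :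
    (S.map (HomologicalComplex.eval (ModuleCat R) (ComplexShape.up (ZMod 2)) i)).ShortExact :=
  h.map_of_exact _

lemma ShortExact.finite₁ [IsNoetherianRing R] {S : ShortComplex (Cx R)} (h : S.ShortExact)
    (h2 : ∀ i, Module.Finite R (S.X₂.X i)) (i : ZMod 2) : Module.Finite R (S.X₁.X i) :=
  have := h2 i
  Module.Finite.of_injective _ (ShortExact.injective h i)

lemma ShortExact.finite₂ {S : ShortComplex (Cx R)} (h : S.ShortExact)
    (h1 : ∀ i, Module.Finite R (S.X₁.X i)) (h3 : ∀ i, Module.Finite R (S.X₃.X i)) (i : ZMod 2) :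
    Module.Finite R (S.X₂.X i) := by
  have := h1 i
  have := h3 i
  refine ⟨Submodule.fg_of_fg_map_of_fg_inf_ker (S.g.f i).hom ?_ ?_⟩
  · rw [Submodule.map_top, LinearMap.range_eq_top.2 (ShortExact.surjective h i)]
    exact Module.Finite.fg_top
  · have e : LinearMap.ker (S.g.f i).hom = LinearMap.range (S.f.f i).hom :=
      le_antisymm (fun y hy => ShortExact.exact h i y hy) (by
        rintro _ ⟨x, rfl⟩
        exact ShortExact.zero i x)
    rw [top_inf_eq, e, LinearMap.range_eq_map]
    exact Module.Finite.fg_top.map _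

lemma PDim.of_shortExact₁ [IsNoetherianRing R] {n : ℕ} {S : ShortComplex (Cx R)}
    (h : S.ShortExact) (h2 : PDim n S.X₂) (h3 : PDim (n + 1) S.X₃) : PDim n S.X₁ :=
  ⟨ShortExact.finite₁ h h2.finite, FinLen.of_shortExact₁ h h2.finLen h3.finLen,
    fun i => (ShortExact.eval h i).hasProjectiveDimensionLT_X₁ (n + 1) (h2.pd i) (h3.pd i)⟩

lemma PDim.of_shortExact₂ {n : ℕ} {S : ShortComplex (Cx R)} (h : S.ShortExact)
    (h1 : PDim n S.X₁) (h3 : PDim n S.X₃) : PDim n S.X₂ :=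
  ⟨ShortExact.finite₂ h h1.finite h3.finite, FinLen.of_shortExact₂ h h1.finLen h3.finLen,
    fun i => (ShortExact.eval h i).hasProjectiveDimensionLT_X₂ (n + 1) (h1.pd i) (h3.pd i)⟩

/-- Every complex of finitely generated modules has a contractible cover. -/
lemma exists_cover (h : ∀ i, Module.Finite R (X.X i)) :
    ∃ (m : ℕ) (K : Cx R) (k : K ⟶ disc R m) (f : disc R m ⟶ X) (w : k ≫ f = 0),
      (ShortComplex.mk k f w).ShortExact := by
  obtain ⟨m, e, he⟩ := exists_span_tot h
  obtain ⟨w, hw⟩ := kerCx_shortExact (discMap_surjective he)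
  exact ⟨m, _, _, _, w, hw⟩

/-! ### Extension of additive functions -/

/-- Functions that are additive on short exact sequences of complexes of projective dimension at
most `n` and vanish on acyclic complexes. -/
structure IsAdditive (n : ℕ) (θ : Cx R → ℤ) : Prop where
  add : ∀ {S : ShortComplex (Cx R)}, S.ShortExact → PDim n S.X₁ → PDim n S.X₂ → PDim n S.X₃ →
    θ S.X₂ = θ S.X₁ + θ S.X₃
  acyclic : ∀ {X : Cx R}, PDim n X → Acyclic X → θ X = 0

variable [IsNoetherianRing R] {n : ℕ} {θ : Cx R → ℤ}

/-- Schanuel's argument: the fibre product of the two covers is an extension of either cover by the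
kernel of the other, and acyclic covers contribute zero. -/
lemma IsAdditive.cover_unique (hθ : IsAdditive n θ) (hX : PDim (n + 1) X) {F F' K K' : Cx R}
    {k : K ⟶ F} {f : F ⟶ X} {w : k ≫ f = 0} (h : (ShortComplex.mk k f w).ShortExact)
    {k' : K' ⟶ F'} {f' : F' ⟶ X} {w' : k' ≫ f' = 0} (h' : (ShortComplex.mk k' f' w').ShortExact)
    (hF : PDim n F) (ha : Acyclic F) (hF' : PDim n F') (ha' : Acyclic F') : θ K = θ K' := by
  obtain ⟨L, i, a, w₁, j, b, w₂, h₁, h₂⟩ := exists_pullback_shortExact h h'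
  have hK : PDim n K := PDim.of_shortExact₁ h hF hX
  have hK' : PDim n K' := PDim.of_shortExact₁ h' hF' hX
  have hL : PDim n L := PDim.of_shortExact₂ h₁ hK' hF
  have e1 := hθ.add h₁ hK' hL hF
  have e2 := hθ.add h₂ hK hL hF'
  have e3 := hθ.acyclic hF ha
  have e4 := hθ.acyclic hF' ha'
  dsimp only at e1 e2
  omega

/-- The value on a complex is minus the value on the kernel of an acyclic cover, the only choice
compatible with additivity. It is well defined by the comparison of covers and agrees with the old
function where both make sense. -/
theorem IsAdditive.exists_succ (hθ : IsAdditive n θ) :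
    ∃ θ' : Cx R → ℤ, IsAdditive (n + 1) θ' ∧ (∀ X, PDim n X → θ' X = θ X) ∧
      ∀ {S : ShortComplex (Cx R)}, S.ShortExact → PDim n S.X₂ → Acyclic S.X₂ →
        PDim (n + 1) S.X₃ → θ' S.X₃ = - θ S.X₁ := by
  classical
  let θ' : Cx R → ℤ := fun X =>
    if h : ∀ i, Module.Finite R (X.X i) then - θ (exists_cover h).choose_spec.choose else 0
  have key : ∀ {S : ShortComplex (Cx R)}, S.ShortExact → PDim n S.X₂ → Acyclic S.X₂ →
        PDim (n + 1) S.X₃ → θ' S.X₃ = - θ S.X₁ := by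
    intro S hS h2 ha h3
    obtain ⟨k, f, w, h⟩ := (exists_cover h3.finite).choose_spec.choose_spec
    have : θ' S.X₃ = - θ (exists_cover h3.finite).choose_spec.choose := dif_pos h3.finite
    rw [this, neg_inj]
    exact hθ.cover_unique h3 h hS (pdim_disc n _) (acyclic_disc _) h2 ha
  refine ⟨θ', ⟨?_, ?_⟩, ?_, key⟩
  · intro S hS h1 h2 h3
    -- A cover of the middle term also covers the third term; the new kernel is the preimage of the
    -- first term and is thus itself an extension of that term by the kernel `K`. Comparing this
    -- with a separate cover of the first term relates the three kernels without a horseshoe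
    -- construction.
    obtain ⟨m, K, k, f, w, h⟩ := exists_cover h2.finite
    obtain ⟨m', K', k', f', w', h'⟩ := exists_cover h1.finite
    have := h.epi_g
    have hpb := IsPullback.of_hasPullback S.f f
    obtain ⟨v, hv⟩ := shortExact_comp_of_isPullback hS hpb
    obtain ⟨j, w'', h''⟩ := exists_shortExact_of_isPullback h hpb
    have hD := pdim_disc (R := R) n m
    have hD' := pdim_disc (R := R) n m'
    have hK := PDim.of_shortExact₁ h hD h2
    have hK' := PDim.of_shortExact₁ h' hD' h1
    have hK'' := PDim.of_shortExact₁ hv hD h3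
    obtain ⟨L, i, a, w₁, j', b, w₂, h₁, h₂⟩ := exists_pullback_shortExact h'' h'
    have hL : PDim n L := PDim.of_shortExact₂ h₁ hK' hK''
    have e1 := hθ.add h₁ hK' hL hK''
    have e2 := hθ.add h₂ hK hL hD'
    have e3 := hθ.acyclic hD' (acyclic_disc m')
    have e4 := key h hD (acyclic_disc m) h2
    have e5 := key h' hD' (acyclic_disc m') h1
    have e6 := key hv hD (acyclic_disc m) h3
    dsimp only at *
    omega
  · intro X hX ha
    obtain ⟨m, K, k, f, w, h⟩ := exists_cover hX.finite
    rw [key h (pdim_disc n m) (acyclic_disc m) hX, neg_eq_zero]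
    exact hθ.acyclic (PDim.of_shortExact₁ h (pdim_disc n m) hX)
      (Acyclic.of_shortExact₁ h (acyclic_disc m) ha)
  · intro X hX
    obtain ⟨m, K, k, f, w, h⟩ := exists_cover hX.finite
    rw [key h (pdim_disc n m) (acyclic_disc m) (hX.mono (Nat.le_succ n))]
    have e1 := hθ.add h (PDim.of_shortExact₁ h (pdim_disc n m) (hX.mono (Nat.le_succ n)))
      (pdim_disc n m) hX
    have e2 := hθ.acyclic (pdim_disc n m) (acyclic_disc m)
    dsimp only at *
    omega

end Extension
end
end CyclicAdams

namespace CyclicAdams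
open scoped Fin.NatCast Fin.CommRing
noncomputable section

/-! ### Syzygies that are compatible with reduction modulo regular elements. -/

section Reductions

variable {R S : Type u} [CommRing R] [CommRing S] {φ : R →+* S} {x : R} {X : Cx R} {Y : Cx S}

/-! ### Null homotopies on kernels -/

/-- A lift `g` of the homotopy to the projective complex is a homotopy for `r` only up to an error
`E`, which is a chain map with values in the kernel. Composing `E` with a contraction of the cover
corrects it, and the corrected homotopy preserves the kernel. -/
lemma Null.kerCx {F : Cx R} {r : R} {f : F ⟶ X} (hf : ∀ i, Function.Surjective (f.f i).hom)
    (hF : ∀ i, Module.Projective R (F.X i)) (h1 : Null 1 F) (hr : Null r X) :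
    Null r (kerCx f) := by
  obtain ⟨h, hh⟩ := hr
  obtain ⟨s, hs⟩ := h1
  have hl (i j : ZMod 2) : ∃ g : F.X i →ₗ[R] F.X j, (f.f j).hom ∘ₗ g = h i j ∘ₗ (f.f i).hom :=
    Module.projective_lifting_property _ _ (hf j)
  choose g hg using hl
  have hg' (i j : ZMod 2) (v : F.X i) : (f.f j).hom (g i j v) = h i j ((f.f i).hom v) :=
    LinearMap.congr_fun (hg i j) v
  let E (i : ZMod 2) : F.X i →ₗ[R] F.X i := r • LinearMap.id -
    (g (i + 1) i ∘ₗ (F.d i (i + 1)).hom + (F.d (i + 1) i).hom ∘ₗ g i (i + 1))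
  have hE (i : ZMod 2) (v : F.X i) : E i v = r • v -
    (g (i + 1) i ((F.d i (i + 1)).hom v) + (F.d (i + 1) i).hom (g i (i + 1) v)) := rfl
  have hfE (i : ZMod 2) (v : F.X i) : (f.f i).hom (E i v) = 0 := by
    rw [hE, map_sub, map_smul, map_add, hg', hom_comm_apply, hom_comm_apply, hg', hh, sub_self]
  have hdE (i : ZMod 2) (v : F.X (i + 1)) :
      (F.d (i + 1) i).hom (E (i + 1) v) = E i ((F.d (i + 1) i).hom v) := by
    rw [hE, hE, map_sub, map_add, map_smul, d_d_apply, add_one_add_one, d_d_apply, map_zero,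
      add_zero, zero_add]
  let H (i j : ZMod 2) : LinearMap.ker (f.f i).hom →ₗ[R] LinearMap.ker (f.f j).hom :=
    ((g i j + E j ∘ₗ s i j) ∘ₗ Submodule.subtype _).codRestrict _ fun v => by
      rw [LinearMap.mem_ker]
      change (f.f j).hom (g i j v.1 + E j (s i j v.1)) = 0
      rw [map_add, hfE, hg', v.2, map_zero, add_zero]
  refine ⟨H, fun i (v : LinearMap.ker (f.f i).hom) => Subtype.ext ?_⟩
  change (g (i + 1) i ((F.d i (i + 1)).hom v.1) + E i (s (i + 1) i ((F.d i (i + 1)).hom v.1))) +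
    (F.d (i + 1) i).hom (g i (i + 1) v.1 + E (i + 1) (s i (i + 1) v.1)) = r • v.1
  rw [map_add, hdE, add_add_add_comm, ← map_add, hs, one_smul, hE, add_sub_cancel]

lemma null_disc (m : ℕ) : Null 1 (disc R m) := by
  refine ⟨fun i j => (LinearMap.inl R _ _ ∘ₗ LinearMap.snd R _ _ :
    (Fin m → R) × (Fin m → R) →ₗ[R] (Fin m → R) × (Fin m → R)),
    fun i (v : (Fin m → R) × (Fin m → R)) => ?_⟩
  have e1 := disc_d_apply m i v
  have e2 := disc_d_apply' m i ((v.2, 0) : (Fin m → R) × (Fin m → R))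
  refine (congrArg₂ (fun a b : (Fin m → R) × (Fin m → R) => ((a.2, 0) : (Fin m → R) × (Fin m → R)) + b)
    e1 e2).trans ?_
  refine Eq.trans (b := v) (Prod.ext (add_zero v.1) (zero_add v.2)) (one_smul R v).symm

/-! ### Reductions modulo a regular element -/

/-- `S` is the quotient of `R` by the regular element `x`. -/
structure RingRed (φ : R →+* S) (x : R) : Prop where
  surj : Function.Surjective φ
  zero : φ x = 0
  ker : ∀ r, φ r = 0 → ∃ s, r = x * s
  reg : ∀ r, x * r = 0 → r = 0

/-- `Y` is the reduction of the complex `X` modulo the regular element `x`. -/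
structure Red (φ : R →+* S) (x : R) (X : Cx R) (Y : Cx S) where
  /-- The projection. -/
  map : ∀ i, X.X i →ₛₗ[φ] Y.X i
  comm : ∀ i j v, map j ((X.d i j).hom v) = (Y.d i j).hom (map i v)
  surj : ∀ i, Function.Surjective (map i)
  ker : ∀ i v, map i v = 0 → ∃ w, v = x • w
  reg : ∀ i (v : X.X i), x • v = 0 → v = 0

/-- Componentwise application of a ring homomorphism. -/
def piMap (φ : R →+* S) (m : ℕ) : (Fin m → R) →ₛₗ[φ] (Fin m → S) where
  toFun a i := φ (a i)
  map_add' _ _ := funext fun _ => map_add _ _ _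
  map_smul' _ _ := funext fun _ => map_mul _ _ _

/-- Reduction of contractible complexes. -/
def redDiscMap (φ : R →+* S) (m : ℕ) :
    (Fin m → R) × (Fin m → R) →ₛₗ[φ] (Fin m → S) × (Fin m → S) where
  toFun a := (piMap φ m a.1, piMap φ m a.2)
  map_add' _ _ := Prod.ext (map_add _ _ _) (map_add _ _ _)
  map_smul' _ _ := Prod.ext (map_smulₛₗ _ _ _) (map_smulₛₗ _ _ _)

/-- The images of elements under a reduction. -/
def Red.basis (r : Red φ x X Y) {m : ℕ} (e : Fin m → Tot X) (a : Fin m) : Tot Y :=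
  semiTot r.map (e a)

lemma Red.linearCombination (r : Red φ x X Y) {m : ℕ} (e : Fin m → Tot X) (a : Fin m → R) :
    semiTot r.map (Fintype.linearCombination R e a) =
      Fintype.linearCombination S (r.basis e) (piMap φ m a) := by
  rw [Fintype.linearCombination_apply, Fintype.linearCombination_apply, map_sum]
  exact Finset.sum_congr rfl fun i _ => map_smulₛₗ _ _ _

lemma Red.span_basis (r : Red φ x X Y) {m : ℕ} {e : Fin m → Tot X}
    (he : Submodule.span R (Set.range e) = ⊤) :
    Submodule.span S (Set.range (r.basis e)) = ⊤ := by
  rw [← Fintype.range_linearCombination, LinearMap.range_eq_top] at he ⊢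
  intro y
  obtain ⟨v, rfl⟩ := semiTot_surjective r.surj y
  obtain ⟨a, rfl⟩ := he v
  exact ⟨_, (r.linearCombination e a).symm⟩

lemma Red.discMap (r : Red φ x X Y) {m : ℕ} (e : Fin m → Tot X) (i : ZMod 2)
    (a : (Fin m → R) × (Fin m → R)) :
    r.map i (((discMap e).f i).hom a) =
      ((CyclicAdams.discMap (r.basis e)).f i).hom (redDiscMap φ m a) := by
  have h (b : Fin m → R) (j : ZMod 2) : r.map j (Fintype.linearCombination R e b j) =
      Fintype.linearCombination S (r.basis e) (piMap φ m b) j :=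
    congrFun (r.linearCombination e b) j
  refine (congrArg (r.map i) (discMap_apply e i a)).trans
    (Eq.trans ?_ (discMap_apply (r.basis e) i (redDiscMap φ m a)).symm)
  rw [map_add, r.comm, h, h]
  rfl

/-- The reduction of a kernel. -/
def Red.kerCx (hR : RingRed φ x) (r : Red φ x X Y) {m : ℕ} {e : Fin m → Tot X}
    (he : Submodule.span R (Set.range e) = ⊤) :
    Red φ x (kerCx (CyclicAdams.discMap e)) (CyclicAdams.kerCx (CyclicAdams.discMap (r.basis e))) where
  map i := ((redDiscMap φ m).domRestrict
    (LinearMap.ker ((CyclicAdams.discMap e).f i).hom)).codRestrict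
      (LinearMap.ker ((CyclicAdams.discMap (r.basis e)).f i).hom) fun a => by
    rw [LinearMap.mem_ker]
    exact (r.discMap e i a.1).symm.trans ((congrArg (r.map i) a.2).trans (map_zero _))
  comm i j v := by
    refine Subtype.ext ?_
    change redDiscMap φ m ((if i + 1 = j then LinearMap.inr R _ _ ∘ₗ LinearMap.fst R _ _ else 0 :
      (Fin m → R) × (Fin m → R) →ₗ[R] (Fin m → R) × (Fin m → R)) v.1) =
      (if i + 1 = j then LinearMap.inr S _ _ ∘ₗ LinearMap.fst S _ _ else 0 :
      (Fin m → S) × (Fin m → S) →ₗ[S] (Fin m → S) × (Fin m → S)) (redDiscMap φ m v.1)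
    split_ifs
    · exact Prod.ext (map_zero (piMap φ m)) rfl
    · exact map_zero _
  surj i := by
    rintro ⟨⟨b, b'⟩, hb⟩
    choose τ hτ using hR.surj
    let a : (Fin m → R) × (Fin m → R) := (fun i => τ (b i), fun i => τ (b' i))
    have ha : redDiscMap φ m a = (b, b') := Prod.ext (funext fun i => hτ _) (funext fun i => hτ _)
    let D : (Fin m → R) × (Fin m → R) →ₗ[R] X.X i := ((CyclicAdams.discMap e).f i).hom
    have hD : Function.Surjective D := discMap_surjective he i
    -- An arbitrary lift of an element of the reduced kernel is mapped into the multiples of `x`;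
    -- subtracting `x` times a preimage moves it into the kernel without changing its reduction.
    obtain ⟨w, hw⟩ := r.ker i (D a) ((r.discMap e i a).trans (by rw [ha]; exact hb))
    obtain ⟨c, rfl⟩ := hD w
    refine ⟨⟨a - x • c, ?_⟩, Subtype.ext ?_⟩
    · change D (a - x • c) = 0
      rw [map_sub, map_smul, hw, sub_self]
    · change redDiscMap φ m (a - x • c) = (b, b')
      rw [map_sub, ha, map_smulₛₗ, hR.zero, zero_smul, sub_zero]
  ker i v hv := by
    obtain ⟨⟨a, a'⟩, hv'⟩ := v
    have h0 : redDiscMap φ m (a, a') = 0 := congrArg Subtype.val hv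
    have h1 (i) : φ (a i) = 0 := congrFun (congrArg Prod.fst h0) i
    have h2 (i) : φ (a' i) = 0 := congrFun (congrArg Prod.snd h0) i
    choose b hb using fun i => hR.ker _ (h1 i)
    choose b' hb' using fun i => hR.ker _ (h2 i)
    have e1 : ((a, a') : (Fin m → R) × (Fin m → R)) = x • (b, b') :=
      Prod.ext (funext hb) (funext hb')
    -- The quotient by `x` lies in the kernel again because `x` is regular on the target complex.
    refine ⟨⟨((b, b') : (Fin m → R) × (Fin m → R)), r.reg i _ ?_⟩, Subtype.ext e1⟩
    rw [e1] at hv'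
    exact (map_smul ((CyclicAdams.discMap e).f i).hom x _).symm.trans hv'
  reg i v hv := by
    obtain ⟨⟨a, a'⟩, hv'⟩ := v
    have h0 : x • ((a, a') : (Fin m → R) × (Fin m → R)) = 0 := congrArg Subtype.val hv
    exact Subtype.ext (Prod.ext (funext fun i => hR.reg _ (congrFun (congrArg Prod.fst h0) i))
      (funext fun i => hR.reg _ (congrFun (congrArg Prod.snd h0) i)))

/-! ### Resolutions and their reductions -/

/-- Compatible extensions of an additive function to complexes of finite projective dimension. -/
structure ExtSeq (θ : Cx S → ℤ) where
  /-- The extension to complexes of projective dimension at most `n`. -/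
  ext : ℕ → Cx S → ℤ
  zero : ∀ {Y}, PDim 0 Y → ext 0 Y = θ Y
  add : ∀ n, IsAdditive n (ext n)
  succ : ∀ n {Y}, PDim n Y → ext (n + 1) Y = ext n Y
  syz : ∀ n {T : ShortComplex (Cx S)}, T.ShortExact → PDim n T.X₂ → Acyclic T.X₂ →
        PDim (n + 1) T.X₃ → ext (n + 1) T.X₃ = - ext n T.X₁

lemma IsAdditive.exists_extSeq [IsNoetherianRing S] {θ : Cx S → ℤ} (hθ : IsAdditive 0 θ) :
    Nonempty (ExtSeq θ) := by
  let Θ : ∀ n, {θ : Cx S → ℤ // IsAdditive n θ} := fun n =>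
    Nat.rec ⟨θ, hθ⟩ (fun n t => ⟨t.2.exists_succ.choose, t.2.exists_succ.choose_spec.1⟩) n
  exact ⟨⟨fun n => (Θ n).1, fun _ => rfl, fun n => (Θ n).2,
    fun n Y hY => (Θ n).2.exists_succ.choose_spec.2.1 Y hY,
    fun n T hT => (Θ n).2.exists_succ.choose_spec.2.2 hT⟩⟩

/-- Complexes of finite projective dimension are, up to shifts, syzygies compatible with all
reductions. -/
theorem exists_resolution [IsNoetherianRing R] [IsNoetherianRing S] {θ : Cx S → ℤ} (Θ : ExtSeq θ)
    (n : ℕ) : ∀ X : Cx R,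
      (∀ i, Module.Finite R (X.X i)) → (∀ i, HasProjectiveDimensionLT (X.X i) (n + 1)) →
      ∃ E : Cx R, (∀ i, Module.Finite R (E.X i)) ∧ (∀ i, Module.Projective R (E.X i)) ∧
        (∀ r, Null r X → Null r E) ∧
        ∀ (φ : R →+* S) (x : R) (Y : Cx S), RingRed φ x → Nonempty (Red φ x X Y) → PDim n Y →
          ∃ E' : Cx S, Nonempty (Red φ x E E') ∧ IsMFfl E' ∧ Θ.ext n Y = (-1) ^ n * θ E' := by
  induction n with
  | zero =>
    intro X hX hX'
    refine ⟨X, hX, fun i => ?_, fun r h => h, fun φ x Y _ h hY => ⟨Y, h, pdim_zero_iff.1 hY, ?_⟩⟩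
    · have := hX' i
      rwa [zero_add, ← projective_iff_hasProjectiveDimensionLT_one, ← IsProjective.iff_projective]
        at this
    · rw [pow_zero, one_mul, Θ.zero hY]
  | succ n ih =>
    intro X hX hX'
    obtain ⟨m, e, he⟩ := exists_span_tot hX
    obtain ⟨w, hw⟩ := kerCx_shortExact (discMap_surjective he)
    obtain ⟨E, h1, h2, h3, h4⟩ := ih (kerCx (discMap e))
      (ShortExact.finite₁ hw (fun i => inferInstanceAs (Module.Finite R ((disc R m).X i))))
      (fun i => (ShortExact.eval hw i).hasProjectiveDimensionLT_X₁ (n + 1)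
        ((pdim_disc n m).pd i) (hX' i))
    -- The syzygy is chosen before the reduction is specified, so one and the same complex serves
    -- all reductions simultaneously.
    refine ⟨E, h1, h2, fun r hr => h3 r (Null.kerCx (discMap_surjective he) inferInstance
      (null_disc m) hr), fun φ x Y hR ⟨r⟩ hY => ?_⟩
    obtain ⟨w', hw'⟩ := kerCx_shortExact (discMap_surjective (r.span_basis he))
    obtain ⟨E', h5, h6, h7⟩ := h4 φ x _ hR ⟨r.kerCx hR he⟩
      (PDim.of_shortExact₁ hw' (pdim_disc n m) hY)
    refine ⟨E', h5, h6, ?_⟩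
    have := Θ.syz n hw' (pdim_disc n m) (acyclic_disc m) hY
    dsimp only at this
    rw [this, h7, pow_succ]
    ring

end Reductions
end
end CyclicAdams

namespace CyclicAdams
open scoped Fin.NatCast Fin.CommRing
noncomputable section

/-! ### The index of multiplication by X - a on modules supported on the closed fibre. -/

section Index

variable {R : Type u} [CommRing R]

/-! ### The index of a scalar -/

/-- The complex `M → M → M` with maps `x` and `0`. -/
def kz (x : R) (M : Type u) [AddCommGroup M] [Module R M] : Cx R :=
  mkCx (fun _ => M) (fun i j => if i = 0 ∧ j = 1 then x • LinearMap.id else 0)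
    (fun i j h => if_neg (by rintro ⟨rfl, rfl⟩; exact h rfl)) fun i j k v => by
      by_cases h : j = 0 ∧ k = 1
      · rw [if_pos h, if_neg (by rintro ⟨-, h'⟩; exact absurd (h'.symm.trans h.1) (by decide))]
        exact map_zero _
      · rw [if_neg h]
        rfl

variable {x : R} {M M' M'' : Type u} [AddCommGroup M] [Module R M] [AddCommGroup M'] [Module R M']
  [AddCommGroup M''] [Module R M'']

lemma kz_shortExact (x : R) {f : M' →ₗ[R] M} {g : M →ₗ[R] M''} (hf : Function.Injective f)
    (hg : Function.Surjective g) (h : Function.Exact f g) :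
    ∃ S : ShortComplex (Cx R), S.ShortExact ∧ S.X₁ = kz x M' ∧ S.X₂ = kz x M ∧ S.X₃ = kz x M'' := by
  have hc {A B : Type u} [AddCommGroup A] [AddCommGroup B] [Module R A] [Module R B]
      (q : A →ₗ[R] B) (i j : ZMod 2) (v : A) :
      q ((if i = 0 ∧ j = 1 then x • LinearMap.id else 0 : A →ₗ[R] A) v) =
        (if i = 0 ∧ j = 1 then x • LinearMap.id else 0 : B →ₗ[R] B) (q v) := by
    split_ifs
    · exact map_smul q x v
    · exact map_zero q
  obtain ⟨w, hw⟩ := shortExact_of (X := kz x M') (Y := kz x M) (Z := kz x M'')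
    (mkHom (X := kz x M') (Y := kz x M) (fun _ => f) fun i v => hc f i (i + 1) v)
    (mkHom (X := kz x M) (Y := kz x M'') (fun _ => g) fun i v => hc g i (i + 1) v)
    (fun _ => hf) (fun _ => hg) (fun _ v => h.apply_apply_eq_zero v) fun _ y hy => (h y).1 hy
  exact ⟨_, hw, rfl, rfl, rfl⟩

lemma length_kz_zero : Module.length R ((kz x M).homology 0) =
    Module.length R (LinearMap.ker (LinearMap.lsmul R M x)) := by
  have h : (bdry (kz x M) 0).submoduleOf (cyc (kz x M) 0) = ⊥ := by
    rw [eq_bot_iff]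
    rintro z ⟨y, hy⟩
    exact Subtype.ext hy.symm
  exact ((homologyEquiv (kz x M) 0).trans (Submodule.quotEquivOfEqBot _ h)).length_eq

lemma length_kz_one : Module.length R ((kz x M).homology 1) =
    Module.length R (M ⧸ LinearMap.range (LinearMap.lsmul R M x)) := by
  have h : cyc (kz x M) 1 = ⊤ := LinearMap.ker_eq_top.2 rfl
  refine ((homologyEquiv (kz x M) 1).trans (Submodule.Quotient.equiv _ _
    ((LinearEquiv.ofEq _ _ h).trans Submodule.topEquiv) ?_)).length_eq
  ext z
  constructor
  · rintro ⟨y, hy, rfl⟩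
    exact hy
  · rintro hz
    exact ⟨⟨z, h ▸ trivial⟩, hz, rfl⟩

/-- Kernel and cokernel of `x` appear as the homology of a two-term complex, so additivity of the
index becomes an instance of `eul_shortExact`. -/
lemma eul_kz : eul (kz x M) =
    ((Module.length R (LinearMap.ker (LinearMap.lsmul R M x))).toNat : ℤ) -
      (Module.length R (M ⧸ LinearMap.range (LinearMap.lsmul R M x))).toNat := by
  rw [eul, length_kz_zero, length_kz_one]

lemma finLen_kz_iff : FinLen (kz x M) ↔
    Module.length R (LinearMap.ker (LinearMap.lsmul R M x)) ≠ ⊤ ∧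
      Module.length R (M ⧸ LinearMap.range (LinearMap.lsmul R M x)) ≠ ⊤ := by
  rw [finLen_iff, ← length_kz_zero, ← length_kz_one]
  refine ⟨fun h => ⟨h 0, h 1⟩, fun h i => ?_⟩
  rcases zmod2_cases i with rfl | rfl
  exacts [h.1, h.2]

/-- The long exact sequence of multiplication by `x` breaks into short ones: the homology of the
quotient is an extension of the kernel of `x` on the next homology by the cokernel of `x` on the
present one. -/
lemma length_homology_of_smul {X Y : Cx R} {g : X ⟶ Y} {w : (x • 𝟙 X) ≫ g = 0}
    (h : (ShortComplex.mk (x • 𝟙 X) g w).ShortExact) (i : ZMod 2) :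
    Module.length R (Y.homology i) = Module.length R ((kz x (X.homology i)).homology 1) +
      Module.length R ((kz x (X.homology (i + 1))).homology 0) := by
  have r : (ComplexShape.up (ZMod 2)).Rel i (i + 1) := rfl
  have hx (j : ZMod 2) : (HomologicalComplex.homologyMap (x • 𝟙 X) j).hom =
      LinearMap.lsmul R (X.homology j) x := by
    have e : HomologicalComplex.homologyMap (x • 𝟙 X) j = x • 𝟙 (X.homology j) := by
      rw [← HomologicalComplex.homologyMap_id]
      exact ShortComplex.homologyMap_smul
        ((HomologicalComplex.shortComplexFunctor (ModuleCat R) (ComplexShape.up (ZMod 2)) j).map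
          (𝟙 X)) x
    rw [e]
    rfl
  rw [length_of_exact (h.homology_exact₃ i (i + 1) r), length_kz_zero, length_kz_one]
  have e1 := (ShortComplex.moduleCat_exact_iff_range_eq_ker _).1 (h.homology_exact₂ i)
  have e2 := (ShortComplex.moduleCat_exact_iff_range_eq_ker _).1 (h.homology_exact₁ i (i + 1) r)
  dsimp only at e1 e2
  rw [hx] at e1 e2
  congr 1
  · rw [e1]
    exact (LinearMap.quotKerEquivRange _).length_eq.symm
  · rw [← e2]

/-- The Euler characteristic of the reduction of a complex modulo a regular scalar. -/
lemma eul_of_smul {X Y : Cx R} {g : X ⟶ Y} {w : (x • 𝟙 X) ≫ g = 0}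
    (h : (ShortComplex.mk (x • 𝟙 X) g w).ShortExact)
    (hf : ∀ i, FinLen (kz x (X.homology i))) :
    eul Y = eul (kz x (X.homology 1)) - eul (kz x (X.homology 0)) := by
  have h0 := length_homology_of_smul h 0
  have h1 := length_homology_of_smul h 1
  rw [zero_add] at h0
  rw [(by decide : (1 + 1 : ZMod 2) = 0)] at h1
  rw [eul, eul, eul, h0, h1, ENat.toNat_add, ENat.toNat_add]
  · push_cast; ring
  all_goals exact finLen_iff.1 (hf _) _

open Polynomial IsLocalRing

variable {Q : Type u} [CommRing Q] [IsLocalRing Q]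

/-- By Schur's lemma `x` acts bijectively or as zero; in both cases kernel and cokernel have the
same length. -/
lemma kz_of_isSimpleModule {N : Type u} [AddCommGroup N] [Module R N] [IsSimpleModule R N] (x : R) :
    FinLen (kz x N) ∧ eul (kz x N) = 0 := by
  rw [finLen_kz_iff, eul_kz]
  have h1 : Module.length R N = 1 := Module.length_eq_one R N
  rcases LinearMap.bijective_or_eq_zero (LinearMap.lsmul R N x) with h | h
  · rw [LinearMap.ker_eq_bot.2 h.1, LinearMap.range_eq_top.2 h.2]
    simp
  · rw [h, LinearMap.ker_zero, LinearMap.range_zero, (Submodule.topEquiv).length_eq,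
      (Submodule.quotEquivOfEqBot (⊥ : Submodule R N) rfl).length_eq, h1]
    simp

/-- Primes containing the extension of the maximal ideal correspond to primes of a polynomial ring
over a field, in which every nonzero prime is maximal. -/
lemma isMaximal_or_le_map_C {P : Ideal Q[X]} [hP : P.IsPrime] (h : (maximalIdeal Q).map C ≤ P) :
    P.IsMaximal ∨ P = (maximalIdeal Q).map C := by
  let π : Q[X] →+* (ResidueField Q)[X] := mapRingHom (residue Q)
  have hπ : Function.Surjective π := map_surjective _ residue_surjective
  have hk : RingHom.ker π = (maximalIdeal Q).map C := by
    rw [ker_mapRingHom, ker_residue]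
  have hkP : RingHom.ker π ≤ P := hk.trans_le h
  have hprime := Ideal.map_isPrime_of_surjective hπ hkP
  have hc : (P.map π).comap π = P := by
    rw [Ideal.comap_map_of_surjective _ hπ, ← RingHom.ker_eq_comap_bot, sup_eq_left.2 hkP]
  by_cases h0 : P.map π = ⊥
  · right
    rw [← hc, h0, ← RingHom.ker_eq_comap_bot, hk]
  · left
    have := hprime.isMaximal h0
    rw [← hc]
    exact Ideal.comap_isMaximal_of_surjective π hπ

/-- For maximal `P` the module is simple and the index is zero. Otherwise it is the polynomial ring
over the residue field, on which X - a is injective with a cokernel of length one, for every a. -/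
lemma index_quotient {P : Ideal Q[X]} [hP : P.IsPrime] (h : (maximalIdeal Q).map C ≤ P)
    (N : Type u) [AddCommGroup N] [Module Q[X] N] (e : N ≃ₗ[Q[X]] Q[X] ⧸ P) :
    ∃ k : ℤ, ∀ a : Q, FinLen (kz (X - C a) N) ∧ eul (kz (X - C a) N) = k := by
  by_cases hm : P.IsMaximal
  · have : IsSimpleModule Q[X] N := isSimpleModule_iff_quot_maximal.2 ⟨P, hm, ⟨e⟩⟩
    exact ⟨0, fun a => kz_of_isSimpleModule _⟩
  have hP' := (isMaximal_or_le_map_C h).resolve_left hm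
  refine ⟨-1, fun a => ?_⟩
  let ev : Q[X] →+* ResidueField Q := (residue Q).comp (evalRingHom a)
  have hev : Function.Surjective ev :=
    residue_surjective.comp fun q => ⟨C q, eval_C⟩
  have hk : (RingHom.ker ev).IsMaximal := RingHom.ker_isMaximal_of_surjective ev hev
  have hPk : P ≤ RingHom.ker ev := by
    rw [hP', Ideal.map_le_iff_le_comap]
    intro r hr
    change residue Q (eval a (C r)) = 0
    rwa [eval_C, residue_eq_zero_iff]
  have hX : X - C a ∈ RingHom.ker ev := by
    change residue Q (eval a (X - C a)) = 0
    simp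
  have hsub (f : Q[X]) : ∃ g, f = C (eval a f) + (X - C a) * g := by
    obtain ⟨g, hg⟩ := X_sub_C_dvd_sub_C_eval (p := f) (a := a)
    exact ⟨g, by rw [← hg]; ring⟩
  have hXP : X - C a ∉ P := fun hx => hm (by
    have : P = RingHom.ker ev := le_antisymm hPk fun f hf => by
      obtain ⟨g, hg⟩ := hsub f
      rw [hg]
      exact P.add_mem (h (Ideal.mem_map_of_mem _ ((residue_eq_zero_iff _).1 hf)))
        (P.mul_mem_right _ hx)
    rwa [this])
  have hker : LinearMap.ker (LinearMap.lsmul Q[X] N (X - C a)) = ⊥ := by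
    rw [LinearMap.ker_eq_bot']
    intro n hn
    rw [← e.map_eq_zero_iff]
    obtain ⟨f, hf⟩ := Ideal.Quotient.mk_surjective (e n)
    have h0 : (X - C a) • e n = 0 := by
      rw [← map_smul]; exact e.map_eq_zero_iff.2 hn
    rw [← hf] at h0 ⊢
    have h0' : Ideal.Quotient.mk P ((X - C a) * f) = 0 := h0
    rw [Ideal.Quotient.eq_zero_iff_mem] at h0' ⊢
    exact (hP.mem_or_mem h0').resolve_left hXP
  -- The cokernel of X - a is a quotient of Q[X]; its annihilator turns out to be the kernel of
  -- evaluation at `a` into the residue field, hence it is simple.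
  let F : Q[X] →ₗ[Q[X]] N ⧸ LinearMap.range (LinearMap.lsmul Q[X] N (X - C a)) :=
    Submodule.mkQ _ ∘ₗ e.symm.toLinearMap ∘ₗ P.mkQ
  have hF : Function.Surjective F :=
    (Submodule.mkQ_surjective _).comp (e.symm.surjective.comp (Submodule.mkQ_surjective _))
  have hFk : LinearMap.ker F = RingHom.ker ev := by
    ext f
    rw [LinearMap.mem_ker]
    constructor
    · intro hf
      obtain ⟨n, hn⟩ := (Submodule.Quotient.mk_eq_zero _).1 hf
      obtain ⟨g, hg⟩ := Ideal.Quotient.mk_surjective (e n)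
      have h1 : P.mkQ f = P.mkQ ((X - C a) * g) := by
        apply e.symm.injective
        refine hn.symm.trans ?_
        apply e.injective
        rw [LinearEquiv.apply_symm_apply]
        refine (map_smul e _ _).trans ?_
        rw [← hg]
        rfl
      have h2 : f - (X - C a) * g ∈ P := by
        rw [← Submodule.Quotient.eq]; exact h1
      have := (RingHom.ker ev).add_mem (hPk h2) ((RingHom.ker ev).mul_mem_right g hX)
      rwa [sub_add_cancel] at this
    · intro hf
      obtain ⟨g, hg⟩ := hsub f
      refine (Submodule.Quotient.mk_eq_zero _).2 ⟨e.symm (P.mkQ g), ?_⟩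
      change (X - C a) • e.symm (P.mkQ g) = e.symm (P.mkQ f)
      rw [← map_smul, ← map_smul]
      congr 1
      refine ((Submodule.Quotient.eq P).2 ?_).symm
      rw [smul_eq_mul]
      have : f - (X - C a) * g = C (eval a f) := by
        conv_lhs => rw [hg]
        simp
      rw [this]
      exact h (Ideal.mem_map_of_mem _ ((residue_eq_zero_iff _).1 hf))
  have hs : IsSimpleModule Q[X] (N ⧸ LinearMap.range (LinearMap.lsmul Q[X] N (X - C a))) :=
    isSimpleModule_iff_quot_maximal.2 ⟨_, hFk ▸ hk, ⟨(LinearMap.quotKerEquivOfSurjective F hF).symm⟩⟩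
  rw [finLen_kz_iff, eul_kz, hker, Module.length_eq_one Q[X] (N ⧸ _)]
  simp

variable (Q) in
/-- The index of `X - a` on `H` is finite and does not depend on `a`. -/
def HasIndex (H : Type u) [AddCommGroup H] [Module Q[X] H] : Prop :=
  ∃ k : ℤ, ∀ a : Q, FinLen (kz (X - C a) H) ∧ eul (kz (X - C a) H) = k

variable (Q) in
/-- The module `H` is supported on the closed fibre. -/
def ClosedFibre (H : Type u) [AddCommGroup H] [Module Q[X] H] : Prop :=
  ∀ r ∈ maximalIdeal Q, ∃ n : ℕ, ∀ y : H, (C r : Q[X]) ^ n • y = 0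

lemma HasIndex.of_subsingleton (N : Type u) [AddCommGroup N] [Module Q[X] N] [Subsingleton N] :
    HasIndex Q N := by
  refine ⟨0, fun a => ?_⟩
  have : Acyclic (kz (X - C a) N) := by
    rw [acyclic_iff_exact]
    intro i y _
    exact ⟨y, Subsingleton.elim (α := N) _ _⟩
  exact ⟨this.finLen, this.eul⟩

lemma ClosedFibre.hasIndex_quotient {P : Ideal Q[X]} (hP : P.IsPrime) {N : Type u} [AddCommGroup N]
    [Module Q[X] N] (hN : ClosedFibre Q N) (e : N ≃ₗ[Q[X]] Q[X] ⧸ P) : HasIndex Q N := by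
  refine index_quotient (Ideal.map_le_iff_le_comap.2 fun r hr => ?_) N e
  obtain ⟨n, hn⟩ := hN r hr
  have := congrArg e (hn (e.symm (Ideal.Quotient.mk P 1)))
  rw [map_smul, LinearEquiv.apply_symm_apply, map_zero] at this
  have h0 : Ideal.Quotient.mk P ((C r : Q[X]) ^ n * 1) = 0 := this
  rw [mul_one, Ideal.Quotient.eq_zero_iff_mem] at h0
  exact hP.mem_of_pow_mem n h0

lemma HasIndex.of_exact {A B D : Type u} [AddCommGroup A] [Module Q[X] A] [AddCommGroup B]
    [Module Q[X] B] [AddCommGroup D] [Module Q[X] D] {f : A →ₗ[Q[X]] B} {g : B →ₗ[Q[X]] D}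
    (hf : Function.Injective f) (hg : Function.Surjective g) (hfg : Function.Exact f g)
    (hA : HasIndex Q A) (hD : HasIndex Q D) : HasIndex Q B := by
  obtain ⟨k, hk⟩ := hA
  obtain ⟨l, hl⟩ := hD
  refine ⟨k + l, fun a => ?_⟩
  obtain ⟨s, hs, e1, e2, e3⟩ := kz_shortExact (X - C a) hf hg hfg
  have f1 : FinLen s.X₁ := e1 ▸ (hk a).1
  have f3 : FinLen s.X₃ := e3 ▸ (hl a).1
  have f2 := FinLen.of_shortExact₂ hs f1 f3
  have := eul_shortExact hs f2 f3
  rw [e1, e2, e3, (hk a).2, (hl a).2] at this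
  exact ⟨e2 ▸ f2, this⟩

/-- On finitely generated `Q[X]`-modules supported on the closed fibre, the index of `X - a` does
not depend on `a`. -/
theorem ClosedFibre.hasIndex [IsNoetherianRing Q] (H : Type u) [AddCommGroup H] [Module Q[X] H]
    [Module.Finite Q[X] H] : ClosedFibre Q H → HasIndex Q H := by
  refine IsNoetherianRing.induction_on_isQuotientEquivQuotientPrime Q[X] (M := H) inferInstance
    (motive := fun N _ _ _ => ClosedFibre Q N → HasIndex Q N) ?_ ?_ ?_
  · exact fun N _ _ _ _ _ => HasIndex.of_subsingleton N
  · exact fun N _ _ _ P e hN => hN.hasIndex_quotient P.2 e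
  · intro A _ _ _ B _ _ _ D _ _ _ f g hf hg hfg hA hD hB
    refine HasIndex.of_exact hf hg hfg (hA fun r hr => ?_) (hD fun r hr => ?_)
    · obtain ⟨n, hn⟩ := hB r hr
      exact ⟨n, fun y => hf (by rw [map_smul, hn, map_zero])⟩
    · obtain ⟨n, hn⟩ := hB r hr
      refine ⟨n, fun y => ?_⟩
      obtain ⟨z, rfl⟩ := hg y
      rw [← map_smul, hn, map_zero]

end Index
end
end CyclicAdams

namespace CyclicAdams
open scoped Fin.NatCast Fin.CommRing
noncomputable section

/-! ### Polynomials with coefficients in a module. -/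

section PolyModules

open Polynomial

variable {Q : Type u} [CommRing Q] {V W : Type u} [AddCommGroup V] [Module Q V] [AddCommGroup W]
  [Module Q W]

/-! ### Polynomials with coefficients in a module -/

lemma polyCoeff_ext {f g : PolynomialModule Q V} (h : ∀ n, f.coeff n = g.coeff n) : f = g :=
  PolynomialModule.coeff_injective (Finsupp.ext h)

lemma coeff_X_smul_zero (f : PolynomialModule Q V) : ((X : Q[X]) • f).coeff 0 = 0 := by
  rw [← monomial_one_one_eq_X, PolynomialModule.monomial_smul_apply, if_neg (by simp)]

lemma coeff_X_smul_succ (f : PolynomialModule Q V) (n : ℕ) :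
    ((X : Q[X]) • f).coeff (n + 1) = f.coeff n := by
  rw [← monomial_one_one_eq_X, PolynomialModule.monomial_smul_apply, if_pos (by simp), one_smul, Nat.add_sub_cancel]

lemma coeff_smul_zero (p : Q[X]) (f : PolynomialModule Q V) :
    (p • f).coeff 0 = p.coeff 0 • f.coeff 0 := by
  rw [PolynomialModule.smul_apply, Finset.Nat.antidiagonal_zero, Finset.sum_singleton]

lemma coeff_smul_one (p : Q[X]) (f : PolynomialModule Q V) :
    (p • f).coeff 1 = p.coeff 0 • f.coeff 1 + p.coeff 1 • f.coeff 0 := by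
  rw [PolynomialModule.smul_apply, Finset.Nat.antidiagonal_succ]
  simp

/-- The map on polynomials induced by a linear map. -/
def polyMap (f : V →ₗ[Q] W) : PolynomialModule Q V →ₗ[Q[X]] PolynomialModule Q W where
  toFun := PolynomialModule.map Q f
  map_add' := map_add _
  map_smul' p q := by
    rw [PolynomialModule.map_smul]
    simp

lemma coeff_polyMap (f : V →ₗ[Q] W) (q : PolynomialModule Q V) (n : ℕ) :
    (polyMap f q).coeff n = f (q.coeff n) := by
  change (PolynomialModule.map Q f q).coeff n = _
  simp [PolynomialModule.map]

/-- Division by the variable. -/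
def polyDivX (f : PolynomialModule Q V) : PolynomialModule Q V :=
  PolynomialModule.ofCoeff Q (Finsupp.comapDomain Nat.succ f.coeff Nat.succ_injective.injOn)

lemma coeff_polyDivX (f : PolynomialModule Q V) (n : ℕ) :
    (polyDivX f).coeff n = f.coeff (n + 1) := rfl

lemma X_smul_polyDivX {f : PolynomialModule Q V} (h : f.coeff 0 = 0) :
    (X : Q[X]) • polyDivX f = f := polyCoeff_ext fun n => by
  cases n with
  | zero => rw [coeff_X_smul_zero, h]
  | succ n => rw [coeff_X_smul_succ, coeff_polyDivX]

lemma polyDivX_X_smul (f : PolynomialModule Q V) : polyDivX ((X : Q[X]) • f) = f :=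
  polyCoeff_ext fun n => by rw [coeff_polyDivX, coeff_X_smul_succ]

lemma X_smul_injective : Function.Injective fun f : PolynomialModule Q V => (X : Q[X]) • f :=
  fun f g h => by rw [← polyDivX_X_smul f, ← polyDivX_X_smul g]; exact congrArg polyDivX h

lemma polyDivX_smul (p : Q[X]) {f : PolynomialModule Q V} (h : f.coeff 0 = 0) :
    polyDivX (p • f) = p • polyDivX f := by
  apply X_smul_injective
  dsimp only
  rw [X_smul_polyDivX (by rw [coeff_smul_zero, h, smul_zero]), smul_comm, X_smul_polyDivX h]

lemma single_add_X_smul_polyDivX (f : PolynomialModule Q V) :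
    PolynomialModule.single Q 0 (f.coeff 0) + (X : Q[X]) • polyDivX f = f := polyCoeff_ext fun n => by
  rw [PolynomialModule.coeff_add, Finsupp.add_apply, PolynomialModule.coeff_single]
  cases n with
  | zero => rw [coeff_X_smul_zero, Finsupp.single_eq_same, add_zero]
  | succ n => rw [coeff_X_smul_succ, coeff_polyDivX, Finsupp.single_eq_of_ne (by simp), zero_add]

lemma exists_eq_single_add (a : Q) (f : PolynomialModule Q V) :
    ∃ g, f = PolynomialModule.single Q 0 (PolynomialModule.eval a f) + (X - C a : Q[X]) • g := by
  induction f using PolynomialModule.induction_linear with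
  | zero => exact ⟨0, by simp⟩
  | add f g hf hg =>
    obtain ⟨f', hf'⟩ := hf
    obtain ⟨g', hg'⟩ := hg
    refine ⟨f' + g', ?_⟩
    conv_lhs => rw [hf', hg']
    rw [map_add, PolynomialModule.single_add, smul_add]
    abel
  | single n v =>
    obtain ⟨q, hq⟩ := X_sub_C_dvd_sub_C_eval (p := (X ^ n : Q[X])) (a := a)
    refine ⟨q • PolynomialModule.single Q 0 v, ?_⟩
    rw [smul_smul, ← hq, sub_smul, PolynomialModule.eval_single, ← monomial_one_right_eq_X_pow, PolynomialModule.monomial_smul_single,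
      eval_monomial, one_mul, ← monomial_zero_left, PolynomialModule.monomial_smul_single]
    simp

lemma projective_polynomialModule [Module.Projective Q V] :
    Module.Projective Q[X] (PolynomialModule Q V) :=
  Module.Projective.of_equiv (PolynomialModule.polynomialTensorProductLEquivPolynomialModule Q V)

lemma finite_polynomialModule [Module.Finite Q V] :
    Module.Finite Q[X] (PolynomialModule Q V) :=
  Module.Finite.equiv (PolynomialModule.polynomialTensorProductLEquivPolynomialModule Q V)

/-- Flatness of Q[X] preserves syzygy sequences, and base change preserves projectives; finite
generation of the syzygies comes from the Noetherian hypothesis. -/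
lemma hasProjectiveDimensionLT_baseChange [IsNoetherianRing Q] (n : ℕ) : ∀ (V : Type u)
    [AddCommGroup V] [Module Q V] [Module.Finite Q V],
    HasProjectiveDimensionLT (ModuleCat.of Q V) (n + 1) →
      HasProjectiveDimensionLT (ModuleCat.of Q[X] (Q[X] ⊗[Q] V)) (n + 1) := by
  induction n with
  | zero =>
    intro V _ _ _ h
    rw [zero_add, ← projective_iff_hasProjectiveDimensionLT_one, ← IsProjective.iff_projective]
      at h ⊢
    infer_instance
  | succ n ih =>
    intro V _ _ _ h
    obtain ⟨m, f, hf⟩ := Module.Finite.exists_fin' Q V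
    have hex : Function.Exact (LinearMap.ker f).subtype f := LinearMap.exact_subtype_ker_map f
    have h1 := (shortExact_of_exact (Submodule.subtype_injective _) hf
      hex).hasProjectiveDimensionLT_X₁ (n + 1)
        (by
          have : Projective (ModuleCat.of Q (Fin m → Q)) :=
            (IsProjective.iff_projective _).1 inferInstance
          exact hasProjectiveDimensionLT_of_ge _ 1 _ (by omega)) h
    have h2 := ih _ h1
    refine (shortExact_of_exact (f := (LinearMap.ker f).subtype.baseChange Q[X])
      (g := f.baseChange Q[X]) ?_ ?_ ?_).hasProjectiveDimensionLT_X₃ (n + 1) h2 ?_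
    · exact Module.Flat.lTensor_preserves_injective_linearMap (M := Q[X]) _
        (Submodule.subtype_injective _)
    · exact LinearMap.lTensor_surjective _ hf
    · exact lTensor_exact _ hex hf
    · have : Projective (ModuleCat.of Q[X] (Q[X] ⊗[Q] (Fin m → Q))) :=
        (IsProjective.iff_projective _).1 inferInstance
      exact hasProjectiveDimensionLT_of_ge _ 1 _ (by omega)

lemma hasProjectiveDimensionLT_polynomialModule [IsNoetherianRing Q] {n : ℕ} [Module.Finite Q V]
    (h : HasProjectiveDimensionLT (ModuleCat.of Q V) (n + 1)) :
    HasProjectiveDimensionLT (ModuleCat.of Q[X] (PolynomialModule Q V)) (n + 1) :=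
  have := hasProjectiveDimensionLT_baseChange n V h
  hasProjectiveDimensionLT_of_iso
    (PolynomialModule.polynomialTensorProductLEquivPolynomialModule Q V).toModuleIso _

/-! ### Polynomials with constant term in a submodule -/

/-- The polynomials with constant term in `Z`. -/
def constIn (Z : Submodule Q V) : Submodule Q[X] (PolynomialModule Q V) where
  carrier := {f | f.coeff 0 ∈ Z}
  zero_mem' := Z.zero_mem
  add_mem' ha hb := Z.add_mem ha hb
  smul_mem' p f hf := by
    change (p • f).coeff 0 ∈ Z
    rw [coeff_smul_zero]
    exact Z.smul_mem _ hf

lemma mem_constIn {Z : Submodule Q V} {f : PolynomialModule Q V} :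
    f ∈ constIn Z ↔ f.coeff 0 ∈ Z := Iff.rfl

lemma X_smul_mem_constIn (Z : Submodule Q V) (f : PolynomialModule Q V) :
    (X : Q[X]) • f ∈ constIn Z := by
  rw [mem_constIn, coeff_X_smul_zero]
  exact Z.zero_mem

/-- The polynomials with constant term in `Z` are the sum of Z[X] and X·V[X], which meet in X·Z[X].
The resulting sequence has Z[X] on the left, embedded by q ↦ (Xq, -q), and the sum of Z[X] with V[X]
in the middle, so the bound grows by one. -/
lemma hasProjectiveDimensionLT_constIn [IsNoetherianRing Q] {n : ℕ} [Module.Finite Q V]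
    [Module.Projective Q V] (Z : Submodule Q V)
    (h : HasProjectiveDimensionLT (ModuleCat.of Q Z) (n + 1)) :
    HasProjectiveDimensionLT (ModuleCat.of Q[X] (constIn Z)) (n + 2) := by
  have h1 := hasProjectiveDimensionLT_polynomialModule h
  have h2 : HasProjectiveDimensionLT (ModuleCat.of Q[X] (PolynomialModule Q V)) (n + 1) := by
    have := projective_polynomialModule (Q := Q) (V := V)
    have : Projective (ModuleCat.of Q[X] (PolynomialModule Q V)) :=
      (IsProjective.iff_projective _).1 inferInstance
    exact hasProjectiveDimensionLT_of_ge _ 1 _ (by omega)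
  have h3 : HasProjectiveDimensionLT
      (ModuleCat.of Q[X] (PolynomialModule Q Z × PolynomialModule Q V)) (n + 1) :=
    (shortExact_of_exact (f := LinearMap.inl Q[X] (PolynomialModule Q Z) (PolynomialModule Q V))
      LinearMap.inl_injective LinearMap.snd_surjective
      Function.Exact.inl_snd).hasProjectiveDimensionLT_X₂ _ h1 h2
  let α : PolynomialModule Q Z →ₗ[Q[X]] PolynomialModule Q Z × PolynomialModule Q V :=
    LinearMap.prod (LinearMap.lsmul Q[X] _ X) (-polyMap Z.subtype)
  let β : PolynomialModule Q Z × PolynomialModule Q V →ₗ[Q[X]] constIn Z :=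
    (LinearMap.coprod (polyMap Z.subtype) (LinearMap.lsmul Q[X] _ X)).codRestrict _ fun f => by
      refine (constIn Z).add_mem ?_ (X_smul_mem_constIn Z f.2)
      change (polyMap Z.subtype f.1).coeff 0 ∈ Z
      rw [coeff_polyMap]
      exact (f.1.coeff 0).2
  have hα (q) : α q = ((X : Q[X]) • q, - polyMap Z.subtype q) := rfl
  have hβ (q y) : (β (q, y)).1 = polyMap Z.subtype q + (X : Q[X]) • y := rfl
  refine (shortExact_of_exact (f := α) (g := β) ?_ ?_ ?_).hasProjectiveDimensionLT_X₃ (n + 1) h1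
    (hasProjectiveDimensionLT_of_ge _ (n + 1) _ (by omega))
  · intro q q' h
    exact X_smul_injective (congrArg Prod.fst h)
  · intro f
    refine ⟨(PolynomialModule.single Q 0 ⟨f.1.coeff 0, f.2⟩, polyDivX f.1), Subtype.ext ?_⟩
    rw [hβ]
    refine Eq.trans ?_ (single_add_X_smul_polyDivX f.1)
    congr 1
    exact PolynomialModule.map_single _ _ _ _
  · rintro ⟨q, y⟩
    constructor
    · intro h
      have h0 : polyMap Z.subtype q + (X : Q[X]) • y = 0 := congrArg Subtype.val h
      have hc (n) : (q.coeff n).1 + ((X : Q[X]) • y).coeff n = 0 := by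
        have := congrArg (fun f => f.coeff n) h0
        rw [PolynomialModule.coeff_add, Finsupp.add_apply, coeff_polyMap] at this
        exact this
      refine ⟨polyDivX q, ?_⟩
      rw [hα, X_smul_polyDivX]
      · refine Prod.ext rfl (polyCoeff_ext fun n => ?_)
        have := hc (n + 1)
        rw [coeff_X_smul_succ] at this
        refine Eq.trans ?_ (neg_eq_of_add_eq_zero_right this)
        change -((polyMap Z.subtype (polyDivX q)).coeff n) = _
        rw [coeff_polyMap]
        rfl
      · have := hc 0
        rw [coeff_X_smul_zero, add_zero] at this
        exact Subtype.ext this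
    · rintro ⟨q', h⟩
      rw [← h]
      refine Subtype.ext ?_
      rw [hα, hβ]
      rw [map_smul]
      change X • polyMap Z.subtype q' + X • -polyMap Z.subtype q' = 0
      rw [smul_neg, add_neg_cancel]

end PolyModules
end
end CyclicAdams

namespace CyclicAdams
open scoped Fin.NatCast Fin.CommRing
noncomputable section

/-! ### The degeneration of a complex to its homology and the invariance of Euler characteristics.
-/

section Degeneration

open Polynomial IsLocalRing

variable {Q : Type u} [CommRing Q]

/-! ### The degeneration of a complex -/

lemma d_eq_zero_of_mem_cyc {V : Cx Q} {i : ZMod 2} {z : V.X i} (hz : z ∈ cyc V i) (j : ZMod 2) :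
    (V.d i j).hom z = 0 := by
  by_cases h : i + 1 = j
  · subst h; exact hz
  · rw [V.shape i j h]; rfl

lemma d_mem_bdry (V : Cx Q) (i j : ZMod 2) (y : V.X i) : (V.d i j).hom y ∈ bdry V j := by
  by_cases h : i + 1 = j
  · obtain rfl : i = j + 1 := by rw [← h, add_one_add_one]
    exact ⟨y, rfl⟩
  · rw [V.shape i j h]; exact Submodule.zero_mem _

lemma polyDivX_add {W : Type u} [AddCommGroup W] [Module Q W] (f g : PolynomialModule Q W) :
    polyDivX (f + g) = polyDivX f + polyDivX g :=
  polyCoeff_ext fun _ => rfl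

lemma coeff_C_smul {W : Type u} [AddCommGroup W] [Module Q W] (r : Q) (f : PolynomialModule Q W)
    (n : ℕ) : ((C r : Q[X]) • f).coeff n = r • f.coeff n := by
  rw [← monomial_zero_left, PolynomialModule.monomial_smul_apply, if_pos (Nat.zero_le n),
    Nat.sub_zero]

variable (V : Cx Q)

lemma coeff_zero_polyMap_d {i : ZMod 2} (j : ZMod 2) (f : constIn (cyc V i)) :
    (polyMap (V.d i j).hom f.1).coeff 0 = 0 := by
  rw [coeff_polyMap, d_eq_zero_of_mem_cyc f.2]

/-- The complex of polynomials with coefficients in `V` the constant term of which is a cycle, with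
the differential of `V` divided by the variable. -/
def rees : Cx Q[X] :=
  mkCx (fun i => constIn (cyc V i))
    (fun i j =>
      -- Division by the variable is possible because the constant term is a cycle; the new constant
      -- term is the differential of the linear coefficient, hence again a cycle.
      { toFun := fun f => ⟨polyDivX (polyMap (V.d i j).hom f.1), by
          rw [mem_constIn, coeff_polyDivX, coeff_polyMap]
          exact d_d_apply V i j (j + 1) _⟩
        map_add' := fun f g => Subtype.ext (by
          change polyDivX (polyMap _ (f.1 + g.1)) = _
          rw [map_add, polyDivX_add]
          rfl)
        map_smul' := fun q f => Subtype.ext (by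
          change polyDivX (polyMap _ (q • f.1)) = _
          rw [map_smul, polyDivX_smul _ (coeff_zero_polyMap_d V j f)]
          rfl) })
    (fun i j h => LinearMap.ext fun f => Subtype.ext (polyCoeff_ext fun n => by
      change (polyMap (V.d i j).hom f.1).coeff (n + 1) = 0
      rw [coeff_polyMap, V.shape i j h]
      rfl))
    fun i j k f => Subtype.ext (polyCoeff_ext fun n => by
      change (polyMap (V.d j k).hom (polyDivX (polyMap (V.d i j).hom f.1))).coeff (n + 1) = 0
      rw [coeff_polyMap, coeff_polyDivX, coeff_polyMap]
      exact d_d_apply V i j k _)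

variable {V}

/-- The differential is divided by the variable, so the homotopy is multiplied by it. The product
with the variable has zero constant term and thus stays in the complex. -/
lemma Null.rees {r : Q} (h : Null r V) : Null (C r) (rees V) := by
  obtain ⟨h, hh⟩ := h
  refine ⟨fun i j => ((LinearMap.lsmul Q[X] _ X ∘ₗ polyMap (h i j)) ∘ₗ
    (constIn (cyc V i)).subtype).codRestrict (constIn (cyc V j))
      fun f => X_smul_mem_constIn _ _, fun i (f : constIn (cyc V i)) => Subtype.ext ?_⟩
  change (X : Q[X]) • polyMap (h (i + 1) i) (polyDivX (polyMap (V.d i (i + 1)).hom f.1)) +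
    polyDivX (polyMap (V.d (i + 1) i).hom ((X : Q[X]) • polyMap (h i (i + 1)) f.1)) =
      (C r : Q[X]) • f.1
  rw [← map_smul, X_smul_polyDivX (coeff_zero_polyMap_d V (i + 1) f), map_smul, polyDivX_X_smul]
  refine polyCoeff_ext fun n => ?_
  rw [PolynomialModule.coeff_add, Finsupp.add_apply, coeff_polyMap, coeff_polyMap, coeff_polyMap,
    coeff_polyMap, coeff_C_smul, hh]

lemma ringRed_eval (a : Q) : RingRed (evalRingHom a) (X - C a) where
  surj q := ⟨C q, eval_C⟩
  zero := by simp
  ker f hf := by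
    obtain ⟨g, hg⟩ := dvd_iff_isRoot.2 (show IsRoot f a from hf)
    exact ⟨g, hg⟩
  reg f hf := (monic_X_sub_C a).mul_right_eq_zero_iff.1 hf

lemma smul_eq_zero_of_projective {a : Q} {M : Type u} [AddCommGroup M] [Module Q[X] M]
    [Module.Projective Q[X] M] {m : M} (h : (X - C a : Q[X]) • m = 0) : m = 0 :=
  (Module.Flat.isSMulRegular_of_nonZeroDivisors (M := M)
    (monic_X_sub_C a).mem_nonZeroDivisors).right_eq_zero_of_smul h

/-- The reduction of the degeneration at `1` is the complex itself. -/
def redReesOne (hV : ∀ i, Module.Projective Q (V.X i)) :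
    Red (evalRingHom (1 : Q)) (X - C 1) (rees V) V where
  map i :=
    { toFun := fun f => PolynomialModule.eval 1 f.1
      map_add' := fun f g => map_add _ _ _
      map_smul' := fun q f => PolynomialModule.eval_smul _ _ _ }
  comm i j f := by
    have h := X_smul_polyDivX (coeff_zero_polyMap_d V j f)
    have h1 := congrArg (PolynomialModule.eval (1 : Q)) h
    rw [PolynomialModule.eval_smul, eval_X, one_smul] at h1
    refine h1.trans ?_
    exact PolynomialModule.eval_map Q (V.d i j).hom f.1 1
  surj i y := by
    -- A constant would have to be a cycle; the monomial yX has zero constant term and still takes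
    -- the value `y` at 1.
    refine ⟨⟨PolynomialModule.single Q 1 y, ?_⟩, ?_⟩
    · rw [mem_constIn, PolynomialModule.coeff_single, Finsupp.single_eq_of_ne (by simp)]
      exact Submodule.zero_mem _
    · change PolynomialModule.eval 1 (PolynomialModule.single Q 1 y) = y
      rw [PolynomialModule.eval_single, one_pow, one_smul]
  ker i f hf := by
    obtain ⟨g, hg⟩ := exists_eq_single_add 1 f.1
    have hf' : PolynomialModule.eval 1 f.1 = 0 := hf
    rw [hf', PolynomialModule.single_zero, zero_add] at hg
    refine ⟨⟨g, ?_⟩, Subtype.ext hg⟩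
    -- If f = (X - 1) g, the constant terms differ only by a sign, so that of `g` is a cycle as
    -- well.
    have h0 := f.2
    rw [mem_constIn, hg, coeff_smul_zero] at h0
    rw [mem_constIn]
    simpa using h0
  reg i f hf := by
    have := hV i
    have := projective_polynomialModule (Q := Q) (V := V.X i)
    exact Subtype.ext (smul_eq_zero_of_projective (congrArg Subtype.val hf))

/-- The differential of `nilCx`. -/
def nilD (V : Cx Q) (U : ∀ i, Submodule Q (V.X i)) (hU : ∀ i, bdry V i ≤ U i) (i j : ZMod 2) :
    U i × (V.X i ⧸ cyc V i) →ₗ[Q] U j × (V.X j ⧸ cyc V j) :=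
  LinearMap.inl Q _ _ ∘ₗ (cyc V i).liftQ
    ((V.d i j).hom.codRestrict (U j) fun y => hU j (d_mem_bdry V i j y))
    (fun _ hz => Subtype.ext (d_eq_zero_of_mem_cyc hz j)) ∘ₗ LinearMap.snd Q _ _

lemma nilD_apply (U : ∀ i, Submodule Q (V.X i)) (hU : ∀ i, bdry V i ≤ U i) (i j : ZMod 2) (z : U i)
    (y : V.X i) : nilD V U hU i j (z, Submodule.Quotient.mk y) =
      (⟨(V.d i j).hom y, hU j (d_mem_bdry V i j y)⟩, 0) := rfl

/-- For a family `U` of submodules containing the boundaries, the complex with components `U`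
and `V / Z` with the differential induced by that of `V`. -/
def nilCx (V : Cx Q) (U : ∀ i, Submodule Q (V.X i)) (hU : ∀ i, bdry V i ≤ U i) : Cx Q :=
  mkCx (fun i => U i × (V.X i ⧸ cyc V i)) (nilD V U hU)
    (fun i j h => LinearMap.ext fun ⟨z, y⟩ => by
      obtain ⟨y, rfl⟩ := Submodule.Quotient.mk_surjective _ y
      rw [nilD_apply]
      refine Prod.ext (Subtype.ext ?_) rfl
      change (V.d i j).hom y = 0
      rw [V.shape i j h]
      rfl)
    fun i j k ⟨z, y⟩ => by
      obtain ⟨y, rfl⟩ := Submodule.Quotient.mk_surjective _ y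
      rw [nilD_apply, ← Submodule.Quotient.mk_zero, nilD_apply]
      exact Prod.ext (Subtype.ext (map_zero (V.d j k).hom)) rfl

/-- The reduction of the degeneration at `0`. -/
def redReesZero (hV : ∀ i, Module.Projective Q (V.X i)) :
    Red (evalRingHom (0 : Q)) (X - C 0) (rees V) (nilCx V (cyc V) (bdry_le_cyc V)) where
  map i :=
    -- A multiple of the variable within the complex has zero constant term and a cycle as linear
    -- coefficient, and nothing else is constrained. So the fibre at 0 remembers the constant term
    -- and the linear coefficient modulo cycles.
    { toFun := fun f => ((⟨f.1.coeff 0, f.2⟩, Submodule.Quotient.mk (f.1.coeff 1)) :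
        cyc V i × (V.X i ⧸ cyc V i))
      map_add' := fun f g => rfl
      map_smul' := fun q f => by
        refine Prod.ext (Subtype.ext ?_) ?_
        · change (q • f.1).coeff 0 = q.eval 0 • f.1.coeff 0
          rw [coeff_smul_zero, coeff_zero_eq_eval_zero]
        · change (cyc V i).mkQ ((q • f.1).coeff 1) = q.eval 0 • (cyc V i).mkQ (f.1.coeff 1)
          have h : (cyc V i).mkQ (f.1.coeff 0) = 0 := (Submodule.Quotient.mk_eq_zero _).2 f.2
          rw [coeff_smul_one, map_add, map_smul, coeff_zero_eq_eval_zero, map_smul, h, smul_zero,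
            add_zero] }
  comm i j f := by
    refine Prod.ext (Subtype.ext ?_) ?_
    · change (polyMap (V.d i j).hom f.1).coeff 1 = (V.d i j).hom (f.1.coeff 1)
      rw [coeff_polyMap]
    · change (Submodule.Quotient.mk ((polyMap (V.d i j).hom f.1).coeff 2) : V.X j ⧸ cyc V j) = 0
      rw [coeff_polyMap, Submodule.Quotient.mk_eq_zero]
      exact d_d_apply V i j (j + 1) _
  surj i := by
    rintro ⟨z, y⟩
    obtain ⟨y, rfl⟩ := Submodule.Quotient.mk_surjective _ y
    have e0 : (PolynomialModule.single Q 0 z.1 + PolynomialModule.single Q 1 y).coeff 0 = z.1 := by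
      simp
    have e1 : (PolynomialModule.single Q 0 z.1 + PolynomialModule.single Q 1 y).coeff 1 = y := by
      simp
    refine ⟨⟨PolynomialModule.single Q 0 z.1 + PolynomialModule.single Q 1 y, ?_⟩, ?_⟩
    · rw [mem_constIn, e0]
      exact z.2
    · exact Prod.ext (Subtype.ext e0) (congrArg Submodule.Quotient.mk e1)
  ker i f hf := by
    have h0 : f.1.coeff 0 = 0 := congrArg Subtype.val (congrArg Prod.fst hf)
    have h1 : (Submodule.Quotient.mk (f.1.coeff 1) : V.X i ⧸ cyc V i) = 0 := congrArg Prod.snd hf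
    refine ⟨⟨polyDivX f.1, (Submodule.Quotient.mk_eq_zero (cyc V i)).1 h1⟩, Subtype.ext ?_⟩
    refine (X_smul_polyDivX h0).symm.trans ?_
    rw [C_0, sub_zero]
    rfl
  reg i f hf := by
    have := hV i
    have := projective_polynomialModule (Q := Q) (V := V.X i)
    exact Subtype.ext (smul_eq_zero_of_projective (congrArg Subtype.val hf))

/-! ### Invariance of Euler characteristics of eigenspaces -/

/-- The Euler characteristics of the eigenspaces of the reductions of a complex of projective
`Q[X]`-modules at `a` do not depend on `a`. -/
theorem exists_eul_eigen_eq [IsLocalRing Q] [IsNoetherianRing Q] {E : Cx Q[X]}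
    (hE : ∀ i, Module.Finite Q[X] (E.X i)) (hE' : ∀ i, Module.Projective Q[X] (E.X i))
    (hN : ∀ r ∈ maximalIdeal Q, ∃ n : ℕ, Null (C r ^ n) E) {p : ℕ} {u l : Q} (hp : p ≠ 0)
    (hu : u * p = 1) (hl : l ^ p = 1) :
    ∃ k : ℤ, ∀ (a : Q) (E' : Cx Q), Nonempty (Red (evalRingHom a) (X - C a) E E') →
      eul (eigen p E' l) = k := by
  have hu' : C u * (p : Q[X]) = 1 := by rw [← C_eq_natCast, ← C_mul, hu, C_1]
  have hl' : (C l : Q[X]) ^ p = 1 := by rw [← C_pow, hl, C_1]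
  have hI (i : ZMod 2) : HasIndex Q ((eigen p E (C l)).homology i) := by
    have h := finite_eigen hp hu' hl' hE
    have := homology_finite h i
    -- A null homotopic power of `C r` on `E` gives one on the eigenspace, so the finitely generated
    -- homology of the eigenspace is supported on the closed fibre.
    refine ClosedFibre.hasIndex _ fun r hr => ?_
    obtain ⟨n, hn⟩ := hN r hr
    refine ⟨n * p, fun y => ?_⟩
    rw [pow_mul]
    exact (hn.eigen hp hu' hl').smul_homology i y
  choose k hk using hI
  refine ⟨k 1 - k 0, fun a E' ⟨r⟩ => ?_⟩
  obtain ⟨g, w, h⟩ := exists_shortExact_eigen_resCx (ringRed_eval a).surj r.map r.comm r.surj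
    (ringRed_eval a).zero r.ker hp hu' hl' fun t ht => by
      have := projective_tPow (p := p) hE hE'
      exact smul_eq_zero_of_projective ht
  have e : evalRingHom a (C l) = l := eval_C
  -- The eigenspace of the fibre at `a` is the quotient of the eigenspace of `E` by X - a. Its Euler
  -- characteristic is thus a difference of two indices, and these do not depend on `a`.
  have := eul_of_smul h fun i => (hk i a).1
  rw [eul_resCx (ringRed_eval a).surj, e, (hk 1 a).2, (hk 0 a).2] at this
  exact this

end Degeneration
end
end CyclicAdams

namespace CyclicAdams
open scoped Fin.NatCast Fin.CommRing
noncomputable section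

/-! ### Complexes with zero differential and the structure of the degenerate fibre. -/

section Devissage

open Polynomial IsLocalRing

variable {Q : Type u} [CommRing Q]

/-! ### Complexes with zero differential -/

/-- The complex with components `S i` and zero differential. -/
abbrev zeroCx {T : Type u} [AddCommGroup T] [Module Q T] (S : ZMod 2 → Submodule Q T) : Cx Q :=
  gradedCx 0 S (fun k _ _ => (S (k + 1)).zero_mem) fun _ _ _ => rfl

variable (Q) in
/-- The module `W` in degree `j`. -/
abbrev conc (W : Type u) [AddCommGroup W] [Module Q W] (j : ZMod 2) : Cx Q :=
  zeroCx (T := W) fun i => if i = j then (⊤ : Submodule Q W) else ⊥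

lemma FinLen.of_isFiniteLength {X : Cx Q} (h : ∀ i, IsFiniteLength Q (X.X i)) : FinLen X := by
  rw [finLen_iff]
  intro i
  rw [(homologyEquiv X i).length_eq]
  refine ne_top_of_le_ne_top (Module.length_ne_top_iff.2 (h i)) ?_
  exact (Module.length_le_of_surjective _ (Submodule.mkQ_surjective _)).trans
    (Module.length_le_of_injective _ (Submodule.subtype_injective _))

lemma IsFiniteLength.submodule {T : Type u} [AddCommGroup T] [Module Q T] (h : IsFiniteLength Q T)
    (S : Submodule Q T) : IsFiniteLength Q S := by
  rw [← Module.length_ne_top_iff] at *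
  exact ne_top_of_le_ne_top h (Module.length_le_of_injective _ (Submodule.subtype_injective _))

lemma IsFiniteLength.finite {T : Type u} [AddCommGroup T] [Module Q T] (h : IsFiniteLength Q T) :
    Module.Finite Q T :=
  have := (isFiniteLength_iff_isNoetherian_isArtinian.1 h).1
  inferInstance

lemma pdim_of_finite [IsRegularLocalRing Q] {d n : ℕ} (hd : ringKrullDim Q = d) (hn : d ≤ n)
    {X : Cx Q} (h : ∀ i, Module.Finite Q (X.X i)) (h' : FinLen X) : PDim n X :=
  ⟨h, h', fun i =>
    have := h i
    have := hasProjectiveDimensionLT_of_isRegularLocalRing Q hd (X.X i)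
    hasProjectiveDimensionLT_of_ge _ (d + 1) _ (by omega)⟩

lemma pdim_zeroCx [IsRegularLocalRing Q] {d n : ℕ} (hd : ringKrullDim Q = d) (hn : d ≤ n)
    {T : Type u} [AddCommGroup T] [Module Q T] (h : IsFiniteLength Q T)
    (S : ZMod 2 → Submodule Q T) : PDim n (zeroCx S) :=
  pdim_of_finite hd hn (fun i => IsFiniteLength.finite (IsFiniteLength.submodule h (S i)))
    (FinLen.of_isFiniteLength fun i => IsFiniteLength.submodule h (S i))

variable {W W' W'' : Type u} [AddCommGroup W] [Module Q W] [AddCommGroup W'] [Module Q W']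
  [AddCommGroup W''] [Module Q W'']

lemma conc_shortExact (j : ZMod 2) {f : W' →ₗ[Q] W} {g : W →ₗ[Q] W''} (hf : Function.Injective f)
    (hg : Function.Surjective g) (h : Function.Exact f g) :
    ∃ S : ShortComplex (Cx Q), S.ShortExact ∧ S.X₁ = conc Q W' j ∧ S.X₂ = conc Q W j ∧
      S.X₃ = conc Q W'' j := by
  have key {A B : Type u} [AddCommGroup A] [Module Q A] [AddCommGroup B] [Module Q B]
      (q : A →ₗ[Q] B) (k : ZMod 2) (t : A) (ht : t ∈ (if k = j then (⊤ : Submodule Q A) else ⊥)) :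
      q t ∈ (if k = j then (⊤ : Submodule Q B) else ⊥) := by
    split_ifs at ht ⊢
    · trivial
    · rw [(Submodule.mem_bot Q).1 ht, map_zero]
      exact Submodule.zero_mem _
  refine gradedCx_shortExact f g (key f) (key g) (fun _ _ _ => map_zero _) (fun _ _ _ => map_zero _)
    (fun _ t _ ht => hf (ht.trans (map_zero f).symm)) (fun k t ht => ?_)
    (fun _ t _ => h.apply_apply_eq_zero t) fun k t ht h0 => ?_
  · split_ifs at ht ⊢
    · obtain ⟨s, hs⟩ := hg t
      exact ⟨s, trivial, hs⟩
    · exact ⟨0, Submodule.zero_mem _, by rw [(Submodule.mem_bot Q).1 ht, map_zero]⟩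
  · split_ifs at ht ⊢
    · obtain ⟨s, hs⟩ := (h t).1 h0
      exact ⟨s, trivial, hs⟩
    · exact ⟨0, Submodule.zero_mem _, by rw [(Submodule.mem_bot Q).1 ht, map_zero]⟩

lemma acyclic_zeroCx {T : Type u} [AddCommGroup T] [Module Q T] [Subsingleton T]
    (S : ZMod 2 → Submodule Q T) : Acyclic (zeroCx S) :=
  (acyclic_iff_exact _).2 fun i (x : S i) _ => ⟨0, (map_zero _).trans
    (Subtype.ext (Subsingleton.elim _ _) : (0 : S i) = x)⟩

/-- The contractible complex with components `W`. -/
lemma exists_shift_shortExact (W : Type u) [AddCommGroup W] [Module Q W] :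
    ∃ S : ShortComplex (Cx Q), S.ShortExact ∧ S.X₁ = conc Q W 1 ∧ S.X₃ = conc Q W 0 ∧
      Acyclic S.X₂ ∧ ∀ i, IsFiniteLength Q W → IsFiniteLength Q (S.X₂.X i) := by
  let U : ZMod 2 → Submodule Q (W × W) := fun i =>
    if i = 0 then LinearMap.ker (LinearMap.snd Q W W) else LinearMap.ker (LinearMap.fst Q W W)
  let D : Module.End Q (W × W) := LinearMap.inr Q W W ∘ₗ LinearMap.fst Q W W
  let H : Module.End Q (W × W) := LinearMap.inl Q W W ∘ₗ LinearMap.snd Q W W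
  have hU0 (t : W × W) : t ∈ U 0 ↔ t.2 = 0 := by simp [U]
  have hU1 (t : W × W) : t ∈ U 1 ↔ t.1 = 0 := by simp [U]
  have e2 : (1 + 1 : ZMod 2) = 0 := by decide
  have hS : ∀ k, ∀ t ∈ U k, D t ∈ U (k + 1) := by
    intro k t ht
    rcases zmod2_cases k with rfl | rfl
    · rw [zero_add, hU1]; rfl
    · rw [e2, hU0]; exact (hU1 t).1 ht
  have hH : ∀ k, ∀ t ∈ U k, H t ∈ U (k + 1) := by
    intro k t ht
    rcases zmod2_cases k with rfl | rfl
    · rw [zero_add, hU1]; exact (hU0 t).1 ht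
    · rw [e2, hU0]; rfl
  have hD : ∀ k, ∀ t ∈ U k, D (D t) = 0 := fun _ _ _ => rfl
  obtain ⟨S, h, h1, h2, h3⟩ := gradedCx_shortExact (R := Q) (T := W) (T' := W × W) (T'' := W)
    (D := 0) (D' := D) (D'' := 0) (S := fun i => if i = 1 then (⊤ : Submodule Q W) else ⊥) (S' := U)
    (S'' := fun i => if i = 0 then (⊤ : Submodule Q W) else ⊥)
    (hS := fun k _ _ => Submodule.zero_mem _) (hD := fun _ _ _ => rfl) (hS' := hS) (hD' := hD)
    (hS'' := fun k _ _ => Submodule.zero_mem _) (hD'' := fun _ _ _ => rfl)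
    (LinearMap.inr Q W W) (LinearMap.fst Q W W) (fun k t ht => by
      rcases zmod2_cases k with rfl | rfl
      · have : t = 0 := by simpa using ht
        rw [this, map_zero]; exact Submodule.zero_mem _
      · rw [hU1]; rfl) (fun k t ht => by
      rcases zmod2_cases k with rfl | rfl
      · simp
      · have : t.1 = 0 := (hU1 t).1 ht
        simp [this]) (fun _ _ _ => rfl) (fun _ _ _ => rfl) (fun _ t _ ht => congrArg Prod.snd ht)
      (fun k t ht => by
      rcases zmod2_cases k with rfl | rfl
      · exact ⟨(t, 0), (hU0 _).2 rfl, rfl⟩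
      · have : t = 0 := by simpa using ht
        exact ⟨0, Submodule.zero_mem _, this.symm⟩) (fun _ _ _ => rfl) (fun k t ht h0 => by
      rcases zmod2_cases k with rfl | rfl
      · exact ⟨0, Submodule.zero_mem _, Prod.ext (Eq.symm h0) ((hU0 t).1 ht).symm⟩
      · exact ⟨t.2, by simp, Prod.ext (Eq.symm h0) rfl⟩)
  refine ⟨S, h, h1, h3, ?_, fun i hW => ?_⟩
  · rw [h2]
    exact (Null.of_graded H hH fun k t _ => by
      rw [one_smul]
      exact Prod.ext (add_zero t.1) (zero_add t.2)).acyclic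
  · rw [h2]
    refine IsFiniteLength.submodule (T := W × W) ?_ (U i)
    rw [← Module.length_ne_top_iff] at hW ⊢
    rw [Module.length_prod]
    rw [ne_eq, ENat.add_eq_top, or_self]
    exact hW

/-! ### The degenerate complex -/

/-- The differential of `V` identifies the quotient by the cycles with the boundaries of the next
degree, so nothing is left over in homology. -/
lemma acyclic_nilCx_bdry (V : Cx Q) : Acyclic (nilCx V (bdry V) fun _ => le_rfl) := by
  rw [acyclic_iff_exact]
  rintro i ⟨⟨z, y', rfl⟩, y⟩ h
  obtain ⟨y, rfl⟩ := Submodule.Quotient.mk_surjective _ y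
  have h0 : (V.d i (i + 1)).hom y = 0 :=
    congrArg (fun x : bdry V (i + 1) × (V.X (i + 1) ⧸ cyc V (i + 1)) => x.1.1) h
  refine ⟨((0, Submodule.Quotient.mk y') : bdry V (i + 1) × (V.X (i + 1) ⧸ cyc V (i + 1))), ?_⟩
  exact Prod.ext rfl ((Submodule.Quotient.mk_eq_zero _).2 h0).symm

/-- The homology as a quotient of the cycles. -/
abbrev HMod (V : Cx Q) (i : ZMod 2) : Type u := cyc V i ⧸ (bdry V i).submoduleOf (cyc V i)

/-- The module of all homology classes. -/
abbrev HTot (V : Cx Q) : Type u := ∀ i, HMod V i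

/-- The inclusion of the homology of degree `i`. -/
abbrev hSingle (V : Cx Q) (i : ZMod 2) : HMod V i →ₗ[Q] HTot V := LinearMap.single Q (HMod V) i

/-- The homology as a complex with zero differential. -/
abbrev homCx (V : Cx Q) : Cx Q :=
  zeroCx (T := HTot V) fun i => LinearMap.range (hSingle V i)

/-- Replacing cycles by boundaries leaves the quotient of cycles by boundaries, on which the induced
differential vanishes. So the degenerate fibre is an extension of the homology by an acyclic
complex. -/
lemma nilCx_shortExact (V : Cx Q) :
    ∃ (f : nilCx V (bdry V) (fun _ => le_rfl) ⟶ nilCx V (cyc V) (bdry_le_cyc V))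
      (g : nilCx V (cyc V) (bdry_le_cyc V) ⟶ homCx V) (w : f ≫ g = 0),
      (ShortComplex.mk f g w).ShortExact := by
  let ι (i : ZMod 2) : bdry V i × (V.X i ⧸ cyc V i) →ₗ[Q] cyc V i × (V.X i ⧸ cyc V i) :=
    LinearMap.prodMap (Submodule.inclusion (bdry_le_cyc V i)) LinearMap.id
  let π (i : ZMod 2) : cyc V i × (V.X i ⧸ cyc V i) →ₗ[Q]
      LinearMap.range (hSingle V i) :=
    (hSingle V i).rangeRestrict ∘ₗ Submodule.mkQ _ ∘ₗ LinearMap.fst Q _ _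
  have hinj (i : ZMod 2) : Function.Injective (hSingle V i) :=
    Pi.single_injective (M := HMod V) i
  have hπ (i : ZMod 2) (x : cyc V i × (V.X i ⧸ cyc V i)) : π i x = 0 ↔ x.1.1 ∈ bdry V i := by
    rw [Subtype.ext_iff]
    change hSingle V i (Submodule.Quotient.mk x.1) = 0 ↔ _
    rw [map_eq_zero_iff _ (hinj i), Submodule.Quotient.mk_eq_zero]
    rfl
  obtain ⟨w, hw⟩ := shortExact_of
    (mkHom (X := nilCx V (bdry V) fun _ => le_rfl) (Y := nilCx V (cyc V) (bdry_le_cyc V)) ι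
      fun i ⟨z, y⟩ => by
        obtain ⟨y, rfl⟩ := Submodule.Quotient.mk_surjective _ y
        rfl)
    (mkHom (X := nilCx V (cyc V) (bdry_le_cyc V)) (Y := homCx V) π fun i ⟨z, y⟩ => by
        obtain ⟨y, rfl⟩ := Submodule.Quotient.mk_surjective _ y
        have h1 : π (i + 1) (⟨(V.d i (i + 1)).hom y, bdry_le_cyc V _ (d_mem_bdry V i (i + 1) y)⟩, 0) = 0 :=
          (hπ _ _).2 (d_mem_bdry V i (i + 1) y)
        refine h1.trans (Subtype.ext ?_)
        exact (coe_gradedCx_d (D := (0 : Module.End Q (HTot V)))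
          (S := fun i => LinearMap.range (hSingle V i)) (hS := fun k _ _ => Submodule.zero_mem _)
          (hD := fun _ _ _ => rfl) (i := i) rfl
          (π i (z, Submodule.Quotient.mk y))).symm)
    (fun i x y (h : ι i x = ι i y) => Prod.ext
      (Subtype.ext (congrArg (fun x : cyc V i × (V.X i ⧸ cyc V i) => x.1.1) h))
      (congrArg (fun x : cyc V i × (V.X i ⧸ cyc V i) => x.2) h))
    (fun i => (LinearMap.surjective_rangeRestrict _).comp
      ((Submodule.mkQ_surjective _).comp LinearMap.fst_surjective))
    (fun i x => (hπ i (ι i x)).2 x.1.2)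
    (fun i y hy => ⟨((⟨y.1.1, (hπ i y).1 hy⟩, y.2) : bdry V i × (V.X i ⧸ cyc V i)), rfl⟩)
  exact ⟨_, _, w, hw⟩

lemma homCx_shortExact (V : Cx Q) :
    ∃ S : ShortComplex (Cx Q), S.ShortExact ∧
      S.X₁ = conc Q (HMod V 0) 0 ∧
      S.X₂ = homCx V ∧ S.X₃ = conc Q (HMod V 1) 1 := by
  have h01 : (0 : ZMod 2) ≠ 1 := by decide
  refine gradedCx_shortExact (hSingle V 0) (LinearMap.proj 1) (fun k t ht => ?_)
    (fun k t ht => ?_) (fun _ _ _ => map_zero _) (fun _ _ _ => map_zero _)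
    (fun _ t _ ht => Pi.single_injective (M := HMod V) 0 (ht.trans (map_zero (hSingle V 0)).symm)) (fun k t ht => ?_)
    (fun _ t _ => Pi.single_eq_of_ne (M := HMod V) h01.symm t) fun k t ht h0 => ?_
  · split_ifs at ht with hk
    · subst hk; exact ⟨t, rfl⟩
    · rw [(Submodule.mem_bot Q).1 ht, map_zero]
      exact Submodule.zero_mem _
  · split_ifs with hk
    · trivial
    · obtain ⟨s, rfl⟩ := ht
      exact (Submodule.mem_bot Q).2 (Pi.single_eq_of_ne (M := HMod V) (Ne.symm hk) s)
  · split_ifs at ht with hk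
    · subst hk
      exact ⟨hSingle V 1 t, ⟨t, rfl⟩, Pi.single_eq_same (M := HMod V) 1 t⟩
    · exact ⟨0, Submodule.zero_mem _, by rw [(Submodule.mem_bot Q).1 ht, map_zero]⟩
  · obtain ⟨s, rfl⟩ := ht
    rcases zmod2_cases k with rfl | rfl
    · exact ⟨s, by simp, rfl⟩
    · have : s = 0 := (Pi.single_eq_same (M := HMod V) 1 s).symm.trans h0
      exact ⟨0, by simp, by rw [this, map_zero, map_zero]⟩

end Devissage
end
end CyclicAdams

namespace CyclicAdams
open scoped Fin.NatCast Fin.CommRing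
noncomputable section

/-! ### Proportionality of the eigenspace difference to the Euler characteristic. -/

section Proportionality

open Polynomial IsLocalRing

variable {Q : Type u} [CommRing Q] [IsRegularLocalRing Q] {d n : ℕ}

/-- Invariance under isomorphism is not part of `IsAdditive`; it follows from a short exact sequence
with zero third term. -/
lemma ext_conc_equiv {Θ : Cx Q → ℤ} (hΘ : IsAdditive n Θ) (hd : ringKrullDim Q = d)
    (hn : d ≤ n) (j : ZMod 2) {W W' : Type u} [AddCommGroup W] [Module Q W] [AddCommGroup W']
    [Module Q W'] (e : W ≃ₗ[Q] W') (h : IsFiniteLength Q W) :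
    Θ (conc Q W j) = Θ (conc Q W' j) := by
  have h' : IsFiniteLength Q W' := by
    rw [← Module.length_ne_top_iff] at *
    rwa [← e.length_eq]
  obtain ⟨S, hS, e1, e2, e3⟩ := conc_shortExact (Q := Q) j (W' := W) (W := W') (W'' := PUnit)
    (f := e.toLinearMap) (g := 0) e.injective (fun _ => ⟨0, rfl⟩)
    (fun y => ⟨fun _ => ⟨e.symm y, e.apply_symm_apply y⟩, fun _ => rfl⟩)
  have hz := pdim_zeroCx hd hn (T := PUnit.{u + 1}) (Q := Q) IsFiniteLength.of_subsingleton
    (fun i => if i = j then ⊤ else ⊥)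
  have := hΘ.add hS (by rw [e1]; exact pdim_zeroCx hd hn h _)
    (by rw [e2]; exact pdim_zeroCx hd hn h' _) (by rw [e3]; exact hz)
  rw [e1, e2, e3] at this
  rw [this, hΘ.acyclic hz (acyclic_zeroCx _), add_zero]

/-- Each step of a composition series contributes a simple module, which over a local ring is the
residue field. -/
lemma ext_conc {Θ : Cx Q → ℤ} (hΘ : IsAdditive n Θ) (hd : ringKrullDim Q = d)
    (hn : d ≤ n) (j : ZMod 2) {W : Type u} [AddCommGroup W] [Module Q W]
    (h : IsFiniteLength Q W) :
    Θ (conc Q W j) = (Module.length Q W).toNat * Θ (conc Q (Q ⧸ maximalIdeal Q) j) := by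
  induction h with
  | @of_subsingleton W _ _ _ =>
    rw [hΘ.acyclic (pdim_zeroCx hd hn IsFiniteLength.of_subsingleton _)
      (acyclic_zeroCx _)]
    simp
  | @of_simple_quotient W _ _ N hs hN ih =>
    have hs' : IsFiniteLength Q (W ⧸ N) := by
      rw [← Module.length_ne_top_iff, Module.length_eq_one Q (W ⧸ N)]
      exact ENat.one_ne_top
    have hl := Module.length_eq_add_of_exact N.subtype N.mkQ (Submodule.subtype_injective _)
      (Submodule.mkQ_surjective _) (LinearMap.exact_subtype_mkQ N)
    have hW : IsFiniteLength Q W := IsFiniteLength.of_simple_quotient hN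
    obtain ⟨I, hI, ⟨e⟩⟩ := isSimpleModule_iff_quot_maximal.1 hs
    obtain rfl := eq_maximalIdeal hI
    obtain ⟨S, hS, e1, e2, e3⟩ := conc_shortExact (Q := Q) j (Submodule.subtype_injective N)
      (Submodule.mkQ_surjective N) (LinearMap.exact_subtype_mkQ N)
    have := hΘ.add hS (by rw [e1]; exact pdim_zeroCx hd hn hN _)
      (by rw [e2]; exact pdim_zeroCx hd hn hW _) (by rw [e3]; exact pdim_zeroCx hd hn hs' _)
    rw [e1, e2, e3, ih, ext_conc_equiv hΘ hd hn j e hs'] at this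
    rw [this, hl, Module.length_eq_one Q (W ⧸ N), ENat.toNat_add (Module.length_ne_top_iff.2 hN)
      ENat.one_ne_top]
    push_cast
    rw [ENat.toNat_one]
    ring

/-- A contractible complex is an extension of the module in degree 0 by the same module in degree 1,
so the two values cancel. -/
lemma ext_conc_one {Θ : Cx Q → ℤ} (hΘ : IsAdditive n Θ) (hd : ringKrullDim Q = d)
    (hn : d ≤ n) {W : Type u} [AddCommGroup W] [Module Q W] (h : IsFiniteLength Q W) :
    Θ (conc Q W 1) = - Θ (conc Q W 0) := by
  obtain ⟨S, hS, e1, e3, ha, hf⟩ := exists_shift_shortExact (Q := Q) W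
  have h2 : PDim n S.X₂ := pdim_of_finite hd hn (fun i => IsFiniteLength.finite (hf i h)) ha.finLen
  have := hΘ.add hS (by rw [e1]; exact pdim_zeroCx hd hn h _) h2
    (by rw [e3]; exact pdim_zeroCx hd hn h _)
  rw [e1, e3, hΘ.acyclic h2 ha] at this
  omega

/-- The degenerate complex. -/
abbrev degCx (V : Cx Q) : Cx Q := nilCx V (cyc V) (bdry_le_cyc V)

/-- Modulo an acyclic complex only the homology counts, and it enters through its two lengths with
opposite signs. -/
lemma ext_degCx {Θ : Cx Q → ℤ} (hΘ : IsAdditive n Θ) (hd : ringKrullDim Q = d)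
    (hn : d ≤ n) {V : Cx Q} (hV : IsMFfl V) :
    PDim n (degCx V) ∧
      Θ (degCx V) = Θ (conc Q (Q ⧸ maximalIdeal Q) 0) * eul V := by
  have hH (i : ZMod 2) : IsFiniteLength Q (HMod V i) := by
    rw [← Module.length_ne_top_iff, ← (homologyEquiv V i).length_eq, Module.length_ne_top_iff]
    exact hV.finiteLength i
  have hl (i : ZMod 2) : Module.length Q (V.homology i) = Module.length Q (HMod V i) :=
    (homologyEquiv V i).length_eq
  have hT : IsFiniteLength Q (HTot V) := by
    rw [← Module.length_ne_top_iff, Module.length_pi_of_fintype]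
    exact ENat.sum_ne_top.2 fun i _ => Module.length_ne_top_iff.2 (hH i)
  obtain ⟨f, g, w, h⟩ := nilCx_shortExact V
  have hfin (U : ∀ i, Submodule Q (V.X i)) (hU : ∀ i, bdry V i ≤ U i) (i : ZMod 2) :
      Module.Finite Q ((nilCx V U hU).X i) :=
    have := hV.finite i
    inferInstanceAs (Module.Finite Q (U i × (V.X i ⧸ cyc V i)))
  have hb : PDim n (nilCx V (bdry V) fun _ => le_rfl) :=
    pdim_of_finite hd hn (hfin _ _) (acyclic_nilCx_bdry V).finLen
  have hh : PDim n (homCx V) := pdim_zeroCx hd hn hT _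
  have hv : PDim n (degCx V) := PDim.of_shortExact₂ h hb hh
  have a1 := hΘ.add h hb hv hh
  dsimp only at a1
  rw [hΘ.acyclic hb (acyclic_nilCx_bdry V), zero_add] at a1
  obtain ⟨S, hS, e1, e2, e3⟩ := homCx_shortExact V
  have a2 := hΘ.add hS (by rw [e1]; exact pdim_zeroCx hd hn (hH 0) _) (by rw [e2]; exact hh)
    (by rw [e3]; exact pdim_zeroCx hd hn (hH 1) _)
  rw [e1, e2, e3, ext_conc_one hΘ hd hn (hH 1), ext_conc hΘ hd hn 0 (hH 0),
    ext_conc hΘ hd hn 0 (hH 1)] at a2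
  refine ⟨hv, ?_⟩
  rw [a1, a2, eul, hl, hl]
  ring

variable (Q) in
/-- The difference of the Euler characteristics of the eigenspaces for `1` and `z`. -/
def eigenDiff (p : ℕ) (z : Q) (X : Cx Q) : ℤ := eul (eigen p X 1) - eul (eigen p X z)

variable {p : ℕ} {u z : Q}

/-- Additivity is the image under χ of the identity in the Grothendieck group, taken with the
trivial twist `1`. An acyclic object over a regular local ring is contractible, hence so are its
eigenspaces. -/
lemma isAdditive_eigenDiff (hp : p.Prime) (hu : u * p = 1) (hz : z ^ p = 1)
    (hd : ringKrullDim Q = d) : IsAdditive 0 (eigenDiff Q p z) where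
  add {S} hS h1 h2 h3 := by
    rw [pdim_zero_iff] at h1 h2 h3
    have h1' := locallyNull_of_isRegularLocalRing hd h1
    have h2' := locallyNull_of_isRegularLocalRing hd h2
    have h3' := locallyNull_of_isRegularLocalRing hd h3
    have key {X : Cx Q} (hX : IsMFfl X) (hN : LocallyNull X) {l : Q} (hl : l ^ p = 1) :
        chi Q (cls (mult 1 (eigen p X l))) = eul (eigen p X l) := by
      rw [cls_of (isMFfl_eigen (w := 1) (mul_one 1) hX.finite hX.projective hN hp.ne_zero hu hl),
        chi_mk]
      exact eul_mult (v := 1) (mul_one 1) _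
    have := congrArg (chi Q) (cls_eigen_shortExact (v := 1) (w := 1) (mul_one 1) hS h2.finite
      h2.projective h3.projective h1' h3' hp hu hz)
    rw [map_add, map_sub, map_sub, map_sub, key h1 h1' (one_pow p), key h1 h1' hz,
      key h2 h2' (one_pow p), key h2 h2' hz, key h3 h3' (one_pow p), key h3 h3' hz] at this
    exact this
  acyclic {X} h ha := by
    rw [pdim_zero_iff] at h
    have h1 := ha.null h
    have key {l : Q} (hl : l ^ p = 1) : eul (eigen p X l) = 0 := by
      have := h1.eigen hp.ne_zero hu hl
      rw [one_pow] at this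
      exact this.acyclic.eul
    rw [eigenDiff, key (one_pow p), key hz, sub_zero]

/-- The difference of the Euler characteristics of the eigenspaces is proportional to the Euler
characteristic. -/
theorem exists_eigenDiff_eq_mul (hp : p.Prime) (hu : u * p = 1) (hz : z ^ p = 1)
    (hd : ringKrullDim Q = d) :
    ∃ c : ℤ, ∀ X, IsMFfl X → eigenDiff Q p z X = c * eul X := by
  obtain ⟨Θ⟩ := (isAdditive_eigenDiff hp hu hz hd).exists_extSeq
  have hstep (m : ℕ) {Y : Cx Q} (hY : IsMFfl Y) : Θ.ext m Y = eigenDiff Q p z Y := by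
    induction m with
    | zero => exact Θ.zero (pdim_zero_iff.2 hY)
    | succ m ih => rw [Θ.succ m ((pdim_zero_iff.2 hY).mono (Nat.zero_le m)), ih]
  -- The constant is the value of the extended function on the residue field placed in degree 0.
  refine ⟨Θ.ext (d + 1) (conc Q (Q ⧸ maximalIdeal Q) 0), fun V hV => ?_⟩
  obtain ⟨hv, e⟩ := ext_degCx (Θ.add (d + 1)) hd (Nat.le_succ d) hV
  rw [← e, ← hstep (d + 1) hV]
  -- The cycles have projective dimension at most `d`, and the components of the degeneration one
  -- more; this is why the extension is taken at level `d + 1`.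
  have hpd (i : ZMod 2) : HasProjectiveDimensionLT ((rees V).X i) (d + 1 + 1) := by
    have := hV.finite i
    have := hV.projective i
    exact hasProjectiveDimensionLT_constIn (cyc V i)
      (hasProjectiveDimensionLT_of_isRegularLocalRing Q hd (ModuleCat.of Q (cyc V i)))
  have hfin (i : ZMod 2) : Module.Finite Q[X] ((rees V).X i) := by
    have := hV.finite i
    have := finite_polynomialModule (Q := Q) (V := V.X i)
    exact inferInstanceAs (Module.Finite Q[X] (constIn (cyc V i)))
  obtain ⟨E, h1, h2, h3, h4⟩ := exists_resolution Θ (d + 1) (rees V) hfin hpd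
  have hN : ∀ r ∈ maximalIdeal Q, ∃ n : ℕ, Null (C r ^ n) E := fun r hr => by
    obtain ⟨n, hn⟩ := locallyNull_of_isRegularLocalRing hd hV r hr
    refine ⟨n, h3 _ ?_⟩
    rw [← C_pow]
    exact hn.rees
  obtain ⟨k, hk⟩ := exists_eul_eigen_eq h1 h2 hN hp.ne_zero hu (one_pow p)
  obtain ⟨l, hl⟩ := exists_eul_eigen_eq h1 h2 hN hp.ne_zero hu hz
  -- The fibres of `E` at 1 and 0 are syzygies of `V` and of its degeneration, with the same sign
  -- (-1)^(d+1). As the Euler characteristics of their eigenspaces agree, so do the extended values.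
  obtain ⟨E1, r1, -, e1⟩ := h4 _ _ V (ringRed_eval 1) ⟨redReesOne hV.projective⟩
    ((pdim_zero_iff.2 hV).mono (Nat.zero_le _))
  obtain ⟨E0, r0, -, e0⟩ := h4 _ _ (degCx V) (ringRed_eval 0) ⟨redReesZero hV.projective⟩ hv
  rw [e1, e0, eigenDiff, eigenDiff, hk 1 E1 r1, hl 1 E1 r1, hk 0 E0 r0, hl 0 E0 r0]

end Proportionality
end
end CyclicAdams

namespace CyclicAdams
open scoped Fin.NatCast Fin.CommRing
noncomputable section

/-! ### The cone of multiplication by an element and its splitting. -/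

section Cone

variable {R S : Type u} [CommRing R] [CommRing S] {φ : R →+* S} (A : Cx R) {x y r : R}

/-! ### The cone of multiplication by an element -/

/-- The identification of components of a complex with equal indices. -/
def tau {i j : ZMod 2} (h : i = j) : A.X i →ₗ[R] A.X j := h ▸ LinearMap.id

variable {A}

lemma tau_rfl {i : ZMod 2} (h : i = i) (a : A.X i) : tau A h a = a := rfl

lemma tau_tau {i j k : ZMod 2} (h : i = j) (h' : j = k) (a : A.X i) :
    tau A h' (tau A h a) = tau A (h.trans h') a := by
  subst h h'; rfl

lemma tau_d {i j k : ZMod 2} (h : j = k) (a : A.X i) :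
    tau A h ((A.d i j).hom a) = (A.d i k).hom a := by
  subst h; rfl

lemma d_tau {i j k : ZMod 2} (h : i = j) (a : A.X i) :
    (A.d j k).hom (tau A h a) = (A.d i k).hom a := by
  subst h; rfl

lemma semi_tau {Y : Cx S} (ρ : ∀ i, A.X i →ₛₗ[φ] Y.X i) {i j : ZMod 2} (h : i = j) (a : A.X i) :
    ρ j (tau A h a) = tau Y h (ρ i a) := by
  subst h; rfl

variable (A) in
/-- The identification of `A.X (i + 1)` with `A.X j` if `i + 1 = j`, and zero otherwise. -/
def tauD (i j : ZMod 2) : A.X (i + 1) →ₗ[R] A.X j := if h : i + 1 = j then tau A h else 0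

lemma tauD_apply {i j : ZMod 2} (h : i + 1 = j) (a : A.X (i + 1)) : tauD A i j a = tau A h a := by
  rw [tauD, dif_pos h]

lemma tauD_of_ne {i j : ZMod 2} (h : i + 1 ≠ j) : tauD A i j = 0 := dif_neg h

lemma semi_tauD {Y : Cx S} (ρ : ∀ i, A.X i →ₛₗ[φ] Y.X i) {i j : ZMod 2} (a : A.X (i + 1)) :
    ρ j (tauD A i j a) = tauD Y i j (ρ _ a) := by
  by_cases h : i + 1 = j
  · rw [tauD_apply h, tauD_apply h, semi_tau]
  · rw [tauD_of_ne h, tauD_of_ne h]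
    exact map_zero _

lemma d_eq_zero (X : Cx R) {i j : ZMod 2} (h : i + 1 ≠ j) (a : X.X i) : (X.d i j).hom a = 0 :=
  congrArg (fun f => f.hom a) (X.shape i j h)

variable (A) in
/-- The shift of a complex. -/
def sh : Cx R :=
  mkCx (fun i => A.X (i + 1)) (fun i j => -(A.d (i + 1) (j + 1)).hom)
    (fun i j h => LinearMap.ext fun a => by
      rw [LinearMap.neg_apply, d_eq_zero A (fun e => h (add_right_cancel e)) a, neg_zero]; rfl)
    fun i j k a => by
      rw [LinearMap.neg_apply, LinearMap.neg_apply, map_neg, d_d_apply, neg_zero, neg_zero]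

variable (A x) in
/-- The differential of the cone. -/
def coneD (i j : ZMod 2) : A.X i × A.X (i + 1) →ₗ[R] A.X j × A.X (j + 1) :=
  LinearMap.prod ((A.d i j).hom ∘ₗ LinearMap.fst R _ _ + x • (tauD A i j ∘ₗ LinearMap.snd R _ _))
    (-((A.d (i + 1) (j + 1)).hom ∘ₗ LinearMap.snd R _ _))

lemma coneD_apply (i j : ZMod 2) (v : A.X i × A.X (i + 1)) : coneD A x i j v =
    ((A.d i j).hom v.1 + x • tauD A i j v.2, -(A.d (i + 1) (j + 1)).hom v.2) := rfl

lemma d_tauD (i j k : ZMod 2) (b : A.X (i + 1)) :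
    (A.d j k).hom (tauD A i j b) = tauD A j k ((A.d (i + 1) (j + 1)).hom b) := by
  by_cases h : i + 1 = j
  · by_cases h' : j + 1 = k
    · rw [tauD_apply h, tauD_apply h', d_tau, tau_d]
    · rw [d_eq_zero A h', tauD_of_ne h', LinearMap.zero_apply]
  · rw [tauD_of_ne h, d_eq_zero A (fun e => h (add_right_cancel e)), LinearMap.zero_apply, map_zero,
      map_zero]

variable (A x) in
/-- The cone of multiplication by `x` on `A`. -/
def cone : Cx R :=
  mkCx (fun i => A.X i × A.X (i + 1)) (coneD A x)
    (fun i j h => LinearMap.ext fun v => by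
      rw [coneD_apply, d_eq_zero A h, d_eq_zero A (fun e => h (add_right_cancel e)), tauD_of_ne h,
        LinearMap.zero_apply, smul_zero, add_zero, neg_zero]
      rfl)
    fun i j k v => by
      rw [coneD_apply, coneD_apply, map_neg, map_neg, map_add, map_smul, d_d_apply, d_d_apply,
        neg_zero, neg_zero, d_tauD, smul_neg, zero_add, add_neg_cancel]
      rfl

lemma finite_cone (h : ∀ i, Module.Finite R (A.X i)) (i : ZMod 2) :
    Module.Finite R ((cone A x).X i) := by
  have := h i
  have := h (i + 1)
  exact inferInstanceAs (Module.Finite R (A.X i × A.X (i + 1)))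

lemma projective_cone (h : ∀ i, Module.Projective R (A.X i)) (i : ZMod 2) :
    Module.Projective R ((cone A x).X i) := by
  have := h i
  have := h (i + 1)
  exact inferInstanceAs (Module.Projective R (A.X i × A.X (i + 1)))

variable (A) in
/-- The homotopy for the element of the cone. -/
def coneH (i j : ZMod 2) : A.X i × A.X (i + 1) →ₗ[R] A.X j × A.X (j + 1) :=
  LinearMap.inr R _ _ ∘ₗ (if h : i = j + 1 then tau A h else 0) ∘ₗ LinearMap.fst R _ _

lemma coneH_apply {i j : ZMod 2} (h : i = j + 1) (v : A.X i × A.X (i + 1)) :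
    coneH A i j v = (0, tau A h v.1) := by
  rw [coneH, dif_pos h]; rfl

/-- The first component in degree `i` is, up to reindexing, the second component in degree `i + 1`.
The homotopy is this identification, and `x` appears as the corner of the differential. -/
lemma null_cone : Null x (cone A x) := by
  refine ⟨coneH A, fun i (v : A.X i × A.X (i + 1)) => ?_⟩
  change coneH A (i + 1) i (coneD A x i (i + 1) v) + coneD A x (i + 1) i (coneH A i (i + 1) v) =
    x • v
  rw [coneH_apply rfl, coneH_apply (add_one_add_one i).symm, coneD_apply, coneD_apply]
  refine Prod.ext ?_ ?_
  · change (0 : A.X i) + ((A.d (i + 1) i).hom 0 + x • tauD A (i + 1) i (tau A _ v.1)) = x • v.1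
    rw [map_zero, zero_add, zero_add, tauD_apply (add_one_add_one i), tau_tau, tau_rfl]
  · change tau A _ ((A.d i (i + 1)).hom v.1 + x • tauD A i (i + 1) v.2) +
      -(A.d (i + 1 + 1) (i + 1)).hom (tau A _ v.1) = x • v.2
    rw [map_add, tau_d, d_tau, map_smul, tauD_apply rfl, tau_tau, tau_rfl]
    exact add_neg_cancel_comm _ _

lemma tau_fam (h : ∀ i j, A.X i →ₗ[R] A.X j) {i j k : ZMod 2} (e : j = k) (a : A.X i) :
    tau A e (h i j a) = h i k a := by
  subst e; rfl

lemma Null.cone (hA : Null r A) : Null r (cone A x) := by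
  obtain ⟨h, hh⟩ := hA
  refine ⟨fun i j => (LinearMap.prodMap (h i j) (-(h (i + 1) (j + 1))) :
    A.X i × A.X (i + 1) →ₗ[R] A.X j × A.X (j + 1)),
    fun i (v : A.X i × A.X (i + 1)) => ?_⟩
  refine Prod.ext ?_ ?_
  · change h (i + 1) i ((A.d i (i + 1)).hom v.1 + x • tauD A i (i + 1) v.2) +
      ((A.d (i + 1) i).hom (h i (i + 1) v.1) +
        x • tauD A (i + 1) i (-(h (i + 1) (i + 1 + 1) v.2))) = r • v.1
    rw [← hh i v.1, map_add, map_smul, tauD_apply rfl, tauD_apply (add_one_add_one i), map_neg,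
      tau_fam, tau_rfl, smul_neg]
    abel
  · change -(h (i + 1 + 1) (i + 1) (-(A.d (i + 1) (i + 1 + 1)).hom v.2)) +
      -(A.d (i + 1 + 1) (i + 1)).hom (-(h (i + 1) (i + 1 + 1) v.2)) = r • v.2
    rw [map_neg, map_neg, neg_neg, neg_neg, hh]

/-! ### The cone and reductions -/

/-- The cone of a reduction. -/
def Red.cone {Y : Cx S} (ρ : Red φ x A Y) (y : R) :
    Red φ x (CyclicAdams.cone A y) (CyclicAdams.cone Y (φ y)) where
  map i := (show A.X i × A.X (i + 1) →ₛₗ[φ] Y.X i × Y.X (i + 1) from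
    { toFun := fun v => (ρ.map i v.1, ρ.map (i + 1) v.2)
      map_add' := fun _ _ => Prod.ext (map_add _ _ _) (map_add _ _ _)
      map_smul' := fun _ _ => Prod.ext (map_smulₛₗ _ _ _) (map_smulₛₗ _ _ _) })
  comm i j (v : A.X i × A.X (i + 1)) := by
    refine Prod.ext ?_ ?_
    · change ρ.map j ((A.d i j).hom v.1 + y • tauD A i j v.2) =
        (Y.d i j).hom (ρ.map i v.1) + φ y • tauD Y i j (ρ.map (i + 1) v.2)
      rw [map_add, map_smulₛₗ, ρ.comm, semi_tauD]
    · change ρ.map (j + 1) (-(A.d (i + 1) (j + 1)).hom v.2) =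
        -(Y.d (i + 1) (j + 1)).hom (ρ.map (i + 1) v.2)
      rw [map_neg, ρ.comm]
  surj i (v : Y.X i × Y.X (i + 1)) := by
    obtain ⟨a, ha⟩ := ρ.surj i v.1
    obtain ⟨b, hb⟩ := ρ.surj (i + 1) v.2
    exact ⟨((a, b) : A.X i × A.X (i + 1)), Prod.ext ha hb⟩
  ker i (v : A.X i × A.X (i + 1)) hv := by
    obtain ⟨a, ha⟩ := ρ.ker i v.1 (congrArg (fun v : Y.X i × Y.X (i + 1) => v.1) hv)
    obtain ⟨b, hb⟩ := ρ.ker (i + 1) v.2 (congrArg (fun v : Y.X i × Y.X (i + 1) => v.2) hv)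
    exact ⟨((a, b) : A.X i × A.X (i + 1)), Prod.ext ha hb⟩
  reg i (v : A.X i × A.X (i + 1)) hv := Prod.ext
    (ρ.reg i v.1 (congrArg (fun v : A.X i × A.X (i + 1) => v.1) hv))
    (ρ.reg (i + 1) v.2 (congrArg (fun v : A.X i × A.X (i + 1) => v.2) hv))

/-- The Euler characteristic of the cone of a regular element. -/
lemma finLen_eul_cone {Y : Cx S} (hφ : RingRed φ x) (ρ : Red φ x A Y) (hY : FinLen Y) :
    FinLen (cone A x) ∧ eul (cone A x) = eul Y := by
  -- Multiplying the first component by `x` maps the cone of `1` injectively to the cone of `x`,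
  -- with cokernel the reduction. The cone of `1` is contractible and contributes nothing.
  obtain ⟨g, w, h⟩ := exists_shortExact_resCx (φ := φ) (X' := cone A 1) (X := cone A x) (Y := Y)
    (mkHom (X := cone A 1) (Y := cone A x)
      (fun i => (LinearMap.prodMap (x • LinearMap.id) LinearMap.id :
        A.X i × A.X (i + 1) →ₗ[R] A.X i × A.X (i + 1)))
      fun i (v : A.X i × A.X (i + 1)) => Prod.ext (by
        change x • ((A.d i (i + 1)).hom v.1 + (1 : R) • tauD A i (i + 1) v.2) =
          (A.d i (i + 1)).hom (x • v.1) + x • tauD A i (i + 1) v.2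
        rw [one_smul, smul_add, map_smul]) rfl)
    (fun i => (show A.X i × A.X (i + 1) →ₛₗ[φ] Y.X i from
      { toFun := fun v => ρ.map i v.1
        map_add' := fun _ _ => map_add _ _ _
        map_smul' := fun _ _ => map_smulₛₗ _ _ _ }))
    (fun i j (v : A.X i × A.X (i + 1)) => by
      change ρ.map j ((A.d i j).hom v.1 + x • tauD A i j v.2) = (Y.d i j).hom (ρ.map i v.1)
      rw [map_add, ρ.comm, map_smulₛₗ, hφ.zero, zero_smul, add_zero])
    (fun i (v v' : A.X i × A.X (i + 1)) h => by
      have h' : ((x • v.1, v.2) : A.X i × A.X (i + 1)) = (x • v'.1, v'.2) := h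
      have h1 : x • v.1 = x • v'.1 := (Prod.mk.inj h').1
      have h2 : v.2 = v'.2 := (Prod.mk.inj h').2
      refine Prod.ext (sub_eq_zero.1 (ρ.reg i _ ?_)) h2
      rw [smul_sub, h1, sub_self])
    (fun i y => by
      obtain ⟨a, ha⟩ := ρ.surj i y
      exact ⟨((a, 0) : A.X i × A.X (i + 1)), ha⟩)
    (fun i (v : A.X i × A.X (i + 1)) => by
      change ρ.map i (x • v.1) = 0
      rw [map_smulₛₗ, hφ.zero, zero_smul])
    (fun i (v : A.X i × A.X (i + 1)) hv => by
      obtain ⟨a, ha⟩ := ρ.ker i v.1 hv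
      exact ⟨((a, v.2) : A.X i × A.X (i + 1)), Prod.ext ha.symm rfl⟩)
  have ha : Acyclic (cone A 1) := null_cone.acyclic
  have h3 := finLen_resCx hφ.surj hY
  have h2 := FinLen.of_shortExact₂ h ha.finLen h3
  refine ⟨h2, (eul_shortExact h h2 h3).trans ?_⟩
  rw [ha.eul, zero_add, eul_resCx hφ.surj]

/-! ### The splitting of the total module of the cone -/

/-- The map of degree one from the total module of the shift. -/
def shNu (A : Cx R) : Tot (sh A) →ₗ[R] Tot A :=
  LinearMap.pi fun i => tau A (sub_add_cancel i 1) ∘ₗ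
    (LinearMap.proj (i - 1) : Tot (sh A) →ₗ[R] A.X (i - 1 + 1))

lemma shNu_apply (v : Tot (sh A)) (i : ZMod 2) :
    shNu A v i = tau A (sub_add_cancel i 1) (v (i - 1) : A.X (i - 1 + 1)) := rfl

lemma sub_one_eq_add_one (i : ZMod 2) : i - 1 = i + 1 := by
  revert i; decide

/-- The inverse of `shNu`. -/
def shInv (A : Cx R) : Tot A →ₗ[R] Tot (sh A) :=
  LinearMap.pi fun i => (tau A (sub_one_eq_add_one i) ∘ₗ LinearMap.proj (i - 1) :
    Tot A →ₗ[R] A.X (i + 1))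

lemma shInv_apply (v : Tot A) (i : ZMod 2) :
    shInv A v i = (tau A (sub_one_eq_add_one i) (v (i - 1)) : A.X (i + 1)) := rfl

lemma tau_tot (v : Tot A) {i j : ZMod 2} (h : i = j) : tau A h (v i) = v j := by
  subst h; rfl

lemma tau_tot_sh (v : Tot (sh A)) {i j : ZMod 2} (h : i + 1 = j + 1) :
    tau A h (v i : A.X (i + 1)) = (v j : A.X (j + 1)) := by
  obtain rfl := add_right_cancel h; rfl

lemma shNu_shInv (v : Tot A) : shNu A (shInv A v) = v := funext fun i => by
  rw [shNu_apply, shInv_apply, tau_tau, tau_tot]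

lemma shInv_shNu (v : Tot (sh A)) : shInv A (shNu A v) = v := funext fun i =>
  (tau_tau (A := A) _ _ (v (i - 1 - 1) : A.X (i - 1 - 1 + 1))).trans
    (tau_tot_sh v (i := i - 1 - 1) (by rw [sub_add_cancel, sub_one_eq_add_one]))

lemma diff_shNu (v : Tot (sh A)) : diff A (shNu A v) + shNu A (diff (sh A) v) = 0 :=
  funext fun i => by
  let b : A.X (i - 1 - 1 + 1) := v (i - 1 - 1)
  change (A.d (i - 1) i).hom (tau A (sub_add_cancel (i - 1) 1) b) +
    tau A (sub_add_cancel i 1) (-(A.d (i - 1 - 1 + 1) (i - 1 + 1)).hom b) = 0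
  rw [map_neg, d_tau, tau_d, add_neg_cancel]

lemma hasDeg_one_of {X Y : Cx R} {f : Tot X →ₗ[R] Tot Y}
    (h : ∀ v i, v (i - 1) = 0 → f v i = 0) : HasDeg 1 f := fun a v => by
  funext i
  rw [proj_apply, proj_apply]
  by_cases hi : i = a + 1
  · subst hi
    rw [Pi.single_eq_same, ← sub_eq_zero]
    have := h (Pi.single a (v a) - v) (a + 1) (by
      rw [add_sub_cancel_right, Pi.sub_apply, Pi.single_eq_same, sub_self])
    rwa [map_sub] at this
  · rw [Pi.single_eq_of_ne hi]
    exact h _ i (Pi.single_eq_of_ne (fun e => hi (by rw [← e, sub_add_cancel])) _)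

lemma hasDeg_shNu : HasDeg 1 (shNu A) := hasDeg_one_of fun v i h => by
  rw [shNu_apply, h]; exact map_zero _

lemma hasDeg_shInv : HasDeg 1 (shInv A) := hasDeg_one_of fun v i h => by
  rw [shInv_apply, h]; exact map_zero _

variable (A x) in
/-- The splitting of the cone. -/
def coneSplit : Split A (cone A x) (sh A) where
  i := famMap (X := A) (Y := cone A x) fun i => LinearMap.inl R (A.X i) (A.X (i + 1))
  r := famMap (X := cone A x) (Y := A) fun i => LinearMap.fst R (A.X i) (A.X (i + 1))
  j := famMap (X := sh A) (Y := cone A x) fun i => LinearMap.inr R (A.X i) (A.X (i + 1))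
  q := famMap (X := cone A x) (Y := sh A) fun i => LinearMap.snd R (A.X i) (A.X (i + 1))
  i_deg := hasDeg_famMap _
  r_deg := hasDeg_famMap _
  j_deg := hasDeg_famMap _
  q_deg := hasDeg_famMap _
  r_i _ := rfl
  q_j _ := rfl
  r_j _ := rfl
  q_i _ := rfl
  sum _ := funext fun _ => Prod.ext (add_zero _) (zero_add _)
  nu := shNu A
  nu_deg := hasDeg_shNu
  nu_comm := diff_shNu

/-- The element `x` enters only as the coefficient of `nu`. It can therefore be replaced by a
coefficient depending on the weight. -/
lemma diff_cone (v : Tot (cone A x)) : diff (cone A x) v =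
    (coneSplit A x).toWeighted.d0 v + x • (coneSplit A x).toWeighted.nu v := funext fun i => by
  let w : A.X (i - 1) × A.X (i - 1 + 1) := v (i - 1)
  change coneD A x (i - 1) i w = ((A.d (i - 1) i).hom w.1, (0 : A.X (i + 1))) +
    ((0 : A.X i), -(A.d (i - 1 + 1) (i + 1)).hom w.2) +
    x • (tau A (sub_add_cancel i 1) w.2, (0 : A.X (i + 1)))
  rw [coneD_apply, tauD_apply (sub_add_cancel i 1)]
  refine Prod.ext ?_ ?_
  · change _ = (A.d (i - 1) i).hom w.1 + 0 + _
    rw [add_zero]; rfl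
  · change _ = 0 + _ + x • 0
    rw [smul_zero, add_zero, zero_add]

lemma diff_shInv (v : Tot A) : diff (sh A) (shInv A v) + shInv A (diff A v) = 0 := by
  have h := diff_shNu (shInv A v)
  rw [shNu_shInv] at h
  have := congrArg (shInv A) h
  rw [map_add, map_zero, shInv_shNu, add_comm] at this
  exact this

/-- The total differential with the element replaced by `1` is contractible. -/
lemma exists_cone_homotopy : ∃ s : Module.End R (Tot (cone A x)), HasDeg 1 s ∧
    ((coneSplit A x).toWeighted.d0 + (coneSplit A x).toWeighted.nu) * s +
      s * ((coneSplit A x).toWeighted.d0 + (coneSplit A x).toWeighted.nu) = 1 := by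
  set T := coneSplit A x with hT
  -- The corner `nu` identifies the two summands, so its inverse is a contraction; it anticommutes
  -- with the diagonal part.
  refine ⟨T.j ∘ₗ shInv A ∘ₗ T.r, T.j_deg.mul (hasDeg_shInv.mul T.r_deg), LinearMap.ext fun v => ?_⟩
  have e1 := congrArg T.j (diff_shInv (T.r v))
  have e2 := congrArg T.i (shNu_shInv (T.r v))
  have e3 := congrArg T.j (shInv_shNu (T.q v))
  rw [map_add, map_zero] at e1
  have hnu : T.nu = shNu A := rfl
  simp only [Split.toWeighted, LinearMap.add_apply, Module.End.mul_apply, LinearMap.comp_apply,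
    map_add, T.r_i, T.r_j, T.q_j, map_zero, add_zero, zero_add, Module.End.one_apply, hnu,
    e2, e3]
  conv_rhs => rw [← T.sum v]
  rw [← sub_eq_zero, ← e1]
  abel

end Cone
end
end CyclicAdams

namespace CyclicAdams
open scoped Fin.NatCast Fin.CommRing
noncomputable section

/-! ### Tensor powers of a cone: interpolation between x and 1. -/

section ConePower

variable {R S : Type u} [CommRing R] [CommRing S] {φ : R →+* S} {A X B : Cx R} {Y : Cx S} {x u l z : R}
  {p : ℕ}

/-! ### The Euler characteristics of the pieces of the weight filtration -/

lemma Split.finLen_eul_fil [IsNoetherianRing R] [IsLocalRing R] (T : Split A X B)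
    (hX : ∀ i, Module.Finite R (X.X i)) (hA : LocallyNull A) (hB : LocallyNull B) (hp : p ≠ 0)
    (hu : u * p = 1) (hl : l ^ p = 1) (m : ℕ) : FinLen (T.toWeighted.fil hp m l) ∧
      eul (T.toWeighted.fil hp m l) = ∑ k ∈ Finset.range m, eul (T.toWeighted.gr hp k l) := by
  induction m with
  | zero =>
    have h0 : Acyclic (T.toWeighted.fil hp 0 l) := by
      refine Null.acyclic (Null.of_graded 0 (fun k _ _ => Submodule.zero_mem _) fun k t ht => ?_)
      have : t = 0 := ht.2.symm.trans (T.toWeighted.W_eq_zero (fun k _ => by simp [below]) _)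
      rw [this, map_zero, map_zero, map_zero, smul_zero, add_zero]
    exact ⟨h0.finLen, by rw [h0.eul, Finset.sum_range_zero]⟩
  | succ m ih =>
    obtain ⟨s, hs, e1, e2, e3⟩ := T.toWeighted.fil_shortExact hp m l
    have g : FinLen (T.toWeighted.gr hp m l) := (hA.gr hB hp hu hl m).finLen
      (T.toWeighted.finite_cx hp (c := fun _ => 0) (h := at_cond m) hu hl (at_sq m) hX)
    have h2 := FinLen.of_shortExact₂ hs (by rw [e1]; exact ih.1) (by rw [e3]; exact g)
    have h := eul_shortExact hs h2 (by rw [e3]; exact g)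
    rw [e1, e2, e3, ih.2] at h
    rw [e2] at h2
    exact ⟨h2, by rw [h, Finset.sum_range_succ]⟩

/-- Below the top weight only the piece of weight zero distinguishes the eigenvalues, whatever the
length of the filtration. -/
lemma Split.eul_fil_sub [IsNoetherianRing R] [IsLocalRing R] (T : Split A X B)
    (hX : ∀ i, Module.Finite R (X.X i)) (hA : LocallyNull A) (hB : LocallyNull B) (hp : p.Prime)
    (hu : u * p = 1) (hz : z ^ p = 1) {m : ℕ} (hm : m < p) :
    eul (T.toWeighted.fil hp.ne_zero (m + 1) 1) - eul (T.toWeighted.fil hp.ne_zero (m + 1) z) =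
      eul (eigen p A 1) - eul (eigen p A z) := by
  rw [(T.finLen_eul_fil hX hA hB hp.ne_zero hu (one_pow p) _).2,
    (T.finLen_eul_fil hX hA hB hp.ne_zero hu hz _).2, Finset.sum_range_succ', Finset.sum_range_succ',
    Finset.sum_congr rfl fun k hk => (T.toWeighted.gr_iso hp hz (Nat.succ_pos k)
      ((Nat.succ_lt_succ (Finset.mem_range.1 hk)).trans_le hm)).elim eul_eq_of_iso,
    (T.gr_zero_iso hp.ne_zero 1).elim eul_eq_of_iso,
    (T.gr_zero_iso hp.ne_zero z).elim eul_eq_of_iso]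
  abel

/-! ### Interpolation between the cone of `x` and that of `1` -/

/-- The function that is `1` below `a` and `x` from `a` on. -/
def interp (x : R) (a k : ℕ) : R := if k < a then 1 else x

/-- The complex that interpolates between the eigenspaces of the cones of `x` and of `1`. -/
abbrev interpCx (A : Cx R) (x : R) (hp : p ≠ 0) (a : ℕ) (l : R) : Cx R :=
  (coneSplit A x).toWeighted.cx hp (interp x a) (fun _ => 1) (fun _ => one_mul _) l

/-- Weight `0` is killed by `nu`, so the value of the coefficient there is irrelevant. -/
lemma Weighted.nu_W_congr (E : Weighted X) {c c' : ℕ → R} (h : ∀ k ≤ p, 0 < k → c k = c' k)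
    (t : TPow p X) : tOdd p E.nu (E.W p c t) = tOdd p E.nu (E.W p c' t) := by
  have h0 := E.nu_W_eq_zero (c := fun k => if k = 0 then c 0 - c' 0 else 0) 
    (fun k hk => if_neg hk.ne') t
  have e : E.W p c t = E.W p (fun k => c' k + if k = 0 then c 0 - c' 0 else 0) t :=
    E.W_congr (fun k hk => by
      rcases k.eq_zero_or_pos with rfl | hk'
      · simp
      · rw [if_neg hk'.ne', add_zero, h k hk hk']) t
  rw [e, E.W_add, map_add, h0, add_zero]

lemma tOdd_smul (d : Module.End R (Tot X)) (a : R) (t : TPow p X) :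
    tOdd p (a • d) t = a • tOdd p d t := by
  have : tOdd p (a • d) = a • tOdd p d := by
    rw [tOdd, tOdd, Finset.smul_sum]
    refine Finset.sum_congr rfl fun i _ => ?_
    have key : ∀ d : Module.End R (Tot X), tOddAt p d i = PiTensorProduct.map
        (Function.update (fun j => if j < i then parity X else 1) i d) := fun d => by
      rw [tOddAt]
      congr 1
      funext j
      by_cases hj : j = i
      · subst hj; simp
      · simp [hj]
    rw [key, key, PiTensorProduct.map_update_smul]
  exact LinearMap.congr_fun this t

/-- For threshold `1` the coefficient is `x` on all positive weights, which gives the differential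
of the power of the cone. -/
lemma interp_first_iso (hp : p ≠ 0) (l : R) :
    Nonempty (interpCx A x hp 1 l ≅ eigen p (cone A x) l) := by
  set E := (coneSplit A x).toWeighted with hE
  have hD : ∀ t : TPow p (cone A x), E.D p (interp x 1) t = tDiff p (cone A x) t := fun t => by
    rw [E.D_apply, tDiff_eq_tOdd, E.nu_W_congr (c' := fun _ => x * 1) fun k _ hk => by
      rw [interp, if_neg (by omega), mul_one], E.W_smul, E.W_eq_self fun _ _ => rfl, map_smul,
      ← tOdd_smul, ← tOdd_add]
    congr 2
    exact (LinearMap.ext diff_cone).symm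
  exact ⟨gradedIso (hS := E.D_mem_deg_sub hp (fun _ => one_mul _) l)
    (hD := fun _ t _ => E.D_sq (interp x 1) t)
    (hS' := fun _ => tDiff_mem_eigenDeg p (cone A x) l rfl)
    (hD' := fun _ t _ => LinearMap.congr_fun (tDiff_sq p (cone A x)) t) LinearMap.id LinearMap.id
    (fun k t ht => ht.1) (fun k t ht => E.mem_deg_sub.2 ⟨ht, E.W_eq_self (fun _ _ => rfl) t⟩)
    (fun k t _ => hD t) (fun _ _ _ => rfl) fun _ _ _ => rfl⟩

/-- For threshold `p + 1` the coefficient is `1` on all weights that occur, so `x` has disappeared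
and the contraction of the cone with corner `1` applies. -/
lemma interp_last_acyclic (hp : p ≠ 0) (hu : u * p = 1) (hl : l ^ p = 1) :
    Acyclic (interpCx A x hp (p + 1) l) := by
  set E := (coneSplit A x).toWeighted with hE
  obtain ⟨s, hs, h⟩ := exists_cone_homotopy (A := A) (x := x)
  obtain ⟨H, hH, hc⟩ := exists_eigen_homotopy (w := 0) (l := l) (a := 1) hp hu hl
    (E.d0_deg.add E.nu_deg) (fun a v => by simp) hs (by simp) (by rw [h, one_smul, sub_zero])
  have h0 : PiTensorProduct.map (fun _ : Fin p => (0 : Module.End R (Tot (cone A x)))) = 0 :=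
    map_eq_zero_at _ ⟨0, Nat.pos_of_ne_zero hp⟩ rfl
  have hD : ∀ t : TPow p (cone A x), E.D p (interp x (p + 1)) t = tOdd p (E.d0 + E.nu) t :=
    fun t => by
      rw [E.D_apply, tOdd_add, E.W_eq_self (c := interp x (p + 1)) fun k hk => if_pos (Nat.lt_succ_of_le hk)]
  refine Null.acyclic (Null.of_graded H (fun k t ht => E.mem_deg_sub.2
    ⟨hH k t ht.1, E.W_eq_self (fun _ _ => rfl) _⟩) fun k t ht => ?_)
  have := hc k t ht.1
  rw [h0, LinearMap.zero_apply, add_zero, one_pow] at this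
  rw [hD, hD, this]

lemma Weighted.tmap_W {E : Weighted X} {E' : Weighted Y} {σ : Tot X →ₛₗ[φ] Tot Y}
    (h : ∀ b v, σ (E.e b v) = E'.e b (σ v)) (c : ℕ → R) (t : TPow p X) :
    tmap p σ (E.W p c t) = E'.W p (fun k => φ (c k)) (tmap p σ t) := by
  simp only [Weighted.W, Weighted.scal, LinearMap.sum_apply, LinearMap.smul_apply, map_sum,
    map_smulₛₗ]
  exact Finset.sum_congr rfl fun δ _ => congrArg _ (tmap_map σ (fun i v => h _ v) t)

variable (ρ : Red φ x A Y)

lemma Red.cone_e (y : R) (b : Bool) (v : Tot (CyclicAdams.cone A y)) :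
    semiTot (ρ.cone y).map ((coneSplit A y).toWeighted.e b v) =
      (coneSplit Y (φ y)).toWeighted.e b (semiTot (ρ.cone y).map v) := by
  cases b
  · exact funext fun i => Prod.ext rfl (map_zero _)
  · exact funext fun i => Prod.ext (map_zero _) rfl

lemma Red.cone_d0 (y : R) (v : Tot (CyclicAdams.cone A y)) :
    semiTot (ρ.cone y).map ((coneSplit A y).toWeighted.d0 v) =
      (coneSplit Y (φ y)).toWeighted.d0 (semiTot (ρ.cone y).map v) := by
  funext i
  let w : A.X (i - 1) × A.X (i - 1 + 1) := v (i - 1)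
  refine Prod.ext ?_ ?_
  · change ρ.map i ((A.d (i - 1) i).hom w.1 + 0) = (Y.d (i - 1) i).hom (ρ.map (i - 1) w.1) + 0
    rw [add_zero, add_zero, ρ.comm]
  · change ρ.map (i + 1) (0 + -(A.d (i - 1 + 1) (i + 1)).hom w.2) =
      0 + -(Y.d (i - 1 + 1) (i + 1)).hom (ρ.map (i - 1 + 1) w.2)
    rw [zero_add, zero_add, map_neg, ρ.comm]

lemma Red.cone_nu (y : R) (v : Tot (CyclicAdams.cone A y)) :
    semiTot (ρ.cone y).map ((coneSplit A y).toWeighted.nu v) =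
      (coneSplit Y (φ y)).toWeighted.nu (semiTot (ρ.cone y).map v) := by
  funext i
  let w : A.X (i - 1) × A.X (i - 1 + 1) := v (i - 1)
  refine Prod.ext ?_ (map_zero _)
  change ρ.map i (tau A (sub_add_cancel i 1) w.2) =
    tau Y (sub_add_cancel i 1) (ρ.map (i - 1 + 1) w.2)
  exact semi_tau ρ.map _ _

include ρ in
/-- The steps of the interpolation. -/
lemma interp_shortExact (hφ : RingRed φ x) (hp : p ≠ 0) (hu : u * p = 1) (hl : l ^ p = 1)
    (hreg : ∀ t : TPow p (cone A x), x • t = 0 → t = 0) {a : ℕ} (ha : 0 < a) :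
    ∃ s : ShortComplex (Cx R), s.ShortExact ∧ s.X₁ = interpCx A x hp (a + 1) l ∧
      s.X₂ = interpCx A x hp a l ∧
      s.X₃ = resCx φ ((coneSplit Y (φ x)).toWeighted.fil hp a (φ l)) := by
  set E := (coneSplit A x).toWeighted with hE
  set E' := (coneSplit Y (φ x)).toWeighted with hE'
  set σ := semiTot (ρ.cone x).map with hσ
  have hg : SemiGraded σ := semiGraded_semiTot _
  have hs : Function.Surjective σ := semiTot_surjective (ρ.cone x).surj
  have hk : ∀ v, σ v = 0 → ∃ w, v = x • w := semiTot_ker (ρ.cone x).ker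
  let f : ℕ → R := fun k => if k < a then x else 1
  let f' : ℕ → R := fun k => if k < a then 1 else x
  have m0 {c : ℕ → R} {k : ZMod 2} {t : TPow p (cone A x)} (ht : t ∈ eigenDeg p (cone A x) l k) :
      E.W p c t ∈ E.deg_sub p (fun _ => 1) l k :=
    E.mem_deg_sub.2 ⟨E.W_mem hp c k t ht, E.W_eq_self (fun _ _ => rfl) _⟩
  have hW := fun c t => Weighted.tmap_W (p := p) (ρ.cone_e x) c t
  refine gradedCx_shortExact_resCx (E.W p f) ((E'.W p (below a)).comp (tmap p σ))
    (fun k t ht => m0 ht.1) (fun k t ht => ?_) (fun k t ht => ?_) (fun k t ht => ?_)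
    (fun k t ht h0 => ?_) (fun k t ht => ?_) (fun k t ht => ?_) fun k t ht h0 => ?_
  · exact E'.mem_deg_sub.2 ⟨E'.W_mem hp _ k _ (hg.mem_eigenDeg ht.1), by
      rw [LinearMap.comp_apply, E'.W_W]; simp only [below_sq]⟩
  · rw [E.W_D, E.D_apply, E.W_W]
    refine congrArg _ (E.nu_W_congr (fun k _ hk => ?_) t)
    simp only [f, interp]
    split_ifs <;> first | omega | simp
  · rw [LinearMap.comp_apply, LinearMap.comp_apply, E.D_apply, E'.D_apply, map_add,
      hg.tOdd (ρ.cone_d0 x), hg.tOdd (ρ.cone_nu x), hW, map_add, E'.W_d0, E'.W_nu, E'.W_W, E'.W_W]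
    refine congrArg _ (E'.nu_W_congr (fun k _ hk => ?_) _)
    simp only [below, interp]
    split_ifs <;> first | omega | simp [hφ.zero]
  · refine hreg t ?_
    have := congrArg (E.W p f') h0
    rw [E.W_W, map_zero] at this
    rw [← this, ← E.W_eq_self (c := fun _ => 1) (fun _ _ => rfl) t, ← E.W_smul,
      E.W_W]
    refine E.W_congr (fun k _ => ?_) t
    simp only [f, f']
    split_ifs <;> simp
  · obtain ⟨s, hs, rfl⟩ := hg.exists_mem_eigenDeg hφ.surj hs hp hu hl ht.1
    exact ⟨s, E.mem_deg_sub.2 ⟨hs, E.W_eq_self (fun _ _ => rfl) _⟩, ht.2⟩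
  · rw [LinearMap.comp_apply, hW, E'.W_W]
    refine E'.W_eq_zero (fun k _ => ?_) _
    simp only [below, f]
    split_ifs <;> simp [hφ.zero]
  · have h1 : tmap p σ (E.W p (below a) t) = 0 := by
      rw [hW, ← h0]
      refine E'.W_congr (fun k _ => ?_) _
      simp only [below]
      split_ifs <;> simp
    obtain ⟨s, hs, hst⟩ := exists_smul_of_mem_eigenDeg hφ.surj hs hk hp hu hl
      (E.W_mem hp _ k t ht.1) h1
    -- The preimage divides the part of weight below `a` by `x` and keeps the rest.
    refine ⟨E.W p (below a) s + E.W p (fun k => 1 - below a k) t,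
      Submodule.add_mem _ (m0 hs) (m0 ht.1), ?_⟩
    have e1 : E.W p f (E.W p (below a) s) = E.W p (below a) t := by
      rw [E.W_W]
      have : E.W p (below a) (x • s) = E.W p (below a) t := by
        rw [hst, E.W_W]
        simp only [below_sq]
      rw [← this, map_smul, ← E.W_smul]
      refine E.W_congr (fun k _ => ?_) s
      simp only [below, f]
      split_ifs <;> simp
    have e2 : E.W p f (E.W p (fun k => 1 - below a k) t) = E.W p (fun k => 1 - below a k) t := by
      rw [E.W_W]
      refine E.W_congr (fun k _ => ?_) t
      simp only [below, f]
      split_ifs <;> simp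
    rw [map_add, e1, e2, ← E.W_add]
    exact E.W_eq_self (fun k _ => add_sub_cancel _ _) t

/-! ### The tensor power of the cone -/

lemma Null.sh {r : R} (hA : Null r A) : Null r (sh A) := by
  obtain ⟨h, hh⟩ := hA
  refine ⟨fun i j => (-(h (i + 1) (j + 1)) : A.X (i + 1) →ₗ[R] A.X (j + 1)),
    fun i (a : A.X (i + 1)) => ?_⟩
  change -(h (i + 1 + 1) (i + 1) (-(A.d (i + 1) (i + 1 + 1)).hom a)) +
    -(A.d (i + 1 + 1) (i + 1)).hom (-(h (i + 1) (i + 1 + 1) a)) = r • a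
  rw [map_neg, map_neg, neg_neg, neg_neg, hh]

variable [IsNoetherianRing S] [IsLocalRing S]

include ρ in
/-- The difference of the Euler characteristics of the eigenspaces of the cone. -/
lemma eul_eigen_cone (hφ : RingRed φ x) (hp : p.Prime) (hu : u * p = 1) (hz : z ^ p = 1)
    (hreg : ∀ t : TPow p (cone A x), x • t = 0 → t = 0) (hY : ∀ i, Module.Finite S (Y.X i))
    (hN : LocallyNull Y) : eul (eigen p (cone A x) 1) - eul (eigen p (cone A x) z) =
      p * (eul (eigen p Y 1) - eul (eigen p Y (φ z))) := by
  have hu' : φ u * p = 1 := by rw [← map_natCast φ, ← map_mul, hu, map_one]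
  have hN' : LocallyNull (sh Y) := fun r hr => (hN r hr).imp fun _ h => h.sh
  have h0 := hp.ne_zero
  have step {l : R} (hl : l ^ p = 1) {a : ℕ} (ha : 0 < a) (h : FinLen (interpCx A x h0 (a + 1) l)) :
      FinLen (interpCx A x h0 a l) ∧ eul (interpCx A x h0 a l) = eul (interpCx A x h0 (a + 1) l) +
        eul ((coneSplit Y (φ x)).toWeighted.fil h0 a (φ l)) := by
    obtain ⟨s, hs, e1, e2, e3⟩ := interp_shortExact ρ hφ h0 hu hl hreg ha
    have h3 := finLen_resCx hφ.surj ((coneSplit Y (φ x)).finLen_eul_fil (finite_cone hY) hN hN' h0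
      hu' (l := φ l) (by rw [← map_pow, hl, map_one]) a).1
    have h2 := FinLen.of_shortExact₂ hs (by rw [e1]; exact h) (by rw [e3]; exact h3)
    have := eul_shortExact hs h2 (by rw [e3]; exact h3)
    rw [e1, e2, e3, eul_resCx hφ.surj] at this
    rw [e2] at h2
    exact ⟨h2, this⟩
  -- Descent of the threshold `a` from `p + 1`, where everything is acyclic, to `1`, where the power
  -- of the cone appears. Each of the `p` steps adds the difference of the eigenspaces of `Y`.
  have key (m : ℕ) (hm : m ≤ p) : ∃ a, a + m = p + 1 ∧ FinLen (interpCx A x h0 a 1) ∧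
      FinLen (interpCx A x h0 a z) ∧ eul (interpCx A x h0 a 1) - eul (interpCx A x h0 a z) =
        m * (eul (eigen p Y 1) - eul (eigen p Y (φ z))) := by
    induction m with
    | zero =>
      have a1 := interp_last_acyclic (A := A) (x := x) h0 hu (one_pow p)
      have a2 := interp_last_acyclic (A := A) (x := x) h0 hu hz
      exact ⟨p + 1, rfl, a1.finLen, a2.finLen, by rw [a1.eul, a2.eul]; simp⟩
    | succ m ih =>
      obtain ⟨a, ha, h1, h2, h⟩ := ih (by omega)
      obtain ⟨b, rfl⟩ : ∃ b, a = b + 1 + 1 := ⟨a - 2, by omega⟩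
      obtain ⟨f1, e1⟩ := step (one_pow p) b.succ_pos h1
      obtain ⟨f2, e2⟩ := step hz b.succ_pos h2
      refine ⟨b + 1, by omega, f1, f2, ?_⟩
      have h3 := (coneSplit Y (φ x)).eul_fil_sub (z := φ z) (finite_cone hY) hN hN' hp hu'
        (by rw [← map_pow, hz, map_one] : φ z ^ p = 1) (m := b) (by omega)
      rw [map_one] at e1
      rw [e1, e2, add_sub_add_comm, h, h3]
      push_cast
      ring
  obtain ⟨a, ha, -, -, h⟩ := key p le_rfl
  obtain rfl : a = 1 := by omega
  rw [← h, (interp_first_iso h0 1).elim eul_eq_of_iso, (interp_first_iso h0 z).elim eul_eq_of_iso]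

end ConePower
end
end CyclicAdams

namespace CyclicAdams
open scoped Fin.NatCast Fin.CommRing
noncomputable section

/-! ### The Koszul complex of a regular system of parameters and the constant p^d. -/

section Koszul

open IsLocalRing RingTheory.Sequence

/-! ### The unit complex -/

section Unit

variable (R : Type u) [CommRing R] {p : ℕ} {z u : R}

lemma zeroCx_d {T : Type u} [AddCommGroup T] [Module R T] (U : ZMod 2 → Submodule R T) (i j : ZMod 2)
    (t : U i) : ((zeroCx U).d i j).hom t = 0 := by
  by_cases h : i + 1 = j
  · exact Subtype.ext (coe_gradedCx_d (D := (0 : Module.End R T)) (S := U)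
      (hS := fun k _ _ => Submodule.zero_mem _) (hD := fun _ _ _ => rfl) h t)
  · exact d_eq_zero (zeroCx U) h t

lemma length_homology_zeroCx {T : Type u} [AddCommGroup T] [Module R T]
    (U : ZMod 2 → Submodule R T) (i : ZMod 2) :
    Module.length R ((zeroCx U).homology i) = Module.length R (U i) := by
  have hc : cyc (zeroCx U) i = ⊤ := eq_top_iff.2 fun t _ => zeroCx_d R U i (i + 1) t
  have hb : bdry (zeroCx U) i = ⊥ := eq_bot_iff.2 fun t ⟨s, hs⟩ =>
    (Submodule.mem_bot R).2 (hs.symm.trans (zeroCx_d R U (i + 1) i s))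
  rw [(homologyEquiv (zeroCx U) i).length_eq]
  have hb' : (bdry (zeroCx U) i).submoduleOf (cyc (zeroCx U) i) = ⊥ := by
    rw [hb, Submodule.submoduleOf, Submodule.comap_bot, Submodule.ker_subtype]
  rw [(Submodule.quotEquivOfEqBot _ hb').length_eq, hc]
  exact (Submodule.topEquiv (R := R) (M := U i)).length_eq

/-- The unit complex. -/
abbrev unitCx : Cx R := conc R R 0

lemma finLen_eul_unitCx (h : IsSimpleModule R R) : FinLen (unitCx R) ∧ eul (unitCx R) = 1 := by
  have h0 : Module.length R ((unitCx R).homology 0) = 1 := by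
    rw [length_homology_zeroCx, if_pos rfl, Submodule.topEquiv.length_eq, Module.length_eq_one]
  have h1 : Module.length R ((unitCx R).homology 1) = 0 := by
    rw [length_homology_zeroCx, if_neg one_ne_zero, Module.length_eq_zero]
  refine ⟨finLen_iff.2 fun i => ?_, by rw [eul, h0, h1]; simp⟩
  rcases zmod2_cases i with rfl | rfl
  · rw [h0]; exact ENat.one_ne_top
  · rw [h1]; exact ENat.zero_ne_top

/-- The generator of the unit complex. -/
def unitGen : Tot (unitCx R) :=
  Pi.single (M := fun i => (unitCx R).X i) 0 (⟨1, trivial⟩ : (if (0 : ZMod 2) = 0 then (⊤ : Submodule R R) else ⊥ : Submodule R R))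

/-- The coordinate of an element of the unit complex. -/
def unitCoord : Tot (unitCx R) →ₗ[R] R :=
  (Submodule.subtype (if (0 : ZMod 2) = 0 then (⊤ : Submodule R R) else ⊥ : Submodule R R)) ∘ₗ
    (LinearMap.proj 0 : Tot (unitCx R) →ₗ[R] _)

lemma unitCx_one_eq_zero (a : (unitCx R).X 1) : a = 0 := by
  have h (r : R) (hr : r ∈ (if (1 : ZMod 2) = 0 then ⊤ else ⊥ : Submodule R R)) : r = 0 := by
    rwa [if_neg one_ne_zero, Submodule.mem_bot] at hr
  exact Subtype.ext (h _ a.2)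

lemma unitCx_eq (v : Tot (unitCx R)) : unitCoord R v • unitGen R = v := by
  funext i
  rcases zmod2_cases i with rfl | rfl
  · exact (congrArg (unitCoord R v • ·)
      (Pi.single_eq_same (M := fun i => (unitCx R).X i) 0 _)).trans (Subtype.ext (mul_one _))
  · rw [unitCx_one_eq_zero R (v 1)]
    exact unitCx_one_eq_zero R _

/-- The generator of the tensor power of the unit complex. -/
def unitPow (p : ℕ) : TPow p (unitCx R) := PiTensorProduct.tprod R fun _ => unitGen R

/-- The coordinate of an element of the tensor power of the unit complex. -/
def unitPowCoord (p : ℕ) : TPow p (unitCx R) →ₗ[R] R :=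
  PiTensorProduct.lift ((MultilinearMap.mkPiAlgebra R (Fin p) R).compLinearMap
    fun _ => unitCoord R)

lemma unitPow_eq (t : TPow p (unitCx R)) : unitPowCoord R p t • unitPow R p = t := by
  have : (LinearMap.toSpanSingleton R _ (unitPow R p)) ∘ₗ unitPowCoord R p = LinearMap.id := by
    refine PiTensorProduct.ext (MultilinearMap.ext fun v => ?_)
    change unitPowCoord R p (PiTensorProduct.tprod R v) • unitPow R p = PiTensorProduct.tprod R v
    conv_rhs => rw [show v = fun i => unitCoord R (v i) • unitGen R from
      funext fun i => (unitCx_eq R (v i)).symm, MultilinearMap.map_smul_univ]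
    rw [unitPowCoord, PiTensorProduct.lift.tprod]
    rfl
  exact LinearMap.congr_fun this t

lemma unitPowCoord_unitPow : unitPowCoord R p (unitPow R p) = 1 := by
  rw [unitPowCoord, unitPow, PiTensorProduct.lift.tprod]
  change ∏ i : Fin p, unitCoord R (unitGen R) = 1
  have : unitCoord R (unitGen R) = 1 :=
    congrArg Subtype.val (Pi.single_eq_same (M := fun i => (unitCx R).X i) 0 _)
  simp only [this, Finset.prod_const_one]

lemma rot_unitPow (hp : p ≠ 0) : rot p (unitCx R) (unitPow R p) = unitPow R p := by
  obtain ⟨n, rfl⟩ := Nat.exists_eq_succ_of_ne_zero hp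
  refine (rot_tprod n (unitCx R) (fun _ => 0) fun _ => ⟨1, trivial⟩).trans ?_
  rw [ZMod.val_zero, zero_mul, pow_zero, one_smul]
  rfl

lemma rot_unitCx (hp : p ≠ 0) (t : TPow p (unitCx R)) : rot p (unitCx R) t = t := by
  conv_lhs => rw [← unitPow_eq R t, map_smul, rot_unitPow R hp, unitPow_eq]

lemma mem_tDeg_unitCx (t : TPow p (unitCx R)) : t ∈ tDeg p (unitCx R) 0 := by
  rw [← unitPow_eq R t]
  exact Submodule.smul_mem _ _ (Submodule.subset_span
    ⟨fun _ => 0, fun _ => ⟨1, trivial⟩, Finset.sum_const_zero, rfl⟩)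

lemma eq_zero_of_mem_tDeg_one {t : TPow p (unitCx R)} (h : t ∈ tDeg p (unitCx R) 1) : t = 0 := by
  have h0 : tproj p (unitCx R) 1 (unitPow R p) = 0 := by
    have hg : Homog (fun _ : Fin p => (0 : ZMod 2)) fun _ => unitGen R := fun _ =>
      proj_single_self (unitCx R) 0 _
    rw [unitPow, hg.tproj, Finset.sum_const_zero, if_neg zero_ne_one]
  rw [← tproj_of_mem h, ← unitPow_eq R t, map_smul, h0, smul_zero]

/-- The rotation acts trivially on the power of a rank one complex in even degree, so `z` fixes
every vector of its eigenspace. Summing the powers of `z`, which add up to zero, gives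
multiplication by `p`, which is invertible. -/
lemma acyclic_eigen_unitCx (hp : p ≠ 0) (hu : u * p = 1)
    (hz : ∑ i ∈ Finset.range p, z ^ i = 0) : Acyclic (eigen p (unitCx R) z) := by
  refine (acyclic_iff_exact _).2 fun i (t : eigenDeg p (unitCx R) z i) _ =>
    ⟨0, (map_zero _).trans (Subtype.ext ?_ : (0 : eigenDeg p (unitCx R) z i) = t)⟩
  have h1 : z • t.1 = t.1 := (Module.End.mem_eigenspace_iff.1 t.2.2).symm.trans (rot_unitCx R hp _)
  have h2 (i : ℕ) : z ^ i • t.1 = t.1 := by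
    induction i with
    | zero => rw [pow_zero, one_smul]
    | succ i ih => rw [pow_succ, mul_smul, h1, ih]
  have h3 : (p : R) • t.1 = 0 := by
    rw [← zero_smul R t.1, ← hz, Finset.sum_smul, Finset.sum_congr rfl fun i _ => h2 i,
      Finset.sum_const, Finset.card_range, Nat.cast_smul_eq_nsmul]
  change 0 = t.1
  rw [← one_smul R t.1, ← hu, mul_smul, h3, smul_zero]

lemma eigen_unitCx_iso (hp : p ≠ 0) : Nonempty (eigen p (unitCx R) 1 ≅ unitCx R) := by
  have hd : diff (unitCx R) = 0 := LinearMap.ext fun v => funext fun i =>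
    zeroCx_d R (fun i => if i = 0 then (⊤ : Submodule R R) else ⊥) (i - 1) i (v (i - 1))
  have hD (t : TPow p (unitCx R)) : tDiff p (unitCx R) t = 0 := by
    rw [tDiff_eq_tOdd, hd, ← zero_smul R (0 : Module.End R (Tot (unitCx R))), tOdd_smul, zero_smul]
  exact ⟨gradedIso (D := tDiff p (unitCx R)) (S := eigenDeg p (unitCx R) 1)
    (hS := fun _ => tDiff_mem_eigenDeg p (unitCx R) 1 rfl)
    (hD := fun _ t _ => LinearMap.congr_fun (tDiff_sq p (unitCx R)) t)
    (D' := (0 : Module.End R R)) (S' := fun i => if i = 0 then (⊤ : Submodule R R) else ⊥)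
    (hS' := fun k _ _ => Submodule.zero_mem _) (hD' := fun _ _ _ => rfl)
    (unitPowCoord R p) (LinearMap.toSpanSingleton R _ (unitPow R p))
    (fun k t ht => by
      rcases zmod2_cases k with rfl | rfl
      · rw [if_pos rfl]; trivial
      · rw [eq_zero_of_mem_tDeg_one R ht.1, map_zero]
        exact Submodule.zero_mem _)
    (fun k r hr => by
      rcases zmod2_cases k with rfl | rfl
      · exact ⟨mem_tDeg_unitCx R _, Module.End.mem_eigenspace_iff.2
          ((rot_unitCx R hp _).trans (one_smul R _).symm)⟩
      · rw [if_neg one_ne_zero, Submodule.mem_bot] at hr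
        rw [hr, map_zero]
        exact Submodule.zero_mem _)
    (fun k t _ => by rw [hD, map_zero]; rfl) (fun k t _ => unitPow_eq R t)
    fun k r _ => by
      rw [LinearMap.toSpanSingleton_apply, map_smul, unitPowCoord_unitPow, smul_eq_mul, mul_one]⟩

end Unit

/-! ### Koszul complexes -/

variable {R S : Type u} [CommRing R] [CommRing S] {φ : R →+* S} {x : R}

/-- The Koszul complex. -/
def kos : List R → Cx R
  | [] => unitCx R
  | x :: l => cone (kos l) x

lemma finite_kos (l : List R) (i : ZMod 2) : Module.Finite R ((kos l).X i) := by
  induction l generalizing i with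
  | nil =>
    change Module.Finite R (if i = 0 then (⊤ : Submodule R R) else ⊥ : Submodule R R)
    rcases zmod2_cases i with rfl | rfl
    · rw [if_pos rfl]; exact Module.Finite.equiv Submodule.topEquiv.symm
    · rw [if_neg one_ne_zero]; infer_instance
  | cons x l ih => exact finite_cone ih i

lemma projective_kos (l : List R) (i : ZMod 2) : Module.Projective R ((kos l).X i) := by
  induction l generalizing i with
  | nil =>
    change Module.Projective R (if i = 0 then (⊤ : Submodule R R) else ⊥ : Submodule R R)
    rcases zmod2_cases i with rfl | rfl
    · rw [if_pos rfl]; exact Module.Projective.of_equiv Submodule.topEquiv.symm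
    · rw [if_neg one_ne_zero]; infer_instance
  | cons x l ih => exact projective_cone ih i

/-- The newest element is null homotopic by the structure of the cone, and the earlier ones because
the cone inherits their homotopies. -/
lemma ofList_le_nullIdeal (l : List R) : Ideal.ofList l ≤ nullIdeal (kos l) := by
  induction l with
  | nil => simp
  | cons x l ih =>
    rw [Ideal.ofList_cons]
    exact sup_le ((Ideal.span_singleton_le_iff_mem _).2 null_cone) fun r hr => (ih hr).cone

lemma locallyNull_kos [IsLocalRing R] {l : List R} (hl : Ideal.ofList l = maximalIdeal R) :
    LocallyNull (kos l) := fun r hr => ⟨1, by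
  rw [pow_one]
  exact ofList_le_nullIdeal l (hl ▸ hr)⟩

/-- The reduction of the unit complex. -/
def redUnitCx (hφ : RingRed φ x) : Red φ x (unitCx R) (unitCx S) where
  map i := (show (if i = 0 then (⊤ : Submodule R R) else ⊥ : Submodule R R) →ₛₗ[φ]
      (if i = 0 then (⊤ : Submodule S S) else ⊥ : Submodule S S) from
    { toFun := fun r => ⟨φ r.1, by
        have := r.2
        split_ifs at this ⊢
        · trivial
        · rw [(Submodule.mem_bot R).1 this, map_zero]
          exact Submodule.zero_mem _⟩
      map_add' := fun _ _ => Subtype.ext (map_add φ _ _)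
      map_smul' := fun _ _ => Subtype.ext (map_mul φ _ _) })
  comm i j t := by
    refine (congrArg _ (zeroCx_d R (fun i => if i = 0 then (⊤ : Submodule R R) else ⊥) i j t)).trans
      (Eq.trans (map_zero _) (zeroCx_d S (fun i => if i = 0 then (⊤ : Submodule S S) else ⊥) i j
        _).symm)
  surj i t := by
    rcases zmod2_cases i with rfl | rfl
    · obtain ⟨r, hr⟩ := hφ.surj (Subtype.val (p := (· ∈ (if (0 : ZMod 2) = 0 then (⊤ : Submodule S S) else ⊥ : Submodule S S))) t)
      exact ⟨⟨r, trivial⟩, Subtype.ext hr⟩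
    · exact ⟨0, (unitCx_one_eq_zero S _).trans (unitCx_one_eq_zero S t).symm⟩
  ker i t ht := by
    rcases zmod2_cases i with rfl | rfl
    · obtain ⟨s, hs⟩ := hφ.ker _ (congrArg (Subtype.val (p := (· ∈ (if (0 : ZMod 2) = 0 then (⊤ : Submodule S S) else ⊥ : Submodule S S)))) ht)
      exact ⟨⟨s, trivial⟩, Subtype.ext hs⟩
    · exact ⟨0, (unitCx_one_eq_zero R t).trans (unitCx_one_eq_zero R _).symm⟩
  reg i t ht := Subtype.ext (hφ.reg _ (congrArg (Subtype.val (p := (· ∈ (if i = 0 then (⊤ : Submodule R R) else ⊥ : Submodule R R)))) ht))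

/-- The reduction of a Koszul complex. -/
def redKos (hφ : RingRed φ x) : ∀ l : List R, Red φ x (kos l) (kos (l.map φ))
  | [] => redUnitCx hφ
  | y :: l => (redKos hφ l).cone y

lemma RingRed.smul_eq_zero (hφ : RingRed φ x) {M : Type u} [AddCommGroup M] [Module R M]
    [Module.Projective R M] {m : M} (h : x • m = 0) : m = 0 := by
  have hx : x ∈ nonZeroDivisors R := by
    rw [mem_nonZeroDivisors_iff_right]
    intro r hr
    rw [mul_comm] at hr
    exact hφ.reg r hr
  have : IsSMulRegular M x := Module.Flat.isSMulRegular_of_nonZeroDivisors hx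
  exact this.right_eq_zero_of_smul h

/-- The formula for the Koszul complex of a regular sequence that generates the maximal ideal. -/
theorem eul_kos {p : ℕ} (hp : p.Prime) (n : ℕ) : ∀ (R : Type u) [CommRing R] [IsLocalRing R]
    [IsNoetherianRing R] (u z : R) (l : List R), u * p = 1 → ∑ i ∈ Finset.range p, z ^ i = 0 →
    l.length = n → IsWeaklyRegular R l → Ideal.ofList l = maximalIdeal R →
    FinLen (kos l) ∧ eul (kos l) = 1 ∧
      eul (eigen p (kos l) 1) - eul (eigen p (kos l) z) = (p : ℤ) ^ n := by
  induction n with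
  | zero =>
    intro R _ _ _ u z l hu hz hl hreg hgen
    obtain rfl := List.length_eq_zero_iff.1 hl
    have h0 : maximalIdeal R = ⊥ := by rw [← hgen, Ideal.ofList_nil]
    have hs : IsSimpleModule R R := by
      have hf := isField_iff_maximalIdeal_eq.2 h0
      let := hf.toField
      infer_instance
    obtain ⟨h1, h2⟩ := finLen_eul_unitCx R hs
    refine ⟨h1, h2, ?_⟩
    change eul (eigen p (unitCx R) 1) - eul (eigen p (unitCx R) z) = _
    rw [(eigen_unitCx_iso R hp.ne_zero).elim eul_eq_of_iso, h2,
      (acyclic_eigen_unitCx R hp.ne_zero hu hz).eul, pow_zero, sub_zero]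
  | succ n ih =>
    intro R _ _ _ u z l hu hz hl hreg hgen
    obtain ⟨x, l, rfl⟩ := List.exists_cons_of_length_eq_add_one hl
    set mk := Ideal.Quotient.mk (Ideal.span {x}) with hmk
    have hx : x ∈ maximalIdeal R := by
      rw [← hgen, Ideal.ofList_cons]
      exact Ideal.mem_sup_left (Ideal.mem_span_singleton_self x)
    have hne : Ideal.span {x} ≠ ⊤ := fun e => by
      rw [Ideal.span_singleton_eq_top] at e
      exact (mem_maximalIdeal x).1 hx e
    have hx0 : mk x = 0 := Ideal.Quotient.eq_zero_iff_mem.2 (Ideal.mem_span_singleton_self x)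
    have hsurj : Function.Surjective mk := Ideal.Quotient.mk_surjective
    have : Nontrivial (R ⧸ Ideal.span {x}) := Ideal.Quotient.nontrivial_iff.2 hne
    have : IsLocalRing (R ⧸ Ideal.span {x}) := IsLocalRing.of_surjective' mk hsurj
    rw [isWeaklyRegular_cons_iff] at hreg
    have hφ : RingRed mk x := ⟨hsurj, hx0, fun r hr => Ideal.mem_span_singleton.1
      (Ideal.Quotient.eq_zero_iff_mem.1 hr), fun r hr => hreg.1.right_eq_zero_of_smul hr⟩
    have hu' : mk u * p = 1 := by rw [← map_natCast mk, ← map_mul, hu, map_one]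
    -- The root of unity is encoded by the vanishing of the sum of its powers, a condition that
    -- passes to quotient rings.
    have hz' : ∑ i ∈ Finset.range p, mk z ^ i = 0 := by
      simp only [← map_pow, ← map_sum, hz, map_zero]
    have hzp : z ^ p = 1 := by
      have := geom_sum_mul z p
      rw [hz, zero_mul] at this
      exact (sub_eq_zero.1 this.symm)
    have hreg' : IsWeaklyRegular (R ⧸ Ideal.span {x}) (l.map mk) := by
      let e : QuotSMulTop x R ≃ₗ[R] R ⧸ Ideal.span {x} :=
        Submodule.quotEquivOfEq _ _ (by
          rw [← Submodule.ideal_span_singleton_smul, smul_eq_mul, Ideal.mul_top])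
      exact (isWeaklyRegular_map_algebraMap_iff (R ⧸ Ideal.span {x}) _ l).2
        ((e.isWeaklyRegular_congr l).1 hreg.2)
    have hgen' : Ideal.ofList (l.map mk) = maximalIdeal (R ⧸ Ideal.span {x}) := by
      have := IsLocalHom.of_surjective mk hsurj
      rw [← IsLocalRing.map_maximalIdeal_of_surjective mk hsurj, ← hgen, Ideal.map_ofList,
        List.map_cons, Ideal.ofList_cons, hx0, Ideal.span_singleton_eq_bot.2 rfl, bot_sup_eq]
    obtain ⟨h1, h2, h3⟩ := ih (R ⧸ Ideal.span {x}) (mk u) (mk z) (l.map mk) hu' hz'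
      (by simpa using hl) hreg' hgen'
    -- The Koszul complex of the tail reduces modulo the head to the Koszul complex of the quotient
    -- ring, to which the inductive hypothesis applies; the cone then multiplies the difference by
    -- `p`.
    obtain ⟨f1, f2⟩ := finLen_eul_cone hφ (redKos hφ l) h1
    refine ⟨f1, f2.trans h2, ?_⟩
    have hproj : Module.Projective R (TPow p (cone (kos l) x)) :=
      projective_tPow (finite_cone (finite_kos l)) (projective_cone (projective_kos l))
    have := eul_eigen_cone (redKos hφ l) hφ hp hu hzp (fun t ht => hφ.smul_eq_zero ht)
      (finite_kos _) (locallyNull_kos hgen')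
    rw [h3] at this
    exact this.trans (pow_succ' _ _).symm

/-- The difference of the Euler characteristics of the eigenspaces. -/
theorem eigenDiff_eq [IsRegularLocalRing R] {d p : ℕ} {u z : R} (hd : ringKrullDim R = d)
    (hp : p.Prime) (hu : u * p = 1) (hz : ∑ i ∈ Finset.range p, z ^ i = 0) (P : MFfl R) :
    eul (eigen p P.1 1) - eul (eigen p P.1 z) = (p : ℤ) ^ d * eul P.1 := by
  have hzp : z ^ p = 1 := by
    have := geom_sum_mul z p
    rw [hz, zero_mul] at this
    exact (sub_eq_zero.1 this.symm)
  obtain ⟨c, hc⟩ := exists_eigenDiff_eq_mul hp hu hzp hd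
  obtain ⟨l, h1, h2, h3⟩ := exists_isWeaklyRegular R hd
  obtain ⟨f, e, e'⟩ := eul_kos hp d R u z l hu hz h1 h2 h3
  -- The Koszul complex has Euler characteristic 1, so it reads off the proportionality constant.
  have := hc (kos l) ⟨finite_kos l, projective_kos l, f⟩
  rw [e, mul_one, eigenDiff, e'] at this
  rw [this]
  exact hc P.1 P.2

end Koszul
end
end CyclicAdams

theorem theorem3p4 (p : ℕ) (hp : p.Prime) (Q : Type u) [CommRing Q] [IsRegularLocalRing Q]
    [Algebra (CyclicAdams.Ap p) Q] (d : ℕ) (hd : ringKrullDim Q = d) :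
    ∃ h : ∀ (P : CyclicAdams.MFfl Q) (j : Fin p), CyclicAdams.IsMFfl (CyclicAdams.tPow p P.1 j),
      (∃! ψ : CyclicAdams.K0 Q →+ CyclicAdams.K0 Q, CyclicAdams.IsCyclicAdams p Q h ψ) ∧
      ∀ ψ : CyclicAdams.K0 Q →+ CyclicAdams.K0 Q, CyclicAdams.IsCyclicAdams p Q h ψ →
        ∀ x : CyclicAdams.K0 Q,
          CyclicAdams.chi Q (ψ x) = (p : ℤ) ^ d * CyclicAdams.chi Q x := by
  have hN : ∀ P : CyclicAdams.MFfl Q, CyclicAdams.LocallyNull P.1 := fun P =>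
    CyclicAdams.locallyNull_of_isRegularLocalRing hd P.2
  refine ⟨CyclicAdams.isMFfl_tPow hp hN, CyclicAdams.existsUnique_adams hp hN, fun ψ hψ x => ?_⟩
  rw [(CyclicAdams.existsUnique_adams hp hN).unique hψ (CyclicAdams.isCyclicAdams_adams hp hN)]
  exact CyclicAdams.chi_adams hp hN (CyclicAdams.eigenDiff_eq hd hp
    (CyclicAdams.algebraMap_inv_mul hp.ne_zero) (CyclicAdams.sum_algebraMap_zeta hp)) x
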